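/- Let $\Bbbk$ be a field of characteristic $0$. All operads are coloured by two colours, $S$ (solid, first colour, variable $t_1$) and $D$ (dotted, second colour, variable $t_2$). **The operads.** $\mathsf{LP}$ is the symmetric coloured operad of Leibniz pairs, generated by a skew-symmetric operation $\beta\colon D,D\to D$ and operations $a\colon S,S\to S$ and $d\colon D,S\to S$ (without symmetries), subject to the relations $$\beta(\beta(1,2),3)-\beta(\beta(1,3),2)-\beta(1,\beta(2,3))=0,\qquad a(a(1,2),3)-a(1,a(2,3))=0,$$ $$d(1,a(2,3))-a(2,d(1,3))-a(d(1,2),3)=0,\qquad d(\beta(1,2),3)-d(1,d(2,3))+d(2,d(1,3))=0 .$$ $\mathsf{As}$ is the associative operad generated by $a$ (in colour $S$; in colour $D$ it has only the identity), and $\mathsf{MLie}$ is the operad generated by $\beta$ and $d$ subject to the first and the last relation (a Lie algebra and a module over it). $H_0(\mathcal{SC})$ is the zeroth homology, with coefficients in $\Bbbk$, of the Swiss-cheese operad in Voronov's version: operations with closed output $D$ are configurations of at least one disc in the unit disc; operations with open output $S$ are configurations of discs and half-discs in the upper half of the unit disc, with at least one half-disc. **The ordering.** As a shuffle operad, $\mathsf{LP}$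 is generated by $\beta,a,b,d,e$, where $b(1,2)=a(2,1)$ and $e(1,2)=d(2,1)$, and its defining relations are the $\Sigma_3$-orbits of the four relations above. Call $a,b$ letters of type $x$ and $\beta,d,e$ letters of type $y$. Choose a total order of the letters with $a>b$ and $d>e$. Using the rules $yx=xyq$ ($q$ central) every word in the letters is written as (word of type $x$ of length $d_x$)(word of type $y$ of length $d_y$)$q^{d_q}$. Two words are compared successively by: $d_x$ (the greater $d_x$ is *smaller*); the $x$-words lexicographically; $d_y$ (the greater is greater); the $y$-words lexicographically; $d_q$ (the greater is greater). The (partial) QM-ordering compares shuffle tree monomials first by arity and then by the lexicographic comparison of the vectors of the words read along the paths from the root to the leaves $1,2,\dots,n$. A symmetric operad generated by binary operations is called Koszul if the homology of its bar construction is concentrated on the diagonal, i.e. in each arity $n\ge 2$ on trees with $n-1$ vertices. **Theorem.** 1. For every choice as above, the QM-ordering extends to an admissible total ordering of the shuffle tree monomials, and for every admissible total ordering that extends it the defining relations of $\mathsf{LP}$ form a quadratic Gröbner basis (they are quadratic, and the leading term of every nonzero element of the ideal that they generate is divisible by the leading term of one of them). 2. The operad $\mathsf{LP}$ is Koszul.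 3. The operad $H_0(\mathcal{SC})$ is Koszul. Here $H_0(\mathcal{SC})$ is the quadratic operad generated by the classes $m\colon D,D\to D$, $a\colon S,S\to S$, $d\colon D,S\to S$ of two discs in a disc, two half-discs in a half-disc, and a disc and a half-disc in a half-disc, subject to the relations that $m$ is commutative and associative, $a$ is associative, $d(m(1,2),3)=d(1,d(2,3))$ and $d(1,a(2,3))=a(d(1,2),3)=a(2,d(1,3))$. 4. $\mathsf{LP}\cong\mathsf{As}\circ\mathsf{MLie}$ as symmetric coloured collections. 5. All components of $\mathsf{LP}$, $\mathsf{As}$ and $\mathsf{MLie}$ are finite-dimensional. Let $F_{\mathcal P}^c(t_1,t_2)=\sum_{m_1,m_2}\dim\mathcal P(m_1,m_2;c)\,\frac{t_1^{m_1}t_2^{m_2}}{m_1!\,m_2!}$ for $c\in\{S,D\}$, where $\mathcal P(m_1,m_2;c)$ is the component with $m_1$ inputs of colour $S$, $m_2$ inputs of colour $D$ and output $c$, and let $\overrightarrow{F_{\mathcal P}}=(F^S_{\mathcal P};F^D_{\mathcal P})$. Then $\overrightarrow{F_{\mathsf{LP}}}=\overrightarrow{F_{\mathsf{As}}}\circ\overrightarrow{F_{\mathsf{MLie}}}$,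 and $$\overrightarrow{F_{\mathsf{As}}}=\Bigl(\tfrac{t_1}{1-t_1};\,t_2\Bigr),\quad \overrightarrow{F_{\mathsf{MLie}}}=\Bigl(\tfrac{t_1}{1-t_2};\,-\log(1-t_2)\Bigr),\quad \overrightarrow{F_{\mathsf{LP}}}=\Bigl(\tfrac{t_1}{1-t_1-t_2};\,-\log(1-t_2)\Bigr).$$ -/

import Mathlib

open scoped TensorProduct DirectSum

noncomputable section

namespace ColouredOperad

universe u

/-! ## Trees

All operads below are generated by binary operations.  A `PTree Op X` is a planar binary tree whose
inner vertices carry operations and whose leaves carry labels in `X`. -/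

inductive PTree (Op X : Type) : Type
  | leaf (x : X) : PTree Op X
  | node (g : Op) (l r : PTree Op X) : PTree Op X

namespace PTree

variable {Op X Y : Type}

def labels : PTree Op X → List X
  | leaf x => [x]
  | node _ l r => l.labels ++ r.labels

def leafSet (t : PTree Op X) : Set X := {x | x ∈ t.labels}

/-- Simultaneous grafting: the tree `s x` is grafted on every leaf `x` of `t`. -/
def bind : PTree Op X → (X → PTree Op Y) → PTree Op Y
  | leaf x, s => s x
  | node g l r, s => node g (l.bind s) (r.bind s)

/-- Relabelling of the leaves. -/
def map (f : X → Y) : PTree Op X → PTree Op Y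
  | leaf x => leaf (f x)
  | node g l r => node g (l.map f) (r.map f)

/-- The number of inner vertices. -/
def vertices : PTree Op X → ℕ
  | leaf _ => 0
  | node _ l r => l.vertices + r.vertices + 1

/-- The sets of leaves lying above the inner vertices of `t`. -/
def clusters : PTree Op X → Set (Set X)
  | leaf _ => ∅
  | node g l r => {(node g l r).leafSet} ∪ (l.clusters ∪ r.clusters)

/-- The internal edges of `t`; an internal edge is recorded as the set of leaves above it. In a tree
whose leaves have distinct labels, different internal edges have different sets. -/
def innerEdges : PTree Op X → Set (Set X)
  | leaf _ => ∅
  | node _ l r => l.clusters ∪ r.clusters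

/-- The smallest leaf label. -/
def minLabel : PTree Op ℕ → ℕ
  | leaf i => i
  | node _ l r => min l.minLabel r.minLabel

/-- The shuffle condition: at each inner vertex the smallest descendants of the two inputs
increase from left to right. -/
def IsShuffle : PTree Op ℕ → Prop
  | leaf _ => True
  | node _ l r => l.minLabel < r.minLabel ∧ l.IsShuffle ∧ r.IsShuffle

/-- The word of operations met on the path from the root to the leaf `i`. -/
def path (i : ℕ) : PTree Op ℕ → List Op
  | leaf _ => []
  | node g l r => g :: (if i ∈ l.labels then l.path i else r.path i)

theorem labels_map (f : X → Y) (t : PTree Op X) : (t.map f).labels = t.labels.map f := by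
  induction t with
  | leaf x => rfl
  | node g l r hl hr => simp [map, labels, hl, hr]

theorem map_id (t : PTree Op X) : t.map id = t := by
  induction t with
  | leaf x => rfl
  | node g l r hl hr => simp [map, hl, hr]

theorem map_map {Z : Type} (f : X → Y) (g : Y → Z) (t : PTree Op X) :
    (t.map f).map g = t.map (g ∘ f) := by
  induction t with
  | leaf x => rfl
  | node g l r hl hr => simp [map, hl, hr]

theorem map_bind {Z : Type} (f : Y → Z) (s : X → PTree Op Y) (t : PTree Op X) :
    (t.bind s).map f = t.bind (fun x => (s x).map f) := by
  induction t with
  | leaf x => rfl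
  | node g l r hl hr => simp [map, bind, hl, hr]

end PTree

/-- Binary operations with their input colours and output colour. -/
structure Signature (I Op : Type) where
  src₁ : Op → I
  src₂ : Op → I
  tgt : Op → I

namespace Signature

variable {I Op X Y : Type}

/-- `t` is correctly coloured, its leaf `x` has colour `χ x` and its root has colour `c`. -/
def HasColour (Γ : Signature I Op) (χ : X → I) : I → PTree Op X → Prop
  | c, .leaf x => χ x = c
  | c, .node g l r => Γ.tgt g = c ∧ Γ.HasColour χ (Γ.src₁ g) l ∧ Γ.HasColour χ (Γ.src₂ g) r

/-- PTree monomials on the coloured set `(X, χ)` with output colour `c`: correctly coloured trees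
whose leaves are in bijection with `X`. -/
def monomials (Γ : Signature I Op) (χ : X → I) (c : I) : Set (PTree Op X) :=
  {t | t.labels.Nodup ∧ (∀ x, x ∈ t.labels) ∧ Γ.HasColour χ c t}

theorem HasColour.map {Γ : Signature I Op} {χ : X → I} {ψ : Y → I} {f : X → Y}
    (h : ∀ x, ψ (f x) = χ x) {c : I} {t : PTree Op X} (ht : Γ.HasColour χ c t) :
    Γ.HasColour ψ c (t.map f) := by
  induction t generalizing c with
  | leaf x => exact (h x).trans ht
  | node g l r hl hr => exact ⟨ht.1, hl ht.2.1, hr ht.2.2⟩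

theorem map_mem_monomials {Γ : Signature I Op} {χ : X → I} {ψ : Y → I} (e : X ≃ Y)
    (h : ∀ x, ψ (e x) = χ x) {c : I} {t : PTree Op X} (ht : t ∈ Γ.monomials χ c) :
    t.map e ∈ Γ.monomials ψ c := by
  refine ⟨?_, fun y => ?_, ht.2.2.map h⟩
  · rw [PTree.labels_map]
    exact ht.1.map e.injective
  · rw [PTree.labels_map, List.mem_map]
    exact ⟨e.symm y, ht.2.1 _, e.apply_symm_apply y⟩

end Signature

/-! ## Symmetric coloured collections

A symmetric `I`-coloured collection assigns a vector space to every coloured finite set `(X, χ)` and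
every output colour, functorially in colour preserving bijections. -/

structure SymColl (k : Type u) [Field k] (I : Type) where
  obj : (X : Type) → (X → I) → I → Type u
  [acg : ∀ X χ c, AddCommGroup (obj X χ c)]
  [mod : ∀ X χ c, Module k (obj X χ c)]
  map : ∀ {X Y : Type} (e : X ≃ Y) {χ : X → I} {ψ : Y → I} (_ : ∀ x, ψ (e x) = χ x) (c : I),
    obj X χ c →ₗ[k] obj Y ψ c
  map_refl : ∀ {X : Type} {χ : X → I} (h : ∀ x, χ (Equiv.refl X x) = χ x) (c : I) (v : obj X χ c),
    map (Equiv.refl X) h c v = v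
  map_trans : ∀ {X Y Z : Type} (e : X ≃ Y) (e' : Y ≃ Z) {χ : X → I} {ψ : Y → I} {ω : Z → I}
    (h : ∀ x, ψ (e x) = χ x) (h' : ∀ y, ω (e' y) = ψ y)
    (h'' : ∀ x, ω (e.trans e' x) = χ x) (c : I) (v : obj X χ c),
    map e' h' c (map e h c v) = map (e.trans e') h'' c v

namespace SymColl

attribute [instance] SymColl.acg SymColl.mod

variable {k : Type u} [Field k] {I : Type}

/-- Isomorphism of symmetric coloured collections. -/
def Isomorphic (P Q : SymColl k I) : Prop :=
  ∃ φ : ∀ (X : Type) [Finite X] (χ : X → I) (c : I), P.obj X χ c ≃ₗ[k] Q.obj X χ c,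
    ∀ (X Y : Type) [Finite X] [Finite Y] (e : X ≃ Y) (χ : X → I) (ψ : Y → I)
      (h : ∀ x, ψ (e x) = χ x) (c : I) (v : P.obj X χ c),
      φ Y ψ c (P.map e h c v) = Q.map e h c (φ X χ c v)

/-- The coefficient of `∏ tᵢ ^ mᵢ` is `dim P(∑ mᵢ, χ, c) / ∏ mᵢ!` with `χ` taking each value `i`
exactly `mᵢ` times. -/
def genSeries [Fintype I] (P : SymColl k I) (c : I) : MvPowerSeries I ℚ :=
  fun m => (Module.finrank k (P.obj (Σ i : I, Fin (m i)) Sigma.fst c) : ℚ) / ∏ i, ((m i).factorial : ℚ)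

section Comp

/-- A coloured set `(𝐦, κ)` with a surjection `f : X ↠ 𝐦`. -/
structure CompIndex (I X : Type) where
  m : ℕ
  κ : Fin m → I
  f : X → Fin m
  surj : Function.Surjective f

namespace CompIndex

variable {X Y Z : Type}

abbrev perm (i : CompIndex I X) (σ : Equiv.Perm (Fin i.m)) : CompIndex I X :=
  ⟨i.m, i.κ ∘ σ.symm, σ ∘ i.f, σ.surjective.comp i.surj⟩

abbrev push (i : CompIndex I X) (e : X ≃ Y) : CompIndex I Y :=
  ⟨i.m, i.κ, i.f ∘ e.symm, i.surj.comp e.symm.surjective⟩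

def fibrePerm (i : CompIndex I X) (σ : Equiv.Perm (Fin i.m)) (j : Fin i.m) :
    {x // i.f x = σ.symm j} ≃ {x // (i.perm σ).f x = j} :=
  Equiv.subtypeEquivRight fun _ => Equiv.eq_symm_apply σ

def fibrePush (i : CompIndex I X) (e : X ≃ Y) (j : Fin i.m) :
    {x // i.f x = j} ≃ {y // (i.push e).f y = j} :=
  e.subtypeEquiv fun x => by simp [push]

end CompIndex

variable (P Q : SymColl k I)

/-- `P(m, κ, c) ⊗ Q(f⁻¹(1), χ, κ(1)) ⊗ … ⊗ Q(f⁻¹(m), χ, κ(m))`. -/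
abbrev CompSummand (X : Type) (χ : X → I) (c : I) (i : CompIndex I X) : Type u :=
  P.obj (Fin i.m) i.κ c ⊗[k]
    (⨂[k] j : Fin i.m, Q.obj {x // i.f x = j} (fun x => χ x) (i.κ j))

abbrev CompSum (X : Type) (χ : X → I) (c : I) : Type u :=
  ⨁ i : CompIndex I X, CompSummand P Q X χ c i

open Classical in
def compPure {X : Type} (χ : X → I) (c : I) (i : CompIndex I X) (p : P.obj (Fin i.m) i.κ c)
    (q : ∀ j : Fin i.m, Q.obj {x // i.f x = j} (fun x => χ x) (i.κ j)) : CompSum P Q X χ c :=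
  DirectSum.lof k _ (CompSummand P Q X χ c) i (p ⊗ₜ[k] PiTensorProduct.tprod k q)

/-- The relations that turn `⊗` into `⊗` over the group algebra of `Σ_m`. -/
def compRel (X : Type) (χ : X → I) (c : I) : Submodule k (CompSum P Q X χ c) :=
  Submodule.span k {v | ∃ (i : CompIndex I X) (σ : Equiv.Perm (Fin i.m))
    (p : P.obj (Fin i.m) i.κ c)
    (q : ∀ j : Fin i.m, Q.obj {x // i.f x = j} (fun x => χ x) (i.κ j)),
    v = compPure P Q χ c i p q -
      compPure P Q χ c (i.perm σ)
        (P.map σ (fun x => by simp) c p)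
        (fun j => Q.map (i.fibrePerm σ j) (fun _ => rfl) _ (q (σ.symm j)))}

open Classical in
def compPush {X Y : Type} (e : X ≃ Y) {χ : X → I} {ψ : Y → I} (h : ∀ x, ψ (e x) = χ x) (c : I) :
    CompSum P Q X χ c →ₗ[k] CompSum P Q Y ψ c :=
  DirectSum.toModule k _ _ fun i =>
    DirectSum.lof k _ (CompSummand P Q Y ψ c) (i.push e) ∘ₗ
      LinearMap.lTensor (P.obj (Fin i.m) i.κ c)
        (PiTensorProduct.map fun j => Q.map (i.fibrePush e j) (fun x => h x) (i.κ j))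

theorem compPush_pure {X Y : Type} (e : X ≃ Y) {χ : X → I} {ψ : Y → I} (h : ∀ x, ψ (e x) = χ x)
    (c : I) (i : CompIndex I X) (p : P.obj (Fin i.m) i.κ c)
    (q : ∀ j : Fin i.m, Q.obj {x // i.f x = j} (fun x => χ x) (i.κ j)) :
    compPush P Q e h c (compPure P Q χ c i p q) =
      compPure P Q ψ c (i.push e) p
        (fun j => Q.map (i.fibrePush e j) (fun x => h x) (i.κ j) (q j)) := by
  classical
  unfold compPush compPure
  rw [DirectSum.toModule_lof]
  simp only [LinearMap.comp_apply, LinearMap.lTensor_tmul, PiTensorProduct.map_tprod]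

theorem compSum_hom_ext {X : Type} {χ : X → I} {c : I} {M : Type*} [AddCommGroup M] [Module k M]
    {F G : CompSum P Q X χ c →ₗ[k] M}
    (h : ∀ i p q, F (compPure P Q χ c i p q) = G (compPure P Q χ c i p q)) : F = G := by
  classical
  refine DirectSum.linearMap_ext _ fun i => TensorProduct.ext' fun p v => ?_
  induction v using PiTensorProduct.induction_on with
  | smul_tprod r q =>
    have := h i p q
    simp only [compPure] at this
    simp only [LinearMap.comp_apply, TensorProduct.tmul_smul, map_smul]
    exact congrArg (r • ·) this
  | add a b ha hb => simp only [TensorProduct.tmul_add, map_add, ha, hb]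

theorem compRel_le_comap {X Y : Type} (e : X ≃ Y) {χ : X → I} {ψ : Y → I}
    (h : ∀ x, ψ (e x) = χ x) (c : I) :
    compRel P Q X χ c ≤ (compRel P Q Y ψ c).comap (compPush P Q e h c) := by
  refine Submodule.span_le.2 ?_
  rintro _ ⟨i, σ, p, q, rfl⟩
  refine Submodule.subset_span ⟨i.push e, σ, p,
    fun j => Q.map (i.fibrePush e j) (fun x => h x) (i.κ j) (q j), ?_⟩
  rw [map_sub, compPush_pure, compPush_pure]
  congr 1
  change compPure P Q ψ c ((i.push e).perm σ) _ _ = _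
  congr 1
  funext j
  have h'' : ∀ x : {x // i.f x = σ.symm j}, ψ ((((i.fibrePerm σ j).trans
      ((i.perm σ).fibrePush e j)) x : {y // ((i.perm σ).push e).f y = j}) : Y) = χ x :=
    fun x => h x
  exact (Q.map_trans (i.fibrePerm σ j) ((i.perm σ).fibrePush e j) _ _ h'' _ _).trans
    (Q.map_trans (i.fibrePush e (σ.symm j)) ((i.push e).fibrePerm σ j) _ _ h'' _ _).symm

/-- The symmetric composition
`(P ∘ Q)(X, χ, c) = ⨁_{(𝐦, κ)} P(m, κ, c) ⊗_{Σ_m} ⨁_{f : X ↠ 𝐦} ⨂_j Q(f⁻¹(j), χ, κ(j))`. -/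
def comp : SymColl k I where
  obj X χ c := CompSum P Q X χ c ⧸ compRel P Q X χ c
  map e _ _ h c := Submodule.mapQ _ _ (compPush P Q e h c) (compRel_le_comap P Q e h c)
  map_refl {X χ} h c v := by
    have key : compPush P Q (Equiv.refl X) h c = LinearMap.id := by
      refine compSum_hom_ext P Q fun i p q => ?_
      rw [compPush_pure]
      change compPure P Q χ c i p _ = compPure P Q χ c i p q
      congr 1
      funext j
      exact Q.map_refl (fun _ => rfl) _ _
    induction v using Submodule.Quotient.induction_on with
    | _ v => simp [key]
  map_trans {X Y Z} e e' χ ψ ω h h' h'' c v := by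
    have key : compPush P Q e' h' c ∘ₗ compPush P Q e h c =
        compPush P Q (e.trans e') h'' c := by
      refine compSum_hom_ext P Q fun i p q => ?_
      rw [LinearMap.comp_apply, compPush_pure, compPush_pure, compPush_pure]
      change compPure P Q ω c (i.push (e.trans e')) p _ = _
      congr 1
      funext j
      exact Q.map_trans (i.fibrePush e j) ((i.push e).fibrePush e' j) _ _ (fun x => h'' x) _ _
    induction v using Submodule.Quotient.induction_on with
    | _ v => simp [← key]

end Comp

end SymColl

/-! ## Symmetric coloured operads presented by binary generators and relations -/

/-- The relations are linear combinations of trees with leaves labelled `0, 1, …, n - 1`. -/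
structure Presentation (k : Type u) [Field k] (I : Type) where
  Op : Type
  sig : Signature I Op
  rels : Set (PTree Op ℕ →₀ k)

/-- The elements `C ∘ r ∘ (s₀, s₁, …)` obtained from a relation `r` by grafting trees `s i` on its
leaves and grafting the result into a tree `C`, such that none of the internal edges of (the terms
of) `r` belongs to the set of edges `N`. -/
inductive RelInstance {k : Type u} [Field k] {Op X : Type} (R : Set (PTree Op ℕ →₀ k))
    (N : Set (Set X)) : (PTree Op X →₀ k) → Prop
  | subst (r : PTree Op ℕ →₀ k) (hr : r ∈ R) (s : ℕ → PTree Op X)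
      (hN : ∀ t ∈ r.support, ∀ C ∈ t.innerEdges, (⋃ i ∈ C, (s i).leafSet) ∉ N) :
      RelInstance R N (r.mapDomain fun t => t.bind s)
  | left (g : Op) (f : PTree Op X →₀ k) (t : PTree Op X) (hf : RelInstance R N f) :
      RelInstance R N (f.mapDomain fun s => .node g s t)
  | right (g : Op) (t : PTree Op X) (f : PTree Op X →₀ k) (hf : RelInstance R N f) :
      RelInstance R N (f.mapDomain fun s => .node g t s)

namespace Presentation

variable {k : Type u} [Field k] {I : Type} (P : Presentation k I)

/-- The operadic ideal generated by the relations, in its component with inputs `(X, χ)` and output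
colour `c`. -/
def ideal {X : Type} (χ : X → I) (c : I) : Submodule k (PTree P.Op X →₀ k) :=
  Submodule.span k {f | RelInstance P.rels ∅ f ∧ ↑f.support ⊆ P.sig.monomials χ c}

/-- The component of the free operad on planar binary operations, with basis the tree monomials.
(Symmetries of the generators are part of the relations.) -/
abbrev Free {X : Type} (χ : X → I) (c : I) : Type u := P.sig.monomials χ c →₀ k

/-- Forget the colours. -/
abbrev toTrees {X : Type} (χ : X → I) (c : I) : P.Free χ c →ₗ[k] (PTree P.Op X →₀ k) :=
  Finsupp.lmapDomain k k Subtype.val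

theorem relInstance_map {Op X Y : Type} {R : Set (PTree Op ℕ →₀ k)} (e : X → Y)
    {f : PTree Op X →₀ k} (hf : RelInstance R ∅ f) :
    RelInstance R (∅ : Set (Set Y)) (f.mapDomain (PTree.map e)) := by
  induction hf with
  | subst r hr s hN =>
    have := RelInstance.subst (N := (∅ : Set (Set Y))) r hr (fun i => (s i).map e)
      (fun _ _ _ _ => Set.notMem_empty _)
    rw [← Finsupp.mapDomain_comp]
    convert this using 2
    funext t
    exact PTree.map_bind e s t
  | left g f t _ ih =>
    have := RelInstance.left g _ (t.map e) ih
    rw [← Finsupp.mapDomain_comp] at this ⊢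
    exact this
  | right g t f _ ih =>
    have := RelInstance.right g (t.map e) _ ih
    rw [← Finsupp.mapDomain_comp] at this ⊢
    exact this

def freeMap {X Y : Type} (e : X ≃ Y) {χ : X → I} {ψ : Y → I} (h : ∀ x, ψ (e x) = χ x) (c : I) :
    P.Free χ c →ₗ[k] P.Free ψ c :=
  Finsupp.lmapDomain k k fun t => ⟨t.1.map e, Signature.map_mem_monomials e h t.2⟩

theorem toTrees_freeMap {X Y : Type} (e : X ≃ Y) {χ : X → I} {ψ : Y → I}
    (h : ∀ x, ψ (e x) = χ x) (c : I) (f : P.Free χ c) :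
    P.toTrees ψ c (P.freeMap e h c f) = Finsupp.lmapDomain k k (PTree.map e) (P.toTrees χ c f) := by
  simp only [toTrees, freeMap, Finsupp.lmapDomain_apply, ← Finsupp.mapDomain_comp]
  rfl

theorem ideal_le_comap {X Y : Type} (e : X ≃ Y) {χ : X → I} {ψ : Y → I}
    (h : ∀ x, ψ (e x) = χ x) (c : I) :
    (P.ideal χ c).comap (P.toTrees χ c) ≤
      ((P.ideal ψ c).comap (P.toTrees ψ c)).comap (P.freeMap e h c) := by
  classical
  have key : P.ideal χ c ≤ (P.ideal ψ c).comap (Finsupp.lmapDomain k k (PTree.map e)) := by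
    refine Submodule.span_le.2 ?_
    rintro f ⟨hf, hs⟩
    refine Submodule.subset_span ⟨relInstance_map e hf, fun t ht => ?_⟩
    obtain ⟨s, hs', rfl⟩ := Finset.mem_image.1 (Finsupp.mapDomain_support ht)
    exact Signature.map_mem_monomials e h (hs hs')
  intro f hf
  rw [Submodule.mem_comap, Submodule.mem_comap, toTrees_freeMap]
  exact key hf

/-- The presented operad, as a symmetric coloured collection. -/
def toColl : SymColl k I where
  obj _ χ c := P.Free χ c ⧸ (P.ideal χ c).comap (P.toTrees χ c)
  map e _ _ h c := Submodule.mapQ _ _ (P.freeMap e h c) (P.ideal_le_comap e h c)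
  map_refl {X χ} h c v := by
    induction v using Submodule.Quotient.induction_on with
    | _ v =>
      have : P.freeMap (Equiv.refl X) h c v = v := by
        refine (congrArg (fun F => Finsupp.mapDomain F v) ?_).trans Finsupp.mapDomain_id
        funext t
        exact Subtype.ext (PTree.map_id t.1)
      simp [this]
  map_trans {X Y Z} e e' χ ψ ω h h' h'' c v := by
    induction v using Submodule.Quotient.induction_on with
    | _ v =>
      have : P.freeMap e' h' c (P.freeMap e h c v) = P.freeMap (e.trans e') h'' c v := by
        simp only [freeMap, Finsupp.lmapDomain_apply, ← Finsupp.mapDomain_comp]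
        congr 1
        funext t
        exact Subtype.ext (PTree.map_map _ _ t.1)
      simp [this]

/-! ### The bar construction and Koszulness

For an operad `P` generated by binary operations, a basis element of the bar construction is a tree
whose vertices are decorated by elements of `P`.  Such a decorated tree is represented by a binary
tree `T` together with a set `N` of *cut* internal edges: cutting `T` along `N` gives the pieces,
i.e. the vertices, and every piece is an element of `P`, which means that the relations of `P` may be
applied as long as they do not involve a cut edge.  An element with `|N| = j` has `j + 1` vertices
(when `T` is not the trivial tree).  The differential contracts one cut edge at a time, that is,
composes the two adjacent pieces in `P`; the orientation of `(T, N)` is an ordering of the vertices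
up to sign or, equivalently, as every vertex but the lowest one is the upper end of exactly one cut
edge, an ordering of `N`; cut edges are ordered by `∑_{i ∈ C} 2 ^ i`. -/

/-- The pairs `(N, T)` with `|N| = j`. -/
def barCells {n : ℕ} (χ : Fin n → I) (c : I) (j : ℕ) :
    Set (Finset (Finset (Fin n)) × PTree P.Op (Fin n)) :=
  {p | p.1.card = j ∧ p.2 ∈ P.sig.monomials χ c ∧ ∀ C ∈ p.1, (C : Set (Fin n)) ∈ p.2.innerEdges}

/-- The span of the relations of `P` that are applied inside of the pieces. The bar construction
is the quotient of the span of `barCells χ c j` by `barRel χ c j`. -/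
def barRel {n : ℕ} (χ : Fin n → I) (c : I) (j : ℕ) :
    Submodule k (Finset (Finset (Fin n)) × PTree P.Op (Fin n) →₀ k) :=
  Submodule.span k {F | ∃ (N : Finset (Finset (Fin n))) (f : PTree P.Op (Fin n) →₀ k),
    RelInstance P.rels {C | ∃ D ∈ N, C = (D : Set (Fin n))} f ∧
    (∀ T ∈ f.support, (N, T) ∈ P.barCells χ c j) ∧
    F = f.mapDomain fun T => (N, T)}

def edgeCode {n : ℕ} (C : Finset (Fin n)) : ℕ := ∑ i ∈ C, 2 ^ (i : ℕ)

/-- `(N, T) ↦ ∑_{C ∈ N} ± (N \ {C}, T)`. -/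
def barD (n : ℕ) : (Finset (Finset (Fin n)) × PTree P.Op (Fin n) →₀ k) →ₗ[k]
    (Finset (Finset (Fin n)) × PTree P.Op (Fin n) →₀ k) :=
  Finsupp.linearCombination k fun p => ∑ C ∈ p.1,
    Finsupp.single (p.1.erase C, p.2) ((-1) ^ (p.1.filter fun D => edgeCode D < edgeCode C).card)

/-- `P` is Koszul: the homology of its bar construction is concentrated on the diagonal, i.e.
in arity `n` it vanishes except for `n - 1` vertices (`n - 2` cut edges), the largest possible
number. Every cycle of degree `j < n - 2` in the quotient is a boundary. -/
def IsKoszul : Prop :=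
  ∀ (n : ℕ) (χ : Fin n → I) (c : I) (j : ℕ), j + 2 < n →
    ∀ f ∈ Finsupp.supported k k (P.barCells χ c j), P.barD n f ∈ P.barRel χ c (j - 1) →
      ∃ g ∈ Finsupp.supported k k (P.barCells χ c (j + 1)), f - P.barD n g ∈ P.barRel χ c j

end Presentation

/-! ## The operads `As`, `MLie`, `LP` and the quadratic presentation of `H₀(SC)`

The colour `S` (solid) is the first colour and `D` (dotted) is the second one. -/

inductive Colour
  | S
  | D
  deriving DecidableEq

instance : Fintype Colour := ⟨{.S, .D}, fun c => by cases c <;> simp⟩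

section Relations

variable (k : Type u) [Field k] {Op : Type}


/-- The element `[t]` of the free operad. -/
def mon (t : PTree Op ℕ) : PTree Op ℕ →₀ k := Finsupp.single t 1

open PTree in
/-- `β(1,2) + β(2,1)` -/
def antisymmetry (β : Op) : PTree Op ℕ →₀ k :=
  mon k (node β (leaf 0) (leaf 1)) + mon k (node β (leaf 1) (leaf 0))

open PTree in
/-- `m(1,2) - m(2,1)` -/
def commutativity (m : Op) : PTree Op ℕ →₀ k :=
  mon k (node m (leaf 0) (leaf 1)) - mon k (node m (leaf 1) (leaf 0))

open PTree in
/-- `β(β(1,2),3) - β(β(1,3),2) - β(1,β(2,3))` -/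
def jacobi (β : Op) : PTree Op ℕ →₀ k :=
  mon k (node β (node β (leaf 0) (leaf 1)) (leaf 2))
    - mon k (node β (node β (leaf 0) (leaf 2)) (leaf 1))
    - mon k (node β (leaf 0) (node β (leaf 1) (leaf 2)))

open PTree in
/-- `a(a(1,2),3) - a(1,a(2,3))` -/
def associativity (a : Op) : PTree Op ℕ →₀ k :=
  mon k (node a (node a (leaf 0) (leaf 1)) (leaf 2))
    - mon k (node a (leaf 0) (node a (leaf 1) (leaf 2)))

open PTree in
/-- `d(1,a(2,3)) - a(2,d(1,3)) - a(d(1,2),3)` -/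
def derivation (d a : Op) : PTree Op ℕ →₀ k :=
  mon k (node d (leaf 0) (node a (leaf 1) (leaf 2)))
    - mon k (node a (leaf 1) (node d (leaf 0) (leaf 2)))
    - mon k (node a (node d (leaf 0) (leaf 1)) (leaf 2))

open PTree in
/-- `d(β(1,2),3) - d(1,d(2,3)) + d(2,d(1,3))` -/
def lieAction (d β : Op) : PTree Op ℕ →₀ k :=
  mon k (node d (node β (leaf 0) (leaf 1)) (leaf 2))
    - mon k (node d (leaf 0) (node d (leaf 1) (leaf 2)))
    + mon k (node d (leaf 1) (node d (leaf 0) (leaf 2)))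

open PTree in
/-- `d(m(1,2),3) - d(1,d(2,3))` -/
def moduleAction (d m : Op) : PTree Op ℕ →₀ k :=
  mon k (node d (node m (leaf 0) (leaf 1)) (leaf 2))
    - mon k (node d (leaf 0) (node d (leaf 1) (leaf 2)))

open PTree in
/-- `d(1,a(2,3)) - a(d(1,2),3)` -/
def linearLeft (d a : Op) : PTree Op ℕ →₀ k :=
  mon k (node d (leaf 0) (node a (leaf 1) (leaf 2)))
    - mon k (node a (node d (leaf 0) (leaf 1)) (leaf 2))

open PTree in
/-- `d(1,a(2,3)) - a(2,d(1,3))` -/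
def linearRight (d a : Op) : PTree Op ℕ →₀ k :=
  mon k (node d (leaf 0) (node a (leaf 1) (leaf 2)))
    - mon k (node a (leaf 1) (node d (leaf 0) (leaf 2)))

end Relations

inductive AsOp
  | a

inductive MLieOp
  | β
  | d

inductive LPOp
  | β
  | a
  | d

inductive SCOp
  | m
  | a
  | d

open Colour

variable (k : Type u) [Field k]

/-- Associative algebras (living in the first colour). -/
def As : Presentation k Colour where
  Op := AsOp
  sig := ⟨fun _ => S, fun _ => S, fun _ => S⟩
  rels := {associativity k .a}

def mlieSig : Signature Colour MLieOp where
  src₁ := fun _ => D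
  src₂ | .β => D | .d => S
  tgt | .β => D | .d => S

/-- A Lie algebra (colour `D`) and a module over it (colour `S`). -/
def MLie : Presentation k Colour where
  Op := MLieOp
  sig := mlieSig
  rels := {antisymmetry k .β, jacobi k .β, lieAction k .d .β}

def lpSig : Signature Colour LPOp where
  src₁ | .β => D | .a => S | .d => D
  src₂ | .β => D | .a => S | .d => S
  tgt | .β => D | .a => S | .d => S

/-- The quadratic defining relations of the operad of Leibniz pairs. -/
def lpQuadraticRels : Set (PTree LPOp ℕ →₀ k) :=
  {jacobi k .β, associativity k .a, derivation k .d .a, lieAction k .d .β}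

/-- The operad of Leibniz pairs: a Lie algebra (colour `D`) acting by derivations on an associative
algebra (colour `S`). -/
def LP : Presentation k Colour where
  Op := LPOp
  sig := lpSig
  rels := insert (antisymmetry k .β) (lpQuadraticRels k)

def scSig : Signature Colour SCOp where
  src₁ | .m => D | .a => S | .d => D
  src₂ | .m => D | .a => S | .d => S
  tgt | .m => D | .a => S | .d => S

/-- A commutative associative algebra (colour `D`) and an associative algebra over it
(colour `S`). -/
def SCPres : Presentation k Colour where
  Op := SCOp
  sig := scSig
  rels := {commutativity k .m, associativity k .m, associativity k .a, moduleAction k .d .m,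
    linearLeft k .d .a, linearRight k .d .a}

/-! ## The Swiss-cheese operad and its zeroth homology -/

section SwissCheese

/-- The space of operations of the Swiss-cheese operad with inputs `(X, χ)`. A point is a
configuration of discs `κ x = (centre, radius)` with pairwise disjoint interiors.
For the closed output colour `D`, these are discs in the unit disc (all inputs are closed).
For the open output colour `S`, the ambient set is the upper half of the unit disc; open inputs are
upper halves of discs centred at the real line, closed inputs are discs in the open upper half plane,
and there is at least one open input. -/
def SwissCheese {X : Type} (χ : X → Colour) (c : Colour) : Set (X → ℂ × ℝ) :=
  {κ | (∃ x, χ x = c) ∧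
    (∀ x, 0 < (κ x).2 ∧ ‖(κ x).1‖ + (κ x).2 ≤ 1) ∧
    (∀ x y, x ≠ y → (κ x).2 + (κ y).2 ≤ ‖(κ x).1 - (κ y).1‖) ∧
    match c with
    | D => ∀ x, χ x = D
    | S => (∀ x, χ x = S → (κ x).1.im = 0) ∧ (∀ x, χ x = D → (κ x).2 ≤ (κ x).1.im)}

/-- Zeroth homology: the free module on the path components. -/
abbrev H0SC {X : Type} (χ : X → Colour) (c : Colour) : Type u :=
  ZerothHomotopy (SwissCheese χ c) →₀ k

/-- Operadic insertion: `p` is rescaled into the disc `w`. -/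
def place (w p : ℂ × ℝ) : ℂ × ℝ := (w.1 + w.2 * p.1, w.2 * p.2)

/-- Binary configurations: for `m`, two discs in a disc; for `a`, the first half-disc is to the left
of the second one; for `d`, a disc and a half-disc in a half-disc. -/
def scDisc₁ : SCOp → ℂ × ℝ
  | .m => (-1 / 2, 1 / 4)
  | .a => (-1 / 2, 1 / 4)
  | .d => (Complex.I / 2, 1 / 4)

def scDisc₂ : SCOp → ℂ × ℝ
  | .m => (1 / 2, 1 / 4)
  | .a => (1 / 2, 1 / 4)
  | .d => (0, 1 / 4)

open Classical in
/-- The iterated operadic composition, along a tree, of the binary configurations. -/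
def scConf {X : Type} : PTree SCOp X → X → ℂ × ℝ
  | .leaf _, _ => (0, 1)
  | .node g l r, x =>
    if x ∈ l.labels then place (scDisc₁ g) (scConf l x) else place (scDisc₂ g) (scConf r x)


theorem place_mem {w p : ℂ × ℝ} (hw : 0 < w.2 ∧ ‖w.1‖ + w.2 ≤ 1) (hp : 0 < p.2 ∧ ‖p.1‖ + p.2 ≤ 1) :
    0 < (place w p).2 ∧ ‖(place w p).1‖ + (place w p).2 ≤ 1 := by
  refine ⟨mul_pos hw.1 hp.1, ?_⟩
  have h1 : ‖w.1 + w.2 * p.1‖ ≤ ‖w.1‖ + w.2 * ‖p.1‖ := by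
    refine (norm_add_le _ _).trans_eq ?_
    rw [norm_mul, Complex.norm_real, Real.norm_of_nonneg hw.1.le]
  change ‖w.1 + w.2 * p.1‖ + w.2 * p.2 ≤ 1
  nlinarith [hw.1, hw.2, hp.2]

theorem place_sep {w p p' : ℂ × ℝ} (hw : 0 < w.2) (h : p.2 + p'.2 ≤ ‖p.1 - p'.1‖) :
    (place w p).2 + (place w p').2 ≤ ‖(place w p).1 - (place w p').1‖ := by
  have : (place w p).1 - (place w p').1 = w.2 * (p.1 - p'.1) := by simp only [place]; ring
  rw [this, norm_mul, Complex.norm_real, Real.norm_of_nonneg hw.le]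
  change w.2 * p.2 + w.2 * p'.2 ≤ _
  nlinarith

theorem place_sep' {w w' p p' : ℂ × ℝ} (hw : 0 < w.2) (hw' : 0 < w'.2)
    (h : w.2 + w'.2 ≤ ‖w.1 - w'.1‖) (hp : ‖p.1‖ + p.2 ≤ 1) (hp' : ‖p'.1‖ + p'.2 ≤ 1) :
    (place w p).2 + (place w' p').2 ≤ ‖(place w p).1 - (place w' p').1‖ := by
  have e : w.1 - w'.1 = ((place w p).1 - (place w' p').1) + (-(w.2 * p.1) + w'.2 * p'.1) := by
    simp only [place]; ring
  have h1 : ‖w.1 - w'.1‖ ≤ ‖(place w p).1 - (place w' p').1‖ + (w.2 * ‖p.1‖ + w'.2 * ‖p'.1‖) := by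
    rw [e]
    refine (norm_add_le _ _).trans (add_le_add le_rfl ((norm_add_le _ _).trans_eq ?_))
    rw [norm_neg, norm_mul, norm_mul, Complex.norm_real, Complex.norm_real,
      Real.norm_of_nonneg hw.le, Real.norm_of_nonneg hw'.le]
  change w.2 * p.2 + w'.2 * p'.2 ≤ _
  nlinarith

theorem scDisc_spec (g : SCOp) : (0 < (scDisc₁ g).2 ∧ ‖(scDisc₁ g).1‖ + (scDisc₁ g).2 ≤ 1) ∧
    (0 < (scDisc₂ g).2 ∧ ‖(scDisc₂ g).1‖ + (scDisc₂ g).2 ≤ 1) ∧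
    (scDisc₁ g).2 + (scDisc₂ g).2 ≤ ‖(scDisc₁ g).1 - (scDisc₂ g).1‖ := by
  cases g <;> norm_num [scDisc₁, scDisc₂]

theorem scConf_spec {X : Type} (χ : X → Colour) (t : PTree SCOp X) (c : Colour)
    (hn : t.labels.Nodup) (hc : scSig.HasColour χ c t) :
    (∃ x ∈ t.labels, χ x = c) ∧
    (∀ x ∈ t.labels, 0 < (scConf t x).2 ∧ ‖(scConf t x).1‖ + (scConf t x).2 ≤ 1) ∧
    (∀ x ∈ t.labels, ∀ y ∈ t.labels, x ≠ y →
      (scConf t x).2 + (scConf t y).2 ≤ ‖(scConf t x).1 - (scConf t y).1‖) ∧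
    (c = D → ∀ x ∈ t.labels, χ x = D) ∧
    (c = S → ∀ x ∈ t.labels, (χ x = S → (scConf t x).1.im = 0) ∧
      (χ x = D → (scConf t x).2 ≤ (scConf t x).1.im)) := by
  induction t generalizing c with
  | leaf x =>
    have hc' : χ x = c := hc
    simp only [PTree.labels, List.mem_singleton, scConf]
    refine ⟨⟨x, rfl, hc'⟩, by simp, by rintro _ rfl _ rfl h; exact absurd rfl h, ?_, ?_⟩
    · rintro rfl _ rfl; exact hc'
    · rintro rfl _ rfl; simp [hc']
  | node g l r hl hr =>
    obtain ⟨hg, hcl, hcr⟩ := hc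
    rw [PTree.labels, List.nodup_append] at hn
    obtain ⟨hnl, hnr, hd⟩ := hn
    obtain ⟨⟨xl, hxl, hxl'⟩, bl, sl, dl, ol⟩ := hl _ hnl hcl
    obtain ⟨⟨xr, hxr, hxr'⟩, br, sr, dr, or⟩ := hr _ hnr hcr
    obtain ⟨g1, g2, g3⟩ := scDisc_spec g
    have el : ∀ x ∈ l.labels, scConf (.node g l r) x = place (scDisc₁ g) (scConf l x) :=
      fun x hx => by simp [scConf, hx]
    have er : ∀ x ∈ r.labels, scConf (.node g l r) x = place (scDisc₂ g) (scConf r x) :=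
      fun x hx => by
        have : x ∉ l.labels := fun h => hd x h x hx rfl
        simp [scConf, this]
    simp only [PTree.labels, List.mem_append]
    refine ⟨?_, ?_, ?_, ?_, ?_⟩
    · cases g
      · exact ⟨xl, .inl hxl, hxl'.trans hg⟩
      · exact ⟨xl, .inl hxl, hxl'.trans hg⟩
      · exact ⟨xr, .inr hxr, hxr'.trans hg⟩
    · rintro x (hx | hx)
      · rw [el x hx]; exact place_mem g1 (bl x hx)
      · rw [er x hx]; exact place_mem g2 (br x hx)
    · rintro x (hx | hx) y (hy | hy) hxy
      · rw [el x hx, el y hy]; exact place_sep g1.1 (sl x hx y hy hxy)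
      · rw [el x hx, er y hy]; exact place_sep' g1.1 g2.1 g3 (bl x hx).2 (br y hy).2
      · rw [er x hx, el y hy, norm_sub_rev, add_comm]
        exact place_sep' g1.1 g2.1 g3 (bl y hy).2 (br x hx).2
      · rw [er x hx, er y hy]; exact place_sep g2.1 (sr x hx y hy hxy)
    · rintro rfl
      cases g
      · rintro x (hx | hx)
        · exact dl rfl x hx
        · exact dr rfl x hx
      · cases hg
      · cases hg
    · rintro rfl
      cases g
      · cases hg
      · rintro x (hx | hx)
        · obtain ⟨h1, h2⟩ := ol rfl x hx
          rw [el x hx]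
          simp only [place, scDisc₁]
          refine ⟨fun h => ?_, fun h => ?_⟩
          · have := h1 h; norm_num [this]
          · have := h2 h; norm_num; linarith
        · obtain ⟨h1, h2⟩ := or rfl x hx
          rw [er x hx]
          simp only [place, scDisc₂]
          refine ⟨fun h => ?_, fun h => ?_⟩
          · have := h1 h; norm_num [this]
          · have := h2 h; norm_num; linarith
      · rintro x (hx | hx)
        · have hD := dl rfl x hx
          rw [el x hx]
          refine ⟨fun h => (by rw [hD] at h; cases h), fun _ => ?_⟩
          have h1 := (abs_le.1 (Complex.abs_im_le_norm (scConf l x).1)).1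
          have h2 := (bl x hx).2
          simp only [place, scDisc₁]
          norm_num
          linarith
        · obtain ⟨h1, h2⟩ := or rfl x hx
          rw [er x hx]
          simp only [place, scDisc₂]
          refine ⟨fun h => ?_, fun h => ?_⟩
          · have := h1 h; norm_num [this]
          · have := h2 h; norm_num; linarith

theorem scConf_mem {X : Type} {χ : X → Colour} {c : Colour} {t : PTree SCOp X}
    (ht : t ∈ scSig.monomials χ c) : scConf t ∈ SwissCheese χ c := by
  obtain ⟨⟨x₀, _, hx₀⟩, h1, h2, h3, h4⟩ := scConf_spec χ t c ht.1 ht.2.2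
  have hm := ht.2.1
  refine ⟨⟨x₀, hx₀⟩, fun x => h1 x (hm x), fun x y => h2 x (hm x) y (hm y), ?_⟩
  clear hx₀ ht
  cases c
  · exact ⟨fun x => (h4 rfl x (hm x)).1, fun x => (h4 rfl x (hm x)).2⟩
  · exact fun x => h3 rfl x (hm x)

/-- The morphism from the free operad to `H₀(SC)`: the generators `m`, `a`, `d` are sent to the
classes of the binary configurations above. -/
def scClass {X : Type} (χ : X → Colour) (c : Colour) :
    (SCPres k).Free χ c →ₗ[k] H0SC k χ c :=
  Finsupp.lmapDomain k k fun t =>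
    (Quotient.mk _ ⟨scConf t.1, scConf_mem t.2⟩ : ZerothHomotopy (SwissCheese χ c))

end SwissCheese

/-! ## Shuffle coloured operads and Gröbner bases

Shuffle tree monomials of arity `n` have leaves labelled by `0, …, n - 1`. -/

section Shuffle

variable {k} {I Op : Type} (Γ : Signature I Op)

/-- The basis of the component of the free shuffle operad with input colours `χ 0, …, χ (n - 1)` and
output colour `c`. -/
def shMonomials (n : ℕ) (χ : ℕ → I) (c : I) : Set (PTree Op ℕ) :=
  {t | t.labels.Perm (List.range n) ∧ Γ.HasColour χ c t ∧ t.IsShuffle}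

def allShMonomials (n : ℕ) : Set (PTree Op ℕ) := {t | ∃ χ c, t ∈ shMonomials Γ n χ c}

/-- The elements obtained from `g ∈ G`, of arity `m`, by grafting trees `s 0, …, s (m - 1)` with
increasing smallest labels on its inputs and grafting the result into a tree. -/
inductive ShInstance (G : Set (PTree Op ℕ →₀ k)) : (PTree Op ℕ →₀ k) → Prop
  | subst (g : PTree Op ℕ →₀ k) (hg : g ∈ G) (m : ℕ)
      (hm : ∀ t ∈ g.support, t.labels.Perm (List.range m)) (s : ℕ → PTree Op ℕ)
      (hs : ∀ i j, i < j → j < m → (s i).minLabel < (s j).minLabel) :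
      ShInstance G (g.mapDomain fun t => t.bind s)
  | left (g : Op) (f : PTree Op ℕ →₀ k) (t : PTree Op ℕ) (hf : ShInstance G f) :
      ShInstance G (f.mapDomain fun s => .node g s t)
  | right (g : Op) (t : PTree Op ℕ) (f : PTree Op ℕ →₀ k) (hf : ShInstance G f) :
      ShInstance G (f.mapDomain fun s => .node g t s)

/-- The ideal of the free shuffle operad generated by `G`. -/
def shIdeal (G : Set (PTree Op ℕ →₀ k)) (n : ℕ) (χ : ℕ → I) (c : I) :
    Submodule k (PTree Op ℕ →₀ k) :=
  Submodule.span k {f | ShInstance G f ∧ ↑f.support ⊆ shMonomials Γ n χ c}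

/-- `Divides β α`: the tree monomial `β` is the tree monomial of a subtree of `α`, where the leaves of
the subtree are numbered in the order of their smallest descendants. -/
inductive Divides (β : PTree Op ℕ) : PTree Op ℕ → Prop
  | root (m : ℕ) (hm : β.labels.Perm (List.range m)) (s : ℕ → PTree Op ℕ)
      (hs : ∀ i j, i < j → j < m → (s i).minLabel < (s j).minLabel) : Divides β (β.bind s)
  | left (g : Op) (l r : PTree Op ℕ) (h : Divides β l) : Divides β (.node g l r)
  | right (g : Op) (l r : PTree Op ℕ) (h : Divides β r) : Divides β (.node g l r)

/-- The data `ω` of a shuffle composition `α ∘_{i,ω} β` of tree monomials of arities `m` and `n`: the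
new labels `u` of the leaves of `α` other than `i`, and the new labels `v` of the leaves of `β`.
Both are order preserving, and the smallest leaf of `β` takes the place of `i`. -/
structure IsShuffleData (m n i : ℕ) (u v : ℕ → ℕ) : Prop where
  lt : i < m
  mono_left : StrictMonoOn u (Set.Iio m)
  mono_right : StrictMonoOn v (Set.Iio n)
  eq : u i = v 0
  cover : u '' Set.Iio m ∪ v '' Set.Iio n = Set.Iio (m + n - 1)

/-- The shuffle composition `α ∘_{i,ω} β`. -/
def shComp (i : ℕ) (u v : ℕ → ℕ) (α β : PTree Op ℕ) : PTree Op ℕ :=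
  α.bind fun j => if j = i then β.map v else .leaf (u j)

/-- `le` is an admissible total ordering of the tree monomials of the free shuffle operad. -/
structure IsAdmissible (le : PTree Op ℕ → PTree Op ℕ → Prop) : Prop where
  refl : ∀ n, ∀ t ∈ allShMonomials Γ n, le t t
  antisymm : ∀ m n, ∀ t ∈ allShMonomials Γ m, ∀ t' ∈ allShMonomials Γ n, le t t' → le t' t → t = t'
  trans : ∀ l m n, ∀ t ∈ allShMonomials Γ l, ∀ t' ∈ allShMonomials Γ m,
    ∀ t'' ∈ allShMonomials Γ n, le t t' → le t' t'' → le t t''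
  total : ∀ m n, ∀ t ∈ allShMonomials Γ m, ∀ t' ∈ allShMonomials Γ n, le t t' ∨ le t' t
  arity : ∀ m n, ∀ t ∈ allShMonomials Γ m, ∀ t' ∈ allShMonomials Γ n, m < n →
    le t t' ∧ ¬ le t' t
  comp : ∀ (m n i : ℕ) (u v : ℕ → ℕ), IsShuffleData m n i u v →
    ∀ α ∈ allShMonomials Γ m, ∀ α' ∈ allShMonomials Γ m,
    ∀ β ∈ allShMonomials Γ n, ∀ β' ∈ allShMonomials Γ n,
    shComp i u v α β ∈ allShMonomials Γ (m + n - 1) →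
    shComp i u v α' β' ∈ allShMonomials Γ (m + n - 1) →
    le α α' → le β β' → le (shComp i u v α β) (shComp i u v α' β')

/-- `t` is the leading term of `f`. -/
def IsLeadingTerm (le : PTree Op ℕ → PTree Op ℕ → Prop) (f : PTree Op ℕ →₀ k) (t : PTree Op ℕ) :
    Prop :=
  t ∈ f.support ∧ ∀ s ∈ f.support, le s t

/-- `G` is a Gröbner basis of the ideal that it generates. -/
def IsGroebnerBasis (le : PTree Op ℕ → PTree Op ℕ → Prop) (G : Set (PTree Op ℕ →₀ k)) : Prop :=
  ∀ (n : ℕ) (χ : ℕ → I) (c : I), ∀ f ∈ shIdeal Γ G n χ c, f ≠ 0 →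
    ∃ t, IsLeadingTerm le f t ∧ ∃ g ∈ G, ∃ t', IsLeadingTerm le g t' ∧ Divides t' t

/-- `G` consists of nonzero homogeneous quadratic elements. -/
def IsQuadratic (G : Set (PTree Op ℕ →₀ k)) : Prop :=
  ∀ g ∈ G, g ≠ 0 ∧ (∃ n χ c, ↑g.support ⊆ shMonomials Γ n χ c) ∧ ∀ t ∈ g.support, t.vertices = 2

end Shuffle

/-! ### The shuffle operad of Leibniz pairs -/

/-- The generators of the shuffle operad: `b(1,2) = a(2,1)` and `e(1,2) = d(2,1)`. -/
inductive ShOp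
  | β
  | a
  | b
  | d
  | e

def shSig : Signature Colour ShOp where
  src₁ | .β => D | .a => S | .b => S | .d => D | .e => S
  src₂ | .β => D | .a => S | .b => S | .d => S | .e => D
  tgt | .β => D | .a => S | .b => S | .d => S | .e => S

def straight : LPOp → ShOp
  | .β => .β
  | .a => .a
  | .d => .d

def swapped : LPOp → ShOp
  | .β => .β
  | .a => .b
  | .d => .e

def swapSign : LPOp → ℤ
  | .β => -1
  | .a => 1
  | .d => 1

/-- The shuffle tree which, up to the sign `planarSign`, is equal to `t`: at every vertex the two
inputs are interchanged if necessary. -/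
def planar : PTree LPOp ℕ → PTree ShOp ℕ
  | .leaf i => .leaf i
  | .node g l r =>
    if l.minLabel < r.minLabel then .node (straight g) (planar l) (planar r)
    else .node (swapped g) (planar r) (planar l)

def planarSign : PTree LPOp ℕ → ℤ
  | .leaf _ => 1
  | .node g l r =>
    (if l.minLabel < r.minLabel then 1 else swapSign g) * planarSign l * planarSign r

/-- The forgetful functor on elements of the free operad. -/
def planarize : (PTree LPOp ℕ →₀ k) →ₗ[k] (PTree ShOp ℕ →₀ k) :=
  Finsupp.linearCombination k fun t => Finsupp.single (planar t) (planarSign t : k)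

/-- The defining relations of `LP` as a shuffle operad: the `Σ₃`-orbits of the quadratic
relations. -/
def lpShuffleRels : Set (PTree ShOp ℕ →₀ k) :=
  {g | ∃ r ∈ lpQuadraticRels k, ∃ σ : Equiv.Perm ℕ, (∀ i, 3 ≤ i → σ i = i) ∧
    g = planarize k (r.mapDomain (PTree.map σ))}

/-! ### The quantum monomial ordering

A word in the generators is brought to the form `x y q^j` with `x` a word in the letters `a`, `b`
and `y` a word in the letters `β`, `d`, `e`, by the rules `y_i x_j = x_j y_i q`. -/

def isX : ShOp → Bool
  | .a => true
  | .b => true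
  | _ => false

def xWord (w : List ShOp) : List ShOp := w.filter isX

def yWord (w : List ShOp) : List ShOp := w.filter fun g => !isX g

def qDegree : List ShOp → ℕ
  | [] => 0
  | g :: w => (if isX g then 0 else (xWord w).length) + qDegree w

def QMEq (w w' : List ShOp) : Prop :=
  xWord w = xWord w' ∧ yWord w = yWord w' ∧ qDegree w = qDegree w'

/-- Words are compared by: the degree in `x` (a greater degree is smaller), the `x`-word
(lexicographically), the degree in `y`, the `y`-word (lexicographically), the degree in `q`. The
letters are compared by `ρ`. -/
def QMLt (ρ : ShOp → ℕ) (w w' : List ShOp) : Prop :=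
  (xWord w').length < (xWord w).length ∨ (xWord w).length = (xWord w').length ∧
    ((xWord w).map ρ < (xWord w').map ρ ∨ xWord w = xWord w' ∧
      ((yWord w).length < (yWord w').length ∨ (yWord w).length = (yWord w').length ∧
        ((yWord w).map ρ < (yWord w').map ρ ∨ yWord w = yWord w' ∧
          qDegree w < qDegree w')))

/-- The partial QM-ordering of shuffle tree monomials: arities are compared first, and then the
vectors of path words, lexicographically. -/
def QMTreeLt (ρ : ShOp → ℕ) (t t' : PTree ShOp ℕ) : Prop :=
  t.labels.length < t'.labels.length ∨ t.labels.length = t'.labels.length ∧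
    ∃ i < t.labels.length, (∀ j < i, QMEq (t.path j) (t'.path j)) ∧ QMLt ρ (t.path i) (t'.path i)

/-- `le` extends the partial QM-ordering. -/
def ExtendsQM (ρ : ShOp → ℕ) (le : PTree ShOp ℕ → PTree ShOp ℕ → Prop) : Prop :=
  ∀ m n, ∀ t ∈ allShMonomials shSig m, ∀ t' ∈ allShMonomials shSig n,
    QMTreeLt ρ t t' → le t t' ∧ ¬ le t' t

end ColouredOperad

namespace ColouredOperad

universe u

open Finset (coe_range mem_erase mem_filter mem_union smul_sum sum_congr sum_eq_single)
open Finsupp (induction_linear lhom_ext' linearCombination linearCombination_apply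
  linearCombination_single lmapDomain lmapDomain_apply mapDomain_add mapDomain_apply
  mapDomain_comp mapDomain_single mapDomain_zero mem_support_iff mem_supported single
  single_eq_of_ne single_mem_supported smul_single support_single_subset support_sub supported)
open Function (Injective)
open LinearIndependent (of_comp)
open LinearMap (comp_apply ext_ring flip_apply id_apply ker_eq_bot')
open List (cons_append finRange length_append length_range map_append mem_append mem_append_left
  mem_append_right mem_cons_of_mem mem_cons_self mem_flatMap mem_map mem_range mem_singleton
  nodup_range perm_append_comm reverseRecOn)
open Set (disjoint_left mem_singleton_iff union_comm)
open Submodule (liftQ mapQ mem_sup mem_top smul_mem span span_le span_mono subset_span)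

variable {k : Type u} [Field k] {I Op : Type}

/-! ## Trees -/

namespace PTree

variable {Op X Y Z : Type}

def IsNode : PTree Op X → Prop
  | leaf _ => False
  | node _ _ _ => True

theorem labels_ne_nil (t : PTree Op X) : t.labels ≠ [] := by
  induction t with
  | leaf x => simp [labels]
  | node g l r hl hr => simp [labels, hl]

theorem mem_leafSet {t : PTree Op X} {x : X} : x ∈ t.leafSet ↔ x ∈ t.labels := Iff.rfl

theorem leafSet_leaf (x : X) : (leaf x : PTree Op X).leafSet = {x} := by
  ext y; simp [leafSet, labels]

theorem leafSet_node (g : Op) (l r : PTree Op X) :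
    (node g l r).leafSet = l.leafSet ∪ r.leafSet := by
  ext x; simp [leafSet, labels]

theorem leafSet_nonempty (t : PTree Op X) : t.leafSet.Nonempty :=
  List.exists_mem_of_ne_nil _ t.labels_ne_nil

theorem leafSet_eq_of_perm {Op' : Type} {t : PTree Op X} {t' : PTree Op' X} (h : t.labels.Perm t'.labels) :
    t.leafSet = t'.leafSet := by
  ext x; exact h.mem_iff

theorem labels_bind (t : PTree Op X) (s : X → PTree Op Y) :
    (t.bind s).labels = t.labels.flatMap fun x => (s x).labels := by
  induction t with
  | leaf x => simp [bind, labels]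
  | node g l r hl hr => simp [bind, labels, hl, hr]

theorem leafSet_bind (t : PTree Op X) (s : X → PTree Op Y) :
    (t.bind s).leafSet = ⋃ i ∈ t.leafSet, (s i).leafSet := by
  ext x
  simp [leafSet, labels_bind]

theorem bind_congr {t : PTree Op X} {s s' : X → PTree Op Y}
    (h : ∀ x ∈ t.labels, s x = s' x) : t.bind s = t.bind s' := by
  induction t with
  | leaf x => exact h x (by simp [labels])
  | node g l r hl hr =>
    simp only [bind]
    rw [hl fun x hx => h x (by simp [labels, hx]), hr fun x hx => h x (by simp [labels, hx])]

theorem map_eq_bind (f : X → Y) (t : PTree Op X) : t.map f = t.bind fun x => leaf (f x) := by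
  induction t with
  | leaf x => rfl
  | node g l r hl hr => simp [map, bind, hl, hr]

theorem bind_map (f : X → Y) (s : Y → PTree Op Z) (t : PTree Op X) :
    (t.map f).bind s = t.bind (s ∘ f) := by
  induction t with
  | leaf x => rfl
  | node g l r hl hr => simp [map, bind, hl, hr]

theorem subset_of_mem_clusters {t : PTree Op X} {C : Set X} (h : C ∈ t.clusters) :
    C ⊆ t.leafSet := by
  induction t with
  | leaf x => exact h.elim
  | node g l r hl hr =>
    rw [leafSet_node]
    rcases h with h | h | h
    · rw [mem_singleton_iff.1 h, leafSet_node]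
    · exact (hl h).trans Set.subset_union_left
    · exact (hr h).trans Set.subset_union_right

theorem nonempty_of_mem_clusters {t : PTree Op X} {C : Set X} (h : C ∈ t.clusters) :
    C.Nonempty := by
  induction t with
  | leaf x => exact h.elim
  | node g l r hl hr =>
    rcases h with h | h | h
    · rw [mem_singleton_iff.1 h]; exact leafSet_nonempty _
    · exact hl h
    · exact hr h

theorem IsNode.leafSet_mem_clusters {t : PTree Op X} (h : t.IsNode) : t.leafSet ∈ t.clusters := by
  cases t with
  | leaf x => exact h.elim
  | node g l r => exact .inl rfl

theorem mem_clusters_bind {t : PTree Op X} {s : X → PTree Op Y} {C : Set Y} :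
    C ∈ (t.bind s).clusters ↔
      (∃ D ∈ t.clusters, C = ⋃ i ∈ D, (s i).leafSet) ∨ ∃ i ∈ t.labels, C ∈ (s i).clusters := by
  induction t with
  | leaf x => simp [bind, clusters, labels]
  | node g l r hl hr =>
    have e : (node g (l.bind s) (r.bind s)).leafSet =
        ⋃ i ∈ (node g l r).leafSet, (s i).leafSet := leafSet_bind (node g l r) s
    simp only [bind, clusters, Set.mem_union, hl, hr, mem_singleton_iff, e, labels, mem_append]
    constructor
    · rintro (h | (⟨D, hD, h⟩ | ⟨i, hi, h⟩) | (⟨D, hD, h⟩ | ⟨i, hi, h⟩))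
      · exact .inl ⟨_, .inl rfl, h⟩
      · exact .inl ⟨_, .inr (.inl hD), h⟩
      · exact .inr ⟨_, .inl hi, h⟩
      · exact .inl ⟨_, .inr (.inr hD), h⟩
      · exact .inr ⟨_, .inr hi, h⟩
    · rintro (⟨D, rfl | hD | hD, h⟩ | ⟨i, hi | hi, h⟩)
      · exact .inl h
      · exact .inr (.inl (.inl ⟨_, hD, h⟩))
      · exact .inr (.inr (.inl ⟨_, hD, h⟩))
      · exact .inr (.inl (.inr ⟨_, hi, h⟩))
      · exact .inr (.inr (.inr ⟨_, hi, h⟩))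

theorem nodup_node {g : Op} {l r : PTree Op X} (h : (node g l r).labels.Nodup) :
    l.labels.Nodup ∧ r.labels.Nodup ∧ Disjoint l.leafSet r.leafSet := by
  rw [labels, List.nodup_append] at h
  exact ⟨h.1, h.2.1, disjoint_left.2 fun x hx hx' => h.2.2 x hx x hx' rfl⟩

theorem leafSet_notMem_innerEdges {t : PTree Op X} (h : t.labels.Nodup) :
    t.leafSet ∉ t.innerEdges := by
  cases t with
  | leaf x => exact id
  | node g l r =>
    obtain ⟨_, _, hd⟩ := nodup_node h
    obtain ⟨x, hx⟩ := l.leafSet_nonempty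
    obtain ⟨y, hy⟩ := r.leafSet_nonempty
    rw [leafSet_node]
    rintro (h | h)
    · exact disjoint_left.1 hd (subset_of_mem_clusters h (.inr hy)) hy
    · exact disjoint_left.1 hd hx (subset_of_mem_clusters h (.inl hx))

theorem mem_innerEdges_iff {t : PTree Op X} (h : t.labels.Nodup) {C : Set X} :
    C ∈ t.innerEdges ↔ C ∈ t.clusters ∧ C ≠ t.leafSet := by
  constructor
  · intro hC
    refine ⟨?_, fun e => leafSet_notMem_innerEdges h (e ▸ hC)⟩
    cases t with
    | leaf x => exact hC
    | node g l r => exact .inr hC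
  · rintro ⟨hC, hne⟩
    cases t with
    | leaf x => exact hC
    | node g l r => exact hC.resolve_left hne

theorem length_labels (t : PTree Op X) : t.labels.length = t.vertices + 1 := by
  induction t with
  | leaf x => rfl
  | node g l r hl hr => simp [labels, vertices, hl, hr]; omega

theorem finite_clusters (t : PTree Op X) : t.clusters.Finite := by
  induction t with
  | leaf x => exact Set.finite_empty
  | node g l r hl hr => exact (Set.finite_singleton _).union (hl.union hr)

theorem ncard_clusters {t : PTree Op X} (h : t.labels.Nodup) : t.clusters.ncard = t.vertices := by
  induction t with
  | leaf x => simp [clusters, vertices]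
  | node g l r hl hr =>
    have hh : (node g l r).leafSet ∉ l.clusters ∪ r.clusters := leafSet_notMem_innerEdges h
    obtain ⟨h1, h2, hd⟩ := nodup_node h
    simp only [clusters, vertices, Set.singleton_union]
    rw [Set.ncard_insert_of_notMem hh (l.finite_clusters.union r.finite_clusters),
      Set.ncard_union_eq _ l.finite_clusters r.finite_clusters, hl h1, hr h2]
    rw [disjoint_left]
    intro C hC hC'
    obtain ⟨x, hx⟩ := nonempty_of_mem_clusters hC
    exact disjoint_left.1 hd (subset_of_mem_clusters hC hx) (subset_of_mem_clusters hC' hx)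

theorem ncard_innerEdges {t : PTree Op X} (h : t.labels.Nodup) :
    t.innerEdges.ncard + 2 = max t.labels.length 2 := by
  cases t with
  | leaf x => simp [innerEdges, labels]
  | node g l r =>
    have hh : (node g l r).leafSet ∉ l.clusters ∪ r.clusters := leafSet_notMem_innerEdges h
    have := ncard_clusters h
    simp only [clusters, Set.singleton_union] at this
    rw [Set.ncard_insert_of_notMem hh (l.finite_clusters.union r.finite_clusters)] at this
    rw [length_labels, ← this]
    simp only [innerEdges]
    omega

theorem finite_setOf_vertices_le [Finite Op] (S : Set X) (hS : S.Finite) (n : ℕ) :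
    {t : PTree Op X | t.vertices ≤ n ∧ t.leafSet ⊆ S}.Finite := by
  induction n with
  | zero =>
    refine (hS.image leaf).subset ?_
    rintro t ⟨ht, h⟩
    cases t with
    | leaf x => exact ⟨x, h (by simp [leafSet_leaf]), rfl⟩
    | node g l r => simp [vertices] at ht
  | succ n ih =>
    refine ((hS.image leaf).union ((Set.finite_univ (α := Op)).prod (ih.prod ih) |>.image
      fun p => node p.1 p.2.1 p.2.2)).subset ?_
    rintro t ⟨ht, h⟩
    cases t with
    | leaf x => exact .inl ⟨x, h (by simp [leafSet_leaf]), rfl⟩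
    | node g l r =>
      rw [leafSet_node, Set.union_subset_iff] at h
      simp only [vertices] at ht
      have hl : l.vertices ≤ n := by omega
      have hr : r.vertices ≤ n := by omega
      exact .inr ⟨(g, l, r), ⟨trivial, ⟨hl, h.1⟩, hr, h.2⟩, rfl⟩

theorem finite_setOf_perm [Finite Op] (L : List X) : {t : PTree Op X | t.labels.Perm L}.Finite := by
  refine (finite_setOf_vertices_le {x | x ∈ L} L.finite_toSet L.length).subset fun t ht => ?_
  have h1 := t.length_labels
  have h2 := ht.length_eq
  exact ⟨by omega, fun x hx => ht.mem_iff.1 hx⟩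

section Min

variable [LinearOrder X]

def minL : PTree Op X → X
  | leaf x => x
  | node _ l r => min l.minL r.minL

theorem minL_mem (t : PTree Op X) : t.minL ∈ t.labels := by
  induction t with
  | leaf x => simp [minL, labels]
  | node g l r hl hr =>
    rcases min_choice l.minL r.minL with h | h <;> simp [minL, labels, h, hl, hr]

theorem minL_le {t : PTree Op X} {x : X} (h : x ∈ t.labels) : t.minL ≤ x := by
  induction t with
  | leaf y => simp_all [minL, labels]
  | node g l r hl hr =>
    rcases mem_append.1 h with h | h
    · exact (min_le_left _ _).trans (hl h)
    · exact (min_le_right _ _).trans (hr h)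

theorem minL_eq_of_leafSet_eq {Op' : Type} {t : PTree Op X} {t' : PTree Op' X} (h : t.leafSet = t'.leafSet) :
    t.minL = t'.minL :=
  le_antisymm (minL_le ((Set.ext_iff.1 h _).2 t'.minL_mem))
    (minL_le ((Set.ext_iff.1 h _).1 t.minL_mem))

theorem minL_ne_of_disjoint {t t' : PTree Op X} (h : Disjoint t.leafSet t'.leafSet) :
    t.minL ≠ t'.minL := fun e =>
  disjoint_left.1 h t.minL_mem (e ▸ t'.minL_mem)

end Min

theorem minLabel_eq_minL (t : PTree Op ℕ) : t.minLabel = t.minL := by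
  induction t with
  | leaf x => rfl
  | node g l r hl hr => simp [minL, minLabel, hl, hr]

end PTree

open PTree (finite_setOf_perm labels_bind leafSet_eq_of_perm leafSet_node mem_innerEdges_iff nodup_node
  nonempty_of_mem_clusters subset_of_mem_clusters)

/-! ## Spans of relation instances -/

section RelSpan

variable {X Y : Type}

def relSpan (R : Set (PTree Op ℕ →₀ k)) (N : Set (Set X)) : Submodule k (PTree Op X →₀ k) :=
  span k {f | RelInstance R N f}

variable {R : Set (PTree Op ℕ →₀ k)} {N : Set (Set X)}

theorem RelInstance.mem_relSpan {f : PTree Op X →₀ k} (h : RelInstance R N f) :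
    f ∈ relSpan R N := subset_span h

theorem RelInstance.mono {N' : Set (Set X)} (hN : N' ⊆ N) {f : PTree Op X →₀ k}
    (h : RelInstance R N f) : RelInstance R N' f := by
  induction h with
  | subst r hr s hs => exact .subst r hr s fun t ht C hC h => hs t ht C hC (hN h)
  | left g f t _ ih => exact .left g f t ih
  | right g t f _ ih => exact .right g t f ih

theorem mapDomain_left_mem_relSpan (g : Op) (t : PTree Op X) {f : PTree Op X →₀ k}
    (hf : f ∈ relSpan R N) : f.mapDomain (fun s => .node g s t) ∈ relSpan R N := by
  have : relSpan R N ≤ (relSpan R N).comap (lmapDomain k k fun s => .node g s t) :=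
    span_le.2 fun f hf => RelInstance.mem_relSpan (.left g f t hf)
  exact this hf

theorem mapDomain_right_mem_relSpan (g : Op) (t : PTree Op X) {f : PTree Op X →₀ k}
    (hf : f ∈ relSpan R N) : f.mapDomain (fun s => .node g t s) ∈ relSpan R N := by
  have : relSpan R N ≤ (relSpan R N).comap (lmapDomain k k fun s => .node g t s) :=
    span_le.2 fun f hf => RelInstance.mem_relSpan (.right g t f hf)
  exact this hf

/-- The relations are multilinear combinations of nontrivial trees, homogeneous in the colours. -/
structure Homogeneous (Γ : Signature I Op) (R : Set (PTree Op ℕ →₀ k)) : Prop where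
  labels : ∀ r ∈ R, ∃ m, ∀ t ∈ r.support, t.labels.Perm (List.range m)
  isNode : ∀ r ∈ R, ∀ t ∈ r.support, t.IsNode
  colour : ∀ r ∈ R, ∀ t ∈ r.support, ∀ t' ∈ r.support, ∀ χ c, Γ.HasColour χ c t → Γ.HasColour χ c t'

namespace Signature

def rootColour (Γ : Signature I Op) (χ : X → I) : PTree Op X → I
  | .leaf x => χ x
  | .node g _ _ => Γ.tgt g

theorem HasColour.rootColour {Γ : Signature I Op} {χ : X → I} {c : I} {t : PTree Op X}
    (h : Γ.HasColour χ c t) : Γ.rootColour χ t = c := by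
  cases t with
  | leaf x => exact h
  | node g l r => exact h.1

theorem hasColour_bind {Γ : Signature I Op} {χ : Y → I} {c : I} {t : PTree Op X}
    {s : X → PTree Op Y} :
    Γ.HasColour χ c (t.bind s) ↔ Γ.HasColour (fun i => Γ.rootColour χ (s i)) c t ∧
      ∀ i ∈ t.labels, Γ.HasColour χ (Γ.rootColour χ (s i)) (s i) := by
  induction t generalizing c with
  | leaf x =>
    simp only [PTree.bind, HasColour, PTree.labels, mem_singleton, forall_eq]
    exact ⟨fun h => ⟨h.rootColour, h.rootColour.symm ▸ h⟩, fun h => h.1 ▸ h.2⟩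
  | node g l r hl hr =>
    simp only [PTree.bind, HasColour, hl, hr, PTree.labels, mem_append]
    constructor
    · rintro ⟨h, ⟨h1, h2⟩, h3, h4⟩
      exact ⟨⟨h, h1, h3⟩, fun i hi => hi.elim (h2 i) (h4 i)⟩
    · rintro ⟨⟨h, h1, h3⟩, h2⟩
      exact ⟨h, ⟨h1, fun i hi => h2 i (.inl hi)⟩, h3, fun i hi => h2 i (.inr hi)⟩

end Signature

theorem exists_of_mem_mapDomain {α β : Type*} {f : α → β} {v : α →₀ k} {b : β}
    (h : b ∈ (v.mapDomain f).support) : ∃ a ∈ v.support, f a = b := by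
  classical
  obtain ⟨a, ha, h⟩ := Finset.mem_image.1 (Finsupp.mapDomain_support h)
  exact ⟨a, ha, h⟩

theorem RelInstance.similar {Γ : Signature I Op} (hom : Homogeneous Γ R) {f : PTree Op X →₀ k}
    (h : RelInstance R N f) {t t' : PTree Op X} (ht : t ∈ f.support) (ht' : t' ∈ f.support) :
    t.labels.Perm t'.labels ∧ (t.IsNode ∧ t'.IsNode) ∧
      (∀ χ c, Γ.HasColour χ c t → Γ.HasColour χ c t') ∧
      ∀ C ∈ N, C ∈ t.clusters → C ∈ t'.clusters := by
  induction h generalizing t t' with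
  | subst r hr s hN =>
    obtain ⟨p, hp, rfl⟩ := exists_of_mem_mapDomain ht
    obtain ⟨p', hp', rfl⟩ := exists_of_mem_mapDomain ht'
    obtain ⟨m, hm⟩ := hom.labels r hr
    have hperm : p.labels.Perm p'.labels := (hm p hp).trans (hm p' hp').symm
    have node : ∀ q ∈ r.support, (q.bind s).IsNode := fun q hq => by
      have := hom.isNode r hr q hq
      cases q
      · exact this.elim
      · trivial
    refine ⟨?_, ⟨node p hp, node p' hp'⟩, fun χ c h => ?_, fun C hC h => ?_⟩
    · rw [labels_bind, labels_bind]
      exact hperm.flatMap_right _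
    · rw [Signature.hasColour_bind] at h ⊢
      exact ⟨hom.colour r hr p hp p' hp' _ _ h.1, fun i hi => h.2 i (hperm.mem_iff.2 hi)⟩
    · rw [PTree.mem_clusters_bind] at h ⊢
      rcases h with ⟨D, hD, rfl⟩ | ⟨i, hi, h⟩
      · have hn := hom.isNode r hr p hp
        have hn' := hom.isNode r hr p' hp'
        have : D = p.leafSet := by
          by_contra hne
          refine hN p hp D ?_ hC
          cases p
          · exact hD
          · exact hD.resolve_left hne
        subst this
        exact .inl ⟨p'.leafSet, hn'.leafSet_mem_clusters, by rw [leafSet_eq_of_perm hperm]⟩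
      · exact .inr ⟨i, hperm.mem_iff.1 hi, h⟩
  | left g f u _ ih =>
    obtain ⟨p, hp, rfl⟩ := exists_of_mem_mapDomain ht
    obtain ⟨p', hp', rfl⟩ := exists_of_mem_mapDomain ht'
    obtain ⟨h1, h2, h3, h4⟩ := ih hp hp'
    refine ⟨h1.append_right _, ⟨trivial, trivial⟩, fun χ c h => ⟨h.1, h3 _ _ h.2.1, h.2.2⟩,
      fun C hC => .imp (fun h => ?_) (.imp_left (h4 C hC))⟩
    rwa [leafSet_node, ← leafSet_eq_of_perm h1, ← leafSet_node g]
  | right g u f _ ih =>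
    obtain ⟨p, hp, rfl⟩ := exists_of_mem_mapDomain ht
    obtain ⟨p', hp', rfl⟩ := exists_of_mem_mapDomain ht'
    obtain ⟨h1, h2, h3, h4⟩ := ih hp hp'
    refine ⟨h1.append_left _, ⟨trivial, trivial⟩, fun χ c h => ⟨h.1, h.2.1, h3 _ _ h.2.2⟩,
      fun C hC => .imp (fun h => ?_) (.imp_right (h4 C hC))⟩
    rwa [leafSet_node, ← leafSet_eq_of_perm h1, ← leafSet_node g]

theorem filter_eq_self_or_zero {α : Type*} {f : α →₀ k} {p : α → Prop} [DecidablePred p]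
    (h : ∀ a ∈ f.support, ∀ b ∈ f.support, p a → p b) : f.filter p = f ∨ f.filter p = 0 := by
  by_cases hp : ∃ a ∈ f.support, p a
  · obtain ⟨a, ha, hpa⟩ := hp
    exact .inl (Finsupp.filter_eq_self_iff _ _ |>.2 fun b hb => h a ha b (mem_support_iff.2 hb) hpa)
  · push Not at hp
    exact .inr (Finsupp.filter_eq_zero_iff _ _ |>.2 fun b hb => by
      by_contra h0
      exact hp b (mem_support_iff.2 h0) hb)

theorem filter_mem_of_mem_span {α : Type*} {S : Set (α →₀ k)} {p : α → Prop} [DecidablePred p]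
    (hS : ∀ f ∈ S, ∀ a ∈ f.support, ∀ b ∈ f.support, p a → p b) {f : α →₀ k}
    (hf : f ∈ span k S) :
    f.filter p ∈ span k {f | f ∈ S ∧ ∀ a ∈ f.support, p a} := by
  induction hf using Submodule.span_induction with
  | mem f hf =>
    rcases filter_eq_self_or_zero (hS f hf) with h | h
    · rw [h]
      refine subset_span ⟨hf, fun a ha => ?_⟩
      exact (Finsupp.filter_eq_self_iff _ _).1 h a (mem_support_iff.1 ha)
    · rw [h]; exact zero_mem _
  | zero => rw [Finsupp.filter_zero]; exact zero_mem _
  | add f g _ _ hf hg => rw [Finsupp.filter_add]; exact add_mem hf hg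
  | smul a f _ hf => rw [Finsupp.filter_smul]; exact smul_mem _ _ hf

theorem mem_span_of_support {α : Type*} {S : Set (α →₀ k)} {p : α → Prop}
    (hS : ∀ f ∈ S, ∀ a ∈ f.support, ∀ b ∈ f.support, p a → p b) {f : α →₀ k}
    (hf : f ∈ span k S) (hp : ∀ a ∈ f.support, p a) :
    f ∈ span k {f | f ∈ S ∧ ∀ a ∈ f.support, p a} := by
  classical
  rw [← (Finsupp.filter_eq_self_iff p f).2 fun a ha => hp a (mem_support_iff.2 ha)]
  exact filter_mem_of_mem_span hS hf

theorem Presentation.mem_ideal_iff {P : Presentation k I} (hom : Homogeneous P.sig P.rels)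
    {χ : X → I} {c : I} {f : PTree P.Op X →₀ k} (hf : ↑f.support ⊆ P.sig.monomials χ c) :
    f ∈ P.ideal χ c ↔ f ∈ relSpan P.rels (∅ : Set (Set X)) := by
  refine ⟨fun h => span_mono (fun _ h => h.1) h, fun h => ?_⟩
  refine mem_span_of_support (S := {f | RelInstance P.rels ∅ f}) (fun f hf a ha b hb h => ?_) h hf
  obtain ⟨h1, _, h3, _⟩ := RelInstance.similar hom hf ha hb
  exact ⟨h1.nodup_iff.1 h.1, fun x => h1.mem_iff.1 (h.2.1 x), h3 _ _ h.2.2⟩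

theorem Presentation.support_toTrees {P : Presentation k I} {χ : X → I} {c : I}
    (f : P.Free χ c) : ↑(P.toTrees χ c f).support ⊆ P.sig.monomials χ c := by
  intro t ht
  obtain ⟨s, _, rfl⟩ := exists_of_mem_mapDomain ht
  exact s.2

end RelSpan

/-! ## Evaluation of trees in algebras -/

section Eval

variable {X Y : Type} {V W : Type*} [AddCommGroup V] [Module k V]
  [AddCommGroup W] [Module k W]

def evalTree (op : Op → V →ₗ[k] V →ₗ[k] V) (v : X → V) : PTree Op X → V
  | .leaf x => v x
  | .node g l r => op g (evalTree op v l) (evalTree op v r)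

def evalLin (op : Op → V →ₗ[k] V →ₗ[k] V) (v : X → V) : (PTree Op X →₀ k) →ₗ[k] V :=
  linearCombination k (evalTree op v)

variable (op : Op → V →ₗ[k] V →ₗ[k] V)

theorem evalLin_single (v : X → V) (t : PTree Op X) (a : k) :
    evalLin op v (single t a) = a • evalTree op v t :=
  linearCombination_single _ _ _

theorem evalTree_bind (v : Y → V) (t : PTree Op X) (s : X → PTree Op Y) :
    evalTree op v (t.bind s) = evalTree op (fun x => evalTree op v (s x)) t := by
  induction t with
  | leaf x => rfl
  | node g l r hl hr => simp [PTree.bind, evalTree, hl, hr]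

theorem evalLin_mapDomain_bind (v : Y → V) (f : PTree Op X →₀ k) (s : X → PTree Op Y) :
    evalLin op v (f.mapDomain fun t => t.bind s) = evalLin op (fun x => evalTree op v (s x)) f := by
  rw [evalLin, evalLin, Finsupp.linearCombination_mapDomain]
  congr 2
  funext t
  exact evalTree_bind op v t s

theorem evalLin_left (v : X → V) (g : Op) (f : PTree Op X →₀ k) (t : PTree Op X) :
    evalLin op v (f.mapDomain fun s => .node g s t) = op g (evalLin op v f) (evalTree op v t) := by
  induction f using induction_linear with
  | zero => simp
  | add f g hf hg => simp [mapDomain_add, hf, hg]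
  | single s a => simp [mapDomain_single, evalLin_single, evalTree]

theorem evalLin_right (v : X → V) (g : Op) (t : PTree Op X) (f : PTree Op X →₀ k) :
    evalLin op v (f.mapDomain fun s => .node g t s) = op g (evalTree op v t) (evalLin op v f) := by
  induction f using induction_linear with
  | zero => simp
  | add f g hf hg => simp [mapDomain_add, hf, hg]
  | single s a => simp [mapDomain_single, evalLin_single, evalTree]

theorem evalLin_relInstance {R : Set (PTree Op ℕ →₀ k)}
    (hR : ∀ r ∈ R, ∀ v : ℕ → V, evalLin op v r = 0) {N : Set (Set X)} {f : PTree Op X →₀ k}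
    (h : RelInstance R N f) (v : X → V) : evalLin op v f = 0 := by
  induction h with
  | subst r hr s hN => rw [evalLin_mapDomain_bind]; exact hR r hr _
  | left g f t _ ih => rw [evalLin_left, ih, map_zero, LinearMap.zero_apply]
  | right g t f _ ih => rw [evalLin_right, ih, map_zero]

theorem evalLin_relSpan {R : Set (PTree Op ℕ →₀ k)}
    (hR : ∀ r ∈ R, ∀ v : ℕ → V, evalLin op v r = 0) {N : Set (Set X)} {f : PTree Op X →₀ k}
    (h : f ∈ relSpan R N) (v : X → V) : evalLin op v f = 0 := by
  have : relSpan R N ≤ LinearMap.ker (evalLin op v) :=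
    span_le.2 fun f hf => evalLin_relInstance op hR hf v
  exact this h

end Eval

/-! ## Local rewriting rules on trees with ordered leaves -/

/-- `ori g (A < B)` says that the vertex `g(A, B)` is in normal position; `badL g h (A < B) (B < C)
(A < C)` says that the inner edge of `g(h(A, B), C)` is reducible, and similarly for `badR` and
`g(A, h(B, C))`. Subtrees are compared by their smallest leaves. -/
structure Rules (Op : Type) where
  ori : Op → Prop → Prop
  badL : Op → Op → Prop → Prop → Prop → Prop
  badR : Op → Op → Prop → Prop → Prop → Prop

namespace Rules

variable {Op X : Type} [LinearOrder X] (ru : Rules Op)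

def badLeft (g : Op) : PTree Op X → PTree Op X → Prop
  | .node h A B, C => ru.badL g h (A.minL < B.minL) (B.minL < C.minL) (A.minL < C.minL)
  | .leaf _, _ => False

def badRight (g : Op) : PTree Op X → PTree Op X → Prop
  | A, .node h B C => ru.badR g h (A.minL < B.minL) (B.minL < C.minL) (A.minL < C.minL)
  | _, .leaf _ => False

/-- Every vertex is in normal position and all the reducible edges are in `N`. -/
def Normal (N : Set (Set X)) : PTree Op X → Prop
  | .leaf _ => True
  | .node g l r => ru.ori g (l.minL < r.minL) ∧ (ru.badLeft g l r → l.leafSet ∈ N) ∧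
      (ru.badRight g l r → r.leafSet ∈ N) ∧ Normal N l ∧ Normal N r

/-- The reducible edges. -/
def badEdges : PTree Op X → Set (Set X)
  | .leaf _ => ∅
  | .node g l r => {C | C = l.leafSet ∧ ru.badLeft g l r} ∪ {C | C = r.leafSet ∧ ru.badRight g l r} ∪
      (badEdges l ∪ badEdges r)

variable {ru}

theorem Normal.mono {N N' : Set (Set X)} (h : N ⊆ N') {t : PTree Op X} (ht : ru.Normal N t) :
    ru.Normal N' t := by
  induction t with
  | leaf x => trivial
  | node g l r hl hr =>
    exact ⟨ht.1, fun hb => h (ht.2.1 hb), fun hb => h (ht.2.2.1 hb), hl ht.2.2.2.1, hr ht.2.2.2.2⟩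

theorem Normal.badEdges_subset {N : Set (Set X)} {t : PTree Op X} (ht : ru.Normal N t) :
    ru.badEdges t ⊆ N := by
  induction t with
  | leaf x => exact Set.empty_subset _
  | node g l r hl hr =>
    rintro C ((⟨rfl, h⟩ | ⟨rfl, h⟩) | h | h)
    · exact ht.2.1 h
    · exact ht.2.2.1 h
    · exact hl ht.2.2.2.1 h
    · exact hr ht.2.2.2.2 h

theorem Normal.of_badEdges_subset {N N' : Set (Set X)} {t : PTree Op X} (ht : ru.Normal N t)
    (h : ru.badEdges t ⊆ N') : ru.Normal N' t := by
  induction t with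
  | leaf x => trivial
  | node g l r hl hr =>
    exact ⟨ht.1, fun hb => h (.inl (.inl ⟨rfl, hb⟩)), fun hb => h (.inl (.inr ⟨rfl, hb⟩)),
      hl ht.2.2.2.1 fun C hC => h (.inr (.inl hC)), hr ht.2.2.2.2 fun C hC => h (.inr (.inr hC))⟩

end Rules

namespace Signature

variable {I Op X : Type}

/-- The operations of `t` are composable and its root has colour `c`. -/
def Composable (Γ : Signature I Op) : I → PTree Op X → Prop
  | _, .leaf _ => True
  | c, .node g l r => Γ.tgt g = c ∧ Γ.Composable (Γ.src₁ g) l ∧ Γ.Composable (Γ.src₂ g) r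

theorem HasColour.composable {Γ : Signature I Op} {χ : X → I} {c : I} {t : PTree Op X}
    (h : Γ.HasColour χ c t) : Γ.Composable c t := by
  induction t generalizing c with
  | leaf x => trivial
  | node g l r hl hr => exact ⟨h.1, hl h.2.1, hr h.2.2⟩

end Signature

/-! ## Truncation of trees along cut edges -/

section Truncation

variable {n : ℕ}

open Classical in
/-- Replace every cut subtree by a leaf that records its smallest label and its set of leaves. -/
def trunc (N : Set (Set (Fin n))) (code : Set (Fin n) → ℕ) :
    PTree Op (Fin n) → PTree Op (ℕ ×ₗ ℕ)
  | .leaf x => .leaf (toLex (x.val, 0))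
  | .node g l r => if (PTree.node g l r).leafSet ∈ N then
      .leaf (toLex ((PTree.node g l r).minL.val, code (PTree.node g l r).leafSet + 1))
    else .node g (trunc N code l) (trunc N code r)

/-- As `trunc`, but the root is kept. -/
def piece (N : Set (Set (Fin n))) (code : Set (Fin n) → ℕ) :
    PTree Op (Fin n) → PTree Op (ℕ ×ₗ ℕ)
  | .leaf x => .leaf (toLex (x.val, 0))
  | .node g l r => .node g (trunc N code l) (trunc N code r)

variable (N : Set (Set (Fin n))) (code : Set (Fin n) → ℕ)
  (ψ : Set (Fin n) → (PTree Op (ℕ ×ₗ ℕ) →₀ k) →ₗ[k] k)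

open Classical in
/-- The product of the values of the functionals `ψ` on the cut pieces. -/
def cutCoeff : PTree Op (Fin n) → k
  | .leaf _ => 1
  | .node g l r => cutCoeff l * cutCoeff r * if (PTree.node g l r).leafSet ∈ N then
        ψ (PTree.node g l r).leafSet (single (piece N code (.node g l r)) 1) else 1

def innerCoeff : PTree Op (Fin n) → k
  | .leaf _ => 1
  | .node _ l r => cutCoeff N code ψ l * cutCoeff N code ψ r

def pieceLin : (PTree Op (Fin n) →₀ k) →ₗ[k] (PTree Op (ℕ ×ₗ ℕ) →₀ k) :=
  linearCombination k fun t => single (piece N code t) (innerCoeff N code ψ t)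

def truncLin : (PTree Op (Fin n) →₀ k) →ₗ[k] (PTree Op (ℕ ×ₗ ℕ) →₀ k) :=
  linearCombination k fun t => single (trunc N code t) (cutCoeff N code ψ t)

variable {N}

theorem trunc_of_notMem {t : PTree Op (Fin n)} (h : t.leafSet ∉ N) :
    trunc N code t = piece N code t := by
  cases t with
  | leaf x => rfl
  | node g l r => rw [trunc, if_neg h]; rfl

theorem cutCoeff_of_notMem {t : PTree Op (Fin n)} (h : t.leafSet ∉ N) :
    cutCoeff N code ψ t = innerCoeff N code ψ t := by
  cases t with
  | leaf x => rfl
  | node g l r => rw [cutCoeff, if_neg h, mul_one]; rfl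

theorem trunc_bind {X : Type} {t : PTree Op X} {s : X → PTree Op (Fin n)}
    (h : ∀ C ∈ t.clusters, (⋃ i ∈ C, (s i).leafSet) ∉ N) :
    trunc N code (t.bind s) = t.bind (fun i => trunc N code (s i)) ∧
      cutCoeff N code ψ (t.bind s) = (t.labels.map fun i => cutCoeff N code ψ (s i)).prod := by
  induction t with
  | leaf x => simp [PTree.bind, PTree.labels]
  | node g l r hl hr =>
    have h0 : ((PTree.node g l r).bind s).leafSet ∉ N := by
      rw [PTree.leafSet_bind]; exact h _ (.inl rfl)
    obtain ⟨l1, l2⟩ := hl fun C hC => h C (.inr (.inl hC))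
    obtain ⟨r1, r2⟩ := hr fun C hC => h C (.inr (.inr hC))
    rw [trunc_of_notMem _ h0, cutCoeff_of_notMem _ _ h0]
    simp only [PTree.bind, piece, innerCoeff, l1, l2, r1, r2, PTree.labels, map_append,
      List.prod_append, and_self]

theorem piece_bind {X : Type} {t : PTree Op X} {s : X → PTree Op (Fin n)} (ht : t.IsNode)
    (h : ∀ C ∈ t.innerEdges, (⋃ i ∈ C, (s i).leafSet) ∉ N) :
    piece N code (t.bind s) = t.bind (fun i => trunc N code (s i)) ∧
      innerCoeff N code ψ (t.bind s) = (t.labels.map fun i => cutCoeff N code ψ (s i)).prod := by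
  cases t with
  | leaf x => exact ht.elim
  | node g l r =>
    obtain ⟨l1, l2⟩ := trunc_bind code ψ (t := l) (s := s) fun C hC => h C (.inl hC)
    obtain ⟨r1, r2⟩ := trunc_bind code ψ (t := r) (s := s) fun C hC => h C (.inr hC)
    simp only [PTree.bind, piece, innerCoeff, l1, l2, r1, r2, PTree.labels, map_append,
      List.prod_append, and_self]

theorem truncLin_eq {f : PTree Op (Fin n) →₀ k} {L : Set (Fin n)}
    (h : ∀ t ∈ f.support, t.IsNode ∧ t.leafSet = L) :
    truncLin N code ψ f = pieceLin N code ψ f ∨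
      ∃ y, truncLin N code ψ f = single (.leaf y) (ψ L (pieceLin N code ψ f)) := by
  rcases f.support.eq_empty_or_nonempty with h0 | ⟨t₀, ht₀⟩
  · rw [Finsupp.support_eq_empty.1 h0]; exact .inl (by simp)
  by_cases hL : L ∈ N
  · refine .inr ⟨toLex (t₀.minL.val, code L + 1), ?_⟩
    simp only [truncLin, pieceLin, linearCombination_apply, Finsupp.sum, map_sum, map_smul]
    rw [Finsupp.single_finsetSum]
    refine sum_congr rfl fun t ht => ?_
    obtain ⟨h1, h2⟩ := h t ht
    have hm : t₀.minL = t.minL := PTree.minL_eq_of_leafSet_eq ((h _ ht₀).2.trans h2.symm)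
    cases t with
    | leaf x => exact h1.elim
    | node g l r =>
      rw [trunc, cutCoeff, if_pos (h2 ▸ hL), if_pos (h2 ▸ hL), h2, hm, smul_single, innerCoeff]
      congr 2
      rw [← smul_eq_mul, ← map_smul, smul_single, smul_eq_mul, mul_one]
  · left
    simp only [truncLin, pieceLin, linearCombination_apply, Finsupp.sum]
    refine sum_congr rfl fun t ht => ?_
    rw [trunc_of_notMem _ ((h t ht).2 ▸ hL), cutCoeff_of_notMem _ _ ((h t ht).2 ▸ hL)]

theorem pieceLin_relInstance {Γ : Signature I Op} {R : Set (PTree Op ℕ →₀ k)}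
    (hom : Homogeneous Γ R)
    (hψ : ∀ C, ∀ f ∈ relSpan R (∅ : Set (Set (ℕ ×ₗ ℕ))), ψ C f = 0)
    {f : PTree Op (Fin n) →₀ k} (hf : RelInstance R N f) :
    pieceLin N code ψ f ∈ relSpan R (∅ : Set (Set (ℕ ×ₗ ℕ))) := by
  have key : ∀ f : PTree Op (Fin n) →₀ k, RelInstance R N f →
      pieceLin N code ψ f ∈ relSpan R (∅ : Set (Set (ℕ ×ₗ ℕ))) →
      truncLin N code ψ f ∈ relSpan R (∅ : Set (Set (ℕ ×ₗ ℕ))) := by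
    intro f hf ih
    rcases f.support.eq_empty_or_nonempty with h0 | ⟨t₀, ht₀⟩
    · rw [Finsupp.support_eq_empty.1 h0, map_zero]; exact zero_mem _
    · rcases truncLin_eq (N := N) code ψ (f := f) (L := t₀.leafSet) (fun t ht =>
        ⟨(RelInstance.similar hom hf ht ht).2.1.1,
          leafSet_eq_of_perm (RelInstance.similar hom hf ht ht₀).1⟩) with h | ⟨y, h⟩
      · rw [h]; exact ih
      · rw [h, hψ _ _ ih, Finsupp.single_zero]; exact zero_mem _
  have step : ∀ (f : PTree Op (Fin n) →₀ k) (φ : PTree Op (Fin n) → PTree Op (Fin n))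
      (φ' : PTree Op (ℕ ×ₗ ℕ) → PTree Op (ℕ ×ₗ ℕ)) (a : k), (∀ s, piece N code (φ s) =
        φ' (trunc N code s) ∧ innerCoeff N code ψ (φ s) = a * cutCoeff N code ψ s) →
      pieceLin N code ψ (f.mapDomain φ) = a • (truncLin N code ψ f).mapDomain φ' := by
    intro f φ φ' a h
    rw [truncLin, pieceLin, Finsupp.linearCombination_mapDomain, ← lmapDomain_apply k k,
      linearCombination_apply, linearCombination_apply, Finsupp.sum, Finsupp.sum, map_sum, smul_sum]
    refine sum_congr rfl fun s hs => ?_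
    simp only [Function.comp_apply, lmapDomain_apply, mapDomain_single, smul_single, smul_eq_mul,
      h, mul_left_comm]
  induction hf with
  | subst r hr s hN =>
    obtain ⟨m, hm⟩ := hom.labels r hr
    have : pieceLin N code ψ (r.mapDomain fun t => t.bind s) =
        ((List.range m).map fun i => cutCoeff N code ψ (s i)).prod •
          r.mapDomain fun t => t.bind fun i => trunc N code (s i) := by
      rw [pieceLin, Finsupp.linearCombination_mapDomain, linearCombination_apply,
        Finsupp.mapDomain, Finsupp.sum, Finsupp.sum, smul_sum]
      refine sum_congr rfl fun t ht => ?_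
      obtain ⟨h1, h2⟩ := piece_bind code ψ (hom.isNode r hr t ht) (hN t ht)
      rw [Function.comp_apply, h1, h2, ((hm t ht).map _).prod_eq, smul_single,
        smul_single, smul_eq_mul, smul_eq_mul, mul_comm]
    rw [this]
    exact smul_mem _ _ (RelInstance.mem_relSpan (.subst r hr _ fun _ _ _ _ => Set.notMem_empty _))
  | left g f t hf ih =>
    rw [step f _ (fun s => .node g s (trunc N code t)) (cutCoeff N code ψ t) fun s =>
      ⟨rfl, mul_comm _ _⟩]
    exact smul_mem _ _ (mapDomain_left_mem_relSpan _ _ (key f hf ih))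
  | right g t f hf ih =>
    rw [step f _ (fun s => .node g (trunc N code t) s) (cutCoeff N code ψ t) fun s => ⟨rfl, rfl⟩]
    exact smul_mem _ _ (mapDomain_right_mem_relSpan _ _ (key f hf ih))

variable (N)

theorem fst_minL_trunc (t : PTree Op (Fin n)) : (ofLex (trunc N code t).minL).1 = t.minL.val := by
  induction t with
  | leaf x => rfl
  | node g l r hl hr =>
    rw [trunc]
    split_ifs with h
    · rfl
    · have hm : Monotone fun y : ℕ ×ₗ ℕ => (ofLex y).1 := Prod.Lex.monotone_fst
      have := hm.map_min (a := (trunc N code l).minL) (b := (trunc N code r).minL)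
      simp only [PTree.minL, this, hl, hr]
      rcases le_total l.minL r.minL with h | h
      · rw [min_eq_left h, min_eq_left (Fin.val_le_of_le h)]
      · rw [min_eq_right h, min_eq_right (Fin.val_le_of_le h)]

theorem minL_trunc_lt {t t' : PTree Op (Fin n)} (h : Disjoint t.leafSet t'.leafSet) :
    (trunc N code t).minL < (trunc N code t').minL ↔ t.minL < t'.minL := by
  have hne : t.minL.val ≠ t'.minL.val := fun e => PTree.minL_ne_of_disjoint h (Fin.ext e)
  rw [Prod.Lex.lt_iff, fst_minL_trunc, fst_minL_trunc, Fin.lt_def]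
  exact ⟨fun h => h.resolve_right fun h => hne h.1, .inl⟩

theorem fst_of_mem_labels_trunc {t : PTree Op (Fin n)} {y : ℕ ×ₗ ℕ}
    (h : y ∈ (trunc N code t).labels) : ∃ x ∈ t.labels, (ofLex y).1 = x.val := by
  induction t with
  | leaf x =>
    simp only [trunc, PTree.labels, mem_singleton] at h
    exact ⟨x, by simp [PTree.labels], by rw [h]; rfl⟩
  | node g l r hl hr =>
    rw [trunc] at h
    split_ifs at h with hN
    · rw [PTree.labels, mem_singleton] at h
      exact ⟨_, (PTree.node g l r).minL_mem, by rw [h]; rfl⟩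
    · rcases mem_append.1 h with h | h
      · obtain ⟨x, hx, e⟩ := hl h
        exact ⟨x, mem_append_left _ hx, e⟩
      · obtain ⟨x, hx, e⟩ := hr h
        exact ⟨x, mem_append_right _ hx, e⟩

theorem nodup_append_trunc {l r : PTree Op (Fin n)} (hd : Disjoint l.leafSet r.leafSet)
    (hl : (trunc N code l).labels.Nodup) (hr : (trunc N code r).labels.Nodup) :
    ((trunc N code l).labels ++ (trunc N code r).labels).Nodup := by
  refine List.nodup_append.2 ⟨hl, hr, ?_⟩
  rintro a ha _ hb rfl
  obtain ⟨x, hx, e⟩ := fst_of_mem_labels_trunc N code ha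
  obtain ⟨y, hy, e'⟩ := fst_of_mem_labels_trunc N code hb
  have : x = y := Fin.ext (e.symm.trans e')
  exact disjoint_left.1 hd hx (this ▸ hy)

theorem nodup_trunc {t : PTree Op (Fin n)} (h : t.labels.Nodup) :
    (trunc N code t).labels.Nodup := by
  induction t with
  | leaf x => simp [trunc, PTree.labels]
  | node g l r hl hr =>
    obtain ⟨h1, h2, hd⟩ := nodup_node h
    rw [trunc]
    split_ifs with hN
    · simp [PTree.labels]
    · exact nodup_append_trunc N code hd (hl h1) (hr h2)

theorem nodup_piece {t : PTree Op (Fin n)} (h : t.labels.Nodup) :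
    (piece N code t).labels.Nodup := by
  cases t with
  | leaf x => simp [piece, PTree.labels]
  | node g l r =>
    obtain ⟨h1, h2, hd⟩ := nodup_node h
    exact nodup_append_trunc N code hd (nodup_trunc N code h1) (nodup_trunc N code h2)

theorem composable_trunc {Γ : Signature I Op} {c : I} {t : PTree Op (Fin n)}
    (h : Γ.Composable c t) : Γ.Composable c (trunc N code t) := by
  induction t generalizing c with
  | leaf x => trivial
  | node g l r hl hr =>
    rw [trunc]
    split_ifs with hN
    · trivial
    · exact ⟨h.1, hl h.2.1, hr h.2.2⟩

theorem composable_piece {Γ : Signature I Op} {c : I} {t : PTree Op (Fin n)}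
    (h : Γ.Composable c t) : Γ.Composable c (piece N code t) := by
  cases t with
  | leaf x => trivial
  | node g l r => exact ⟨h.1, composable_trunc N code h.2.1, composable_trunc N code h.2.2⟩

variable {ru : Rules Op}

theorem normal_node_trunc {g : Op} {l r : PTree Op (Fin n)} (hn : (PTree.node g l r).labels.Nodup)
    (h : ru.Normal N (.node g l r)) (hl : ru.Normal ∅ (trunc N code l))
    (hr : ru.Normal ∅ (trunc N code r)) :
    ru.Normal ∅ (.node g (trunc N code l) (trunc N code r)) := by
  obtain ⟨h1, h2, hd⟩ := nodup_node hn
  refine ⟨?_, ?_, ?_, hl, hr⟩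
  · rw [minL_trunc_lt N code hd]; exact h.1
  · intro hb
    cases l with
    | leaf x => exact hb.elim
    | node a A B =>
      rw [trunc] at hb
      split_ifs at hb with hN
      · exact hb.elim
      · obtain ⟨_, _, hd'⟩ := nodup_node h1
        rw [leafSet_node, Set.disjoint_union_left] at hd
        simp only [Rules.badLeft, minL_trunc_lt N code hd', minL_trunc_lt N code hd.1,
          minL_trunc_lt N code hd.2] at hb
        exact hN (h.2.1 hb)
  · intro hb
    cases r with
    | leaf x => exact hb.elim
    | node a A B =>
      rw [trunc] at hb
      split_ifs at hb with hN
      · exact hb.elim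
      · obtain ⟨_, _, hd'⟩ := nodup_node h2
        rw [leafSet_node, Set.disjoint_union_right] at hd
        simp only [Rules.badRight, minL_trunc_lt N code hd', minL_trunc_lt N code hd.1,
          minL_trunc_lt N code hd.2] at hb
        exact hN (h.2.2.1 hb)

theorem normal_trunc {t : PTree Op (Fin n)} (hn : t.labels.Nodup) (h : ru.Normal N t) :
    ru.Normal ∅ (trunc N code t) := by
  induction t with
  | leaf x => trivial
  | node g l r hl hr =>
    obtain ⟨h1, h2, hd⟩ := nodup_node hn
    have := normal_node_trunc N code hn h (hl h1 h.2.2.2.1) (hr h2 h.2.2.2.2)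
    rw [trunc]
    split_ifs with hN
    · trivial
    · exact this

theorem normal_piece {t : PTree Op (Fin n)} (hn : t.labels.Nodup) (h : ru.Normal N t) :
    ru.Normal ∅ (piece N code t) := by
  cases t with
  | leaf x => trivial
  | node g l r =>
    obtain ⟨h1, h2, hd⟩ := nodup_node hn
    exact normal_node_trunc N code hn h (normal_trunc N code h1 h.2.2.2.1)
      (normal_trunc N code h2 h.2.2.2.2)

end Truncation

namespace PTree

variable {Op X : Type}

/-- The subtrees of `t` with at least one inner vertex. -/
def subnodes : PTree Op X → Set (PTree Op X)
  | leaf _ => ∅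
  | node g l r => {node g l r} ∪ (l.subnodes ∪ r.subnodes)

theorem leafSet_subset_of_mem_subnodes {t s : PTree Op X} (h : s ∈ t.subnodes) :
    s.leafSet ⊆ t.leafSet := by
  induction t with
  | leaf x => exact h.elim
  | node g l r hl hr =>
    rcases h with h | h | h
    · rw [mem_singleton_iff.1 h]
    · rw [leafSet_node]; exact (hl h).trans Set.subset_union_left
    · rw [leafSet_node]; exact (hr h).trans Set.subset_union_right

theorem eq_of_mem_subnodes {t s s' : PTree Op X} (hn : t.labels.Nodup) (h : s ∈ t.subnodes)
    (h' : s' ∈ t.subnodes) (e : s.leafSet = s'.leafSet) : s = s' := by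
  induction t with
  | leaf x => exact h.elim
  | node g l r hl hr =>
    obtain ⟨h1, h2, hd⟩ := nodup_node hn
    have hL : ∀ u ∈ l.subnodes, u.leafSet ≠ (node g l r).leafSet := fun u hu e => by
      obtain ⟨y, hy⟩ := r.leafSet_nonempty
      rw [leafSet_node] at e
      have := leafSet_subset_of_mem_subnodes hu ((Set.ext_iff.1 e y).2 (.inr hy))
      exact disjoint_left.1 hd this hy
    have hR : ∀ u ∈ r.subnodes, u.leafSet ≠ (node g l r).leafSet := fun u hu e => by
      obtain ⟨y, hy⟩ := l.leafSet_nonempty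
      rw [leafSet_node] at e
      have := leafSet_subset_of_mem_subnodes hu ((Set.ext_iff.1 e y).2 (.inl hy))
      exact disjoint_left.1 hd hy this
    have hLR : ∀ u ∈ l.subnodes, ∀ v ∈ r.subnodes, u.leafSet ≠ v.leafSet := fun u hu v hv e => by
      obtain ⟨y, hy⟩ := u.leafSet_nonempty
      exact disjoint_left.1 hd (leafSet_subset_of_mem_subnodes hu hy)
        (leafSet_subset_of_mem_subnodes hv (e ▸ hy))
    rcases h with h | h | h <;> rcases h' with h' | h' | h'
    · exact (mem_singleton_iff.1 h).trans (mem_singleton_iff.1 h').symm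
    · rw [mem_singleton_iff.1 h] at e; exact absurd e.symm (hL _ h')
    · rw [mem_singleton_iff.1 h] at e; exact absurd e.symm (hR _ h')
    · rw [mem_singleton_iff.1 h'] at e; exact absurd e (hL _ h)
    · exact hl h1 h h'
    · exact absurd e (hLR _ h _ h')
    · rw [mem_singleton_iff.1 h'] at e; exact absurd e (hR _ h)
    · exact absurd e.symm (hLR _ h' _ h)
    · exact hr h2 h h'

end PTree

section Independence

theorem exists_dual {α : Type*} {J : Submodule k (α →₀ k)} {S : Set α}
    (h : ∀ f ∈ J, ↑f.support ⊆ S → f = 0) {a₀ : α} (h₀ : a₀ ∈ S) :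
    ∃ φ : (α →₀ k) →ₗ[k] k, (∀ f ∈ J, φ f = 0) ∧ φ (single a₀ 1) = 1 ∧
      ∀ a ∈ S, φ (single a 1) ≠ 0 → a = a₀ := by
  classical
  let F : supported k k S →ₗ[k] (α →₀ k) ⧸ J := J.mkQ ∘ₗ Submodule.subtype _
  have hF : LinearMap.ker F = ⊥ := by
    refine ker_eq_bot'.2 fun f hf => Subtype.ext ?_
    exact h f.1 ((Submodule.Quotient.mk_eq_zero J).1 hf) ((mem_supported k _).1 f.2)
  obtain ⟨G, hG⟩ := LinearMap.exists_leftInverse_of_injective (K := k)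
    (V := supported k k S) (V' := (α →₀ k) ⧸ J) F hF
  refine ⟨Finsupp.lapply a₀ ∘ₗ Submodule.subtype _ ∘ₗ G ∘ₗ J.mkQ, fun f hf => ?_, ?_, ?_⟩
  · have : J.mkQ f = 0 := (Submodule.Quotient.mk_eq_zero J).2 hf
    simp only [comp_apply, this, map_zero]
  · have := LinearMap.congr_fun hG ⟨single a₀ 1, single_mem_supported k _ h₀⟩
    simp only [comp_apply, F, id_apply, Submodule.subtype_apply] at this ⊢
    rw [this]
    simp
  · intro a ha hne
    have := LinearMap.congr_fun hG ⟨single a 1, single_mem_supported k _ ha⟩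
    simp only [comp_apply, F, id_apply, Submodule.subtype_apply] at this hne
    rw [this] at hne
    by_contra hna
    exact hne (by simp [hna])

/-- The normal trees are linearly independent modulo the relations. -/
def IndependentNormal (Γ : Signature I Op) (R : Set (PTree Op ℕ →₀ k)) (ru : Rules Op)
    (X : Type) [LinearOrder X] : Prop :=
  ∀ f ∈ relSpan R (∅ : Set (Set X)), (∀ t ∈ f.support,
    t.labels.Nodup ∧ (∃ c, Γ.Composable c t) ∧ ru.Normal ∅ t) → f = 0

theorem independent_normal_cut {Γ : Signature I Op} {R : Set (PTree Op ℕ →₀ k)} {ru : Rules Op}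
    (hom : Homogeneous Γ R) (ind : IndependentNormal Γ R ru (ℕ ×ₗ ℕ)) {n : ℕ}
    {N : Set (Set (Fin n))} {f : PTree Op (Fin n) →₀ k} (hf : f ∈ relSpan R N)
    (hs : ∀ t ∈ f.support, t.labels.Nodup ∧ (∃ c, Γ.Composable c t) ∧ ru.Normal N t) : f = 0 := by
  classical
  obtain ⟨code, hcode⟩ := exists_injective_nat (Set (Fin n))
  by_contra hne
  obtain ⟨T₀, hT₀⟩ := Finsupp.support_nonempty_iff.2 hne
  let S : Set (PTree Op (ℕ ×ₗ ℕ)) := {t | t.labels.Nodup ∧ (∃ c, Γ.Composable c t) ∧ ru.Normal ∅ t}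
  have dual : ∀ t₀ : PTree Op (ℕ ×ₗ ℕ), ∃ φ : (PTree Op (ℕ ×ₗ ℕ) →₀ k) →ₗ[k] k,
      (∀ f ∈ relSpan R ∅, φ f = 0) ∧ (t₀ ∈ S → φ (single t₀ 1) = 1 ∧
      ∀ t ∈ S, φ (single t 1) ≠ 0 → t = t₀) := by
    intro t₀
    by_cases h : t₀ ∈ S
    · obtain ⟨φ, h1, h2⟩ := exists_dual (J := relSpan R ∅) (S := S) (fun f hf h => ind f hf h) h
      exact ⟨φ, h1, fun _ => h2⟩
    · exact ⟨0, fun _ _ => rfl, fun h' => absurd h' h⟩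
  choose φ hφ1 hφ2 using dual
  let ψ : Set (Fin n) → (PTree Op (ℕ ×ₗ ℕ) →₀ k) →ₗ[k] k := fun C =>
    if h : ∃ t ∈ T₀.subnodes, t.leafSet = C then φ (piece N code h.choose) else 0
  have hψ0 : ∀ C, ∀ f ∈ relSpan R (∅ : Set (Set (ℕ ×ₗ ℕ))), ψ C f = 0 := by
    intro C f hf
    simp only [ψ]
    split_ifs
    · exact hφ1 _ _ hf
    · rfl
  have hψ : ∀ t ∈ T₀.subnodes, ψ t.leafSet = φ (piece N code t) := by
    intro t ht
    have h : ∃ s ∈ T₀.subnodes, s.leafSet = t.leafSet := ⟨t, ht, rfl⟩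
    simp only [ψ, dif_pos h]
    rw [PTree.eq_of_mem_subnodes (hs _ hT₀).1 h.choose_spec.1 ht h.choose_spec.2]
  have hS : ∀ t, t.labels.Nodup → (∃ c, Γ.Composable c t) → ru.Normal N t →
      piece N code t ∈ S := fun t h1 h2 h3 =>
    ⟨nodup_piece N code h1, h2.imp fun c h => composable_piece N code h, normal_piece N code h1 h3⟩
  have one : ∀ t, t.labels.Nodup → (∃ c, Γ.Composable c t) → ru.Normal N t →
      t.subnodes ⊆ T₀.subnodes → cutCoeff N code ψ t = 1 := by
    intro t h1 h2 h3 h4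
    induction t with
    | leaf x => rfl
    | node g l r hl hr =>
      obtain ⟨c, hc⟩ := h2
      obtain ⟨n1, n2, -⟩ := nodup_node h1
      rw [cutCoeff, hl n1 ⟨_, hc.2.1⟩ h3.2.2.2.1 fun u hu => h4 (.inr (.inl hu)),
        hr n2 ⟨_, hc.2.2⟩ h3.2.2.2.2 fun u hu => h4 (.inr (.inr hu))]
      split_ifs
      · rw [hψ _ (h4 (.inl rfl)), (hφ2 _ (hS _ h1 ⟨c, hc⟩ h3)).1, mul_one, mul_one]
      · rw [mul_one, mul_one]
  have uniq : ∀ t t₀ : PTree Op (Fin n), t.labels.Nodup → (∃ c, Γ.Composable c t) →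
      ru.Normal N t → t₀.labels.Nodup → (∃ c, Γ.Composable c t₀) → ru.Normal N t₀ →
      t₀.subnodes ⊆ T₀.subnodes → trunc N code t = trunc N code t₀ →
      cutCoeff N code ψ t ≠ 0 → t = t₀ := by
    intro t
    induction t with
    | leaf x =>
      intro t₀ _ _ _ _ _ _ _ e _
      cases t₀ with
      | leaf y =>
        simp only [trunc, PTree.leaf.injEq, EmbeddingLike.apply_eq_iff_eq, Prod.mk.injEq,
          and_true] at e
        rw [Fin.ext e]
      | node g l r =>
        simp only [trunc] at e
        split_ifs at e
        simp at e
    | node g l r hl hr =>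
      intro t₀ a1 a2 a3 b1 b2 b3 sub e hc
      have key : piece N code (.node g l r) = piece N code t₀ → .node g l r = t₀ := by
        intro e
        cases t₀ with
        | leaf y => simp [piece] at e
        | node g' l' r' =>
          simp only [piece, PTree.node.injEq] at e
          obtain ⟨rfl, e1, e2⟩ := e
          obtain ⟨n1, n2, -⟩ := nodup_node a1
          obtain ⟨n1', n2', -⟩ := nodup_node b1
          obtain ⟨c, hcc⟩ := a2
          obtain ⟨c', hcc'⟩ := b2
          rw [cutCoeff] at hc
          have hc' := left_ne_zero_of_mul hc
          rw [hl l' n1 ⟨_, hcc.2.1⟩ a3.2.2.2.1 n1' ⟨_, hcc'.2.1⟩ b3.2.2.2.1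
              (fun u hu => sub (.inr (.inl hu))) e1 (left_ne_zero_of_mul hc'),
            hr r' n2 ⟨_, hcc.2.2⟩ a3.2.2.2.2 n2' ⟨_, hcc'.2.2⟩ b3.2.2.2.2
              (fun u hu => sub (.inr (.inr hu))) e2 (right_ne_zero_of_mul hc')]
      by_cases hN : (PTree.node g l r).leafSet ∈ N
      · rw [trunc, if_pos hN] at e
        cases t₀ with
        | leaf y => simp [trunc] at e
        | node g' l' r' =>
          rw [trunc] at e
          split_ifs at e with hN'
          simp only [PTree.leaf.injEq, EmbeddingLike.apply_eq_iff_eq, Prod.mk.injEq,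
            Nat.add_right_cancel_iff] at e
          have e' := hcode e.2
          rw [cutCoeff, if_pos hN, e', hψ _ (sub (.inl rfl))] at hc
          exact key ((hφ2 _ (hS _ b1 b2 b3)).2 _ (hS _ a1 a2 a3) (right_ne_zero_of_mul hc))
      · rw [trunc_of_notMem _ hN] at e
        refine key (e.trans ?_)
        cases t₀ with
        | leaf y => rfl
        | node g' l' r' =>
          refine trunc_of_notMem _ fun hN' => ?_
          rw [trunc, if_pos hN'] at e
          simp [piece] at e
  have zero : φ (piece N code T₀) (pieceLin N code ψ f) = 0 := by
    have : relSpan R N ≤ (relSpan R ∅).comap (pieceLin N code ψ) :=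
      span_le.2 fun f hf => pieceLin_relInstance code ψ hom hψ0 hf
    exact hφ1 _ _ (this hf)
  have hval : ∀ t ∈ f.support, φ (piece N code T₀) (pieceLin N code ψ (single t 1)) =
      if t = T₀ then 1 else 0 := by
    intro t ht
    obtain ⟨a1, a2, a3⟩ := hs t ht
    obtain ⟨b1, b2, b3⟩ := hs T₀ hT₀
    have e1 : φ (piece N code T₀) (pieceLin N code ψ (single t 1)) =
        innerCoeff N code ψ t * φ (piece N code T₀) (single (piece N code t) 1) := by
      rw [pieceLin, linearCombination_single, one_smul, ← smul_eq_mul, ← map_smul,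
        smul_single, smul_eq_mul, mul_one]
    split_ifs with h
    · subst h
      rw [e1, (hφ2 _ (hS _ b1 b2 b3)).1, mul_one]
      cases t with
      | leaf x => rfl
      | node g l r =>
        obtain ⟨n1, n2, -⟩ := nodup_node a1
        obtain ⟨c, hc⟩ := a2
        rw [innerCoeff, one l n1 ⟨_, hc.2.1⟩ a3.2.2.2.1 fun u hu => .inr (.inl hu),
          one r n2 ⟨_, hc.2.2⟩ a3.2.2.2.2 fun u hu => .inr (.inr hu), mul_one]
    · by_contra h0
      rw [e1] at h0
      have hp := (hφ2 _ (hS _ b1 b2 b3)).2 _ (hS _ a1 a2 a3) (right_ne_zero_of_mul h0)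
      refine h ?_
      cases t with
      | leaf x =>
        cases T₀ with
        | leaf y =>
          simp only [piece, PTree.leaf.injEq, EmbeddingLike.apply_eq_iff_eq, Prod.mk.injEq,
            and_true] at hp
          rw [Fin.ext hp]
        | node => simp [piece] at hp
      | node g l r =>
        cases T₀ with
        | leaf y => simp [piece] at hp
        | node g' l' r' =>
          simp only [piece, PTree.node.injEq] at hp
          obtain ⟨rfl, e1, e2⟩ := hp
          obtain ⟨n1, n2, -⟩ := nodup_node a1
          obtain ⟨n1', n2', -⟩ := nodup_node b1
          obtain ⟨c, hcc⟩ := a2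
          obtain ⟨c', hcc'⟩ := b2
          have hc' := left_ne_zero_of_mul h0
          rw [innerCoeff] at hc'
          rw [uniq l l' n1 ⟨_, hcc.2.1⟩ a3.2.2.2.1 n1' ⟨_, hcc'.2.1⟩ b3.2.2.2.1
              (fun u hu => .inr (.inl hu)) e1 (left_ne_zero_of_mul hc'),
            uniq r r' n2 ⟨_, hcc.2.2⟩ a3.2.2.2.2 n2' ⟨_, hcc'.2.2⟩ b3.2.2.2.2
              (fun u hu => .inr (.inr hu)) e2 (right_ne_zero_of_mul hc')]
  have hsum : φ (piece N code T₀) (pieceLin N code ψ f) = f T₀ := by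
    conv_lhs => rw [← f.sum_single]
    rw [Finsupp.sum, map_sum, map_sum, sum_eq_single T₀]
    · rw [← mul_one (f T₀), ← smul_eq_mul, ← smul_single, map_smul, map_smul,
        hval _ hT₀, if_pos rfl]
    · intro t ht hne
      rw [← mul_one (f t), ← smul_eq_mul, ← smul_single, map_smul, map_smul,
        hval _ ht, if_neg hne, smul_zero]
    · exact fun h => absurd hT₀ h
  exact mem_support_iff.1 hT₀ (hsum.symm.trans zero)

end Independence

/-! ## Rewriting -/

section Rewriting

variable {X : Type}

/-- `T` is the greatest term of an instance of a relation. -/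
def Reducible (R : Set (PTree Op ℕ →₀ k)) (lt : PTree Op X → PTree Op X → Prop)
    (N : Set (Set X)) (T : PTree Op X) : Prop :=
  ∃ f : PTree Op X →₀ k, RelInstance R N f ∧ T ∈ f.support ∧ ∀ T' ∈ f.support, T' ≠ T → lt T' T

def ClosedCuts (N : Set (Set X)) (T : PTree Op X) : Prop :=
  ∀ C ∈ N, C ⊆ T.leafSet → C ∈ T.clusters

theorem ClosedCuts.left {N : Set (Set X)} {g : Op} {l r : PTree Op X}
    (hn : (PTree.node g l r).labels.Nodup) (h : ClosedCuts N (.node g l r)) : ClosedCuts N l := by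
  obtain ⟨_, _, hd⟩ := nodup_node hn
  intro C hC hs
  rcases h C hC (hs.trans (by rw [leafSet_node]; exact Set.subset_union_left)) with h | h | h
  · obtain ⟨y, hy⟩ := r.leafSet_nonempty
    rw [mem_singleton_iff.1 h, leafSet_node] at hs
    exact (disjoint_left.1 hd (hs (.inr hy)) hy).elim
  · exact h
  · obtain ⟨y, hy⟩ := nonempty_of_mem_clusters h
    exact (disjoint_left.1 hd (hs hy) (subset_of_mem_clusters h hy)).elim

theorem ClosedCuts.right {N : Set (Set X)} {g : Op} {l r : PTree Op X}
    (hn : (PTree.node g l r).labels.Nodup) (h : ClosedCuts N (.node g l r)) : ClosedCuts N r := by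
  obtain ⟨_, _, hd⟩ := nodup_node hn
  intro C hC hs
  rcases h C hC (hs.trans (by rw [leafSet_node]; exact Set.subset_union_right)) with h | h | h
  · obtain ⟨y, hy⟩ := l.leafSet_nonempty
    rw [mem_singleton_iff.1 h, leafSet_node] at hs
    exact (disjoint_left.1 hd hy (hs (.inl hy))).elim
  · obtain ⟨y, hy⟩ := nonempty_of_mem_clusters h
    exact (disjoint_left.1 hd (subset_of_mem_clusters h hy) (hs hy)).elim
  · exact h

theorem union_ne_of_disjoint {A B C D : Set X} (hA : A.Nonempty) (hB : B.Nonempty)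
    (hD : D ⊆ C) (hd : Disjoint A C ∨ Disjoint B C) : A ∪ B ≠ D := by
  rintro rfl
  rcases hd with hd | hd
  · exact hA.ne_empty (disjoint_self.1 (hd.mono_right (Set.subset_union_left.trans hD)))
  · exact hB.ne_empty (disjoint_self.1 (hd.mono_right (Set.subset_union_right.trans hD)))

/-- The union of two of the three subtrees of a pattern with two vertices is never cut, if the edge
of the pattern is not cut. -/
theorem ClosedCuts.notMem {N : Set (Set X)} {T A B C : PTree Op X} (hc : ClosedCuts N T)
    (hl : T.leafSet = A.leafSet ∪ B.leafSet ∪ C.leafSet)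
    (hAB : Disjoint A.leafSet B.leafSet) (hAC : Disjoint A.leafSet C.leafSet)
    (hBC : Disjoint B.leafSet C.leafSet)
    (hT : T.clusters = {T.leafSet} ∪
      ({A.leafSet ∪ B.leafSet} ∪ (A.clusters ∪ B.clusters ∪ C.clusters))) :
    A.leafSet ∪ C.leafSet ∉ N ∧ B.leafSet ∪ C.leafSet ∉ N := by
  have key : ∀ P Q E : PTree Op X, Disjoint P.leafSet Q.leafSet → Disjoint P.leafSet E.leafSet →
      Disjoint Q.leafSet E.leafSet → T.leafSet = P.leafSet ∪ Q.leafSet ∪ E.leafSet →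
      T.clusters = {T.leafSet} ∪
        ({P.leafSet ∪ Q.leafSet} ∪ (P.clusters ∪ Q.clusters ∪ E.clusters)) →
      P.leafSet ∪ E.leafSet ∉ N := by
    intro P Q E hPQ hPE hQE hl hT hmem
    have := hc _ hmem (hl ▸ Set.union_subset
      (Set.subset_union_left.trans Set.subset_union_left) Set.subset_union_right)
    rw [hT] at this
    rcases this with h | h | (h | h) | h
    · rw [mem_singleton_iff, hl] at h
      obtain ⟨y, hy⟩ := Q.leafSet_nonempty
      have : y ∈ P.leafSet ∪ E.leafSet := h ▸ (.inl (.inr hy))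
      exact this.elim (fun h => disjoint_left.1 hPQ h hy) (fun h => disjoint_left.1 hQE hy h)
    · exact union_ne_of_disjoint P.leafSet_nonempty E.leafSet_nonempty (C := P.leafSet ∪ Q.leafSet)
        subset_rfl (.inr (Set.disjoint_union_right.2 ⟨hPE.symm, hQE.symm⟩)) h
    · exact union_ne_of_disjoint P.leafSet_nonempty E.leafSet_nonempty
        (subset_of_mem_clusters h) (.inr hPE.symm) rfl
    · exact union_ne_of_disjoint P.leafSet_nonempty E.leafSet_nonempty
        (subset_of_mem_clusters h) (.inl hPQ) rfl
    · exact union_ne_of_disjoint P.leafSet_nonempty E.leafSet_nonempty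
        (subset_of_mem_clusters h) (.inl hPE) rfl
  refine ⟨key A B C hAB hAC hBC hl hT, key B A C hAB.symm hBC hAC ?_ ?_⟩
  · rw [hl, union_comm A.leafSet]
  · rw [hT, union_comm A.leafSet, union_comm A.clusters]

theorem ClosedCuts.notMem_left {N : Set (Set X)} {g h : Op} {A B C : PTree Op X}
    (hn : (PTree.node g (.node h A B) C).labels.Nodup)
    (hc : ClosedCuts N (.node g (.node h A B) C)) (hN : (PTree.node h A B).leafSet ∉ N) :
    A.leafSet ∪ B.leafSet ∉ N ∧ A.leafSet ∪ C.leafSet ∉ N ∧ B.leafSet ∪ C.leafSet ∉ N := by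
  obtain ⟨h1, h2, hd⟩ := nodup_node hn
  obtain ⟨h3, h4, hd'⟩ := nodup_node h1
  rw [leafSet_node] at hN hd
  rw [Set.disjoint_union_left] at hd
  refine ⟨hN, hc.notMem ?_ hd' hd.1 hd.2 ?_⟩
  · simp only [leafSet_node]
  · simp only [PTree.clusters, leafSet_node, Set.union_assoc]

theorem ClosedCuts.notMem_right {N : Set (Set X)} {g h : Op} {A B C : PTree Op X}
    (hn : (PTree.node g A (.node h B C)).labels.Nodup)
    (hc : ClosedCuts N (.node g A (.node h B C))) (hN : (PTree.node h B C).leafSet ∉ N) :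
    A.leafSet ∪ B.leafSet ∉ N ∧ A.leafSet ∪ C.leafSet ∉ N ∧ B.leafSet ∪ C.leafSet ∉ N := by
  obtain ⟨h1, h2, hd⟩ := nodup_node hn
  obtain ⟨h3, h4, hd'⟩ := nodup_node h2
  rw [leafSet_node] at hN hd
  rw [Set.disjoint_union_right] at hd
  have := hc.notMem (A := B) (B := C) (C := A) ?_ hd' hd.1.symm hd.2.symm ?_
  · rw [union_comm B.leafSet, union_comm C.leafSet] at this
    exact ⟨this.1, this.2, hN⟩
  · simp only [leafSet_node, union_comm]
  · simp only [PTree.clusters, leafSet_node]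
    congr 1
    rw [union_comm A.clusters, Set.union_assoc]

structure IsRewriting [LinearOrder X] (R : Set (PTree Op ℕ →₀ k)) (ru : Rules Op)
    (lt : PTree Op X → PTree Op X → Prop) : Prop where
  irrefl : ∀ t, ¬ lt t t
  trans : ∀ t t' t'', lt t t' → lt t' t'' → lt t t''
  left : ∀ g t t' u, (PTree.node g t u).labels.Nodup → t'.labels.Perm t.labels → lt t' t →
    lt (.node g t' u) (.node g t u)
  right : ∀ g t t' u, (PTree.node g u t).labels.Nodup → t'.labels.Perm t.labels → lt t' t →
    lt (.node g u t') (.node g u t)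
  reducible : ∀ N g l r, (PTree.node g l r).labels.Nodup → ClosedCuts N (.node g l r) →
    ru.Normal N l → ru.Normal N r → ¬ ru.Normal N (.node g l r) →
    Reducible R lt N (.node g l r)

theorem node_left_injective (g : Op) (u : PTree Op X) :
    Injective fun s => PTree.node g s u := fun s s' h => by simpa using h

theorem node_right_injective (g : Op) (u : PTree Op X) :
    Injective fun s => PTree.node g u s := fun s s' h => by simpa using h

variable [LinearOrder X] {R : Set (PTree Op ℕ →₀ k)} {ru : Rules Op} {lt : PTree Op X → PTree Op X → Prop}
  {Γ : Signature I Op}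

theorem IsRewriting.reducible_of_not_normal (hom : Homogeneous Γ R) (h : IsRewriting R ru lt)
    {N : Set (Set X)} {T : PTree Op X} (hn : T.labels.Nodup) (hc : ClosedCuts N T)
    (hT : ¬ ru.Normal N T) : Reducible R lt N T := by
  have key : ∀ {t} {φ : PTree Op X → PTree Op X}, Injective φ → (∀ f, RelInstance R N f →
      RelInstance R N (f.mapDomain φ)) → (∀ s, s.labels.Perm t.labels → lt s t → lt (φ s) (φ t)) →
      Reducible R lt N t → Reducible R lt N (φ t) := by
    rintro t φ hφ h1 h2 ⟨f, hf, hm, hlt⟩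
    refine ⟨_, h1 f hf, ?_, fun T' hT' hne => ?_⟩
    · rw [mem_support_iff, mapDomain_apply hφ]
      exact mem_support_iff.1 hm
    · obtain ⟨s, hs, rfl⟩ := exists_of_mem_mapDomain hT'
      exact h2 s (RelInstance.similar hom hf hs hm).1 (hlt s hs fun e => hne (e ▸ rfl))
  induction T with
  | leaf x => exact (hT trivial).elim
  | node g l r hl hr =>
    obtain ⟨h1, h2, hd⟩ := nodup_node hn
    by_cases nl : ru.Normal N l
    · by_cases nr : ru.Normal N r
      · exact h.reducible N g l r hn hc nl nr hT
      · exact key (node_right_injective g l) (fun f => .right g l f)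
          (fun s => h.right g _ s l hn) (hr h2 (hc.right hn) nr)
    · exact key (φ := fun s => .node g s r) (node_left_injective g r) (fun f => .left g f r)
        (fun s => h.left g _ s r hn) (hl h1 (hc.left hn) nl)

theorem mem_of_forall_single_mem {α : Type*} {K : Submodule k (α →₀ k)} {f : α →₀ k}
    (h : ∀ a ∈ f.support, single a 1 ∈ K) : f ∈ K := by
  rw [← f.sum_single]
  refine Submodule.sum_mem _ fun a ha => ?_
  rw [← mul_one (f a), ← smul_eq_mul, ← smul_single]
  exact K.smul_mem _ (h a ha)

theorem supported_sup_mono {α : Type*} {S S' : Set α} (h : S ⊆ S') (K : Submodule k (α →₀ k)) :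
    supported k k S ⊔ K ≤ supported k k S' ⊔ K :=
  sup_le_sup_right (Finsupp.supported_mono h) K

/-- The normal trees that `T` can be reduced to. -/
def normalForms (Γ : Signature I Op) (ru : Rules Op) (lt : PTree Op X → PTree Op X → Prop)
    (N : Set (Set X)) (T : PTree Op X) : Set (PTree Op X) :=
  {T' | T.labels.Perm T'.labels ∧ (∀ χ c, Γ.HasColour χ c T → Γ.HasColour χ c T') ∧
    (∀ C ∈ N, C ∈ T.clusters → C ∈ T'.clusters) ∧ ru.Normal N T' ∧ (T' = T ∨ lt T' T)}

theorem IsRewriting.single_mem [Finite Op] (hom : Homogeneous Γ R) (h : IsRewriting R ru lt)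
    {N : Set (Set X)} {T : PTree Op X} (hn : T.labels.Nodup) (hc : ClosedCuts N T) :
    single T 1 ∈ supported k k (normalForms Γ ru lt N T) ⊔ relSpan R N := by
  have : Std.Irrefl lt := ⟨h.irrefl⟩
  have : IsTrans _ lt := ⟨h.trans⟩
  have : IsStrictOrder _ lt := {}
  have wf : {t : PTree Op X | t.labels.Perm T.labels}.WellFoundedOn lt :=
    (finite_setOf_perm T.labels).wellFoundedOn
  have key : ∀ U ∈ {t : PTree Op X | t.labels.Perm T.labels}, ClosedCuts N U → single U 1 ∈
        supported k k (normalForms Γ ru lt N U) ⊔ relSpan R N := by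
    intro U hU
    refine wf.induction (P := fun U => ClosedCuts N U → single U 1 ∈
      supported k k (normalForms Γ ru lt N U) ⊔ relSpan R N) hU ?_
    intro U hU ih hcU
    by_cases hN : ru.Normal N U
    · exact Submodule.mem_sup_left (single_mem_supported k _
        ⟨.refl _, fun _ _ h => h, fun _ _ h => h, hN, .inl rfl⟩)
    obtain ⟨f, hf, hm, hlt⟩ := h.reducible_of_not_normal hom (hU.nodup_iff.2 hn) hcU hN
    have h0 := mem_support_iff.1 hm
    have e : single U (1 : k) = (f U)⁻¹ • f - (f U)⁻¹ • f.erase U := by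
      rw [← smul_sub, sub_eq_of_eq_add (Finsupp.single_add_erase U f).symm, smul_single,
        smul_eq_mul, inv_mul_cancel₀ h0]
    rw [e]
    refine sub_mem (Submodule.mem_sup_right (smul_mem _ _ hf.mem_relSpan))
      (smul_mem _ _ (mem_of_forall_single_mem fun V hV => ?_))
    have hV' : V ∈ f.support ∧ V ≠ U := by
      classical
      rw [Finsupp.support_erase, mem_erase] at hV
      exact ⟨hV.2, hV.1⟩
    have hVU := hlt V hV'.1 hV'.2
    obtain ⟨s1, -, s2, s3⟩ := RelInstance.similar hom hf hm hV'.1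
    refine (supported_sup_mono ?_ _)
      (ih V (s1.symm.trans hU) hVU fun C hC hCV => s3 C hC (hcU C hC ?_))
    · rintro W ⟨t1, t2, t3, t4, t5⟩
      refine ⟨s1.trans t1, fun χ c h => t2 _ _ (s2 _ _ h), fun C hC h => t3 _ hC (s3 _ hC h), t4,
        .inr ?_⟩
      rcases t5 with rfl | t5
      · exact hVU
      · exact h.trans _ _ _ t5 hVU
    · rwa [leafSet_eq_of_perm s1]
  exact key T (.refl _) hc

end Rewriting

/-! ## Koszulness of operads with quadratic normal forms -/

section Koszul

variable {n : ℕ}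

abbrev Cuts (n : ℕ) := Finset (Finset (Fin n))

abbrev Cell (Op : Type) (n : ℕ) := Cuts n × PTree Op (Fin n)

namespace Presentation

def edgeSign (k : Type u) [Field k] (C : Finset (Fin n)) (N : Cuts n) : k :=
  (-1) ^ (N.filter fun D => edgeCode D < edgeCode C).card

theorem edgeCode_injective : Injective (edgeCode (n := n)) := by
  intro C D h
  have e : ∀ C : Finset (Fin n), edgeCode C = ∑ i ∈ C.map Fin.valEmbedding, 2 ^ i := by
    intro C; simp [edgeCode]
  rw [e, e] at h
  exact Finset.map_injective _ (Finset.geomSum_injective le_rfl h)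

theorem edgeSign_sq (C : Finset (Fin n)) (N : Cuts n) : edgeSign k C N * edgeSign k C N = 1 := by
  rw [edgeSign, ← pow_add, ← two_mul, pow_mul]; simp

theorem edgeSign_erase_of_lt {C D : Finset (Fin n)} {N : Cuts n} (hD : D ∈ N)
    (h : edgeCode D < edgeCode C) : edgeSign k C (N.erase D) = - edgeSign k C N := by
  have : (N.filter fun E => edgeCode E < edgeCode C).card =
      ((N.erase D).filter fun E => edgeCode E < edgeCode C).card + 1 := by
    rw [Finset.filter_erase, Finset.card_erase_add_one (mem_filter.2 ⟨hD, h⟩)]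
  rw [edgeSign, edgeSign, this, pow_succ]; ring

theorem edgeSign_erase_of_not_lt {C D : Finset (Fin n)} {N : Cuts n}
    (h : ¬ edgeCode D < edgeCode C) : edgeSign k C (N.erase D) = edgeSign k C N := by
  rw [edgeSign, edgeSign, Finset.filter_erase, Finset.erase_eq_of_notMem]
  exact fun h' => h (mem_filter.1 h').2

theorem edgeSign_insert_self {C : Finset (Fin n)} {N : Cuts n} :
    edgeSign k C (insert C N) = edgeSign k C N := by
  rw [edgeSign, edgeSign, Finset.filter_insert, if_neg (lt_irrefl _)]

theorem edgeSign_mul {C D : Finset (Fin n)} {N : Cuts n} (hC : C ∈ N) (hD : D ∈ N) (hne : C ≠ D) :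
    edgeSign k C N * edgeSign k D (N.erase C) = -(edgeSign k D N * edgeSign k C (N.erase D)) := by
  rcases lt_trichotomy (edgeCode C) (edgeCode D) with h | h | h
  · rw [edgeSign_erase_of_lt hC h, edgeSign_erase_of_not_lt h.not_gt]; ring
  · exact absurd (edgeCode_injective h) hne
  · rw [edgeSign_erase_of_lt hD h, edgeSign_erase_of_not_lt h.not_gt]; ring

variable {I : Type} (P : Presentation k I)

/-- The part of the differential given by the edges with the property `p`. -/
def partialD (p : PTree P.Op (Fin n) → Finset (Fin n) → Prop) :
    (Cell P.Op n →₀ k) →ₗ[k] (Cell P.Op n →₀ k) :=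
  open Classical in
  linearCombination k fun x => ∑ C ∈ x.1 with p x.2 C, single (x.1.erase C, x.2) (edgeSign k C x.1)

variable {P}

theorem barD_single (N : Cuts n) (T : PTree P.Op (Fin n)) (a : k) : P.barD n (single (N, T) a) =
      a • ∑ C ∈ N, single (N.erase C, T) (edgeSign k C N) :=
  linearCombination_single _ _ _

theorem partialD_single (p : PTree P.Op (Fin n) → Finset (Fin n) → Prop)
    (N : Cuts n) (T : PTree P.Op (Fin n)) (a : k) [DecidablePred (p T)] :
    P.partialD p (single (N, T) a) =
      a • ∑ C ∈ N with p T C, single (N.erase C, T) (edgeSign k C N) := by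
  rw [partialD, linearCombination_single]
  congr!

theorem barD_eq_add (p : PTree P.Op (Fin n) → Finset (Fin n) → Prop) (f : Cell P.Op n →₀ k) :
    P.barD n f = P.partialD p f + P.partialD (fun T C => ¬ p T C) f := by
  classical
  induction f using induction_linear with
  | zero => simp
  | add f g hf hg => rw [map_add, map_add, map_add, hf, hg]; abel
  | single x a =>
    obtain ⟨N, T⟩ := x
    rw [barD_single, partialD_single, partialD_single, ← smul_add,
      Finset.sum_filter_add_sum_filter_not]

theorem barD_barD (f : Cell P.Op n →₀ k) : P.barD n (P.barD n f) = 0 := by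
  classical
  induction f using induction_linear with
  | zero => simp
  | add f g hf hg => rw [map_add, map_add, hf, hg, add_zero]
  | single x a =>
    obtain ⟨N, T⟩ := x
    rw [barD_single, map_smul, map_sum]
    refine smul_eq_zero_of_right _ ?_
    simp only [barD_single, smul_sum, smul_single, smul_eq_mul]
    rw [Finset.sum_sigma']
    refine Finset.sum_involution (fun x _ => ⟨x.2, x.1⟩) ?_ ?_ ?_ ?_
    · rintro ⟨C, D⟩ h
      rw [Finset.mem_sigma, mem_erase] at h
      dsimp only at h ⊢
      rw [Finset.erase_right_comm, edgeSign_mul h.2.2 h.1 h.2.1, ← Finsupp.single_add,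
        add_neg_cancel, Finsupp.single_zero]
    · rintro ⟨C, D⟩ h _ e
      rw [Finset.mem_sigma, mem_erase] at h
      simp only [Sigma.mk.injEq, heq_eq_eq] at e
      exact h.2.1 e.1
    · rintro ⟨C, D⟩ h
      rw [Finset.mem_sigma, mem_erase] at h ⊢
      exact ⟨h.2.2, h.2.1.symm, h.1⟩
    · rintro ⟨C, D⟩ h
      rfl

open Classical in
/-- The homotopy that cuts the edge `c T` of `T`. -/
def cutEdge (P : Presentation k I) (c : PTree P.Op (Fin n) → Finset (Fin n)) :
    (Cell P.Op n →₀ k) →ₗ[k] (Cell P.Op n →₀ k) :=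
  linearCombination k fun x => if c x.2 ∈ x.1 then 0 else
    single (insert (c x.2) x.1, x.2) (edgeSign k (c x.2) x.1)

theorem cutEdge_single {c : PTree P.Op (Fin n) → Finset (Fin n)}
    {N : Cuts n} {T : PTree P.Op (Fin n)} (h : c T ∉ N) (a : k) :
    P.cutEdge c (single (N, T) a) = single (insert (c T) N, T) (a * edgeSign k (c T) N) := by
  rw [cutEdge, linearCombination_single, if_neg h, smul_single, smul_eq_mul]

theorem cutEdge_single_of_mem {c : PTree P.Op (Fin n) → Finset (Fin n)}
    {N : Cuts n} {T : PTree P.Op (Fin n)} (h : c T ∈ N) (a : k) :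
    P.cutEdge c (single (N, T) a) = 0 := by
  rw [cutEdge, linearCombination_single, if_pos h, smul_zero]

theorem partialD_cutEdge_add {p : PTree P.Op (Fin n) → Finset (Fin n) → Prop}
    {c : PTree P.Op (Fin n) → Finset (Fin n)} {N : Cuts n}
    {T : PTree P.Op (Fin n)} (h : p T (c T)) :
    P.partialD p (P.cutEdge c (single (N, T) 1)) +
      P.cutEdge c (P.partialD p (single (N, T) 1)) = single (N, T) 1 := by
  classical
  rw [partialD_single, one_smul, map_sum]
  by_cases hm : c T ∈ N
  · rw [cutEdge_single_of_mem hm, map_zero, zero_add, sum_eq_single (c T)]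
    · rw [cutEdge_single (Finset.notMem_erase _ _), Finset.insert_erase hm,
        ← edgeSign_insert_self (N := N.erase (c T)), Finset.insert_erase hm, edgeSign_sq]
    · intro C hC hne
      exact cutEdge_single_of_mem (mem_erase.2 ⟨hne.symm, hm⟩) _
    · exact fun h' => absurd (mem_filter.2 ⟨hm, h⟩) h'
  · rw [cutEdge_single hm, one_mul, partialD_single, Finset.filter_insert, if_pos h,
      Finset.sum_insert (fun h' => hm (mem_filter.1 h').1), Finset.erase_insert hm,
      edgeSign_insert_self, smul_add, smul_single, smul_eq_mul, edgeSign_sq, add_assoc,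
      smul_sum, ← Finset.sum_add_distrib, Finset.sum_eq_zero, add_zero]
    intro C hC
    obtain ⟨hC, -⟩ := mem_filter.1 hC
    have hne : C ≠ c T := fun e => hm (e ▸ hC)
    have hm' : c T ∉ N.erase C := fun h => hm (Finset.mem_of_mem_erase h)
    rw [cutEdge_single hm', Finset.erase_insert_of_ne hne.symm, smul_single,
      ← Finsupp.single_add, smul_eq_mul]
    have e := edgeSign_mul (k := k) (Finset.mem_insert_of_mem (b := c T) hC)
      (Finset.mem_insert_self (c T) N) hne
    rw [Finset.erase_insert_of_ne hne.symm, edgeSign_insert_self, edgeSign_insert_self,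
      Finset.erase_insert hm] at e
    have s1 := edgeSign_sq (k := k) (c T) (N.erase C)
    have s2 := edgeSign_sq (k := k) (c T) N
    refine Finsupp.single_eq_zero.2 ?_
    linear_combination (edgeSign k (c T) N * edgeSign k (c T) (N.erase C)) * e -
      (edgeSign k (c T) N * edgeSign k C (insert (c T) N)) * s1 -
      (edgeSign k C N * edgeSign k (c T) (N.erase C)) * s2

def cutSet (N : Cuts n) : Set (Set (Fin n)) := {C | ∃ D ∈ N, C = (D : Set (Fin n))}

theorem coe_mem_cutSet {N : Cuts n} {C : Finset (Fin n)} : (C : Set (Fin n)) ∈ cutSet N ↔ C ∈ N :=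
  ⟨fun ⟨_, hD, e⟩ => Finset.coe_injective e ▸ hD, fun h => ⟨C, h, rfl⟩⟩

theorem cutSet_mono {N M : Cuts n} (h : N ⊆ M) : cutSet N ⊆ cutSet M :=
  fun _ ⟨D, hD, e⟩ => ⟨D, h hD, e⟩

variable {χ : Fin n → I} {c : I}

theorem closedCuts_of_mem {j : ℕ} {N : Cuts n} {T : PTree P.Op (Fin n)}
    (h : (N, T) ∈ P.barCells χ c j) : ClosedCuts (cutSet N) T := by
  rintro _ ⟨D, hD, rfl⟩ _
  exact ((mem_innerEdges_iff h.2.1.1).1 (h.2.2 D hD)).1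

theorem mem_barCells_of_similar {j : ℕ} {N : Cuts n} {T T' : PTree P.Op (Fin n)}
    (h : (N, T) ∈ P.barCells χ c j) (h1 : T.labels.Perm T'.labels)
    (h2 : ∀ χ c, P.sig.HasColour χ c T → P.sig.HasColour χ c T')
    (h3 : ∀ C ∈ cutSet N, C ∈ T.clusters → C ∈ T'.clusters) : (N, T') ∈ P.barCells χ c j := by
  have hm : T' ∈ P.sig.monomials χ c :=
    ⟨h1.nodup_iff.1 h.2.1.1, fun x => h1.mem_iff.1 (h.2.1.2.1 x), h2 _ _ h.2.1.2.2⟩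
  refine ⟨h.1, hm, fun C hC => ?_⟩
  have := (mem_innerEdges_iff h.2.1.1).1 (h.2.2 C hC)
  refine (mem_innerEdges_iff hm.1).2 ⟨h3 _ (coe_mem_cutSet.2 hC) this.1, ?_⟩
  rw [← leafSet_eq_of_perm h1]; exact this.2

theorem mapDomain_mem_barRel (hom : Homogeneous P.sig P.rels) {j : ℕ}
    {N : Cuts n} {f : PTree P.Op (Fin n) →₀ k}
    (hf : f ∈ relSpan P.rels (cutSet N)) (hs : ∀ T ∈ f.support, (N, T) ∈ P.barCells χ c j) :
    f.mapDomain (fun T => (N, T)) ∈ P.barRel χ c j := by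
  have := mem_span_of_support (S := {f | RelInstance P.rels (cutSet N) f})
    (p := fun T => (N, T) ∈ P.barCells χ c j) (fun f hf a ha b hb h => ?_) hf hs
  · have hle : span k {f | f ∈ {f | RelInstance P.rels (cutSet N) f} ∧
        ∀ T ∈ f.support, (N, T) ∈ P.barCells χ c j} ≤
        (P.barRel χ c j).comap (lmapDomain k k fun T => (N, T)) :=
      span_le.2 fun f hf => subset_span ⟨N, f, hf.1, hf.2, rfl⟩
    exact hle this
  · obtain ⟨h1, _, h3, h4⟩ := RelInstance.similar hom hf ha hb
    exact mem_barCells_of_similar h h1 h3 h4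

/-- The component of the span of the cells with a fixed set of cuts. -/
def slice (k : Type u) [Field k] {Op : Type} (N : Cuts n) :
    (Cell Op n →₀ k) →ₗ[k] (PTree Op (Fin n) →₀ k) :=
  Finsupp.lcomapDomain (fun T => (N, T)) fun _ _ h => (Prod.mk.inj h).2

theorem slice_apply {Op : Type} (N : Cuts n) (f : Cell Op n →₀ k) (T : PTree Op (Fin n)) :
    slice k N f T = f (N, T) := rfl

theorem slice_mem_relSpan {j : ℕ} (N : Cuts n) {f : Cell P.Op n →₀ k} (hf : f ∈ P.barRel χ c j) :
    slice k N f ∈ relSpan P.rels (cutSet N) := by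
  have : P.barRel χ c j ≤ (relSpan P.rels (cutSet N)).comap (slice k N) := by
    refine span_le.2 ?_
    rintro _ ⟨M, f, hf, _, rfl⟩
    by_cases h : M = N
    · subst h
      have : slice k M (f.mapDomain fun T => (M, T)) = f := by
        ext T
        exact mapDomain_apply (fun _ _ h => (Prod.mk.inj h).2) f T
      change slice k M (f.mapDomain fun T => (M, T)) ∈ relSpan P.rels (cutSet M)
      rw [this]
      exact RelInstance.mem_relSpan hf
    · have : slice k N (f.mapDomain fun T => (M, T)) = 0 := by
        ext T
        rw [slice_apply]
        refine Finsupp.mapDomain_of_notMem_range _ _ ?_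
        rintro ⟨T', e⟩
        exact h (Prod.mk.inj e).1
      change slice k N (f.mapDomain fun T => (M, T)) ∈ relSpan P.rels (cutSet N)
      rw [this]
      exact zero_mem _
  exact this hf

theorem barD_mem_barRel {j : ℕ} {f : Cell P.Op n →₀ k}
    (hf : f ∈ P.barRel χ c j) : P.barD n f ∈ P.barRel χ c (j - 1) := by
  classical
  have : P.barRel χ c j ≤ (P.barRel χ c (j - 1)).comap (P.barD n) := by
    refine span_le.2 ?_
    rintro _ ⟨N, f, hf, hs, rfl⟩
    have e : P.barD n (f.mapDomain fun T => (N, T)) =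
        ∑ C ∈ N, edgeSign k C N • f.mapDomain fun T => (N.erase C, T) := by
      clear hf hs
      induction f using induction_linear with
      | zero => simp
      | add f g hf hg =>
        simp only [mapDomain_add, map_add, hf, hg, smul_add, Finset.sum_add_distrib]
      | single T a =>
        simp only [mapDomain_single, barD_single, smul_sum, smul_single, smul_eq_mul, mul_comm]
    change P.barD n (f.mapDomain fun T => (N, T)) ∈ P.barRel χ c (j - 1)
    rw [e]
    refine Submodule.sum_mem _ fun C hC => smul_mem _ _
      (subset_span ⟨N.erase C, f, hf.mono ?_, fun T hT => ?_, rfl⟩)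
    · exact cutSet_mono (Finset.erase_subset _ _)
    · obtain ⟨h1, h2, h3⟩ := hs T hT
      refine ⟨?_, h2, fun D hD => h3 D (Finset.mem_of_mem_erase hD)⟩
      rw [Finset.card_erase_of_mem hC]
      exact congrArg (· - 1) h1
  exact this hf

theorem isKoszul_of_rules [Finite P.Op] (hom : Homogeneous P.sig P.rels) {ru : Rules P.Op}
    (ind : IndependentNormal P.sig P.rels ru (ℕ ×ₗ ℕ))
    {lt : ∀ n, PTree P.Op (Fin n) → PTree P.Op (Fin n) → Prop}
    (hrw : ∀ n, IsRewriting P.rels ru (lt n)) : P.IsKoszul := by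
  classical
  intro n χ c
  have hperm : ∀ T ∈ P.sig.monomials χ c, T.labels.Perm (finRange n) := fun T hT =>
    (List.perm_ext_iff_of_nodup hT.1 (List.nodup_finRange n)).2 fun x => by simp [hT.2.1 x]
  have hfin : {T | T ∈ P.sig.monomials χ c}.Finite := (finite_setOf_perm (finRange n)).subset hperm
  let rank : PTree P.Op (Fin n) → ℕ := fun T => {T' ∈ P.sig.monomials χ c | lt n T' T}.ncard
  have hrank : ∀ T T', T' ∈ P.sig.monomials χ c → lt n T' T → rank T' < rank T := by
    intro T T' h' hlt
    refine Set.ncard_lt_ncard ⟨fun U hU => ⟨hU.1, (hrw n).trans _ _ _ hU.2 hlt⟩, fun hss => ?_⟩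
      (hfin.subset fun U hU => hU.1)
    exact (hrw n).irrefl _ (hss ⟨h', hlt⟩).2
  let NC : ℕ → ℕ → Set (Cell P.Op n) := fun j r =>
    {x | x ∈ P.barCells χ c j ∧ ru.Normal (cutSet x.1) x.2 ∧ rank x.2 < r}
  have H1 : ∀ j N T, (N, T) ∈ P.barCells χ c j → ∀ r, rank T < r ∨ rank T = r ∧
      ¬ ru.Normal (cutSet N) T → single (N, T) 1 ∈ supported k k (NC j r) ⊔ P.barRel χ c j := by
    intro j N T hT r hr
    have hmem : ∀ T' ∈ normalForms P.sig ru (lt n) (cutSet N) T, (N, T') ∈ P.barCells χ c j :=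
      fun T' hT' => mem_barCells_of_similar hT hT'.1 hT'.2.1 hT'.2.2.1
    obtain ⟨f, hf, g, hg, e⟩ := mem_sup.1
      ((hrw n).single_mem (k := k) hom hT.2.1.1 (closedCuts_of_mem hT))
    have hfs := (mem_supported k f).1 hf
    have hg' : g.mapDomain (fun T => (N, T)) ∈ P.barRel χ c j := by
      refine mapDomain_mem_barRel hom hg fun U hU => ?_
      rw [← eq_sub_iff_add_eq'] at e
      rw [e] at hU
      rcases mem_union.1 (support_sub hU) with h | h
      · rw [Finset.mem_singleton.1 (support_single_subset h)]; exact hT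
      · exact hmem U (hfs h)
    have e' : single (N, T) (1 : k) =
        f.mapDomain (fun T => (N, T)) + g.mapDomain (fun T => (N, T)) := by
      rw [← mapDomain_add, e, mapDomain_single]
    rw [e']
    refine Submodule.add_mem_sup ((mem_supported k _).2 fun x hx => ?_) hg'
    obtain ⟨U, hU, rfl⟩ := exists_of_mem_mapDomain hx
    have hU' := hfs hU
    refine ⟨hmem U hU', hU'.2.2.2.1, ?_⟩
    rcases hU'.2.2.2.2 with rfl | h
    · exact hr.resolve_right fun h => h.2 hU'.2.2.2.1
    · exact (hrank _ _ (hmem U hU').2.1 h).trans_le (hr.elim le_of_lt fun h => h.1.le)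
  have H2 : ∀ j r, ∀ f ∈ supported k k (NC j r), f ∈ P.barRel χ c j → f = 0 := by
    intro j r f hf hb
    ext ⟨N, T⟩
    have : slice k N f = 0 := independent_normal_cut hom ind (slice_mem_relSpan N hb) fun T hT => by
      have hm : (N, T) ∈ NC j r := (mem_supported k f).1 hf
        (mem_support_iff.2 (by rw [← slice_apply]; exact mem_support_iff.1 hT))
      exact ⟨hm.1.2.1.1, ⟨c, hm.1.2.1.2.2.composable⟩, hm.2.1⟩
    rw [← slice_apply, this]; rfl
  let p : PTree P.Op (Fin n) → Finset (Fin n) → Prop := fun T C => (C : Set (Fin n)) ∉ ru.badEdges T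
  have hlin : ∀ (S : Set (Cell P.Op n)) (F : (Cell P.Op n →₀ k) →ₗ[k]
        (Cell P.Op n →₀ k)) (K : Submodule k _),
      (∀ x ∈ S, F (single x 1) ∈ K) → ∀ f ∈ supported k k S, F f ∈ K := by
    intro S F K h f hf
    exact mem_of_forall_single_mem (K := K.comap F) fun x hx => h x ((mem_supported k f).1 hf hx)
  have herase : ∀ j N T C, C ∈ N → (N, T) ∈ P.barCells χ c j →
      (N.erase C, T) ∈ P.barCells χ c (j - 1) := fun j N T C hC h =>
    ⟨by rw [Finset.card_erase_of_mem hC]; exact congrArg (· - 1) h.1, h.2.1,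
      fun D hD => h.2.2 D (Finset.mem_of_mem_erase hD)⟩
  have hG : ∀ j r, ∀ f ∈ supported k k (NC j r), P.partialD p f ∈ supported k k (NC (j - 1) r) := by
    intro j r
    refine hlin _ _ _ fun ⟨N, T⟩ hx => ?_
    rw [partialD_single, one_smul]
    refine Submodule.sum_mem _ fun C hC => single_mem_supported k _ ?_
    obtain ⟨hC, hp⟩ := mem_filter.1 hC
    refine ⟨herase j N T C hC hx.1, hx.2.1.of_badEdges_subset fun D hD => ?_, hx.2.2⟩
    obtain ⟨E, hE, rfl⟩ := hx.2.1.badEdges_subset hD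
    exact coe_mem_cutSet.2 (mem_erase.2 ⟨fun e => hp (e ▸ hD), hE⟩)
  have hB : ∀ j r, ∀ f ∈ supported k k (NC j (r + 1)), P.partialD (fun T C => ¬ p T C) f ∈
        supported k k (NC (j - 1) r) ⊔ P.barRel χ c (j - 1) := by
    intro j r
    refine hlin _ _ _ fun ⟨N, T⟩ hx => ?_
    rw [partialD_single, one_smul]
    refine Submodule.sum_mem _ fun C hC => ?_
    obtain ⟨hC, hp⟩ := mem_filter.1 hC
    rw [← mul_one (edgeSign k C N), ← smul_eq_mul, ← smul_single]
    refine smul_mem _ _ ?_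
    have := H1 _ _ _ (herase j N T C hC hx.1) _ (.inr ⟨rfl, fun hN =>
      Finset.notMem_erase C N (coe_mem_cutSet.1 (hN.badEdges_subset (not_not.1 hp)))⟩)
    refine (supported_sup_mono ?_ _) this
    exact fun y hy => ⟨hy.1, hy.2.1, hy.2.2.trans_le (Nat.lt_succ_iff.1 hx.2.2)⟩
  intro j hj
  have hgood : ∀ T : PTree P.Op (Fin n), ∃ C : Finset (Fin n),
      ∀ N, (N, T) ∈ P.barCells χ c j → ru.Normal (cutSet N) T →
        (C : Set (Fin n)) ∈ T.innerEdges ∧ p T C := by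
    intro T
    by_cases h : ∃ N, (N, T) ∈ P.barCells χ c j ∧ ru.Normal (cutSet N) T
    · obtain ⟨N, hN, hnorm⟩ := h
      have hex : ∃ C ∈ T.innerEdges, C ∉ cutSet N := by
        by_contra! hcon
        have hsub : T.innerEdges ⊆ (fun D : Finset (Fin n) => (D : Set (Fin n))) '' (N : Set _) :=
          fun C hC => by obtain ⟨D, hD, e⟩ := hcon C hC; exact ⟨D, hD, e.symm⟩
        have h1 := Set.ncard_le_ncard hsub ((Finset.finite_toSet N).image _)
        have h2 := Set.ncard_image_le (f := fun D : Finset (Fin n) => (D : Set (Fin n)))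
          (Finset.finite_toSet N)
        rw [Set.ncard_coe_finset, hN.1] at h2
        have h3 : T.innerEdges.ncard + 2 = max T.labels.length 2 := PTree.ncard_innerEdges hN.2.1.1
        have h4 := (hperm T hN.2.1).length_eq.trans List.length_finRange
        rw [h4, max_eq_left (by omega)] at h3
        omega
      obtain ⟨C, hC, hCN⟩ := hex
      refine ⟨C.toFinset, fun _ _ _ => ?_⟩
      simp only [p, Set.coe_toFinset]
      exact ⟨hC, fun hb => hCN (hnorm.badEdges_subset hb)⟩
    · push Not at h
      exact ⟨∅, fun N h1 h2 => absurd h2 (h N h1)⟩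
  choose C₀ hC₀ using hgood
  have hh : ∀ r, ∀ f ∈ supported k k (NC j r), P.cutEdge C₀ f ∈ supported k k (NC (j + 1) r) := by
    intro r
    refine hlin _ _ _ fun ⟨N, T⟩ hx => ?_
    by_cases hm : C₀ T ∈ N
    · rw [cutEdge_single_of_mem hm]; exact zero_mem _
    · rw [cutEdge_single hm]
      refine single_mem_supported k _ ⟨⟨?_, hx.1.2.1, fun D hD => ?_⟩, ?_, hx.2.2⟩
      · rw [Finset.card_insert_of_notMem hm, hx.1.1]
      · rcases Finset.mem_insert.1 hD with rfl | hD
        · exact (hC₀ T N hx.1 hx.2.1).1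
        · exact hx.1.2.2 D hD
      · exact hx.2.1.mono (cutSet_mono (Finset.subset_insert _ _))
  have hhom : ∀ r, ∀ f ∈ supported k k (NC j r),
      P.partialD p (P.cutEdge C₀ f) + P.cutEdge C₀ (P.partialD p f) = f := by
    intro r f hf
    have := hlin (NC j r) (P.partialD p ∘ₗ P.cutEdge C₀ + P.cutEdge C₀ ∘ₗ P.partialD p -
      LinearMap.id) ⊥ (fun ⟨N, T⟩ hx => ?_) f hf
    · exact sub_eq_zero.1 this
    · simp only [LinearMap.sub_apply, LinearMap.add_apply, comp_apply, id_apply, Submodule.mem_bot]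
      rw [partialD_cutEdge_add (hC₀ T N hx.1 hx.2.1).2, sub_self]
  have hh' : ∀ r, ∀ f ∈ supported k k (NC (j - 1) r), P.cutEdge C₀ f ∈
      supported k k {x | rank x.2 < r} := by
    intro r
    refine hlin _ _ _ fun ⟨N, T⟩ hx => ?_
    by_cases hm : C₀ T ∈ N
    · rw [cutEdge_single_of_mem hm]; exact zero_mem _
    · rw [cutEdge_single hm]
      exact single_mem_supported k _ hx.2.2
  have main : ∀ r, ∀ f ∈ supported k k (NC j r), P.barD n f ∈ P.barRel χ c (j - 1) →
      ∃ g ∈ supported k k (P.barCells χ c (j + 1)), f - P.barD n g ∈ P.barRel χ c j := by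
    intro r
    induction r with
    | zero =>
      intro f hf _
      have : f = 0 := by
        rw [mem_supported] at hf
        refine Finsupp.support_eq_empty.1 (Finset.eq_empty_of_forall_notMem fun x hx => ?_)
        exact Nat.not_lt_zero _ (hf hx).2.2
      exact ⟨0, zero_mem _, by rw [this, map_zero, sub_zero]; exact zero_mem _⟩
    | succ r ih =>
      intro f hf hd
      rw [barD_eq_add p] at hd
      obtain ⟨u, hu, b, hb, e⟩ := mem_sup.1 (hB j r f hf)
      have hu' : u ∈ supported k k (NC (j - 1) (r + 1)) :=
        Finsupp.supported_mono (fun y (hy : y ∈ NC (j - 1) r) =>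
          show y ∈ NC (j - 1) (r + 1) from ⟨hy.1, hy.2.1, Nat.lt_succ_of_lt hy.2.2⟩) hu
      have hz : P.partialD p f + u = 0 := by
        refine H2 (j - 1) (r + 1) _ (add_mem (hG j _ f hf) hu') ?_
        rw [← e, ← add_assoc] at hd
        exact (Submodule.add_mem_iff_left _ hb).1 hd
      have hlow : P.cutEdge C₀ (P.partialD p f) ∈ supported k k (NC j r) := by
        have h1 : P.cutEdge C₀ (P.partialD p f) ∈ supported k k {x | rank x.2 < r} := by
          rw [eq_neg_of_add_eq_zero_left hz, map_neg]
          exact neg_mem (hh' r u hu)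
        have h2 : P.cutEdge C₀ (P.partialD p f) ∈ supported k k (NC j (r + 1)) := by
          rw [← sub_eq_of_eq_add' (hhom (r + 1) f hf).symm]
          have h3 := hG (j + 1) (r + 1) _ (hh (r + 1) f hf)
          exact sub_mem hf h3
        rw [mem_supported] at h1 h2 ⊢
        exact fun x hx => ⟨(h2 hx).1, (h2 hx).2.1, h1 hx⟩
      obtain ⟨v, hv, b', hb', e'⟩ := mem_sup.1 (hB (j + 1) r _ (hh (r + 1) f hf))
      rw [Nat.add_sub_cancel] at hv hb'
      have efin : f - P.barD n (P.cutEdge C₀ f) = (P.cutEdge C₀ (P.partialD p f) - v) - b' := by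
        rw [barD_eq_add p (P.cutEdge C₀ f), ← e']
        nth_rewrite 1 [← hhom (r + 1) f hf]
        abel
      rw [← barD_eq_add p] at hd
      have hcyc : P.barD n (P.cutEdge C₀ (P.partialD p f) - v) ∈ P.barRel χ c (j - 1) := by
        rw [eq_add_of_sub_eq efin.symm, map_add, map_sub, barD_barD, sub_zero]
        exact add_mem hd (barD_mem_barRel hb')
      obtain ⟨g, hg, hfg⟩ := ih _ (sub_mem hlow hv) hcyc
      refine ⟨P.cutEdge C₀ f + g, add_mem ?_ hg, ?_⟩
      · exact Finsupp.supported_mono (fun x hx => hx.1) (hh (r + 1) f hf)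
      · rw [map_add, ← sub_sub, efin, sub_right_comm]
        exact sub_mem hfg hb'
  intro f hf hd
  obtain ⟨r, hr⟩ : ∃ r, ∀ x ∈ f.support, rank x.2 < r :=
    ⟨f.support.sup (fun x => rank x.2) + 1, fun x hx =>
      Nat.lt_succ_of_le (Finset.le_sup (f := fun x => rank x.2) hx)⟩
  have hf' : f ∈ supported k k (NC j r) ⊔ P.barRel χ c j := mem_of_forall_single_mem fun x hx =>
      H1 j x.1 x.2 ((mem_supported k f).1 hf hx) r (.inl (hr x hx))
  obtain ⟨u, hu, b, hb, rfl⟩ := mem_sup.1 hf'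
  rw [map_add] at hd
  obtain ⟨g, hg, h⟩ := main r u hu ((Submodule.add_mem_iff_left _ (barD_mem_barRel hb)).1 hd)
  exact ⟨g, hg, by rw [add_sub_right_comm]; exact add_mem h hb⟩

end Presentation

end Koszul

/-! ## Words and block words -/

section Words

variable {α γ Y X : Type}

/-- The bilinear extension of a map that is defined on basis elements. -/
def bilinearExt {M : Type*} [AddCommGroup M] [Module k M] (m : α → γ → M) :
    (α →₀ k) →ₗ[k] (γ →₀ k) →ₗ[k] M :=
  linearCombination k fun a => linearCombination k (m a)

theorem bilinearExt_single {M : Type*} [AddCommGroup M] [Module k M] (m : α → γ → M) (a : α)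
    (c : γ) : bilinearExt (k := k) m (single a 1) (single c 1) = m a c := by
  simp [bilinearExt]

/-- Linear maps on the span of a set are determined by the values on the basis. -/
theorem eq_of_eq_on_singles {M : Type*} [AddCommGroup M] [Module k M] {F G : (α →₀ k) →ₗ[k] M}
    (h : ∀ a, F (single a 1) = G (single a 1)) (f : α →₀ k) : F f = G f :=
  LinearMap.congr_fun (lhom_ext' fun a => ext_ring (h a)) f

/-- The concatenation product. -/
def cat : (List Y →₀ k) →ₗ[k] (List Y →₀ k) →ₗ[k] (List Y →₀ k) :=
  bilinearExt fun u v => single (u ++ v) 1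

theorem cat_single (u v : List Y) : cat (single u (1 : k)) (single v 1) = single (u ++ v) 1 :=
  bilinearExt_single _ _ _

theorem cat_assoc (f g h : List Y →₀ k) : cat (cat f g) h = cat f (cat g h) := by
  have h3 : ∀ u v w : List Y, cat (cat (single u (1 : k)) (single v 1))
      (single w 1) = cat (single u 1) (cat (single v 1) (single w 1)) := by
    intro u v w
    simp only [cat_single, List.append_assoc]
  refine eq_of_eq_on_singles (F := (cat.flip h) ∘ₗ (cat.flip g)) (G := cat.flip (cat g h))
    (fun u => ?_) f
  refine eq_of_eq_on_singles (F := (cat.flip h) ∘ₗ (cat (single u 1)))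
    (G := (cat (single u 1)) ∘ₗ (cat.flip h)) (fun v => ?_) g
  exact eq_of_eq_on_singles (F := cat (cat (single u 1) (single v 1)))
    (G := cat (single u 1) ∘ₗ cat (single v 1)) (fun w => h3 u v w) h

/-- A block is a letter followed by a word. -/
abbrev Block (X : Type) : Type := X ×ₗ List X

def Block.extend (u : List X) (b : Block X) : Block X := toLex ((ofLex b).1, (ofLex b).2 ++ u)

/-- The sum over all blocks of the result of appending the word `u` to the block. -/
def appendBlock (u : List X) : List (Block X) → (List (Block X) →₀ k)
  | [] => 0
  | b :: p => single (b.extend u :: p) 1 + cat (single [b] 1) (appendBlock u p)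

def act : (List X →₀ k) →ₗ[k] (List (Block X) →₀ k) →ₗ[k] (List (Block X) →₀ k) :=
  bilinearExt appendBlock

theorem act_single_cons (u : List X) (b : Block X) (p : List (Block X)) :
    act (single u (1 : k)) (single (b :: p) 1) = single (b.extend u :: p) 1 +
      cat (single [b] 1) (act (single u 1) (single p 1)) := by
  rw [act, bilinearExt_single, bilinearExt_single]; rfl

theorem act_single_nil (u : List X) :
    act (single u (1 : k)) (single ([] : List (Block X)) 1) = 0 := by
  rw [act, bilinearExt_single]; rfl

theorem act_single_singleton (u : List X) (b : Block X) :
    act (single u (1 : k)) (single [b] 1) = single [b.extend u] 1 := by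
  rw [act_single_cons, act_single_nil, map_zero, add_zero]

theorem act_cat (f : List X →₀ k) (g h : List (Block X) →₀ k) :
    act f (cat g h) = cat (act f g) h + cat g (act f h) := by
  have key : ∀ (u : List X) (p q : List (Block X)),
      act (single u (1 : k)) (cat (single p 1) (single q 1)) =
        cat (act (single u 1) (single p 1)) (single q 1) +
        cat (single p 1) (act (single u 1) (single q 1)) := by
    intro u p q
    induction p with
    | nil =>
      have : ∀ f : List (Block X) →₀ k, cat (single [] 1) f = f :=
        eq_of_eq_on_singles (F := cat (single [] (1 : k))) (G := LinearMap.id) fun q => by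
          rw [cat_single]; rfl
      rw [this, this, act_single_nil, map_zero, LinearMap.zero_apply, zero_add]
    | cons b p ih =>
      have e : cat (single (b :: p) (1 : k)) (act (single u 1)
          (single q 1)) = cat (single [b] 1) (cat (single p 1)
            (act (single u 1) (single q 1))) := by
        rw [← cat_assoc, cat_single]; rfl
      rw [cat_single] at ih ⊢
      rw [cons_append, act_single_cons, ih, act_single_cons, map_add, map_add,
        LinearMap.add_apply, cat_single, cons_append, cat_assoc, add_assoc, e]
  refine eq_of_eq_on_singles (F := act.flip (cat g h))
    (G := (cat.flip h) ∘ₗ (act.flip g) + (cat g) ∘ₗ (act.flip h)) (fun u => ?_) f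
  refine eq_of_eq_on_singles (F := act (single u 1) ∘ₗ (cat.flip h))
    (G := (cat.flip h) ∘ₗ (act (single u 1)) + cat.flip (act (single u 1) h))
    (fun p => ?_) g
  exact eq_of_eq_on_singles (F := act (single u 1) ∘ₗ cat (single p 1))
    (G := cat (act (single u 1) (single p 1)) +
      cat (single p 1) ∘ₗ act (single u 1)) (fun q => key u p q) h

/-- The commutator in the opposite order. -/
def bracket : (List X →₀ k) →ₗ[k] (List X →₀ k) →ₗ[k] (List X →₀ k) :=
  bilinearExt fun u v => single (v ++ u) 1 - single (u ++ v) 1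

theorem bracket_apply (f g : List X →₀ k) : bracket f g = cat g f - cat f g := by
  refine eq_of_eq_on_singles (F := bracket.flip g) (G := cat g - cat.flip g) (fun u => ?_) f
  refine eq_of_eq_on_singles (F := bracket (single u 1))
    (G := cat.flip (single u 1) - cat (single u 1)) (fun v => ?_) g
  rw [bracket, bilinearExt_single, ← cat_single, ← cat_single]
  rfl

theorem act_bracket (f g : List X →₀ k) (h : List (Block X) →₀ k) :
    act (bracket f g) h = act f (act g h) - act g (act f h) := by
  have key : ∀ (u v : List X) (p : List (Block X)),
      act (bracket (single u (1 : k)) (single v 1)) (single p 1) =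
        act (single u 1) (act (single v 1) (single p 1)) -
        act (single v 1) (act (single u 1) (single p 1)) := by
    intro u v p
    induction p with
    | nil =>
      rw [bracket_apply, cat_single, cat_single, map_sub, LinearMap.sub_apply]
      simp only [act_single_nil, map_zero]
    | cons b p ih =>
      have e : single (b :: p) (1 : k) = cat (single [b] 1) (single p 1) := by
        rw [cat_single]; rfl
      rw [e, act_cat, ih]
      generalize single p (1 : k) = P
      simp only [act_cat, map_sub, map_add, bracket_apply, cat_single, LinearMap.sub_apply,
        act_single_singleton, Block.extend, ofLex_toLex, List.append_assoc]
      abel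
  refine eq_of_eq_on_singles (F := act.flip h ∘ₗ bracket.flip g)
    (G := act.flip (act g h) - act g ∘ₗ act.flip h) (fun u => ?_) f
  refine eq_of_eq_on_singles (F := act.flip h ∘ₗ bracket (single u 1))
    (G := act (single u 1) ∘ₗ act.flip h - act.flip (act (single u 1) h))
    (fun v => ?_) g
  exact eq_of_eq_on_singles (F := act (bracket (single u 1) (single v 1)))
    (G := act (single u 1) ∘ₗ act (single v 1) -
      act (single v 1) ∘ₗ act (single u 1)) (fun p => key u v p) h

/-- The operad of Leibniz pairs acts on words (with the bracket) and block words (with the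
concatenation product). -/
abbrev WordPair (k : Type u) [Field k] (X : Type) : Type u := (List X →₀ k) × (List (Block X) →₀ k)

def wordOp : LPOp → WordPair k X →ₗ[k] WordPair k X →ₗ[k] WordPair k X
  | .β => (bracket.compl₁₂ (LinearMap.fst k _ _) (LinearMap.fst k _ _)).compr₂ (LinearMap.inl k _ _)
  | .a => (cat.compl₁₂ (LinearMap.snd k _ _) (LinearMap.snd k _ _)).compr₂ (LinearMap.inr k _ _)
  | .d => (act.compl₁₂ (LinearMap.fst k _ _) (LinearMap.snd k _ _)).compr₂ (LinearMap.inr k _ _)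

theorem wordOp_β (x y : WordPair k X) : wordOp .β x y = (bracket x.1 y.1, 0) := rfl

theorem wordOp_a (x y : WordPair k X) : wordOp .a x y = (0, cat x.2 y.2) := rfl

theorem wordOp_d (x y : WordPair k X) : wordOp .d x y = (0, act x.1 y.2) := rfl

def wordLeaf (x : X) : WordPair k X :=
  (single [x] 1, single [toLex (x, [])] 1)

theorem evalLin_wordOp_rels (v : ℕ → WordPair k X) : ∀ r ∈ (LP k).rels, evalLin wordOp v r = 0 := by
  rintro r (rfl | rfl | rfl | rfl | rfl)
  · simp only [antisymmetry, mon, map_add, evalLin_single, evalTree, wordOp_β, bracket_apply,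
      one_smul, Prod.mk_add_mk, add_zero]
    rw [sub_add_sub_cancel, sub_self]; rfl
  · simp only [jacobi, mon, map_sub, evalLin_single, evalTree, wordOp_β, bracket_apply,
      one_smul, Prod.mk_sub_mk, sub_zero, LinearMap.sub_apply, cat_assoc]
    refine Prod.ext ?_ rfl
    change _ = (0 : List X →₀ k)
    dsimp only
    abel
  · simp only [associativity, mon, map_sub, evalLin_single, evalTree, wordOp_a, one_smul,
      cat_assoc, sub_self]
  · simp only [derivation, mon, map_sub, evalLin_single, evalTree, wordOp_a, wordOp_d, one_smul,
      Prod.mk_sub_mk, sub_zero, act_cat]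
    refine Prod.ext rfl ?_
    change _ = (0 : List (Block X) →₀ k)
    dsimp only
    abel
  · simp only [lieAction, mon, map_sub, map_add, evalLin_single, evalTree, wordOp_β, wordOp_d,
      one_smul, Prod.mk_sub_mk, Prod.mk_add_mk, sub_zero, add_zero, act_bracket]
    refine Prod.ext rfl ?_
    change _ = (0 : List (Block X) →₀ k)
    dsimp only
    abel

end Words

/-! ## Least words -/

section LeastWord

variable {Y X : Type}

theorem cat_eq_sum (f g : List Y →₀ k) : cat f g = ∑ u ∈ f.support, f u • g.mapDomain (u ++ ·) := by
  have : ∀ u : List Y, cat (single u (1 : k)) g = g.mapDomain (u ++ ·) := fun u =>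
    eq_of_eq_on_singles (F := cat (single u 1)) (G := lmapDomain k k (u ++ ·))
      (fun v => by rw [cat_single, lmapDomain_apply, mapDomain_single]) g
  conv_lhs => rw [← f.sum_single]
  rw [Finsupp.sum, map_sum, LinearMap.sum_apply]
  refine sum_congr rfl fun u _ => ?_
  rw [← this, ← LinearMap.smul_apply, ← map_smul, smul_single, smul_eq_mul, mul_one]

theorem exists_of_mem_support_cat {f g : List Y →₀ k} {w : List Y} (h : w ∈ (cat f g).support) :
    ∃ u ∈ f.support, ∃ v ∈ g.support, u ++ v = w := by
  classical
  rw [cat_eq_sum] at h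
  obtain ⟨u, hu, h⟩ := Finset.mem_biUnion.1 (Finsupp.support_finsetSum h)
  obtain ⟨v, hv, e⟩ := exists_of_mem_mapDomain (Finsupp.support_smul h)
  exact ⟨u, hu, v, hv, e⟩

theorem cat_apply_append {f g : List Y →₀ k} {u : List Y} (v : List Y)
    (h : ∀ u' ∈ f.support, u'.length = u.length) : cat f g (u ++ v) = f u * g v := by
  rw [cat_eq_sum, Finsupp.finsetSum_apply, sum_eq_single u]
  · rw [Finsupp.smul_apply, mapDomain_apply (List.append_right_injective u), smul_eq_mul]
  · intro u' hu' hne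
    rw [Finsupp.smul_apply, Finsupp.mapDomain_of_notMem_range, smul_zero]
    rintro ⟨v', e⟩
    exact hne (List.append_inj e (h u' hu')).1
  · intro hu
    rw [Finsupp.notMem_support_iff.1 hu, zero_smul, Finsupp.zero_apply]

variable [LinearOrder Y]

theorem append_lt_append_of_lt {u v : List Y} (h : u < v) (hl : u.length = v.length)
    (p q : List Y) : u ++ p < v ++ q := by
  induction u generalizing v with
  | nil =>
    cases v with
    | nil => exact absurd h (lt_irrefl _)
    | cons b v => simp at hl
  | cons a u ih =>
    cases v with
    | nil => simp at hl
    | cons b v =>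
      rw [List.cons_lt_cons_iff] at h
      rw [cons_append, cons_append, List.cons_lt_cons_iff]
      exact h.imp_right fun h => ⟨h.1, ih h.2 (by simpa using hl)⟩

theorem append_le_append {u v p q : List Y} (h : u ≤ v) (hl : u.length = v.length)
    (h' : p ≤ q) : u ++ p ≤ v ++ q := by
  rcases h.eq_or_lt with rfl | h
  · rcases h'.eq_or_lt with rfl | h'
    · exact le_rfl
    · exact (List.append_left_lt h').le
  · exact (append_lt_append_of_lt h hl p q).le

/-- `w` is the least word of `f`, and all the words of `f` have the same length. -/
structure LeastWord (f : List Y →₀ k) (w : List Y) : Prop where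
  coeff : f w ≠ 0
  le : ∀ v ∈ f.support, w ≤ v
  length : ∀ v ∈ f.support, v.length = w.length

theorem leastWord_single (w : List Y) : LeastWord (single w (1 : k)) w := by
  refine ⟨by simp, fun v hv => ?_, fun v hv => ?_⟩ <;>
  rw [Finset.mem_singleton.1 (support_single_subset hv)]

theorem LeastWord.cat {f g : List Y →₀ k} {u v : List Y} (hf : LeastWord f u)
    (hg : LeastWord g v) : LeastWord (cat f g) (u ++ v) := by
  refine ⟨?_, fun w hw => ?_, fun w hw => ?_⟩
  · rw [cat_apply_append v hf.length]
    exact mul_ne_zero hf.coeff hg.coeff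
  · obtain ⟨u', hu, v', hv, rfl⟩ := exists_of_mem_support_cat hw
    exact append_le_append (hf.le _ hu) (hf.length _ hu).symm (hg.le _ hv)
  · obtain ⟨u', hu, v', hv, rfl⟩ := exists_of_mem_support_cat hw
    rw [length_append, length_append, hf.length _ hu, hg.length _ hv]

theorem LeastWord.bracket {f g : List Y →₀ k} {u v : List Y} (hf : LeastWord f u)
    (hg : LeastWord g v) (h : ∀ v' ∈ g.support, ∀ u' ∈ f.support, u ++ v < v' ++ u') :
    LeastWord (bracket f g) (u ++ v) := by
  have hc := hf.cat hg
  have h0 : ColouredOperad.cat g f (u ++ v) = 0 := by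
    by_contra hne
    obtain ⟨v', hv, u', hu, e⟩ := exists_of_mem_support_cat (mem_support_iff.2 hne)
    exact (h v' hv u' hu).ne e.symm
  have hs : ∀ w ∈ (ColouredOperad.bracket f g).support, (∃ v' ∈ g.support, ∃ u' ∈ f.support,
      v' ++ u' = w) ∨ w ∈ (ColouredOperad.cat f g).support := by
    intro w hw
    rw [bracket_apply] at hw
    classical
    rcases mem_union.1 (support_sub hw) with h | h
    · exact .inl (exists_of_mem_support_cat h)
    · exact .inr h
  refine ⟨?_, fun w hw => ?_, fun w hw => ?_⟩
  · rw [bracket_apply, Finsupp.sub_apply, h0, zero_sub, neg_ne_zero]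
    exact hc.coeff
  · rcases hs w hw with ⟨v', hv, u', hu, rfl⟩ | hw
    · exact (h v' hv u' hu).le
    · exact hc.le w hw
  · rcases hs w hw with ⟨v', hv, u', hu, rfl⟩ | hw
    · rw [length_append, length_append, hf.length _ hu, hg.length _ hv, add_comm]
    · exact hc.length w hw

theorem LeastWord.mapDomain {Z : Type} [LinearOrder Z] {f : List Y →₀ k} {w : List Y}
    (hf : LeastWord f w) {φ : List Y → List Z} (hφ : StrictMono φ)
    (hl : ∀ u v, (φ u).length = (φ v).length) : LeastWord (f.mapDomain φ) (φ w) := by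
  refine ⟨?_, fun v hv => ?_, fun v hv => ?_⟩
  · rw [mapDomain_apply hφ.injective]; exact hf.coeff
  · obtain ⟨u, hu, rfl⟩ := exists_of_mem_mapDomain hv
    exact hφ.monotone (hf.le u hu)
  · obtain ⟨u, hu, rfl⟩ := exists_of_mem_mapDomain hv
    exact hl u w

theorem notMem_of_leastWord {α : Type*} (F : (α →₀ k) →ₗ[k] (List Y →₀ k)) (lw : α → List Y)
    {S : Set α} (inj : Set.InjOn lw S) (least : ∀ a ∈ S, LeastWord (F (single a 1)) (lw a))
    {f : α →₀ k} (hf : F f = 0)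
    (hs : ∀ a ∈ f.support, a ∈ S ∨ F (single a 1) = 0) : ∀ a ∈ f.support, a ∉ S := by
  classical
  by_contra! hcon
  have hne : (f.support.filter (· ∈ S)).Nonempty := by
    obtain ⟨a, ha, haS⟩ := hcon
    exact ⟨a, mem_filter.2 ⟨ha, haS⟩⟩
  obtain ⟨a, ha, hmin⟩ := Finset.exists_min_image _ lw hne
  rw [mem_filter] at ha
  have h0 : F f (lw a) = f a * F (single a 1) (lw a) := by
    conv_lhs => rw [← f.sum_single]
    rw [Finsupp.sum, map_sum, Finsupp.finsetSum_apply, sum_eq_single a]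
    · rw [← mul_one (f a), ← smul_eq_mul, ← smul_single, map_smul, Finsupp.smul_apply,
        smul_eq_mul, smul_eq_mul, mul_one]
    · intro b hb hba
      rw [← mul_one (f b), ← smul_eq_mul, ← smul_single, map_smul, Finsupp.smul_apply]
      rcases hs b hb with h | h
      · have hlt : lw a < lw b := (hmin b (mem_filter.2 ⟨hb, h⟩)).lt_of_ne fun e =>
          hba (inj h ha.2 e.symm)
        have : lw a ∉ (F (single b 1)).support := fun h' => ((least b h).le _ h').not_gt hlt
        rw [Finsupp.notMem_support_iff.1 this, smul_zero]
      · rw [h, Finsupp.zero_apply, smul_zero]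
    · exact fun h => absurd ha.1 h
  rw [hf, Finsupp.zero_apply] at h0
  exact mul_ne_zero (mem_support_iff.1 ha.1) (least a ha.2).coeff h0.symm

end LeastWord

/-! ## Normal trees of the operad of Leibniz pairs -/

section LPNormal

open PTree Colour

variable {X : Type}

def lpRules : Rules LPOp where
  ori
    | .β, p => p
    | _, _ => True
  badL
    | .β, .β, _, bc, _ => bc
    | .a, .a, ab, _, ac => ¬ (ab ∧ ac)
    | .d, .β, _, _, ac => ac
    | _, _, _, _, _ => False
  badR
    | .a, .a, ab, _, ac => ab ∧ ac
    | .d, .a, _, _, _ => True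
    | .d, .d, ab, bc, _ => ¬ ab ∧ ¬ bc
    | _, _, _, _, _ => False

def blockWord : PTree LPOp X → List (Block X)
  | .leaf x => [toLex (x, [])]
  | .node .a l r => blockWord l ++ blockWord r
  | .node .d l r => (blockWord r).map (Block.extend l.labels)
  | .node .β _ _ => []

def Block.letters (b : Block X) : List X := (ofLex b).1 :: (ofLex b).2

theorem append_cons_inj_of_nodup {p q p' q' : List X} {x : X} (hn : (p ++ x :: q).Nodup)
    (h : p ++ x :: q = p' ++ x :: q') : p = p' ∧ q = q' := by
  induction p generalizing p' with
  | nil =>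
    cases p' with
    | nil => simpa using h
    | cons y p' =>
      simp only [List.nil_append, cons_append, List.cons.injEq] at h hn
      rw [h.2] at hn
      simp at hn
  | cons y p ih =>
    cases p' with
    | nil =>
      simp only [List.nil_append, cons_append, List.cons.injEq] at h hn
      rw [h.1] at hn
      simp at hn
    | cons z p' =>
      simp only [cons_append, List.cons.injEq] at h hn
      obtain ⟨h1, h2⟩ := ih (List.nodup_cons.1 hn).2 h.2
      exact ⟨by rw [h.1, h1], h2⟩

/-- The tree `d(A₁, d(A₂, …, d(Aᵣ, s)))`. -/
def IsModuleTree : PTree LPOp X → Prop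
  | .leaf _ => True
  | .node .d _ r => IsModuleTree r
  | .node _ _ _ => False

theorem IsModuleTree.blockWord_eq {T : PTree LPOp X} (h : IsModuleTree T) :
    ∃ b : Block X, blockWord T = [b] ∧ b.letters.Perm T.labels := by
  induction T with
  | leaf x => exact ⟨_, rfl, .refl _⟩
  | node g l r hl hr =>
    cases g with
    | β => exact h.elim
    | a => exact h.elim
    | d =>
      obtain ⟨b, hb, hp⟩ := hr h
      refine ⟨b.extend l.labels, by rw [blockWord, hb]; rfl, ?_⟩
      exact (hp.append_right l.labels).trans perm_append_comm

def letters (p : List (Block X)) : List X := p.flatMap Block.letters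

theorem letters_take_subset (n : ℕ) (p : List (Block X)) : letters (p.take n) ⊆ letters p := by
  intro x hx
  obtain ⟨b, hb, h⟩ := mem_flatMap.1 hx
  exact mem_flatMap.2 ⟨b, List.mem_of_mem_take hb, h⟩

theorem take_one_append {Y : Type} {p : List Y} (h : p ≠ []) (q : List Y) :
    (p ++ q).take 1 = p.take 1 := by
  cases p with
  | nil => exact absurd rfl h
  | cons y p => rfl

def singleBlock (s : X) (w : List X) : List (Block X) := [toLex (s, w)]

theorem act_mapDomain_singleBlock (s : X) (f g : List X →₀ k) :
    act g (f.mapDomain (singleBlock s)) = (cat f g).mapDomain (singleBlock s) := by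
  refine eq_of_eq_on_singles (F := act.flip (f.mapDomain (singleBlock s)))
    (G := lmapDomain k k (singleBlock s) ∘ₗ cat f) (fun v => ?_) g
  refine eq_of_eq_on_singles (F := act (single v 1) ∘ₗ lmapDomain k k (singleBlock s))
    (G := lmapDomain k k (singleBlock s) ∘ₗ cat.flip (single v 1)) (fun u => ?_) f
  simp only [comp_apply, lmapDomain_apply, mapDomain_single, flip_apply, cat_single]
  exact act_single_singleton _ _

variable [LinearOrder X]

/-- `T` is a normal tree with output colour `c`. -/
def LPGood (c : Colour) (T : PTree LPOp X) : Prop :=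
  T.labels.Nodup ∧ lpSig.Composable c T ∧ lpRules.Normal ∅ T

theorem LPGood.of_D {g : LPOp} {l r : PTree LPOp X} (h : LPGood D (node g l r)) :
    g = .β ∧ LPGood D l ∧ LPGood D r ∧ Disjoint l.leafSet r.leafSet ∧ l.minL < r.minL ∧
      ∀ A B, l = node .β A B → r.minL < B.minL := by
  obtain ⟨hn, hc, hN⟩ := h
  obtain ⟨h1, h2, hd⟩ := nodup_node hn
  cases g with
  | β =>
    refine ⟨rfl, ⟨h1, hc.2.1, hN.2.2.2.1⟩, ⟨h2, hc.2.2, hN.2.2.2.2⟩, hd, hN.1, ?_⟩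
    rintro A B rfl
    rw [leafSet_node, Set.disjoint_union_left] at hd
    refine (lt_or_gt_of_ne (minL_ne_of_disjoint hd.2)).resolve_left fun h => ?_
    exact hN.2.1 h
  | a => cases hc.1
  | d => cases hc.1

theorem LPGood.of_S {g : LPOp} {l r : PTree LPOp X} (h : LPGood S (node g l r)) :
    (g = .a ∧ LPGood S l ∧ LPGood S r ∧ Disjoint l.leafSet r.leafSet ∧
      (∀ A B, l = node .a A B → A.minL < B.minL ∧ A.minL < r.minL) ∧
      (∀ B C, r = node .a B C → ¬ (l.minL < B.minL ∧ l.minL < C.minL))) ∨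
    (g = .d ∧ LPGood D l ∧ LPGood S r ∧ Disjoint l.leafSet r.leafSet ∧ (∀ B C, r ≠ node .a B C) ∧
      (∀ A B, l = node .β A B → r.minL < A.minL) ∧
      (∀ B C, r = node .d B C → l.minL < B.minL ∨ B.minL < C.minL)) := by
  obtain ⟨hn, hc, hN⟩ := h
  obtain ⟨h1, h2, hd⟩ := nodup_node hn
  cases g with
  | β => cases hc.1
  | a =>
    refine .inl ⟨rfl, ⟨h1, hc.2.1, hN.2.2.2.1⟩, ⟨h2, hc.2.2, hN.2.2.2.2⟩, hd, ?_, ?_⟩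
    · rintro A B rfl
      by_contra h
      exact hN.2.1 h
    · rintro B C rfl h
      exact hN.2.2.1 h
  | d =>
    refine .inr ⟨rfl, ⟨h1, hc.2.1, hN.2.2.2.1⟩, ⟨h2, hc.2.2, hN.2.2.2.2⟩, hd, ?_, ?_, ?_⟩
    · rintro B C rfl
      exact hN.2.2.1 trivial
    · rintro A B rfl
      rw [leafSet_node, Set.disjoint_union_left] at hd
      refine (lt_or_gt_of_ne (minL_ne_of_disjoint hd.1)).resolve_left fun h => ?_
      exact hN.2.1 h
    · rintro B C rfl
      by_contra h
      exact hN.2.2.1 (not_or.1 h)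

theorem LPGood.exists_labels_eq {T : PTree LPOp X} (h : LPGood D T) :
    ∃ q, T.labels = T.minL :: q := by
  induction T with
  | leaf x => exact ⟨[], rfl⟩
  | node g l r hl hr =>
    obtain ⟨rfl, h1, h2, hd, hlt, -⟩ := h.of_D
    obtain ⟨q, hq⟩ := hl h1
    exact ⟨q ++ r.labels, by rw [labels, hq, minL, min_eq_left hlt.le]; rfl⟩

theorem LPGood.minL_le_of_mem_tail {g : LPOp} {l r : PTree LPOp X} (h : LPGood D (node g l r))
    {x : X} (hx : x ∈ (node g l r).labels.tail) : r.minL ≤ x := by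
  induction l generalizing g r with
  | leaf y => exact minL_le hx
  | node g' A B hA hB =>
    obtain ⟨rfl, h1, h2, hd, hlt, hbad⟩ := h.of_D
    obtain ⟨rfl, -⟩ := h1.of_D
    rw [labels, List.tail_append_of_ne_nil (labels_ne_nil _), mem_append] at hx
    rcases hx with hx | hx
    · exact (hbad A B rfl).le.trans (hA h1 hx)
    · exact minL_le hx

theorem LPGood.labels_injective {T T' : PTree LPOp X} (h : LPGood D T) (h' : LPGood D T')
    (e : T.labels = T'.labels) : T = T' := by
  induction T generalizing T' with
  | leaf x =>
    cases T' with
    | leaf y => simpa [labels] using e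
    | node g l r =>
      have := congrArg List.length e
      rw [length_labels, length_labels] at this
      simp [vertices] at this
  | node g l r hl hr =>
    cases T' with
    | leaf y =>
      have := congrArg List.length e
      rw [length_labels, length_labels] at this
      simp [vertices] at this
    | node g' l' r' =>
      have hmem : ∀ (g : LPOp) (l r : PTree LPOp X), r.minL ∈ (node g l r).labels.tail := by
        intro g l r
        rw [labels, List.tail_append_of_ne_nil (labels_ne_nil _)]
        exact mem_append_right _ r.minL_mem
      have hm : r.minL = r'.minL := le_antisymm
        (h.minL_le_of_mem_tail (e ▸ hmem g' l' r')) (h'.minL_le_of_mem_tail (e ▸ hmem g l r))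
      obtain ⟨rfl, h1, h2, -⟩ := h.of_D
      obtain ⟨rfl, h1', h2', -⟩ := h'.of_D
      obtain ⟨q, hq⟩ := h2.exists_labels_eq
      obtain ⟨q', hq'⟩ := h2'.exists_labels_eq
      have hn := h.1
      simp only [labels, hq, hq', ← hm] at e hn
      obtain ⟨e1, e2⟩ := append_cons_inj_of_nodup hn e
      rw [hl h1 h1' e1, hr h2 h2' (by rw [hq, hq', ← hm, e2])]

theorem LPGood.isModuleTree {T : PTree LPOp X} (h : LPGood S T) (ha : ∀ B C, T ≠ node .a B C) :
    IsModuleTree T := by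
  induction T with
  | leaf x => trivial
  | node g l r hl hr =>
    rcases h.of_S with ⟨rfl, -⟩ | ⟨rfl, h1, h2, -, h3, -⟩
    · exact absurd rfl (ha l r)
    · exact hr h2 h3

theorem LPGood.module_aux {T : PTree LPOp X} (h : LPGood S T) (hM : IsModuleTree T) {s y : X}
    {p v : List X} (hw : blockWord T = [toLex (s, p ++ y :: v)]) (hv : ∀ z ∈ v, y ≤ z)
    (hp : ∃ z ∈ s :: p, z < y) :
    ∃ A B, T = node .d A B ∧ B.minL < A.minL ∧ A.minL ≤ y := by
  induction T generalizing v with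
  | leaf x =>
    have := congrArg (fun b => (ofLex b).2) (List.cons.inj hw).1
    simp at this
  | node g l r hl hr =>
    rcases h.of_S with ⟨rfl, -⟩ | ⟨rfl, h1, h2, hd, -, hβ, hdd⟩
    · exact hM.elim
    obtain ⟨b, hb, hperm⟩ := IsModuleTree.blockWord_eq (T := r) hM
    rw [blockWord, hb] at hw
    have hw' := (List.cons.inj hw).1
    have hs : (ofLex b).1 = s := congrArg (fun b => (ofLex b).1) hw'
    have hu : (ofLex b).2 ++ l.labels = p ++ y :: v := congrArg (fun b => (ofLex b).2) hw'
    rw [Block.letters, hs] at hperm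
    have first : ∀ p₁, p = (ofLex b).2 ++ p₁ → l.labels = p₁ ++ y :: v →
        ∃ A B, node LPOp.d l r = node .d A B ∧ B.minL < A.minL ∧ A.minL ≤ y := by
      intro p₁ e1 e2
      refine ⟨l, r, rfl, ?_, minL_le (by rw [e2]; simp)⟩
      cases l with
      | leaf x =>
        have hp1 : p₁ = [] := by
          have := congrArg List.length e2
          simp [labels] at this
          exact List.eq_nil_of_length_eq_zero (by omega)
        subst hp1
        have hx : x = y := by simpa [labels] using (List.cons.inj e2).1
        obtain ⟨z, hz, hzy⟩ := hp
        rw [List.append_nil] at e1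
        subst hx
        exact (minL_le (hperm.mem_iff.1 (e1 ▸ hz))).trans_lt hzy
      | node g' A B =>
        obtain ⟨rfl, -, -, -, hAB, -⟩ := h1.of_D
        rw [minL, min_eq_left hAB.le]
        exact hβ A B rfl
    rcases List.append_eq_append_iff.1 hu with ⟨p₁, e1, e2⟩ | ⟨p₂, e1, e2⟩
    · exact first p₁ e1 e2
    · cases p₂ with
      | nil => exact first [] (by simpa using e1.symm) (by simpa using e2.symm)
      | cons y' p₂ =>
        rw [cons_append] at e2
        obtain ⟨rfl, e3⟩ := List.cons.inj e2
        obtain ⟨A, B, rfl, h3, h4⟩ := hr h2 hM (v := p₂) (by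
          rw [hb]
          exact congrArg (fun u => [u]) (Prod.ext hs e1 : ofLex b = (s, p ++ y :: p₂)))
          (fun z hz => hv z (e3 ▸ mem_append_left _ hz))
        have h5 : y ≤ l.minL := hv _ (e3 ▸ mem_append_right _ l.minL_mem)
        rcases hdd A B rfl with h6 | h6
        · exact absurd ((h5.trans_lt h6).trans_le h4) (lt_irrefl _)
        · exact absurd h6 h3.not_gt

theorem LPGood.module_split_absurd {A A' B B' : PTree LPOp X} (h : LPGood S (node .d A B))
    (h' : LPGood S (node .d A' B')) (hM : IsModuleTree B) (hM' : IsModuleTree B') {s : X}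
    {u p : List X} (hB : blockWord B = [toLex (s, u)]) (hB' : blockWord B' = [toLex (s, u ++ p)])
    (hA : A.labels = p ++ A'.labels) : p = [] := by
  by_contra hp
  rcases h.of_S with ⟨⟨⟩, -⟩ | ⟨-, h1, h2, hd, -, hβ, -⟩
  rcases h'.of_S with ⟨⟨⟩, -⟩ | ⟨-, h1', h2', hd', -, -, hdd⟩
  obtain ⟨q, hq⟩ := h1.exists_labels_eq
  obtain ⟨y, p', rfl⟩ := List.exists_cons_of_ne_nil hp
  rw [hq, cons_append] at hA
  obtain ⟨rfl, hq'⟩ := List.cons.inj hA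
  have hmin : B.minL < A.minL := by
    cases A with
    | leaf x =>
      have := congrArg List.length hq
      rw [hq', List.length_cons, length_append, length_labels, length_labels] at this
      simp [vertices] at this
    | node g C E =>
      obtain ⟨rfl, -, -, -, hCE, -⟩ := h1.of_D
      rw [minL, min_eq_left hCE.le]
      exact hβ C E rfl
  have hle : ∀ z ∈ q, A.minL ≤ z := fun z hz => minL_le (hq ▸ mem_cons_of_mem _ hz)
  obtain ⟨b, hb, hperm⟩ := IsModuleTree.blockWord_eq hM
  rw [hB] at hb
  rw [← (List.cons.inj hb).1] at hperm
  obtain ⟨C, E, rfl, h3, h4⟩ := h2'.module_aux hM' hB'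
    (fun z hz => hle z (hq' ▸ mem_append_left _ hz))
    ⟨B.minL, hperm.mem_iff.2 B.minL_mem, hmin⟩
  have h5 : A.minL ≤ A'.minL := hle _ (hq' ▸ mem_append_right _ A'.minL_mem)
  rcases hdd C E rfl with h6 | h6
  · exact absurd ((h5.trans_lt h6).trans_le h4) (lt_irrefl _)
  · exact absurd h6 h3.not_gt

theorem LPGood.module_injective {T T' : PTree LPOp X} (h : LPGood S T) (h' : LPGood S T')
    (hM : IsModuleTree T) (hM' : IsModuleTree T') (e : blockWord T = blockWord T') : T = T' := by
  induction T generalizing T' with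
  | leaf x =>
    cases T' with
    | leaf y =>
      have := congrArg (fun b => (ofLex b).1) (List.cons.inj e).1
      exact congrArg leaf this
    | node g l r =>
      rcases h'.of_S with ⟨rfl, -⟩ | ⟨rfl, -⟩
      · exact hM'.elim
      obtain ⟨b, hb, -⟩ := IsModuleTree.blockWord_eq (T := r) hM'
      rw [blockWord, blockWord, hb] at e
      have := congrArg (fun b => (ofLex b).2) (List.cons.inj e).1
      simp [Block.extend, labels_ne_nil] at this
  | node g l r hl hr =>
    rcases h.of_S with ⟨rfl, -⟩ | ⟨rfl, h1, h2, -⟩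
    · exact hM.elim
    obtain ⟨b, hb, -⟩ := IsModuleTree.blockWord_eq (T := r) hM
    cases T' with
    | leaf y =>
      rw [blockWord, blockWord, hb] at e
      have := congrArg (fun b => (ofLex b).2) (List.cons.inj e).1
      simp [Block.extend, labels_ne_nil] at this
    | node g' l' r' =>
      rcases h'.of_S with ⟨rfl, -⟩ | ⟨rfl, h1', h2', -⟩
      · exact hM'.elim
      obtain ⟨b', hb', -⟩ := IsModuleTree.blockWord_eq (T := r') hM'
      rw [blockWord, blockWord, hb, hb'] at e
      have e' := (List.cons.inj e).1
      have hs : (ofLex b).1 = (ofLex b').1 := congrArg (fun b => (ofLex b).1) e'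
      have hu : (ofLex b).2 ++ l.labels = (ofLex b').2 ++ l'.labels :=
        congrArg (fun b => (ofLex b).2) e'
      have key : (ofLex b).2 = (ofLex b').2 ∧ l.labels = l'.labels := by
        rcases List.append_eq_append_iff.1 hu with ⟨p, e1, e2⟩ | ⟨p, e1, e2⟩
        · have := h.module_split_absurd h' hM hM' (s := (ofLex b).1) (u := (ofLex b).2) (p := p)
            (by rw [hb]; rfl) (by rw [hb', hs, ← e1]; rfl) e2
          subst this
          simp_all
        · have := h'.module_split_absurd h hM' hM (s := (ofLex b).1) (u := (ofLex b').2) (p := p)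
            (by rw [hb', hs]; rfl) (by rw [hb, ← e1]; rfl) e2
          subst this
          simp_all
      rw [h1.labels_injective h1' key.2, hr h2 h2' hM hM' (by
        rw [hb, hb']
        exact congrArg (fun u => [u]) (Prod.ext hs key.1 : ofLex b = ofLex b'))]

theorem LPGood.letters_perm {T : PTree LPOp X} (h : LPGood S T) :
    (letters (blockWord T)).Perm T.labels := by
  induction T with
  | leaf x => exact .refl _
  | node g l r hl hr =>
    rcases h.of_S with ⟨rfl, h1, h2, -⟩ | ⟨rfl, h1, h2, -, h3, -⟩
    · rw [blockWord, letters, List.flatMap_append]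
      exact (hl h1).append (hr h2)
    · obtain ⟨b, hb, hp⟩ := IsModuleTree.blockWord_eq (T := node LPOp.d l r) (h2.isModuleTree h3)
      rw [hb]
      simpa [letters] using hp

theorem LPGood.blockWord_ne_nil {T : PTree LPOp X} (h : LPGood S T) : blockWord T ≠ [] := by
  intro e
  have := h.letters_perm
  rw [e] at this
  exact labels_ne_nil _ this.nil_eq.symm

theorem LPGood.length_eq_one_iff {T : PTree LPOp X} (h : LPGood S T) :
    (blockWord T).length = 1 ↔ IsModuleTree T := by
  constructor
  · intro e
    refine h.isModuleTree ?_
    rintro B C rfl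
    rcases h.of_S with ⟨-, h1, h2, -⟩ | ⟨⟨⟩, -⟩
    rw [blockWord, length_append] at e
    have := List.length_pos_iff.2 h1.blockWord_ne_nil
    have := List.length_pos_iff.2 h2.blockWord_ne_nil
    omega
  · intro hM
    obtain ⟨b, hb, -⟩ := hM.blockWord_eq
    rw [hb]; rfl

theorem LPGood.minL_mem_first {A B C : PTree LPOp X} (h : LPGood S (node .a (node .a A B) C)) :
    (node .a (node .a A B) C).minL ∈ letters ((blockWord (node .a (node .a A B) C)).take 1) := by
  induction A generalizing B C with
  | leaf x =>
    rcases h.of_S with ⟨-, h1, h2, -, hL, -⟩ | ⟨⟨⟩, -⟩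
    obtain ⟨h3, h4⟩ := hL _ _ rfl
    rw [minL, minL, min_eq_left h3.le, min_eq_left h4.le]
    simp [blockWord, letters, minL, Block.letters]
  | node g P Q hP hQ =>
    rcases h.of_S with ⟨-, h1, h2, -, hL, -⟩ | ⟨⟨⟩, -⟩
    obtain ⟨h3, h4⟩ := hL _ _ rfl
    have hm : (node LPOp.a (node .a (node g P Q) B) C).minL = (node LPOp.a (node g P Q) B).minL := by
      rw [minL, min_eq_left]
      rw [minL, min_eq_left h3.le]
      exact h4.le
    rw [hm, blockWord, take_one_append h1.blockWord_ne_nil]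
    rcases h1.of_S with ⟨-, h5, h6, -⟩ | ⟨⟨⟩, -⟩
    rcases h5.of_S with ⟨rfl, h7, h8, -⟩ | ⟨rfl, h7, h8, -, h9, -⟩
    · exact hP h1
    · obtain ⟨b, hb, hp⟩ := IsModuleTree.blockWord_eq (T := node LPOp.d P Q) (h8.isModuleTree h9)
      rw [blockWord, hb, minL, min_eq_left h3.le]
      simp only [List.singleton_append, List.take_succ_cons, List.take_zero, letters,
        List.flatMap_cons, List.flatMap_nil, List.append_nil]
      exact hp.mem_iff.2 (minL_mem _)

theorem LPGood.blockWord_injective {T T' : PTree LPOp X} (h : LPGood S T) (h' : LPGood S T')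
    (e : blockWord T = blockWord T') : T = T' := by
  induction T generalizing T' with
  | leaf x => exact h.module_injective h' trivial (h'.length_eq_one_iff.1 (by rw [← e]; rfl)) e
  | node g l r hl hr =>
    rcases h.of_S with ⟨rfl, h1, h2, hd, hL, hR⟩ | ⟨rfl, h1, h2, -, h3, -⟩
    swap
    · have hM : IsModuleTree (node LPOp.d l r) := h2.isModuleTree h3
      exact h.module_injective h' hM (h'.length_eq_one_iff.1 (by
        rw [← e]; exact h.length_eq_one_iff.2 hM)) e
    by_cases hM' : IsModuleTree T'
    · exact (h.length_eq_one_iff.1 (by rw [e]; exact h'.length_eq_one_iff.2 hM')).elim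
    obtain ⟨l', r', rfl⟩ : ∃ l' r', T' = node .a l' r' := by
      by_contra! hcon
      exact hM' (h'.isModuleTree hcon)
    rcases h'.of_S with ⟨-, h1', h2', hd', hL', hR'⟩ | ⟨⟨⟩, -⟩
    have hm : (node LPOp.a l r).minL = (node LPOp.a l' r').minL :=
      minL_eq_of_leafSet_eq (leafSet_eq_of_perm
        (h.letters_perm.symm.trans ((e ▸ .refl _ : (letters (blockWord (node LPOp.a l r))).Perm
          (letters (blockWord (node LPOp.a l' r')))).trans h'.letters_perm)))
    have right : ∀ l r : PTree LPOp X, LPGood S (node LPOp.a l r) →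
        (node LPOp.a l r).minL ∈ letters ((blockWord (node LPOp.a l r)).take 1) →
        (blockWord r).length = 1 := by
      intro l r h hmem
      rcases h.of_S with ⟨-, h1, h2, hd, hL, hR⟩ | ⟨⟨⟩, -⟩
      refine h2.length_eq_one_iff.2 (h2.isModuleTree ?_)
      rintro B C rfl
      rw [blockWord, take_one_append h1.blockWord_ne_nil] at hmem
      have hml : (node LPOp.a l (node .a B C)).minL ∈ l.labels :=
        h1.letters_perm.mem_iff.1 (letters_take_subset _ _ hmem)
      have hle := minL_le hml
      have hne := minL_ne_of_disjoint hd
      refine hR B C rfl (lt_min_iff.1 (lt_of_le_of_ne ?_ hne))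
      exact hle.trans (min_le_right _ _)
    have left : ∀ l r : PTree LPOp X, LPGood S (node LPOp.a l r) →
        (node LPOp.a l r).minL ∉ letters ((blockWord (node LPOp.a l r)).take 1) →
        (blockWord l).length = 1 := by
      intro l r h hmem
      rcases h.of_S with ⟨-, h1, h2, hd, hL, hR⟩ | ⟨⟨⟩, -⟩
      refine h1.length_eq_one_iff.2 (h1.isModuleTree ?_)
      rintro B C rfl
      exact hmem h.minL_mem_first
    have key : (blockWord l).length = (blockWord l').length := by
      have hlen := congrArg List.length e
      rw [blockWord, blockWord, length_append, length_append] at hlen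
      by_cases hmem : (node LPOp.a l r).minL ∈ letters ((blockWord (node LPOp.a l r)).take 1)
      · have e1 := right l r h hmem
        have e2 := right l' r' h' (by rw [← hm, ← e]; exact hmem)
        omega
      · have e1 := left l r h hmem
        have e2 := left l' r' h' (by rw [← hm, ← e]; exact hmem)
        omega
    rw [blockWord, blockWord] at e
    obtain ⟨e1, e2⟩ := List.append_inj e key
    rw [hl h1 h1' e1, hr h2 h2' e2]

/-! ### Evaluation of normal trees -/

theorem evalTree_wordOp_fst {T : PTree LPOp X} (h : LPGood D T) :
    LeastWord (evalTree (k := k) wordOp wordLeaf T).1 T.labels ∧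
      ∀ v ∈ (evalTree (k := k) wordOp wordLeaf T).1.support, v.Perm T.labels := by
  induction T with
  | leaf x =>
    refine ⟨leastWord_single _, fun v hv => ?_⟩
    rw [Finset.mem_singleton.1 (support_single_subset hv)]; rfl
  | node g l r hl hr =>
    obtain ⟨rfl, h1, h2, hd, hlt, -⟩ := h.of_D
    obtain ⟨l1, l2⟩ := hl h1
    obtain ⟨r1, r2⟩ := hr h2
    rw [evalTree, wordOp_β]
    refine ⟨l1.bracket r1 fun v hv u hu => ?_, fun w hw => ?_⟩
    · obtain ⟨q, hq⟩ := h1.exists_labels_eq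
      have hv' := r2 v hv
      cases v with
      | nil => exact (labels_ne_nil _ hv'.nil_eq.symm).elim
      | cons y v =>
        rw [hq, cons_append, cons_append, List.cons_lt_cons_iff]
        exact .inl (hlt.trans_le (minL_le (hv'.mem_iff.1 (mem_cons_self ..))))
    · classical
      rw [bracket_apply] at hw
      rcases mem_union.1 (support_sub hw) with hw | hw
      · obtain ⟨v, hv, u, hu, rfl⟩ := exists_of_mem_support_cat hw
        exact perm_append_comm.trans ((l2 u hu).append (r2 v hv))
      · obtain ⟨u, hu, v, hv, rfl⟩ := exists_of_mem_support_cat hw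
        exact (l2 u hu).append (r2 v hv)

theorem singleBlock_strictMono (s : X) : StrictMono (singleBlock s) := by
  intro u v h
  rw [singleBlock, singleBlock, List.cons_lt_cons_iff, Prod.Lex.lt_iff]
  exact .inl (.inr ⟨rfl, h⟩)

theorem evalTree_wordOp_module {T : PTree LPOp X} (h : LPGood S T) (hM : IsModuleTree T) :
    ∃ s u f, blockWord T = singleBlock s u ∧ LeastWord f u ∧
      (evalTree (k := k) wordOp wordLeaf T).2 = f.mapDomain (singleBlock s) := by
  induction T with
  | leaf x =>
    refine ⟨x, [], single [] 1, rfl, leastWord_single _, ?_⟩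
    rw [mapDomain_single]; rfl
  | node g l r hl hr =>
    rcases h.of_S with ⟨rfl, -⟩ | ⟨rfl, h1, h2, -⟩
    · exact hM.elim
    obtain ⟨s, u, f, e1, e2, e3⟩ := hr h2 hM
    refine ⟨s, u ++ l.labels, cat f (evalTree (k := k) wordOp wordLeaf l).1, ?_,
      e2.cat (evalTree_wordOp_fst h1).1, ?_⟩
    · rw [blockWord, e1]; rfl
    · rw [evalTree, wordOp_d, e3]
      exact act_mapDomain_singleBlock _ _ _

theorem evalTree_wordOp_snd {T : PTree LPOp X} (h : LPGood S T) :
    LeastWord (evalTree (k := k) wordOp wordLeaf T).2 (blockWord T) := by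
  induction T with
  | leaf x => exact leastWord_single _
  | node g l r hl hr =>
    rcases h.of_S with ⟨rfl, h1, h2, -⟩ | ⟨rfl, h1, h2, -, h3, -⟩
    · exact (hl h1).cat (hr h2)
    · obtain ⟨s, u, f, e1, e2, e3⟩ := evalTree_wordOp_module (k := k) h (h2.isModuleTree h3)
      rw [e1, e3]
      exact e2.mapDomain (singleBlock_strictMono s) fun _ _ => rfl

theorem independentNormal_of_evalLin {f : PTree LPOp X →₀ k} (hf : evalLin wordOp wordLeaf f = 0)
    (hs : ∀ t ∈ f.support,
      t.labels.Nodup ∧ (∃ c, lpSig.Composable c t) ∧ lpRules.Normal ∅ t) : f = 0 := by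
  have hS : ∀ t ∈ f.support, ¬ LPGood S t := by
    refine notMem_of_leastWord (LinearMap.snd k _ _ ∘ₗ evalLin wordOp wordLeaf) blockWord
      (S := {t | LPGood S t}) (fun t ht t' ht' e => ht.blockWord_injective ht' e)
      (fun t ht => ?_) (by rw [comp_apply, hf]; rfl) (fun t ht => ?_)
    · rw [comp_apply, evalLin_single, one_smul]
      exact evalTree_wordOp_snd ht
    · obtain ⟨h1, ⟨c, h2⟩, h3⟩ := hs t ht
      cases c with
      | S => exact .inl ⟨h1, h2, h3⟩
      | D =>
        rw [comp_apply, evalLin_single, one_smul]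
        cases t with
        | leaf x => exact .inl ⟨h1, trivial, h3⟩
        | node g l r =>
          obtain ⟨rfl, -⟩ := LPGood.of_D ⟨h1, h2, h3⟩
          exact .inr rfl
  have hD : ∀ t ∈ f.support, LPGood D t := by
    intro t ht
    obtain ⟨h1, ⟨c, h2⟩, h3⟩ := hs t ht
    cases c with
    | S => exact (hS t ht ⟨h1, h2, h3⟩).elim
    | D => exact ⟨h1, h2, h3⟩
  have hD' : ∀ t ∈ f.support, ¬ LPGood D t := by
    refine notMem_of_leastWord (LinearMap.fst k _ _ ∘ₗ evalLin wordOp wordLeaf) labels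
      (S := {t | LPGood D t}) (fun t ht t' ht' e => ht.labels_injective ht' e)
      (fun t ht => ?_) (by rw [comp_apply, hf]; rfl) (fun t ht => .inl (hD t ht))
    rw [comp_apply, evalLin_single, one_smul]
    exact (evalTree_wordOp_fst ht).1
  exact Finsupp.support_eq_empty.1 (Finset.eq_empty_of_forall_notMem fun t ht => hD' t ht (hD t ht))

theorem independentNormal_LP : IndependentNormal lpSig (LP k).rels lpRules X := fun f hf hs =>
  independentNormal_of_evalLin (k := k) (f := f) (evalLin_relSpan (V := WordPair k X)
    (R := (LP k).rels) wordOp (fun r hr v => evalLin_wordOp_rels v r hr) hf wordLeaf) hs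

end LPNormal

/-! ## The quantum monomial order on the trees of the operad of Leibniz pairs -/

section QMOrder

open PTree Colour

/-- The data that are compared by the QM-ordering of words. -/
def qmKey (ρ : ShOp → ℕ) (w : List ShOp) : ℕᵒᵈ ×ₗ List ℕ ×ₗ ℕ ×ₗ List ℕ ×ₗ ℕ :=
  toLex (OrderDual.toDual (xWord w).length, toLex ((xWord w).map ρ, toLex ((yWord w).length,
    toLex ((yWord w).map ρ, qDegree w))))

variable {ρ : ShOp → ℕ}

theorem qmKey_eq_iff (hρ : Injective ρ) {w w' : List ShOp} :
    qmKey ρ w = qmKey ρ w' ↔ QMEq w w' := by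
  have hm : ∀ u v : List ShOp, u.map ρ = v.map ρ ↔ u = v := fun u v =>
    (List.map_injective_iff.2 hρ).eq_iff
  simp only [qmKey, EmbeddingLike.apply_eq_iff_eq, Prod.mk.injEq, hm, QMEq]
  constructor
  · rintro ⟨-, h1, -, h2, h3⟩; exact ⟨h1, h2, h3⟩
  · rintro ⟨h1, h2, h3⟩; exact ⟨by rw [h1], h1, by rw [h2], h2, h3⟩

theorem qmKey_lt_iff (hρ : Injective ρ) {w w' : List ShOp} :
    qmKey ρ w < qmKey ρ w' ↔ QMLt ρ w w' := by
  have hm : ∀ u v : List ShOp, u.map ρ = v.map ρ ↔ u = v := fun u v =>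
    (List.map_injective_iff.2 hρ).eq_iff
  simp only [qmKey, Prod.Lex.lt_iff, ofLex_toLex, OrderDual.toDual_lt_toDual,
    EmbeddingLike.apply_eq_iff_eq, hm, QMLt]

theorem xWord_append (u v : List ShOp) : xWord (u ++ v) = xWord u ++ xWord v :=
  List.filter_append ..

theorem yWord_append (u v : List ShOp) : yWord (u ++ v) = yWord u ++ yWord v :=
  List.filter_append ..

theorem qDegree_append (u v : List ShOp) :
    qDegree (u ++ v) = qDegree u + (yWord u).length * (xWord v).length + qDegree v := by
  induction u with
  | nil => simp [qDegree, yWord]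
  | cons g u ih =>
    rw [cons_append, qDegree, ih, xWord_append, qDegree]
    cases hg : isX g
    · simp [yWord, hg]; ring
    · simp [yWord, hg]

theorem QMEq.append {u u' v v' : List ShOp} (h : QMEq u u') (h' : QMEq v v') :
    QMEq (u ++ v) (u' ++ v') := by
  obtain ⟨h1, h2, h3⟩ := h
  obtain ⟨h4, h5, h6⟩ := h'
  simp only [QMEq, xWord_append, yWord_append, qDegree_append, h1, h2, h3, h4, h5, h6, and_self]

theorem QMEq.refl (w : List ShOp) : QMEq w w := ⟨rfl, rfl, rfl⟩

theorem QMLt.append_left {u u' v v' : List ShOp} (hu : QMEq u u') (h : QMLt ρ v v') :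
    QMLt ρ (u ++ v) (u' ++ v') := by
  obtain ⟨h1, h2, h3⟩ := hu
  simp only [QMLt, xWord_append, yWord_append, qDegree_append, h1, h2, h3, length_append,
    map_append]
  rcases h with h | ⟨e1, h | ⟨e2, h | ⟨e3, h | ⟨e4, h⟩⟩⟩⟩
  · exact .inl (by omega)
  · exact .inr ⟨by omega, .inl (List.append_left_lt h)⟩
  · exact .inr ⟨by omega, .inr ⟨by rw [e2], .inl (by omega)⟩⟩
  · exact .inr ⟨by omega, .inr ⟨by rw [e2], .inr ⟨by omega, .inl (List.append_left_lt h)⟩⟩⟩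
  · refine .inr ⟨by omega, .inr ⟨by rw [e2], .inr ⟨by omega, .inr ⟨by rw [e4], ?_⟩⟩⟩⟩
    rw [e2]; omega

theorem QMLt.append_right {u u' v v' : List ShOp} (h : QMLt ρ u u') (hv : QMEq v v') :
    QMLt ρ (u ++ v) (u' ++ v') := by
  obtain ⟨h1, h2, h3⟩ := hv
  simp only [QMLt, xWord_append, yWord_append, qDegree_append, h1, h2, h3, length_append,
    map_append]
  rcases h with h | ⟨e1, h | ⟨e2, h | ⟨e3, h | ⟨e4, h⟩⟩⟩⟩
  · exact .inl (by omega)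
  · exact .inr ⟨by omega, .inl (append_lt_append_of_lt h (by simpa using e1) _ _)⟩
  · exact .inr ⟨by omega, .inr ⟨by rw [e2], .inl (by omega)⟩⟩
  · exact .inr ⟨by omega, .inr ⟨by rw [e2], .inr ⟨by omega,
      .inl (append_lt_append_of_lt h (by simpa using e3) _ _)⟩⟩⟩
  · refine .inr ⟨by omega, .inr ⟨by rw [e2], .inr ⟨by omega, .inr ⟨by rw [e4], ?_⟩⟩⟩⟩
    rw [e4]; omega

theorem reducible_of_subst {Op X : Type} {R : Set (PTree Op ℕ →₀ k)}
    {lt : PTree Op X → PTree Op X → Prop} (irrefl : ∀ t, ¬ lt t t) {N : Set (Set X)}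
    {r : PTree Op ℕ →₀ k} (hr : r ∈ R) {T : PTree Op ℕ} (hT : T ∈ r.support)
    {s : ℕ → PTree Op X}
    (hN : ∀ t ∈ r.support, ∀ C ∈ t.innerEdges, (⋃ i ∈ C, (s i).leafSet) ∉ N)
    (hlt : ∀ t ∈ r.support, t ≠ T → lt (t.bind s) (T.bind s)) : Reducible R lt N (T.bind s) := by
  refine ⟨_, .subst r hr s hN, ?_, fun T' hT' hne => ?_⟩
  · rw [mem_support_iff, Finsupp.mapDomain, Finsupp.sum, Finsupp.finsetSum_apply,
      sum_eq_single T, Finsupp.single_eq_same]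
    · exact mem_support_iff.1 hT
    · intro t ht hne
      refine single_eq_of_ne fun e => irrefl (T.bind s) ?_
      have := hlt t ht hne
      rwa [← e] at this
    · exact fun h => absurd hT h
  · obtain ⟨t, ht, rfl⟩ := exists_of_mem_mapDomain hT'
    exact hlt t ht fun e => hne (e ▸ rfl)

variable {X Y : Type} [LinearOrder X]

open Classical in
/-- The letter of a vertex whose inputs are in the right order if `p` holds. -/
def vertexLetter (g : LPOp) (p : Prop) : ShOp := if p then straight g else swapped g

/-- The path from the root to the leaf `x` in the shuffle tree of a planar tree. -/
def dpath (x : X) : PTree LPOp X → List ShOp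
  | .leaf _ => []
  | .node g l r => vertexLetter g (l.minL < r.minL) ::
      (if x ∈ l.labels then dpath x l else dpath x r)

theorem minL_bind (t : PTree LPOp Y) (s : Y → PTree LPOp X) :
    (t.bind s).minL = (t.map fun i => (s i).minL).minL := by
  induction t with
  | leaf x => rfl
  | node g l r hl hr => simp only [PTree.bind, PTree.map, minL, hl, hr]

theorem dpath_bind {t : PTree LPOp Y} {s : Y → PTree LPOp X} {i : Y} (hi : i ∈ t.labels)
    (hd : ∀ j ∈ t.labels, j ≠ i → Disjoint (s j).leafSet (s i).leafSet) {x : X}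
    (hx : x ∈ (s i).labels) :
    dpath x (t.bind s) = dpath (s i).minL (t.map fun i => (s i).minL) ++ dpath x (s i) := by
  induction t with
  | leaf j =>
    rw [labels, mem_singleton] at hi
    subst hi
    rfl
  | node g l r hl hr =>
    have key : ∀ u ∈ (s i).labels, ∀ l : PTree LPOp Y, (∀ j ∈ l.labels, j ≠ i →
        Disjoint (s j).leafSet (s i).leafSet) → (u ∈ (l.bind s).labels ↔ i ∈ l.labels) := by
      intro u hu l hd
      rw [labels_bind, mem_flatMap]
      refine ⟨fun ⟨j, hj, h⟩ => ?_, fun h => ⟨i, h, hu⟩⟩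
      by_contra hne
      exact disjoint_left.1 (hd j hj fun e => hne (e ▸ hj)) h hu
    have hdl := fun j hj => hd j (mem_append_left r.labels hj)
    have hdr := fun j hj => hd j (mem_append_right l.labels hj)
    have e2 : (s i).minL ∈ (l.map fun i => (s i).minL).labels ↔ i ∈ l.labels := by
      rw [labels_map, mem_map]
      refine ⟨fun ⟨j, hj, h⟩ => ?_, fun h => ⟨i, h, rfl⟩⟩
      by_contra hne
      exact minL_ne_of_disjoint (hdl j hj fun e => hne (e ▸ hj)) h
    simp only [PTree.bind, PTree.map, dpath, minL_bind, cons_append]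
    by_cases h : i ∈ l.labels
    · rw [if_pos ((key x hx l hdl).2 h), if_pos (e2.2 h), hl h hdl]
    · rw [if_neg (mt (key x hx l hdl).1 h), if_neg (mt e2.1 h), hr ((mem_append.1 hi).resolve_left h) hdr]

/-- The QM-ordering of trees with the same leaves. -/
def QMTreeLess (ρ : ShOp → ℕ) (T' T : PTree LPOp X) : Prop :=
  T'.labels.Perm T.labels ∧ ∃ x ∈ T.labels,
    (∀ y ∈ T.labels, y < x → QMEq (dpath y T') (dpath y T)) ∧ QMLt ρ (dpath x T') (dpath x T)

open Classical in
/-- The number of vertices that are not in normal position. -/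
def disorder : PTree LPOp X → ℕ
  | .leaf _ => 0
  | .node g l r => (if lpRules.ori g (l.minL < r.minL) then 0 else 1) + (disorder l + disorder r)

/-- The QM-ordering, refined by the number of vertices that are out of order. -/
def LPLess (ρ : ShOp → ℕ) (T' T : PTree LPOp X) : Prop :=
  QMTreeLess ρ T' T ∨ (T'.labels.Perm T.labels ∧
    (∀ y ∈ T.labels, QMEq (dpath y T') (dpath y T)) ∧ disorder T' < disorder T)

theorem QMLt.irrefl (hρ : Injective ρ) (w : List ShOp) : ¬ QMLt ρ w w := by
  rw [← qmKey_lt_iff hρ]; exact lt_irrefl _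

theorem LPLess.irrefl (hρ : Injective ρ) (T : PTree LPOp X) : ¬ LPLess ρ T T := by
  rintro (⟨-, x, -, -, h⟩ | ⟨-, -, h⟩)
  · exact h.irrefl hρ
  · exact lt_irrefl _ h

theorem LPLess.trans (hρ : Injective ρ) {T₁ T₂ T₃ : PTree LPOp X} (h : LPLess ρ T₁ T₂)
    (h' : LPLess ρ T₂ T₃) : LPLess ρ T₁ T₃ := by
  simp only [LPLess, QMTreeLess, ← qmKey_lt_iff hρ, ← qmKey_eq_iff hρ] at h h' ⊢
  rcases h with ⟨hp, x, hx, h1, h2⟩ | ⟨hp, h1, h2⟩ <;>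
  rcases h' with ⟨hp', y, hy, h3, h4⟩ | ⟨hp', h3, h4⟩
  · refine .inl ⟨hp.trans hp', ?_⟩
    have hx' := hp'.mem_iff.1 hx
    rcases lt_trichotomy x y with hxy | rfl | hxy
    · exact ⟨x, hx', fun z hz hzx => (h1 z (hp'.mem_iff.2 hz) hzx).trans (h3 z hz (hzx.trans hxy)),
        h2.trans_eq (h3 x hx' hxy)⟩
    · exact ⟨x, hx', fun z hz hzx => (h1 z (hp'.mem_iff.2 hz) hzx).trans (h3 z hz hzx), h2.trans h4⟩
    · exact ⟨y, hy, fun z hz hzx => (h1 z (hp'.mem_iff.2 hz) (hzx.trans hxy)).trans (h3 z hz hzx),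
        (h1 y (hp'.mem_iff.2 hy) hxy).trans_lt h4⟩
  · have hx' := hp'.mem_iff.1 hx
    exact .inl ⟨hp.trans hp', x, hx', fun z hz hzx => (h1 z (hp'.mem_iff.2 hz) hzx).trans (h3 z hz),
      h2.trans_eq (h3 x hx')⟩
  · exact .inl ⟨hp.trans hp', y, hy, fun z hz hzx => (h1 z (hp'.mem_iff.2 hz)).trans (h3 z hz hzx),
      (h1 y (hp'.mem_iff.2 hy)).trans_lt h4⟩
  · exact .inr ⟨hp.trans hp', fun z hz => (h1 z (hp'.mem_iff.2 hz)).trans (h3 z hz), h2.trans h4⟩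

theorem LPLess.of_dpath {t t' T T' : PTree LPOp X} (h : LPLess ρ t' t) (hp : T'.labels.Perm T.labels)
    (hs : t.labels ⊆ T.labels) (e : ∀ x ∈ t.labels, ∃ c, dpath x T' = [c] ++ dpath x t' ∧
      dpath x T = [c] ++ dpath x t) (e' : ∀ x ∈ T.labels, x ∉ t.labels → dpath x T' = dpath x T)
    (hd : disorder t' < disorder t → disorder T' < disorder T) : LPLess ρ T' T := by
  have key : ∀ y ∈ T.labels, (y ∈ t.labels → QMEq (dpath y t') (dpath y t)) →
      QMEq (dpath y T') (dpath y T) := fun y hy h => by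
    by_cases hyt : y ∈ t.labels
    · obtain ⟨c, e1, e2⟩ := e y hyt
      rw [e1, e2]
      exact (QMEq.refl _).append (h hyt)
    · rw [e' y hy hyt]; exact .refl _
  rcases h with ⟨-, x, hx, h1, h2⟩ | ⟨-, h1, h2⟩
  · refine .inl ⟨hp, x, hs hx, fun y hy hyx => key y hy fun h => h1 y h hyx, ?_⟩
    obtain ⟨c, e1, e2⟩ := e x hx
    rw [e1, e2]
    exact h2.append_left (.refl _)
  · exact .inr ⟨hp, fun y hy => key y hy (h1 y), hd h2⟩

theorem LPLess.left (g : LPOp) {t t' : PTree LPOp X} (u : PTree LPOp X)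
    (hn : (PTree.node g t u).labels.Nodup) (h : LPLess ρ t' t) :
    LPLess ρ (.node g t' u) (.node g t u) := by
  have hp : t'.labels.Perm t.labels := by rcases h with ⟨h, -⟩ | ⟨h, -⟩ <;> exact h
  have hm : t'.minL = t.minL := minL_eq_of_leafSet_eq (leafSet_eq_of_perm hp)
  refine h.of_dpath (hp.append_right _) (fun _ => mem_append_left _) (fun x hx =>
    ⟨_, by rw [dpath, if_pos (hp.mem_iff.2 hx), hm]; rfl, by rw [dpath, if_pos hx]; rfl⟩)
    (fun x _ hx => ?_) fun h => by rw [disorder, disorder, hm]; omega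
  rw [dpath, if_neg fun h => hx (hp.mem_iff.1 h), dpath, if_neg hx, hm]

theorem LPLess.right (g : LPOp) {t t' : PTree LPOp X} (u : PTree LPOp X)
    (hn : (PTree.node g u t).labels.Nodup) (h : LPLess ρ t' t) :
    LPLess ρ (.node g u t') (.node g u t) := by
  obtain ⟨-, -, hd⟩ := nodup_node hn
  have hp : t'.labels.Perm t.labels := by rcases h with ⟨h, -⟩ | ⟨h, -⟩ <;> exact h
  have hm : t'.minL = t.minL := minL_eq_of_leafSet_eq (leafSet_eq_of_perm hp)
  refine h.of_dpath (hp.append_left _) (fun _ => mem_append_right _) (fun x hx => ?_)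
    (fun x hx hx' => ?_) fun h => by rw [disorder, disorder, hm]; omega
  · have h1 : x ∉ u.labels := fun h => disjoint_left.1 hd h hx
    exact ⟨_, by rw [dpath, if_neg h1, hm]; rfl, by rw [dpath, if_neg h1]; rfl⟩
  · have hx := (mem_append.1 hx).resolve_right hx'
    rw [dpath, if_pos hx, dpath, if_pos hx, hm]

/-- The comparison of two patterns is inherited by their substitution instances. -/
theorem QMTreeLess.bind {t t' : PTree LPOp Y} {s : Y → PTree LPOp X} (hp : t'.labels.Perm t.labels)
    (hd : ∀ i ∈ t.labels, ∀ j ∈ t.labels, i ≠ j → Disjoint (s i).leafSet (s j).leafSet)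
    (h : QMTreeLess ρ (t'.map fun i => (s i).minL) (t.map fun i => (s i).minL)) :
    QMTreeLess ρ (t'.bind s) (t.bind s) := by
  have e : ∀ i ∈ t.labels, ∀ x ∈ (s i).labels,
      dpath x (t.bind s) = dpath (s i).minL (t.map fun i => (s i).minL) ++ dpath x (s i) :=
    fun i hi x hx => dpath_bind hi (fun j hj hne => hd j hj i hi hne) hx
  have e' : ∀ i ∈ t.labels, ∀ x ∈ (s i).labels,
      dpath x (t'.bind s) = dpath (s i).minL (t'.map fun i => (s i).minL) ++ dpath x (s i) :=
    fun i hi x hx => dpath_bind (hp.mem_iff.2 hi)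
      (fun j hj hne => hd j (hp.mem_iff.1 hj) i hi hne) hx
  obtain ⟨-, x, hx, h1, h2⟩ := h
  rw [labels_map, mem_map] at hx
  obtain ⟨i, hi, rfl⟩ := hx
  refine ⟨by rw [labels_bind, labels_bind]; exact hp.flatMap_right _, (s i).minL, ?_, ?_, ?_⟩
  · rw [labels_bind]
    exact mem_flatMap.2 ⟨i, hi, minL_mem _⟩
  · intro y hy hlt
    rw [labels_bind] at hy
    obtain ⟨j, hj, hyj⟩ := mem_flatMap.1 hy
    rw [e j hj y hyj, e' j hj y hyj]
    exact (h1 _ (by rw [labels_map]; exact List.mem_map_of_mem hj)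
      ((minL_le hyj).trans_lt hlt)).append (.refl _)
  · rw [e i hi _ (minL_mem _), e' i hi _ (minL_mem _)]
    exact h2.append_right (.refl _)

variable (k)

/-- The rewriting rules: a relation, its greatest term, and the condition on the order of the inputs
under which this term is the greatest one. -/
inductive LPRule : (PTree LPOp ℕ →₀ k) → PTree LPOp ℕ → (Prop → Prop → Prop → Prop) → Prop
  | jacobi : LPRule (jacobi k .β) (node .β (node .β (leaf 0) (leaf 1)) (leaf 2))
      fun ab bc ac => ab ∧ bc ∧ ac
  | assocLeft : LPRule (associativity k .a) (node .a (node .a (leaf 0) (leaf 1)) (leaf 2))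
      fun ab _ ac => ¬ (ab ∧ ac)
  | assocRight : LPRule (associativity k .a) (node .a (leaf 0) (node .a (leaf 1) (leaf 2)))
      fun ab _ ac => ab ∧ ac
  | derivation : LPRule (derivation k .d .a) (node .d (leaf 0) (node .a (leaf 1) (leaf 2)))
      fun _ _ _ => True
  | actionLeft : LPRule (lieAction k .d .β) (node .d (node .β (leaf 0) (leaf 1)) (leaf 2))
      fun ab _ ac => ab ∧ ac
  | actionRight : LPRule (lieAction k .d .β) (node .d (leaf 0) (node .d (leaf 1) (leaf 2)))
      fun ab bc _ => ¬ ab ∧ ¬ bc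

variable {k}

theorem LPRule.mem {r : PTree LPOp ℕ →₀ k} {T : PTree LPOp ℕ} {p : Prop → Prop → Prop → Prop}
    (h : LPRule k r T p) : r ∈ lpQuadraticRels k ∧ T ∈ r.support := by
  rw [mem_support_iff]
  cases h
  · exact ⟨.inl rfl, by simp [ColouredOperad.jacobi, mon]⟩
  · exact ⟨.inr (.inl rfl), by simp [associativity, mon]⟩
  · exact ⟨.inr (.inl rfl), by simp [associativity, mon]⟩
  · exact ⟨.inr (.inr (.inl rfl)), by simp [ColouredOperad.derivation, mon]⟩
  · exact ⟨.inr (.inr (.inr rfl)), by simp [lieAction, mon]⟩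
  · exact ⟨.inr (.inr (.inr rfl)), by simp [lieAction, mon]⟩

theorem support_sub_mon {α : Type*} {f : α →₀ k} {a t : α} (h : t ∈ (f - single a 1).support) :
    t ∈ f.support ∨ t = a := by
  classical
  exact (mem_union.1 (support_sub h)).imp_right fun h =>
    Finset.mem_singleton.1 (support_single_subset h)

theorem support_add_mon {α : Type*} {f : α →₀ k} {a t : α} (h : t ∈ (f + single a 1).support) :
    t ∈ f.support ∨ t = a := by
  classical
  exact (mem_union.1 (Finsupp.support_add h)).imp_right fun h =>
    Finset.mem_singleton.1 (support_single_subset h)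

section Support

variable {Op : Type} {β d a : Op} {t t' : PTree Op ℕ}

theorem support_mon (h : t ∈ (mon k t').support) : t = t' :=
  Finset.mem_singleton.1 (support_single_subset h)

theorem mem_support_antisymmetry (h : t ∈ (antisymmetry k β).support) :
    t = node β (leaf 0) (leaf 1) ∨ t = node β (leaf 1) (leaf 0) :=
  (support_add_mon h).imp_left support_mon

theorem mem_support_jacobi (h : t ∈ (jacobi k β).support) :
    t = node β (node β (leaf 0) (leaf 1)) (leaf 2) ∨
    t = node β (node β (leaf 0) (leaf 2)) (leaf 1) ∨
    t = node β (leaf 0) (node β (leaf 1) (leaf 2)) :=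
  or_assoc.1 ((support_sub_mon h).imp_left fun h => (support_sub_mon h).imp_left support_mon)

theorem mem_support_associativity (h : t ∈ (associativity k a).support) :
    t = node a (node a (leaf 0) (leaf 1)) (leaf 2) ∨
    t = node a (leaf 0) (node a (leaf 1) (leaf 2)) :=
  (support_sub_mon h).imp_left support_mon

theorem mem_support_derivation (h : t ∈ (derivation k d a).support) :
    t = node d (leaf 0) (node a (leaf 1) (leaf 2)) ∨
    t = node a (leaf 1) (node d (leaf 0) (leaf 2)) ∨
    t = node a (node d (leaf 0) (leaf 1)) (leaf 2) :=
  or_assoc.1 ((support_sub_mon h).imp_left fun h => (support_sub_mon h).imp_left support_mon)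

theorem mem_support_lieAction (h : t ∈ (lieAction k d β).support) :
    t = node d (node β (leaf 0) (leaf 1)) (leaf 2) ∨
    t = node d (leaf 0) (node d (leaf 1) (leaf 2)) ∨
    t = node d (leaf 1) (node d (leaf 0) (leaf 2)) :=
  or_assoc.1 ((support_add_mon h).imp_left fun h => (support_sub_mon h).imp_left support_mon)

/-- The condition on a relation in `Homogeneous`. -/
def HomogeneousRel (Γ : Signature Colour Op) (r : PTree Op ℕ →₀ k) : Prop :=
  ∃ m, ∀ t ∈ r.support, ∀ t' ∈ r.support, t.labels.Perm (List.range m) ∧ t.IsNode ∧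
    ∀ χ c, Γ.HasColour χ c t → Γ.HasColour χ c t'

variable {Γ : Signature Colour Op}

theorem Homogeneous.of {R : Set (PTree Op ℕ →₀ k)} (h : ∀ r ∈ R, HomogeneousRel Γ r) :
    Homogeneous Γ R where
  labels r hr := (h r hr).imp fun _ h t ht => (h t ht t ht).1
  isNode r hr t ht := ((h r hr).choose_spec t ht t ht).2.1
  colour r hr t ht t' ht' := ((h r hr).choose_spec t ht t' ht').2.2

theorem HomogeneousRel.antisymmetry (h : Γ.src₁ β = Γ.src₂ β) :
    HomogeneousRel Γ (antisymmetry k β) := ⟨2, fun t ht t' ht' => by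
  rcases mem_support_antisymmetry ht with rfl | rfl <;>
    rcases mem_support_antisymmetry ht' with rfl | rfl <;>
    refine ⟨by simp only [labels]; decide, trivial, fun χ c => ?_⟩ <;>
    simp only [Signature.HasColour, h] <;> tauto⟩

theorem HomogeneousRel.jacobi (h1 : Γ.src₁ β = D) (h2 : Γ.src₂ β = D) (h3 : Γ.tgt β = D) :
    HomogeneousRel Γ (jacobi k β) := ⟨3, fun t ht t' ht' => by
  rcases mem_support_jacobi ht with rfl | rfl | rfl <;>
    rcases mem_support_jacobi ht' with rfl | rfl | rfl <;>
    refine ⟨by simp only [labels]; decide, trivial, fun χ c => ?_⟩ <;>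
    simp only [Signature.HasColour, h1, h2, h3] <;> tauto⟩

theorem HomogeneousRel.associativity (h1 : Γ.src₁ a = S) (h2 : Γ.src₂ a = S) (h3 : Γ.tgt a = S) :
    HomogeneousRel Γ (associativity k a) := ⟨3, fun t ht t' ht' => by
  rcases mem_support_associativity ht with rfl | rfl <;>
    rcases mem_support_associativity ht' with rfl | rfl <;>
    refine ⟨by simp only [labels]; decide, trivial, fun χ c => ?_⟩ <;>
    simp only [Signature.HasColour, h1, h2, h3] <;> tauto⟩

theorem HomogeneousRel.lieAction (h1 : Γ.src₁ β = D) (h2 : Γ.src₂ β = D) (h3 : Γ.tgt β = D)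
    (h4 : Γ.src₁ d = D) (h5 : Γ.src₂ d = S) (h6 : Γ.tgt d = S) :
    HomogeneousRel Γ (lieAction k d β) := ⟨3, fun t ht t' ht' => by
  rcases mem_support_lieAction ht with rfl | rfl | rfl <;>
    rcases mem_support_lieAction ht' with rfl | rfl | rfl <;>
    refine ⟨by simp only [labels]; decide, trivial, fun χ c => ?_⟩ <;>
    simp only [Signature.HasColour, h1, h2, h3, h4, h5, h6] <;> tauto⟩

end Support

theorem mem_support_lpQuadraticRels {r : PTree LPOp ℕ →₀ k} (hr : r ∈ lpQuadraticRels k)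
    {t : PTree LPOp ℕ} (h : t ∈ r.support) : t.labels.Perm [0, 1, 2] ∧ t.vertices = 2 ∧
      ∀ C ∈ t.innerEdges, C = {0} ∪ {1} ∨ C = {0} ∪ {2} ∨ C = {1} ∪ {2} := by
  rcases hr with rfl | rfl | rfl | rfl <;> [rcases mem_support_jacobi h with rfl | rfl | rfl;
    rcases mem_support_associativity h with rfl | rfl;
    rcases mem_support_derivation h with rfl | rfl | rfl;
    rcases mem_support_lieAction h with rfl | rfl | rfl] <;>
  refine ⟨by decide, rfl, fun C hC => ?_⟩ <;>
  simp [innerEdges, clusters, leafSet_node, leafSet_leaf] at hC <;> simp [hC]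

theorem dpath_left_comb (g h : LPOp) {a b c : X} (hac : a ≠ c) (hbc : b ≠ c) :
    dpath a (node g (node h (leaf a) (leaf b)) (leaf c)) =
      [vertexLetter g (min a b < c), vertexLetter h (a < b)] ∧
    dpath b (node g (node h (leaf a) (leaf b)) (leaf c)) =
      [vertexLetter g (min a b < c), vertexLetter h (a < b)] ∧
    dpath c (node g (node h (leaf a) (leaf b)) (leaf c)) = [vertexLetter g (min a b < c)] := by
  simp [dpath, labels, minL, hac.symm, hbc.symm]

theorem dpath_right_comb (g h : LPOp) {a b c : X} (hab : a ≠ b) (hac : a ≠ c) :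
    dpath a (node g (leaf a) (node h (leaf b) (leaf c))) = [vertexLetter g (a < min b c)] ∧
    dpath b (node g (leaf a) (node h (leaf b) (leaf c))) =
      [vertexLetter g (a < min b c), vertexLetter h (b < c)] ∧
    dpath c (node g (leaf a) (node h (leaf b) (leaf c))) =
      [vertexLetter g (a < min b c), vertexLetter h (b < c)] := by
  simp [dpath, labels, minL, hac.symm, hab.symm]

theorem QMTreeLess.of_min {T T' : PTree LPOp X} (hp : T'.labels.Perm T.labels)
    (h : QMLt ρ (dpath T.minL T') (dpath T.minL T)) : QMTreeLess ρ T' T :=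
  ⟨hp, T.minL, minL_mem T, fun _ hy hlt => absurd (minL_le hy) hlt.not_ge, h⟩

attribute [local simp] QMLt QMEq xWord yWord List.filter qDegree vertexLetter straight swapped
  isX in
/-- The comparison of the terms of a relation. -/
theorem LPRule.less (hba : ρ .b < ρ .a) (hed : ρ .e < ρ .d) {r : PTree LPOp ℕ →₀ k}
    {T : PTree LPOp ℕ} {p : Prop → Prop → Prop → Prop} (h : LPRule k r T p) {μ : ℕ → X}
    (h01 : μ 0 ≠ μ 1) (h02 : μ 0 ≠ μ 2) (h12 : μ 1 ≠ μ 2)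
    (hp : p (μ 0 < μ 1) (μ 1 < μ 2) (μ 0 < μ 2)) {t : PTree LPOp ℕ} (ht : t ∈ r.support)
    (hne : t ≠ T) : QMTreeLess ρ (t.map μ) (T.map μ) := by
  have hr := h.mem
  have hperm : (t.map μ).labels.Perm (T.map μ).labels := by
    rw [labels_map, labels_map]
    exact ((mem_support_lpQuadraticRels hr.1 ht).1.trans
      (mem_support_lpQuadraticRels hr.1 hr.2).1.symm).map μ
  clear hr
  generalize ha : μ 0 = a, hb : μ 1 = b, hc : μ 2 = c at *
  cases h
  case jacobi =>
    obtain ⟨hab, hbc, hac⟩ := hp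
    rcases mem_support_jacobi ht with rfl | rfl | rfl
    · exact absurd rfl hne
    · simp only [PTree.map, ha, hb, hc] at hperm ⊢
      refine ⟨hperm, b, by simp [labels], fun y hy hlt => ?_, ?_⟩
      · have : y = a := by
          simp only [labels, mem_append, mem_singleton] at hy
          rcases hy with (hy | hy) | hy
          · exact hy
          · exact absurd hy hlt.ne
          · exact absurd (hy ▸ hlt) hbc.not_gt
        rw [this, (dpath_left_comb .β .β h02 h12).1, (dpath_left_comb .β .β h01 h12.symm).1]
        simp
      · rw [(dpath_left_comb .β .β h02 h12).2.1, (dpath_left_comb .β .β h01 h12.symm).2.2]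
        simp
    · refine .of_min hperm ?_
      simp only [PTree.map, ha, hb, hc, minL, min_eq_left hab.le, min_eq_left hac.le]
      rw [(dpath_left_comb .β .β h02 h12).1, (dpath_right_comb .β .β h01 h02).1]
      simp
  case assocLeft =>
    rcases mem_support_associativity ht with rfl | rfl
    · exact absurd rfl hne
    refine .of_min hperm ?_
    simp only [PTree.map, ha, hb, hc, minL]
    obtain ⟨l1, l2, l3⟩ := dpath_left_comb .a .a h02 h12
    obtain ⟨r1, r2, r3⟩ := dpath_right_comb .a .a h01 h02
    by_cases hcm : c < min a b
    · rw [min_eq_right hcm.le, l3, r3]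
      unfold vertexLetter
      split_ifs <;> simp
    · have hbc : b < c := by
        rcases lt_or_gt_of_ne h01 with h | h
        · rw [min_eq_left h.le, not_lt] at hcm
          exact absurd ⟨h, lt_of_le_of_ne hcm h02⟩ hp
        · rw [min_eq_right h.le, not_lt] at hcm
          exact lt_of_le_of_ne hcm h12
      have hba' : b < a := by
        by_contra h
        have hab := lt_of_le_of_ne (not_lt.1 h) h01
        exact hp ⟨hab, hab.trans hbc⟩
      rw [min_eq_right hba'.le, min_eq_left hbc.le, l2, r2, min_eq_right hba'.le,
        min_eq_left hbc.le]
      simp [hbc, hba'.not_gt, hba, List.cons_lt_cons_iff]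
  case assocRight =>
    obtain ⟨hab, hac⟩ := hp
    rcases mem_support_associativity ht with rfl | rfl
    swap
    · exact absurd rfl hne
    refine .of_min hperm ?_
    simp only [PTree.map, ha, hb, hc, minL]
    obtain ⟨l1, l2, l3⟩ := dpath_left_comb .a .a h02 h12
    obtain ⟨r1, r2, r3⟩ := dpath_right_comb .a .a h01 h02
    rw [min_eq_left (lt_min hab hac).le, l1, r1]
    unfold vertexLetter
    split_ifs <;> simp
  case derivation =>
    have hmin : (∀ z, min a (min b c) = z → z = a ∧ a < b ∧ a < c ∨ z = b ∧ b < a ∧ b < c ∨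
        z = c ∧ c < a ∧ c < b) := by
      rintro z rfl
      rcases lt_or_gt_of_ne h01 with h1 | h1 <;> rcases lt_or_gt_of_ne h02 with h2 | h2 <;>
        rcases lt_or_gt_of_ne h12 with h3 | h3 <;>
        simp [h1, h2, h3, h1.le, h2.le, h3.le, h1.not_gt, h2.not_gt, h3.not_gt]
      all_goals first
        | exact lt_irrefl _ ((h1.trans h3).trans h2)
        | exact lt_irrefl _ ((h1.trans h2).trans h3)
    rcases mem_support_derivation ht with rfl | rfl | rfl
    · exact absurd rfl hne
    · refine .of_min hperm ?_
      simp only [PTree.map, ha, hb, hc, minL]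
      obtain ⟨l1, l2, l3⟩ := dpath_right_comb .d .a h01 h02
      obtain ⟨r1, r2, r3⟩ := dpath_right_comb .a .d h01.symm h12
      rcases hmin _ rfl with ⟨e, h1, h2⟩ | ⟨e, h1, h2⟩ | ⟨e, h1, h2⟩ <;> rw [e]
      · rw [l1, r2]
        unfold vertexLetter
        split_ifs <;> simp
      · rw [l2, r1]
        simp [h1, h2, h1.not_gt]
      · rw [l3, r3]
        simp [h1.not_gt, h2.not_gt]
    · refine .of_min hperm ?_
      simp only [PTree.map, ha, hb, hc, minL]
      obtain ⟨l1, l2, l3⟩ := dpath_right_comb .d .a h01 h02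
      obtain ⟨r1, r2, r3⟩ := dpath_left_comb .a .d h02 h12
      rcases hmin _ rfl with ⟨e, h1, h2⟩ | ⟨e, h1, h2⟩ | ⟨e, h1, h2⟩ <;> rw [e]
      · rw [l1, r1]
        unfold vertexLetter
        split_ifs <;> simp
      · rw [l2, r2]
        simp [h2, h1.not_gt]
      · rw [l3, r3]
        simp [h1.not_gt, h2.not_gt]
  case actionLeft =>
    obtain ⟨hab, hac⟩ := hp
    obtain ⟨l1, l2, l3⟩ := dpath_left_comb .d .β h02 h12
    rcases mem_support_lieAction ht with rfl | rfl | rfl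
    · exact absurd rfl hne
    · refine .of_min hperm ?_
      simp only [PTree.map, ha, hb, hc, minL, min_eq_left hab.le, min_eq_left hac.le]
      rw [l1, (dpath_right_comb .d .d h01 h02).1]
      unfold vertexLetter
      split_ifs <;> simp
    · refine .of_min hperm ?_
      simp only [PTree.map, ha, hb, hc, minL, min_eq_left hab.le, min_eq_left hac.le]
      rw [l1, (dpath_right_comb .d .d h01.symm h12).2.1]
      simp [hab, hac, hab.not_gt, hac.le, hed, List.cons_lt_cons_iff]
  case actionRight =>
    obtain ⟨hab, hbc⟩ := hp
    have hba' : b < a := lt_of_le_of_ne (not_lt.1 hab) h01.symm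
    have hcb : c < b := lt_of_le_of_ne (not_lt.1 hbc) h12.symm
    obtain ⟨l1, l2, l3⟩ := dpath_right_comb .d .d h01 h02
    rcases mem_support_lieAction ht with rfl | rfl | rfl
    · refine .of_min hperm ?_
      simp only [PTree.map, ha, hb, hc, minL, min_eq_right hcb.le, min_eq_right (hcb.trans hba').le]
      rw [l3, (dpath_left_comb .d .β h02 h12).2.2]
      unfold vertexLetter
      split_ifs <;> simp
    · exact absurd rfl hne
    · obtain ⟨r1, r2, r3⟩ := dpath_right_comb .d .d h01.symm h12
      simp only [PTree.map, ha, hb, hc] at hperm ⊢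
      refine ⟨hperm, b, by simp [labels], fun y hy hlt => ?_, ?_⟩
      · have : y = c := by
          simp only [labels, mem_append, mem_singleton] at hy
          rcases hy with hy | hy | hy
          · exact absurd (hy ▸ hlt) hba'.not_gt
          · exact absurd hy hlt.ne
          · exact hy
        rw [this, l3, r3]
        simp [hab, hbc, (hcb.trans hba').not_gt]
      · rw [l2, r1]
        unfold vertexLetter
        split_ifs <;> simp

/-- The map that sends `0`, `1`, `2` to the given objects. -/
def triple {α : Type} (A B C : α) : ℕ → α
  | 0 => A
  | 1 => B
  | _ => C

theorem homogeneous_LP : Homogeneous lpSig (LP k).rels := .of (by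
  rintro r (rfl | rfl | rfl | rfl | rfl)
  · exact .antisymmetry rfl
  · exact .jacobi rfl rfl rfl
  · exact .associativity rfl rfl rfl
  · refine ⟨3, fun t ht t' ht' => ?_⟩
    rcases mem_support_derivation ht with rfl | rfl | rfl <;>
      rcases mem_support_derivation ht' with rfl | rfl | rfl <;>
      refine ⟨by decide, trivial, fun χ c => ?_⟩ <;>
      simp only [Signature.HasColour, lpSig] <;> tauto
  · exact .lieAction rfl rfl rfl rfl rfl rfl)

variable (k) in
/-- The relations of the operad of Leibniz pairs. -/
abbrev lpRels : Set (PTree LPOp ℕ →₀ k) := (LP k).rels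

theorem LPRule.reducible (hρ : Injective ρ) (hba : ρ .b < ρ .a) (hed : ρ .e < ρ .d)
    {r : PTree LPOp ℕ →₀ k} {T : PTree LPOp ℕ} {p : Prop → Prop → Prop → Prop}
    (h : LPRule k r T p) {A B C : PTree LPOp X} {N : Set (Set X)}
    (hAB : Disjoint A.leafSet B.leafSet) (hAC : Disjoint A.leafSet C.leafSet)
    (hBC : Disjoint B.leafSet C.leafSet) (hN : A.leafSet ∪ B.leafSet ∉ N ∧
      A.leafSet ∪ C.leafSet ∉ N ∧ B.leafSet ∪ C.leafSet ∉ N)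
    (hp : p (A.minL < B.minL) (B.minL < C.minL) (A.minL < C.minL)) :
    Reducible (lpRels k) (LPLess ρ) N (T.bind (triple A B C)) := by
  obtain ⟨hr, hT⟩ := h.mem
  refine reducible_of_subst (LPLess.irrefl hρ) (.inr hr) hT (fun t ht E hE => ?_)
    fun t ht hne => .inl ?_
  · rcases (mem_support_lpQuadraticRels hr ht).2.2 E hE with rfl | rfl | rfl <;>
      simp only [Set.biUnion_union, Set.biUnion_singleton, triple] <;> tauto
  · have hl := (mem_support_lpQuadraticRels hr ht).1
    have hl' := (mem_support_lpQuadraticRels hr hT).1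
    refine QMTreeLess.bind (hl.trans hl'.symm) ?_ (h.less hba hed (μ := fun i =>
      (triple A B C i).minL) (minL_ne_of_disjoint hAB) (minL_ne_of_disjoint hAC)
      (minL_ne_of_disjoint hBC) hp ht hne)
    intro i hi j hj hij
    have hi := hl'.mem_iff.1 hi
    have hj := hl'.mem_iff.1 hj
    simp only [List.mem_cons, List.not_mem_nil, or_false] at hi hj
    rcases hi with rfl | rfl | rfl <;> rcases hj with rfl | rfl | rfl <;>
      first | exact absurd rfl hij | assumption | exact Disjoint.symm (by assumption)

/-- A tree that is not normal at the root, although its root is in the right order, is an instance of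
a rule. -/
theorem exists_rule {N : Set (Set X)} {g : LPOp} {l r : PTree LPOp X} (hl : lpRules.Normal N l)
    (ho : lpRules.ori g (l.minL < r.minL)) :
    (lpRules.badLeft g l r → ∃ (h : LPOp) (A B : PTree LPOp X) (rel : PTree LPOp ℕ →₀ k)
      (T : PTree LPOp ℕ) (p : Prop → Prop → Prop → Prop), l = .node h A B ∧ LPRule k rel T p ∧
        .node g l r = T.bind (triple A B r) ∧
        p (A.minL < B.minL) (B.minL < r.minL) (A.minL < r.minL)) ∧
    (lpRules.badRight g l r → ∃ (h : LPOp) (B C : PTree LPOp X) (rel : PTree LPOp ℕ →₀ k)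
      (T : PTree LPOp ℕ) (p : Prop → Prop → Prop → Prop), r = .node h B C ∧ LPRule k rel T p ∧
        .node g l r = T.bind (triple l B C) ∧
        p (l.minL < B.minL) (B.minL < C.minL) (l.minL < C.minL)) := by
  constructor
  · intro hb
    cases l with
    | leaf x => exact hb.elim
    | node h A B =>
      refine ⟨h, A, B, ?_⟩
      cases g <;> cases h <;> try exact hb.elim
      · have hab : A.minL < B.minL := hl.1
        have hac : A.minL < r.minL := by
          have h : (PTree.node LPOp.β A B).minL < r.minL := ho
          rwa [minL, min_eq_left hab.le] at h
        exact ⟨_, _, _, rfl, .jacobi, rfl, hab, hb, hac⟩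
      · exact ⟨_, _, _, rfl, .assocLeft, rfl, hb⟩
      · exact ⟨_, _, _, rfl, .actionLeft, rfl, hl.1, hb⟩
  · intro hb
    cases r with
    | leaf x => cases g <;> exact hb.elim
    | node h B C =>
      refine ⟨h, B, C, ?_⟩
      cases g <;> cases h <;> try exact hb.elim
      · exact ⟨_, _, _, rfl, .assocRight, rfl, hb⟩
      · exact ⟨_, _, _, rfl, .derivation, rfl, trivial⟩
      · exact ⟨_, _, _, rfl, .actionRight, rfl, hb⟩

theorem reducible_of_not_normal_node (hρ : Injective ρ) (hba : ρ .b < ρ .a)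
    (hed : ρ .e < ρ .d) {N : Set (Set X)} {g : LPOp} {l r : PTree LPOp X}
    (hn : (PTree.node g l r).labels.Nodup) (hc : ClosedCuts N (PTree.node g l r))
    (hl : lpRules.Normal N l) (hr : lpRules.Normal N r)
    (hnn : ¬ lpRules.Normal N (.node g l r)) :
    Reducible (lpRels k) (LPLess ρ) N (PTree.node g l r) := by
  obtain ⟨h1, h2, hd⟩ := nodup_node hn
  by_cases ho : lpRules.ori g (l.minL < r.minL)
  · obtain ⟨hL, hR⟩ := exists_rule (k := k) (r := r) hl ho
    by_cases hbl : lpRules.badLeft g l r ∧ l.leafSet ∉ N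
    · obtain ⟨h, A, B, rel, T, p, rfl, hrule, e, hp⟩ := hL hbl.1
      obtain ⟨_, _, hd'⟩ := nodup_node h1
      have hN := hc.notMem_left hn hbl.2
      rw [leafSet_node, Set.disjoint_union_left] at hd
      rw [e]
      exact hrule.reducible hρ hba hed hd' hd.1 hd.2 hN hp
    by_cases hbr : lpRules.badRight g l r ∧ r.leafSet ∉ N
    · obtain ⟨h, B, C, rel, T, p, rfl, hrule, e, hp⟩ := hR hbr.1
      obtain ⟨_, _, hd'⟩ := nodup_node h2
      have hN := hc.notMem_right hn hbr.2
      rw [leafSet_node, Set.disjoint_union_right] at hd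
      rw [e]
      exact hrule.reducible hρ hba hed hd.1 hd.2 hd' hN hp
    · exact (hnn ⟨ho, fun h => not_not.1 fun h' => hbl ⟨h, h'⟩,
        fun h => not_not.1 fun h' => hbr ⟨h, h'⟩, hl, hr⟩).elim
  · cases g with
    | a => exact (ho trivial).elim
    | d => exact (ho trivial).elim
    | β =>
      have hlt : r.minL < l.minL := lt_of_le_of_ne (not_lt.1 ho) (minL_ne_of_disjoint hd).symm
      have hsupp : ∀ t ∈ (antisymmetry k LPOp.β).support,
          t = node .β (leaf 0) (leaf 1) ∨ t = node .β (leaf 1) (leaf 0) := fun t ht =>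
        (support_add_mon ht).imp_left support_mon
      refine reducible_of_subst (T := node .β (leaf 0) (leaf 1)) (s := triple l r r)
        (LPLess.irrefl hρ) (.inl rfl) ?_ (fun t ht C hC => ?_) fun t ht hne => .inr ?_
      · rw [mem_support_iff]
        simp [antisymmetry, mon]
      · rcases hsupp t ht with rfl | rfl <;> exact (hC.elim id id).elim
      · obtain rfl := (hsupp t ht).resolve_left hne
        refine ⟨perm_append_comm, fun y hy => ?_, ?_⟩
        · change QMEq (dpath y (node .β r l)) (dpath y (node .β l r))
          rcases mem_append.1 hy with hy | hy
          · have hy' : y ∉ r.labels := fun h => disjoint_left.1 hd hy h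
            rw [dpath, dpath, if_neg hy', if_pos (show y ∈ l.labels from hy)]
            unfold vertexLetter
            split_ifs <;> exact .refl _
          · have hy' : y ∉ l.labels := fun h => disjoint_left.1 hd h hy
            rw [dpath, dpath, if_neg hy', if_pos (show y ∈ r.labels from hy)]
            unfold vertexLetter
            split_ifs <;> exact .refl _
        · change disorder (node .β r l) < disorder (node .β l r)
          rw [disorder, disorder, if_pos (show lpRules.ori .β (r.minL < l.minL) from hlt), if_neg ho]
          omega

theorem isRewriting_LP (hρ : Injective ρ) (hba : ρ .b < ρ .a) (hed : ρ .e < ρ .d) :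
    IsRewriting (X := X) (LP k).rels lpRules (LPLess ρ) where
  irrefl := LPLess.irrefl hρ
  trans _ _ _ := LPLess.trans hρ
  left g _ _ u hn _ h := h.left g u hn
  right g _ _ u hn _ h := h.right g u hn
  reducible _ _ _ _ hn hc hl hr hnn := reducible_of_not_normal_node hρ hba hed hn hc hl hr hnn

instance : Finite LPOp :=
  Finite.of_injective (fun | .β => 0 | .a => 1 | .d => 2 : LPOp → Fin 3) fun g g' h => by
    cases g <;> cases g' <;> first | rfl | simp at h

theorem isKoszul_LP : (LP k).IsKoszul := by
  have : Finite (LP k).Op := inferInstanceAs (Finite LPOp)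
  let ρ : ShOp → ℕ := fun | .β => 0 | .b => 1 | .a => 2 | .e => 3 | .d => 4
  have hρ : Injective ρ := fun g g' h => by
    cases g <;> cases g' <;> first | rfl | simp [ρ] at h
  exact Presentation.isKoszul_of_rules homogeneous_LP independentNormal_LP fun n =>
    isRewriting_LP hρ (by simp [ρ]) (by simp [ρ])

end QMOrder

/-! ## Shuffle trees and planar trees -/

section Planar

open PTree Colour

variable {X Y : Type}

namespace PTree

/-- The path from the root to the leaf `x`, with the directions of its steps. -/
def directedPath {Op : Type} (x : ℕ) : PTree Op ℕ → List (Op × Bool)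
  | .leaf _ => []
  | .node g l r => (g, decide (x ∈ l.labels)) ::
      (if x ∈ l.labels then directedPath x l else directedPath x r)

theorem map_fst_directedPath {Op : Type} (x : ℕ) (t : PTree Op ℕ) :
    (directedPath x t).map Prod.fst = t.path x := by
  induction t with
  | leaf y => rfl
  | node g l r hl hr =>
    rw [directedPath, path, List.map_cons, apply_ite (List.map Prod.fst), hl, hr]

theorem directedPath_bind {Op : Type} {t : PTree Op ℕ} {s : ℕ → PTree Op ℕ} {i : ℕ}
    (hi : i ∈ t.labels) (hd : ∀ j ∈ t.labels, j ≠ i → Disjoint (s j).leafSet (s i).leafSet) {x : ℕ}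
    (hx : x ∈ (s i).labels) :
    directedPath x (t.bind s) = directedPath i t ++ directedPath x (s i) := by
  induction t with
  | leaf j =>
    rw [labels, mem_singleton] at hi
    subst hi
    rfl
  | node g l r hl hr =>
    have key : ∀ l : PTree Op ℕ, (∀ j ∈ l.labels, j ≠ i →
        Disjoint (s j).leafSet (s i).leafSet) → (x ∈ (l.bind s).labels ↔ i ∈ l.labels) := by
      intro l hd
      rw [labels_bind, mem_flatMap]
      refine ⟨fun ⟨j, hj, h⟩ => ?_, fun h => ⟨i, h, hx⟩⟩
      by_contra hne
      exact disjoint_left.1 (hd j hj fun e => hne (e ▸ hj)) h hx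
    have hdl := fun j hj => hd j (mem_append_left r.labels hj)
    have hdr := fun j hj => hd j (mem_append_right l.labels hj)
    simp only [PTree.bind, directedPath, key l hdl, cons_append]
    by_cases h : i ∈ l.labels
    · rw [if_pos h, if_pos h, hl h hdl]
    · rw [if_neg h, if_neg h, hr ((mem_append.1 hi).resolve_left h) hdr]

theorem eq_of_directedPath {Op : Type} {t t' : PTree Op ℕ} (hn : t.labels.Nodup)
    (hn' : t'.labels.Nodup) (hs : t.leafSet = t'.leafSet)
    (h : ∀ x ∈ t.labels, directedPath x t = directedPath x t') : t = t' := by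
  induction t generalizing t' with
  | leaf x =>
    cases t' with
    | leaf y =>
      rw [leafSet_leaf, leafSet_leaf, Set.singleton_eq_singleton_iff] at hs
      rw [hs]
    | node g l r => cases h x (List.mem_singleton_self x)
  | node g l r hl hr =>
    cases t' with
    | leaf y => cases h _ (minL_mem _)
    | node g' l' r' =>
      obtain ⟨h1, h2, hd⟩ := nodup_node hn
      obtain ⟨h1', h2', hd'⟩ := nodup_node hn'
      have e : ∀ x ∈ (node g l r).labels, g = g' ∧ (x ∈ l.labels ↔ x ∈ l'.labels) := fun x hx => by
        have := h x hx
        simp only [directedPath, List.cons.injEq, Prod.mk.injEq, decide_eq_decide] at this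
        exact this.1
      have key : l.leafSet = l'.leafSet := by
        ext x
        constructor
        · intro hx
          exact (e x (mem_append_left _ hx)).2.1 hx
        · intro hx
          have : x ∈ (node g l r).leafSet := hs ▸ mem_append_left _ hx
          exact (e x this).2.2 hx
      have key' : r.leafSet = r'.leafSet := by
        rw [leafSet_node, leafSet_node] at hs
        rw [← Set.union_sdiff_cancel_left (Set.disjoint_iff.1 hd), hs, key,
          Set.union_sdiff_cancel_left (Set.disjoint_iff.1 hd')]
      rw [(e _ (minL_mem _)).1, hl h1 h1' key ?_, hr h2 h2' key' ?_] <;> intro x hx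
      · have hx' : x ∉ l.labels := fun h => disjoint_left.1 hd h hx
        have := h x (mem_append_right _ hx)
        rw [directedPath, directedPath, if_neg hx',
          if_neg fun h => hx' ((e x (mem_append_right _ hx)).2.2 h)] at this
        exact List.tail_eq_of_cons_eq this
      · have := h x (mem_append_left _ hx)
        rw [directedPath, directedPath, if_pos hx,
          if_pos ((e x (mem_append_left _ hx)).2.1 hx)] at this
        exact List.tail_eq_of_cons_eq this

theorem minL_map_of_strictMonoOn [LinearOrder X] [LinearOrder Y] {Op : Type} {f : X → Y}
    {t : PTree Op X} (hf : StrictMonoOn f t.leafSet) : (t.map f).minL = f t.minL := by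
  induction t with
  | leaf x => rfl
  | node g l r hl hr =>
    rw [leafSet_node] at hf
    rw [PTree.map, minL, minL, hl (hf.mono Set.subset_union_left), hr (hf.mono Set.subset_union_right)]
    exact (hf.monotoneOn.map_min (.inl (minL_mem l)) (.inr (minL_mem r))).symm

end PTree

theorem labels_planar (t : PTree LPOp ℕ) : (planar t).labels.Perm t.labels := by
  induction t with
  | leaf x => exact .refl _
  | node g l r hl hr =>
    rw [planar]
    split_ifs
    · exact hl.append hr
    · exact (hr.append hl).trans perm_append_comm

theorem minLabel_planar (t : PTree LPOp ℕ) : (planar t).minLabel = t.minLabel := by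
  rw [minLabel_eq_minL, minLabel_eq_minL]
  exact minL_eq_of_leafSet_eq (leafSet_eq_of_perm (labels_planar t))

theorem path_planar {t : PTree LPOp ℕ} (hn : t.labels.Nodup) {x : ℕ} (hx : x ∈ t.labels) :
    (planar t).path x = dpath x t := by
  induction t with
  | leaf y => rfl
  | node g l r hl hr =>
    obtain ⟨h1, h2, hd⟩ := nodup_node hn
    have hl' : ∀ h : x ∈ l.labels, x ∉ r.labels := fun h h' => disjoint_left.1 hd h h'
    rw [planar, dpath, minLabel_eq_minL, minLabel_eq_minL]
    unfold vertexLetter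
    split_ifs with hlt hxl hxl <;> rw [path]
    · rw [if_pos ((labels_planar l).mem_iff.2 hxl), hl h1 hxl]
    · rw [if_neg (mt (labels_planar l).mem_iff.1 hxl), hr h2 ((mem_append.1 hx).resolve_left hxl)]
    · rw [if_neg (mt (labels_planar r).mem_iff.1 (hl' hxl)), hl h1 hxl]
    · have := (mem_append.1 hx).resolve_left hxl
      rw [if_pos ((labels_planar r).mem_iff.2 this), hr h2 this]

theorem isShuffle_planar {t : PTree LPOp ℕ} (hn : t.labels.Nodup) : (planar t).IsShuffle := by
  induction t with
  | leaf y => trivial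
  | node g l r hl hr =>
    obtain ⟨h1, h2, hd⟩ := nodup_node hn
    rw [planar]
    split_ifs with h
    · exact ⟨by rwa [minLabel_planar, minLabel_planar], hl h1, hr h2⟩
    · refine ⟨?_, hr h2, hl h1⟩
      rw [minLabel_planar, minLabel_planar]
      rw [minLabel_eq_minL, minLabel_eq_minL] at h ⊢
      exact lt_of_le_of_ne (not_lt.1 h) (minL_ne_of_disjoint hd).symm

theorem hasColour_planar {χ : ℕ → Colour} {c : Colour} {t : PTree LPOp ℕ}
    (h : lpSig.HasColour χ c t) : shSig.HasColour χ c (planar t) := by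
  induction t generalizing c with
  | leaf y => exact h
  | node g l r hl hr =>
    obtain ⟨h1, h2, h3⟩ := h
    rw [planar]
    split_ifs
    · cases g <;> exact ⟨h1, hl h2, hr h3⟩
    · cases g <;> exact ⟨h1, hr h3, hl h2⟩

theorem planar_bind {t : PTree LPOp ℕ} {s : ℕ → PTree LPOp ℕ}
    (hs : StrictMonoOn (fun i => (s i).minLabel) t.leafSet) :
    planar (t.bind s) = (planar t).bind fun i => planar (s i) := by
  induction t with
  | leaf y => rfl
  | node g l r hl hr =>
    rw [leafSet_node] at hs
    have e : ∀ t : PTree LPOp ℕ, StrictMonoOn (fun i => (s i).minLabel) t.leafSet →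
        (t.bind s).minLabel = (s t.minLabel).minLabel := fun t ht => by
      rw [minLabel_eq_minL, minL_bind, minLabel_eq_minL t]
      simp only [← minLabel_eq_minL (s _)]
      exact minL_map_of_strictMonoOn ht
    have h1 := hs.mono Set.subset_union_left
    have h2 := hs.mono Set.subset_union_right
    have e' : (l.bind s).minLabel < (r.bind s).minLabel ↔ l.minLabel < r.minLabel := by
      rw [e l h1, e r h2]
      refine hs.lt_iff_lt (.inl ?_) (.inr ?_) <;> rw [minLabel_eq_minL] <;> exact minL_mem _
    simp only [PTree.bind, planar, e', hl h1, hr h2]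
    split_ifs <;> rfl

/-- The planar tree of a shuffle tree. -/
def unplanar : PTree ShOp ℕ → PTree LPOp ℕ
  | .leaf x => .leaf x
  | .node .β l r => .node .β (unplanar l) (unplanar r)
  | .node .a l r => .node .a (unplanar l) (unplanar r)
  | .node .d l r => .node .d (unplanar l) (unplanar r)
  | .node .b l r => .node .a (unplanar r) (unplanar l)
  | .node .e l r => .node .d (unplanar r) (unplanar l)

theorem labels_unplanar (t : PTree ShOp ℕ) : (unplanar t).labels.Perm t.labels := by
  induction t with
  | leaf x => exact .refl _
  | node g l r hl hr =>
    cases g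
    · exact hl.append hr
    · exact hl.append hr
    · exact (hr.append hl).trans perm_append_comm
    · exact hl.append hr
    · exact (hr.append hl).trans perm_append_comm

theorem minLabel_unplanar (t : PTree ShOp ℕ) : (unplanar t).minLabel = t.minLabel := by
  rw [minLabel_eq_minL, minLabel_eq_minL]
  exact minL_eq_of_leafSet_eq (leafSet_eq_of_perm (labels_unplanar t))

theorem planar_unplanar {t : PTree ShOp ℕ} (ht : t.IsShuffle) : planar (unplanar t) = t := by
  induction t with
  | leaf x => rfl
  | node g l r hl hr =>
    obtain ⟨h, h1, h2⟩ := ht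
    cases g <;> simp only [unplanar, planar, minLabel_unplanar, h, h.not_gt, if_true, if_false, hl h1,
      hr h2] <;> rfl

theorem hasColour_unplanar {χ : ℕ → Colour} {c : Colour} {t : PTree ShOp ℕ}
    (h : shSig.HasColour χ c t) : lpSig.HasColour χ c (unplanar t) := by
  induction t generalizing c with
  | leaf y => exact h
  | node g l r hl hr =>
    obtain ⟨h1, h2, h3⟩ := h
    cases g
    · exact ⟨h1, hl h2, hr h3⟩
    · exact ⟨h1, hl h2, hr h3⟩
    · exact ⟨h1, hr h3, hl h2⟩
    · exact ⟨h1, hl h2, hr h3⟩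
    · exact ⟨h1, hr h3, hl h2⟩

theorem QMTreeLess.planar {ρ : ShOp → ℕ} {n : ℕ} {t t' : PTree LPOp ℕ}
    (ht : t.labels.Perm (List.range n)) (h : QMTreeLess ρ t' t) :
    QMTreeLt ρ (planar t') (planar t) := by
  obtain ⟨hp, x, hx, h1, h2⟩ := h
  have hn := ht.nodup_iff.2 nodup_range
  have hn' := hp.nodup_iff.2 hn
  have e : (ColouredOperad.planar t').labels.length = n := by
    rw [((labels_planar t').trans (hp.trans ht)).length_eq, length_range]
  refine .inr ⟨(((labels_planar t').trans hp).trans (labels_planar t).symm).length_eq, x, ?_, ?_, ?_⟩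
  · rw [e]
    exact mem_range.1 (ht.mem_iff.1 hx)
  · intro j hj
    have hj' : j ∈ t.labels := ht.mem_iff.2 (mem_range.2 (hj.trans (mem_range.1 (ht.mem_iff.1 hx))))
    rw [path_planar hn' (hp.mem_iff.2 hj'), path_planar hn hj']
    exact h1 j hj' hj
  · rw [path_planar hn' (hp.mem_iff.2 hx), path_planar hn hx]
    exact h2

/-! ### Evaluation of shuffle trees -/

/-- The operations on words that correspond to the generators of the shuffle operad. -/
def shuffleOp : ShOp → WordPair k X →ₗ[k] WordPair k X →ₗ[k] WordPair k X
  | .β => wordOp .β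
  | .a => wordOp .a
  | .b => (wordOp .a).flip
  | .d => wordOp .d
  | .e => (wordOp .d).flip

theorem evalTree_unplanar (v : ℕ → WordPair k X) (t : PTree ShOp ℕ) :
    evalTree wordOp v (unplanar t) = evalTree shuffleOp v t := by
  induction t with
  | leaf x => rfl
  | node g l r hl hr => cases g <;> simp only [unplanar, evalTree, hl, hr, shuffleOp, flip_apply]

theorem shuffleOp_straight (g : LPOp) : shuffleOp (k := k) (X := X) (straight g) = wordOp g := by
  cases g <;> rfl

theorem shuffleOp_swapped (g : LPOp) (x y : WordPair k X) :
    (swapSign g : k) • shuffleOp (swapped g) y x = wordOp g x y := by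
  cases g
  · simp [swapSign, swapped, shuffleOp, wordOp_β, bracket_apply]
  · simp [swapSign, swapped, shuffleOp]
  · simp [swapSign, swapped, shuffleOp]

theorem evalTree_planar (v : ℕ → WordPair k X) (t : PTree LPOp ℕ) :
    (planarSign t : k) • evalTree shuffleOp v (planar t) = evalTree wordOp v t := by
  induction t with
  | leaf x => simp [planarSign, planar, evalTree]
  | node g l r hl hr =>
    rw [evalTree, ← hl, ← hr, planar, planarSign]
    split_ifs
    · rw [evalTree, shuffleOp_straight]
      simp only [map_smul, LinearMap.smul_apply, smul_smul]
      push_cast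
      congr 1
      ring
    · rw [evalTree, ← shuffleOp_swapped]
      simp only [map_smul, LinearMap.smul_apply, smul_smul]
      push_cast
      congr 1
      ring

theorem evalLin_planarize (v : ℕ → WordPair k X) (f : PTree LPOp ℕ →₀ k) :
    evalLin shuffleOp v (planarize k f) = evalLin wordOp v f := by
  induction f using induction_linear with
  | zero => simp
  | add f g hf hg => rw [map_add, map_add, map_add, hf, hg]
  | single t a =>
    rw [planarize, linearCombination_single, smul_single, evalLin_single, evalLin_single,
      smul_eq_mul, mul_smul, evalTree_planar]

theorem evalLin_shuffleOp_shInstance {f : PTree ShOp ℕ →₀ k} (hf : ShInstance (lpShuffleRels k) f)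
    (v : ℕ → WordPair k X) : evalLin shuffleOp v f = 0 := by
  induction hf with
  | subst g hg m hm s hs =>
    obtain ⟨r, hr, σ, -, rfl⟩ := hg
    rw [evalLin_mapDomain_bind, evalLin_planarize]
    have : (fun t : PTree LPOp ℕ => t.map σ) = fun t => t.bind fun i => .leaf (σ i) :=
      funext fun t => map_eq_bind _ t
    change evalLin wordOp _ (r.mapDomain fun t : PTree LPOp ℕ => t.map σ) = 0
    rw [this, evalLin_mapDomain_bind]
    exact evalLin_wordOp_rels _ r (.inr hr)
  | left g f t _ ih => rw [evalLin_left, ih, map_zero, LinearMap.zero_apply]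
  | right g t f _ ih => rw [evalLin_right, ih, map_zero]

theorem evalLin_mapDomain_unplanar (v : ℕ → WordPair k X) (f : PTree ShOp ℕ →₀ k) :
    evalLin wordOp v (f.mapDomain unplanar) = evalLin shuffleOp v f := by
  induction f using induction_linear with
  | zero => simp
  | add f g hf hg => rw [mapDomain_add, map_add, map_add, hf, hg]
  | single t a => rw [mapDomain_single, evalLin_single, evalLin_single, evalTree_unplanar]

theorem evalLin_unplanar_of_mem_shIdeal {n : ℕ} {χ : ℕ → Colour} {c : Colour} {f : PTree ShOp ℕ →₀ k}
    (hf : f ∈ shIdeal shSig (lpShuffleRels k) n χ c) (v : ℕ → WordPair k X) :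
    evalLin wordOp v (f.mapDomain unplanar) = 0 := by
  rw [evalLin_mapDomain_unplanar]
  have : shIdeal shSig (lpShuffleRels k) n χ c ≤ LinearMap.ker (evalLin shuffleOp v) :=
    span_le.2 fun g hg => evalLin_shuffleOp_shInstance hg.1 v
  exact this hf

theorem support_subset_of_mem_shIdeal {n : ℕ} {χ : ℕ → Colour} {c : Colour} {f : PTree ShOp ℕ →₀ k}
    (hf : f ∈ shIdeal shSig (lpShuffleRels k) n χ c) : ↑f.support ⊆ shMonomials shSig n χ c := by
  have : shIdeal shSig (lpShuffleRels k) n χ c ≤ supported k k (shMonomials shSig n χ c) :=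
    span_le.2 fun g hg => hg.2
  exact this hf

end Planar

/-! ## The Gröbner basis of the operad of Leibniz pairs -/

section Groebner

open PTree Colour

/-- Three distinct values can be sorted. -/
theorem exists_sorting {X : Type} [LinearOrder X] (μ : ℕ → X) (h01 : μ 0 ≠ μ 1) (h02 : μ 0 ≠ μ 2)
    (h12 : μ 1 ≠ μ 2) : ∃ τ : Equiv.Perm ℕ, (∀ i, 3 ≤ i → τ i = i) ∧
      StrictMonoOn (fun i => μ (τ i)) (Set.Iio 3) := by
  let f : Fin 3 → X := fun i => μ i
  have hf : Injective f := fun i j h => by fin_cases i <;> fin_cases j <;> simp_all [f]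
  have hm := (Tuple.monotone_sort f).strictMono_of_injective (hf.comp (Equiv.injective _))
  have e := Equiv.Perm.extendDomain_apply_image (Tuple.sort f) Fin.equivSubtype
  refine ⟨(Tuple.sort f).extendDomain Fin.equivSubtype, fun i hi =>
    Equiv.Perm.extendDomain_apply_not_subtype _ _ (not_lt.2 hi), fun i hi j hj hij => ?_⟩
  have := hm (a := ⟨i, hi⟩) (b := ⟨j, hj⟩) hij
  rw [Function.comp_apply, Function.comp_apply] at this
  exact (congrArg μ (e ⟨i, hi⟩)).trans_lt (this.trans_eq (congrArg μ (e ⟨j, hj⟩)).symm)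

variable {ρ : ShOp → ℕ}

theorem exists_hasColour {r : PTree LPOp ℕ →₀ k} (hr : r ∈ lpQuadraticRels k) :
    ∃ (χ : ℕ → Colour) (c : Colour), ∀ t ∈ r.support, lpSig.HasColour χ c t := by
  rcases hr with rfl | rfl | rfl | rfl
  · refine ⟨fun _ => D, D, fun t ht => ?_⟩
    rcases mem_support_jacobi ht with rfl | rfl | rfl <;> simp [Signature.HasColour, lpSig]
  · refine ⟨fun _ => S, S, fun t ht => ?_⟩
    rcases mem_support_associativity ht with rfl | rfl <;> simp [Signature.HasColour, lpSig]
  · refine ⟨fun i => if i = 0 then D else S, S, fun t ht => ?_⟩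
    rcases mem_support_derivation ht with rfl | rfl | rfl <;> simp [Signature.HasColour, lpSig]
  · refine ⟨fun i => if i = 2 then S else D, S, fun t ht => ?_⟩
    rcases mem_support_lieAction ht with rfl | rfl | rfl <;> simp [Signature.HasColour, lpSig]

theorem range_three_map_perm {σ : Equiv.Perm ℕ} (hσ : ∀ i, 3 ≤ i → σ i = i) :
    ([0, 1, 2].map σ).Perm (List.range 3) := by
  have hlt : ∀ i < 3, σ i < 3 := fun i hi => by
    by_contra h
    have := σ.injective (hσ _ (not_lt.1 h))
    omega
  refine (List.subperm_of_subset (List.Nodup.map σ.injective (by decide)) fun x hx => ?_).perm_of_length_le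
    (by simp)
  obtain ⟨i, hi, rfl⟩ := mem_map.1 hx
  exact mem_range.2 (hlt i (by simp at hi; omega))

theorem mem_support_planarize {f : PTree LPOp ℕ →₀ k} {t : PTree ShOp ℕ}
    (h : t ∈ (planarize k f).support) : ∃ s ∈ f.support, planar s = t := by
  rw [planarize, linearCombination_apply] at h
  classical
  obtain ⟨s, hs, h⟩ := Finset.mem_biUnion.1 (Finsupp.support_sum h)
  exact ⟨s, hs, (Finset.mem_singleton.1 (support_single_subset (Finsupp.support_smul h))).symm⟩

theorem planarSign_ne_zero [CharZero k] (t : PTree LPOp ℕ) : (planarSign t : k) ≠ 0 := by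
  rw [Int.cast_ne_zero]
  induction t with
  | leaf x => exact one_ne_zero
  | node g l r hl hr =>
    rw [planarSign]
    refine mul_ne_zero (mul_ne_zero ?_ hl) hr
    split_ifs
    · exact one_ne_zero
    · cases g <;> simp [swapSign]

theorem mem_support_shuffleRel {r : PTree LPOp ℕ →₀ k} {σ : Equiv.Perm ℕ} {t : PTree ShOp ℕ}
    (h : t ∈ (planarize k (r.mapDomain (PTree.map σ))).support) :
    ∃ s ∈ r.support, planar (s.map σ) = t := by
  obtain ⟨s, hs, rfl⟩ := mem_support_planarize h
  obtain ⟨s', hs', rfl⟩ := exists_of_mem_mapDomain hs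
  exact ⟨s', hs', rfl⟩

theorem labels_map_perm_range {r : PTree LPOp ℕ →₀ k} (hr : r ∈ lpQuadraticRels k)
    {σ : Equiv.Perm ℕ} (hσ : ∀ i, 3 ≤ i → σ i = i) {T : PTree LPOp ℕ} (hT : T ∈ r.support) :
    (T.map σ).labels.Perm (List.range 3) := by
  rw [labels_map]
  exact ((mem_support_lpQuadraticRels hr hT).1.map σ).trans (range_three_map_perm hσ)

theorem planar_map_mem_shMonomials {r : PTree LPOp ℕ →₀ k} (hr : r ∈ lpQuadraticRels k)
    {σ : Equiv.Perm ℕ} (hσ : ∀ i, 3 ≤ i → σ i = i) :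
    ∃ χ c, ∀ s ∈ r.support, planar (s.map σ) ∈ shMonomials shSig 3 χ c := by
  obtain ⟨χ, c, h⟩ := exists_hasColour hr
  refine ⟨χ ∘ σ.symm, c, fun s hs => ?_⟩
  have hp := labels_map_perm_range hr hσ hs
  exact ⟨(labels_planar _).trans hp, hasColour_planar ((h s hs).map (by simp)),
    isShuffle_planar (hp.nodup_iff.2 nodup_range)⟩

theorem planarize_mapDomain_apply {r : PTree LPOp ℕ →₀ k} {σ : Equiv.Perm ℕ} {T : PTree LPOp ℕ}
    (h : ∀ t ∈ r.support, planar (t.map σ) = planar (T.map σ) → t = T) :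
    planarize k (r.mapDomain (PTree.map σ)) (planar (T.map σ)) = r T * planarSign (T.map σ) := by
  rw [planarize, Finsupp.linearCombination_mapDomain, linearCombination_apply, Finsupp.sum,
    Finsupp.finsetSum_apply, sum_eq_single T]
  · simp
  · intro t ht hne
    rw [Finsupp.smul_apply, Function.comp_apply, single_eq_of_ne fun e => hne (h t ht e.symm),
      smul_zero]
  · intro hT
    rw [Finsupp.notMem_support_iff.1 hT, zero_smul, Finsupp.zero_apply]

theorem LPRule.isLeadingTerm [CharZero k] (hba : ρ .b < ρ .a)
    (hed : ρ .e < ρ .d) {le : PTree ShOp ℕ → PTree ShOp ℕ → Prop} (hle : IsAdmissible shSig le)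
    (hqm : ExtendsQM ρ le) {r : PTree LPOp ℕ →₀ k} {T : PTree LPOp ℕ}
    {p : Prop → Prop → Prop → Prop} (h : LPRule k r T p) {σ : Equiv.Perm ℕ}
    (hσ : ∀ i, 3 ≤ i → σ i = i) (hp : p (σ 0 < σ 1) (σ 1 < σ 2) (σ 0 < σ 2)) :
    IsLeadingTerm le (planarize k (r.mapDomain (PTree.map σ))) (planar (T.map σ)) := by
  obtain ⟨hr, hT⟩ := h.mem
  obtain ⟨χ, c, hm⟩ := planar_map_mem_shMonomials hr hσ
  have hne : ∀ i j : ℕ, i ≠ j → σ i ≠ σ j := fun i j hij e => hij (σ.injective e)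
  have lt : ∀ t ∈ r.support, t ≠ T → le (planar (t.map σ)) (planar (T.map σ)) ∧
      ¬ le (planar (T.map σ)) (planar (t.map σ)) := fun t ht hne' =>
    hqm 3 3 _ ⟨χ, c, hm t ht⟩ _ ⟨χ, c, hm T hT⟩ ((h.less hba hed (hne 0 1 (by omega))
      (hne 0 2 (by omega)) (hne 1 2 (by omega)) hp ht hne').planar (labels_map_perm_range hr hσ hT))
  have refl := hle.refl 3 _ ⟨χ, c, hm T hT⟩
  constructor
  · rw [mem_support_iff, planarize_mapDomain_apply]
    · exact mul_ne_zero (mem_support_iff.1 hT) (planarSign_ne_zero _)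
    · intro t ht e
      by_contra hne'
      have := (lt t ht hne').2
      rw [e] at this
      exact this refl
  · intro s hs
    obtain ⟨t, ht, rfl⟩ := mem_support_shuffleRel hs
    by_cases e : t = T
    · rwa [e]
    · exact (lt t ht e).1

theorem planarize_ne_zero [CharZero k] {r : PTree LPOp ℕ →₀ k} (hr : r ∈ lpQuadraticRels k)
    {σ : Equiv.Perm ℕ} (hσ : ∀ i, 3 ≤ i → σ i = i) : planarize k (r.mapDomain (PTree.map σ)) ≠ 0 := by
  have depth : ∀ t ∈ r.support, ((planar (t.map σ)).path (σ 2)).length =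
      (dpath (σ 2) (t.map σ)).length := fun t ht => by
    have hp := labels_map_perm_range hr hσ ht
    rw [path_planar (hp.nodup_iff.2 nodup_range)]
    rw [labels_map]
    exact List.mem_map_of_mem ((mem_support_lpQuadraticRels hr ht).1.mem_iff.2 (by simp))
  obtain ⟨T, hT, h⟩ : ∃ T ∈ r.support, ∀ t ∈ r.support,
      (dpath (σ 2) (t.map σ)).length = (dpath (σ 2) (T.map σ)).length → t = T := by
    rcases hr with rfl | rfl | rfl | rfl
    · refine ⟨_, (LPRule.jacobi (k := k)).mem.2, fun t ht => ?_⟩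
      rcases mem_support_jacobi ht with rfl | rfl | rfl <;> simp [PTree.map, dpath, labels]
    · refine ⟨_, (LPRule.assocLeft (k := k)).mem.2, fun t ht => ?_⟩
      rcases mem_support_associativity ht with rfl | rfl <;> simp [PTree.map, dpath, labels]
    · refine ⟨node .a (node .d (leaf 0) (leaf 1)) (leaf 2), ?_, fun t ht => ?_⟩
      · rw [mem_support_iff]
        simp [derivation, mon]
      · rcases mem_support_derivation ht with rfl | rfl | rfl <;> simp [PTree.map, dpath, labels]
    · refine ⟨_, (LPRule.actionLeft (k := k)).mem.2, fun t ht => ?_⟩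
      rcases mem_support_lieAction ht with rfl | rfl | rfl <;> simp [PTree.map, dpath, labels]
  intro e
  have := planarize_mapDomain_apply (σ := σ) (T := T) fun t ht e =>
    h t ht (by rw [← depth t ht, ← depth T hT, e])
  rw [e, Finsupp.zero_apply] at this
  exact mul_ne_zero (mem_support_iff.1 hT) (planarSign_ne_zero _) this.symm

theorem isQuadratic_lpShuffleRels [CharZero k] : IsQuadratic shSig (lpShuffleRels k) := by
  rintro _ ⟨r, hr, σ, hσ, rfl⟩
  obtain ⟨χ, c, hm⟩ := planar_map_mem_shMonomials hr hσ
  refine ⟨planarize_ne_zero hr hσ, ⟨3, χ, c, fun t ht => ?_⟩, fun t ht => ?_⟩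
  · obtain ⟨s, hs, rfl⟩ := mem_support_shuffleRel ht
    exact hm s hs
  · obtain ⟨s, hs, rfl⟩ := mem_support_shuffleRel ht
    have h1 := length_labels (planar (s.map σ))
    rw [(hm s hs).1.length_eq, length_range] at h1
    omega

theorem LPRule.exists_divides [CharZero k] (hba : ρ .b < ρ .a)
    (hed : ρ .e < ρ .d) {le : PTree ShOp ℕ → PTree ShOp ℕ → Prop} (hle : IsAdmissible shSig le)
    (hqm : ExtendsQM ρ le) {r : PTree LPOp ℕ →₀ k} {T : PTree LPOp ℕ}
    {p : Prop → Prop → Prop → Prop} (h : LPRule k r T p) {A B C : PTree LPOp ℕ}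
    (hAB : Disjoint A.leafSet B.leafSet) (hAC : Disjoint A.leafSet C.leafSet)
    (hBC : Disjoint B.leafSet C.leafSet)
    (hp : p (A.minL < B.minL) (B.minL < C.minL) (A.minL < C.minL)) :
    ∃ g ∈ lpShuffleRels k, ∃ t', IsLeadingTerm le g t' ∧
      Divides t' (planar (T.bind (triple A B C))) := by
  obtain ⟨hr, hT⟩ := h.mem
  obtain ⟨τ, hτ, hmono⟩ := exists_sorting (fun i => (triple A B C i).minL) (minL_ne_of_disjoint hAB)
    (minL_ne_of_disjoint hAC) (minL_ne_of_disjoint hBC)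
  have hσ : ∀ i, 3 ≤ i → τ.symm i = i := fun i hi => by rw [Equiv.symm_apply_eq, hτ i hi]
  have hlt : ∀ i < 3, τ.symm i ∈ Set.Iio 3 := fun i hi => by
    by_contra h
    have := τ.symm.injective (hσ _ (not_lt.1 h))
    simp only [Set.mem_Iio] at h
    omega
  have e : ∀ i < 3, ∀ j < 3, (τ.symm i < τ.symm j) =
      ((triple A B C i).minL < (triple A B C j).minL) := fun i hi j hj => propext (by
    have := hmono.lt_iff_lt (hlt i hi) (hlt j hj)
    simp only [Equiv.apply_symm_apply] at this
    exact this.symm)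
  refine ⟨_, ⟨r, hr, τ.symm, hσ, rfl⟩, _, h.isLeadingTerm hba hed hle hqm hσ ?_, ?_⟩
  · rw [e 0 (by omega) 1 (by omega), e 1 (by omega) 2 (by omega), e 0 (by omega) 2 (by omega)]
    exact hp
  · have hperm := labels_map_perm_range hr hσ hT
    have e1 : T.bind (triple A B C) = (T.map τ.symm).bind fun i => triple A B C (τ i) := by
      rw [bind_map]
      exact bind_congr fun i _ => congrArg _ (τ.apply_symm_apply i).symm
    rw [e1, planar_bind]
    · refine .root 3 ((labels_planar _).trans hperm) _ fun i j hij hj => ?_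
      simp only [minLabel_planar]
      rw [minLabel_eq_minL, minLabel_eq_minL]
      exact hmono (hij.trans hj) hj hij
    · refine StrictMonoOn.mono (s := Set.Iio 3) ?_ fun i hi => mem_range.1 (hperm.mem_iff.1 hi)
      simpa only [minLabel_eq_minL] using hmono

/-- Every shuffle tree that is not normal is divisible by a leading term. -/
theorem exists_divides_of_not_normal [CharZero k] (hba : ρ .b < ρ .a)
    (hed : ρ .e < ρ .d) {le : PTree ShOp ℕ → PTree ShOp ℕ → Prop} (hle : IsAdmissible shSig le)
    (hqm : ExtendsQM ρ le) {t : PTree ShOp ℕ} (ht : t.IsShuffle) (hn : t.labels.Nodup)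
    (h : ¬ lpRules.Normal ∅ (unplanar t)) :
    ∃ g ∈ lpShuffleRels k, ∃ t', IsLeadingTerm le g t' ∧ Divides t' t := by
  induction t with
  | leaf x => exact (h trivial).elim
  | node g l r hl hr =>
    obtain ⟨h1, h2, -⟩ := nodup_node hn
    by_cases nl : lpRules.Normal ∅ (unplanar l)
    swap
    · obtain ⟨g', hg', t', ht', hd⟩ := hl ht.2.1 h1 nl
      exact ⟨g', hg', t', ht', .left _ _ _ hd⟩
    by_cases nr : lpRules.Normal ∅ (unplanar r)
    swap
    · obtain ⟨g', hg', t', ht', hd⟩ := hr ht.2.2 h2 nr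
      exact ⟨g', hg', t', ht', .right _ _ _ hd⟩
    obtain ⟨g', L, R, e, nL, nR, ho⟩ : ∃ g' L R, unplanar (.node g l r) = .node g' L R ∧
        lpRules.Normal ∅ L ∧ lpRules.Normal ∅ R ∧ lpRules.ori g' (L.minL < R.minL) := by
      cases g
      · refine ⟨_, _, _, rfl, nl, nr, ?_⟩
        change (unplanar l).minL < (unplanar r).minL
        rw [← minLabel_eq_minL, ← minLabel_eq_minL, minLabel_unplanar, minLabel_unplanar]
        exact ht.1
      · exact ⟨_, _, _, rfl, nl, nr, trivial⟩
      · exact ⟨_, _, _, rfl, nr, nl, trivial⟩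
      · exact ⟨_, _, _, rfl, nl, nr, trivial⟩
      · exact ⟨_, _, _, rfl, nr, nl, trivial⟩
    have hn' := (labels_unplanar (.node g l r)).nodup_iff.2 hn
    rw [← planar_unplanar ht]
    rw [e] at h hn' ⊢
    obtain ⟨n1, n2, hd⟩ := nodup_node hn'
    obtain ⟨hL, hR⟩ := exists_rule (k := k) nL ho (r := R)
    by_cases hbl : lpRules.badLeft g' L R
    · obtain ⟨h', A, B, rel, T, p, rfl, hrule, e', hp⟩ := hL hbl
      rw [leafSet_node, Set.disjoint_union_left] at hd
      rw [e']
      exact hrule.exists_divides hba hed hle hqm (nodup_node n1).2.2 hd.1 hd.2 hp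
    by_cases hbr : lpRules.badRight g' L R
    · obtain ⟨h', B, C, rel, T, p, rfl, hrule, e', hp⟩ := hR hbr
      rw [leafSet_node, Set.disjoint_union_right] at hd
      rw [e']
      exact hrule.exists_divides hba hed hle hqm hd.1 hd.2 (nodup_node n2).2.2 hp
    · exact (h ⟨ho, fun h => (hbl h).elim, fun h => (hbr h).elim, nL, nR⟩).elim

theorem exists_isLeadingTerm {le : PTree ShOp ℕ → PTree ShOp ℕ → Prop} (hle : IsAdmissible shSig le)
    {f : PTree ShOp ℕ →₀ k} (hf : f ≠ 0) {n : ℕ} (hs : ∀ t ∈ f.support, t ∈ allShMonomials shSig n) :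
    ∃ t, IsLeadingTerm le f t := by
  let r : f.support → f.support → Prop := fun a b => le a b
  have hm := fun a : f.support => hs a a.2
  have refl := fun a : f.support => hle.refl n _ (hm a)
  have : IsTrans _ r := ⟨fun a b c => hle.trans n n n _ (hm a) _ (hm b) _ (hm c)⟩
  have : Nonempty f.support := (Finsupp.support_nonempty_iff.2 hf).to_subtype
  have D : Directed r id := fun a b => (hle.total n n _ (hm a) _ (hm b)).elim
    (fun h => ⟨b, h, refl b⟩) fun h => ⟨a, refl a, h⟩
  obtain ⟨z, hz⟩ := D.finset_le f.support.attach
  exact ⟨z, z.2, fun s h => hz ⟨s, h⟩ (Finset.mem_attach ..)⟩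

theorem single_unplanar_mem [CharZero k] (hρ : Injective ρ) (hba : ρ .b < ρ .a)
    (hed : ρ .e < ρ .d) {le : PTree ShOp ℕ → PTree ShOp ℕ → Prop} 
    (hqm : ExtendsQM ρ le) {n : ℕ} {χ : ℕ → Colour} {c : Colour} {s t : PTree ShOp ℕ}
    (hs : s ∈ shMonomials shSig n χ c) (ht : t ∈ shMonomials shSig n χ c) (hst : le s t) (hne : s ≠ t) :
    single (unplanar s) (1 : k) ∈ supported k k {T | T.labels.Nodup ∧
      (∃ c, lpSig.Composable c T) ∧ lpRules.Normal ∅ T ∧ T ≠ unplanar t} ⊔ relSpan (lpRels k) ∅ := by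
  have : Finite (LP k).Op := inferInstanceAs (Finite LPOp)
  have hp := (labels_unplanar s).trans hs.1
  have hn := hp.nodup_iff.2 nodup_range
  refine supported_sup_mono ?_ _ ((isRewriting_LP (k := k) hρ hba hed).single_mem homogeneous_LP hn
    (N := ∅) fun C hC => hC.elim)
  rintro T ⟨h1, h2, -, h4, h5⟩
  refine ⟨h1.nodup_iff.1 hn, ⟨c, (h2 χ c (hasColour_unplanar hs.2.1)).composable⟩, h4, ?_⟩
  rintro rfl
  have inj : unplanar t = unplanar s → False := fun e => hne (by
    rw [← planar_unplanar hs.2.2, ← e, planar_unplanar ht.2.2])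
  rcases h5 with h5 | h5
  · exact inj h5
  rcases h5 with h5 | ⟨-, h5, h6⟩
  · have := h5.planar hp
    rw [planar_unplanar hs.2.2, planar_unplanar ht.2.2] at this
    exact (hqm n n t ⟨χ, c, ht⟩ s ⟨χ, c, hs⟩ this).2 hst
  · have zero : ∀ s : PTree ShOp ℕ, s.IsShuffle → disorder (unplanar s) = 0 := by
      intro s hs
      induction s with
      | leaf x => rfl
      | node g l r hl hr =>
        cases g
        · rw [unplanar, disorder, hl hs.2.1, hr hs.2.2, if_pos]
          change (unplanar l).minL < (unplanar r).minL
          rw [← minLabel_eq_minL, ← minLabel_eq_minL, minLabel_unplanar, minLabel_unplanar]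
          exact hs.1
        all_goals rw [unplanar, disorder, hl hs.2.1, hr hs.2.2, if_pos (by trivial)]
    rw [zero s hs.2.2] at h6
    omega

theorem isGroebnerBasis_lpShuffleRels [CharZero k] (hρ : Injective ρ) (hba : ρ .b < ρ .a)
    (hed : ρ .e < ρ .d) {le : PTree ShOp ℕ → PTree ShOp ℕ → Prop} (hle : IsAdmissible shSig le)
    (hqm : ExtendsQM ρ le) : IsGroebnerBasis shSig le (lpShuffleRels k) := by
  intro n χ c f hf hf0
  have hs := support_subset_of_mem_shIdeal hf
  obtain ⟨t, ht⟩ := exists_isLeadingTerm hle hf0 fun t ht => ⟨χ, c, hs ht⟩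
  have htm := hs ht.1
  refine ⟨t, ht, exists_divides_of_not_normal hba hed hle hqm htm.2.2
    (htm.1.nodup_iff.2 nodup_range) fun hnormal => ?_⟩
  set A : Set (PTree LPOp ℕ) := {T | T.labels.Nodup ∧
      (∃ c, lpSig.Composable c T) ∧ lpRules.Normal ∅ T ∧ T ≠ unplanar t}
  have hrest : (f.erase t).mapDomain unplanar ∈ supported k k A ⊔ relSpan (lpRels k) ∅ := by
    refine Submodule.sum_mem _ fun s hs' => ?_
    classical
    rw [Finsupp.support_erase, mem_erase] at hs'
    change single (unplanar s) (f.erase t s) ∈ _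
    rw [← mul_one (f.erase t s), ← smul_eq_mul, ← smul_single]
    exact smul_mem _ _ (single_unplanar_mem hρ hba hed hqm (hs hs'.2) htm (ht.2 s hs'.2) hs'.1)
  obtain ⟨h, hh, z, hz, e⟩ := mem_sup.1 hrest
  have hz0 : evalLin wordOp wordLeaf z = 0 := evalLin_relSpan (V := WordPair k ℕ)
    (R := lpRels k) wordOp (fun r hr v => evalLin_wordOp_rels v r hr) hz wordLeaf
  have hsum : f.mapDomain unplanar = single (unplanar t) (f t) + (h + z) := by
    rw [e, ← mapDomain_single, ← mapDomain_add, Finsupp.single_add_erase]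
  have h0 := evalLin_unplanar_of_mem_shIdeal hf (wordLeaf (k := k) (X := ℕ))
  rw [hsum, ← add_assoc, map_add, hz0, add_zero] at h0
  have hA : h (unplanar t) = 0 := by
    by_contra hne
    exact (hh (mem_support_iff.2 hne)).2.2.2 rfl
  have := independentNormal_of_evalLin h0 fun T hT => ?_
  · have := DFunLike.congr_fun this (unplanar t)
    rw [Finsupp.add_apply, Finsupp.single_eq_same, hA, add_zero] at this
    exact mem_support_iff.1 ht.1 this
  · classical
    rcases mem_union.1 (Finsupp.support_add hT) with hT | hT
    · rw [Finset.mem_singleton.1 (support_single_subset hT)]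
      exact ⟨((labels_unplanar t).trans htm.1).nodup_iff.2 nodup_range,
        ⟨c, (hasColour_unplanar htm.2.1).composable⟩, hnormal⟩
    · obtain ⟨h1, h2, h3, -⟩ := hh hT
      exact ⟨h1, h2, h3⟩

end Groebner

/-! ## An admissible order that extends the QM-ordering -/

section AdmissibleOrder

open PTree

variable {Op K : Type} [LinearOrder K]

/-- A key of words that is compatible with concatenation. -/
structure IsPathKey {A : Type} (φ : List A → K) : Prop where
  eq : ∀ {u u' v v'}, φ u = φ u' → φ v = φ v' → φ (u ++ v) = φ (u' ++ v')
  left : ∀ {u u' v v'}, φ u = φ u' → φ v < φ v' → φ (u ++ v) < φ (u' ++ v')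
  right : ∀ {u u' v v'}, φ u < φ u' → φ v = φ v' → φ (u ++ v) < φ (u' ++ v')

/-- The vector of the keys of the paths of a tree. -/
def pathVector (φ : List (Op × Bool) → K) (t : PTree Op ℕ) : Lex (ℕ → K) :=
  toLex fun i => if i < t.labels.length then φ (directedPath i t) else φ []

variable {φ : List (Op × Bool) → K}

theorem pathVector_eq_iff {t t' : PTree Op ℕ} {n : ℕ} (h : t.labels.length = n)
    (h' : t'.labels.length = n) : pathVector φ t = pathVector φ t' ↔
      ∀ i < n, φ (directedPath i t) = φ (directedPath i t') := by
  rw [pathVector, pathVector, h, h', EmbeddingLike.apply_eq_iff_eq, funext_iff]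
  refine forall_congr' fun i => ?_
  split_ifs with hi <;> simp [hi]

theorem pathVector_lt_iff {t t' : PTree Op ℕ} {n : ℕ} (h : t.labels.length = n)
    (h' : t'.labels.length = n) : pathVector φ t < pathVector φ t' ↔
      ∃ i < n, (∀ j < i, φ (directedPath j t) = φ (directedPath j t')) ∧
        φ (directedPath i t) < φ (directedPath i t') := by
  have e : pathVector φ t < pathVector φ t' ↔ ∃ i, (∀ j < i, (if j < n then φ (directedPath j t)
      else φ []) = if j < n then φ (directedPath j t') else φ []) ∧
      (if i < n then φ (directedPath i t) else φ []) < if i < n then φ (directedPath i t') else φ [] := by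
    rw [pathVector, pathVector, h, h']; rfl
  rw [e]
  constructor
  · rintro ⟨i, h1, h2⟩
    have hi : i < n := by
      by_contra hi
      rw [if_neg hi, if_neg hi] at h2
      exact lt_irrefl _ h2
    rw [if_pos hi, if_pos hi] at h2
    refine ⟨i, hi, fun j hj => ?_, h2⟩
    have := h1 j hj
    rwa [if_pos (hj.trans hi), if_pos (hj.trans hi)] at this
  · rintro ⟨i, hi, h1, h2⟩
    refine ⟨i, fun j hj => ?_, ?_⟩
    · rw [if_pos (hj.trans hi), if_pos (hj.trans hi), h1 j hj]
    · rwa [if_pos hi, if_pos hi]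

theorem IsShuffleData.ne {m n i : ℕ} {u v : ℕ → ℕ} (h : IsShuffleData m n i u v) {j l : ℕ} (hj : j < m)
    (hl : l < n) (hne : j ≠ i) : u j ≠ v l := by
  intro e
  set U := (Finset.range m).image u
  set V := (Finset.range n).image v
  have hU : U.card = m := by
    rw [Finset.card_image_of_injOn, Finset.card_range]
    simpa [coe_range] using h.mono_left.injOn
  have hV : V.card = n := by
    rw [Finset.card_image_of_injOn, Finset.card_range]
    simpa [coe_range] using h.mono_right.injOn
  have hUV : U ∪ V = Finset.range (m + n - 1) := by
    rw [← Finset.coe_inj, Finset.coe_union, Finset.coe_image, Finset.coe_image, coe_range,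
      coe_range, coe_range, h.cover]
  have hcard := Finset.card_union_add_card_inter U V
  rw [hUV, hU, hV, Finset.card_range] at hcard
  have h2 : 1 < (U ∩ V).card := by
    refine Finset.one_lt_card.2 ⟨u i, ?_, u j, ?_, fun e => hne (h.mono_left.injOn hj h.lt e.symm)⟩
    · exact Finset.mem_inter.2 ⟨Finset.mem_image_of_mem u (Finset.mem_range.2 h.lt), h.eq ▸
        Finset.mem_image_of_mem v (Finset.mem_range.2 (by omega))⟩
    · exact Finset.mem_inter.2 ⟨Finset.mem_image_of_mem u (Finset.mem_range.2 hj), e ▸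
        Finset.mem_image_of_mem v (Finset.mem_range.2 hl)⟩
  omega

theorem labels_shComp_perm {m n i : ℕ} {u v : ℕ → ℕ} {α β : PTree Op ℕ}
    (hα : α.labels.Perm (List.range m)) (hβ : β.labels.Perm (List.range n)) :
    (shComp i u v α β).labels.Perm
      ((List.range m).flatMap fun j => if j = i then (List.range n).map v else [u j]) := by
  rw [shComp, labels_bind]
  refine (hα.flatMap_right _).trans (List.Perm.flatMap_left _ fun j _ => ?_)
  split_ifs
  · rw [labels_map]; exact hβ.map v
  · exact .refl _

section Paths

variable {m n i : ℕ} {u v : ℕ → ℕ} (h : IsShuffleData m n i u v) {α β : PTree Op ℕ}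
  (hα : α.labels.Perm (List.range m)) (hβ : β.labels.Perm (List.range n))

include h hα hβ

theorem directedPath_shComp_left {j : ℕ} (hj : j < m) (hne : j ≠ i) :
    directedPath (u j) (shComp i u v α β) = directedPath j α := by
  rw [shComp, directedPath_bind (i := j) (hα.mem_iff.2 (mem_range.2 hj)), if_neg hne]
  · exact List.append_nil _
  · intro l hl hlj
    have hl' := mem_range.1 (hα.mem_iff.1 hl)
    rw [if_neg hne, leafSet_leaf, Set.disjoint_singleton_right]
    split_ifs with hli
    · rw [mem_leafSet, labels_map, mem_map]
      rintro ⟨x, hx, e⟩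
      exact h.ne hj (mem_range.1 (hβ.mem_iff.1 hx)) hne e.symm
    · rw [leafSet_leaf, mem_singleton_iff]
      exact fun e => hlj (h.mono_left.injOn hj hl' e).symm
  · rw [if_neg hne]; exact List.mem_singleton_self _

theorem directedPath_shComp_right {l : ℕ} (hl : l < n) :
    directedPath (v l) (shComp i u v α β) = directedPath i α ++ directedPath l β := by
  have hl' : l ∈ β.labels := hβ.mem_iff.2 (mem_range.2 hl)
  have e : directedPath (v l) (β.map v) = directedPath l β := by
    rw [map_eq_bind, directedPath_bind hl' _ (List.mem_singleton_self _)]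
    · exact List.append_nil _
    · intro x hx hne
      rw [leafSet_leaf, leafSet_leaf, Set.disjoint_singleton]
      exact fun e => hne (h.mono_right.injOn (mem_range.1 (hβ.mem_iff.1 hx)) hl e)
  rw [shComp, directedPath_bind (i := i) (hα.mem_iff.2 (mem_range.2 h.lt)), if_pos rfl, e]
  · intro j hj hne
    rw [if_neg hne, if_pos rfl, leafSet_leaf, Set.disjoint_singleton_left, mem_leafSet, labels_map,
      mem_map]
    rintro ⟨x, hx, e⟩
    exact h.ne (mem_range.1 (hα.mem_iff.1 hj)) (mem_range.1 (hβ.mem_iff.1 hx)) hne e.symm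
  · rw [if_pos rfl, labels_map]
    exact List.mem_map_of_mem hl'

end Paths

theorem IsShuffleData.cases {m n i : ℕ} {u v : ℕ → ℕ} (h : IsShuffleData m n i u v) (hn : 0 < n) {x : ℕ}
    (hx : x < m + n - 1) : (∃ j < m, j ≠ i ∧ u j = x) ∨ ∃ l < n, v l = x := by
  have : x ∈ u '' Set.Iio m ∪ v '' Set.Iio n := h.cover ▸ hx
  rcases this with ⟨j, hj, rfl⟩ | ⟨l, hl, rfl⟩
  · by_cases e : j = i
    · exact .inr ⟨0, hn, by rw [e, h.eq]⟩
    · exact .inl ⟨j, hj, e, rfl⟩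
  · exact .inr ⟨l, hl, rfl⟩

section Compare

variable {m n i : ℕ} {u v : ℕ → ℕ} (h : IsShuffleData m n i u v) {α α' β β' : PTree Op ℕ}
  (hα : α.labels.Perm (List.range m)) (hα' : α'.labels.Perm (List.range m))
  (hβ : β.labels.Perm (List.range n)) (hβ' : β'.labels.Perm (List.range n)) 
  (hlen : (shComp i u v α β).labels.length = m + n - 1)

include h hα hα' hβ hβ' hlen

theorem length_shComp_eq : (shComp i u v α' β').labels.length = m + n - 1 := by
  rw [← hlen]
  exact ((labels_shComp_perm hα' hβ').trans (labels_shComp_perm hα hβ).symm).length_eq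

theorem pathVector_shComp_eq (hφ : IsPathKey φ) (hn : 0 < n)
    (e : pathVector φ α = pathVector φ α') (e' : pathVector φ β = pathVector φ β') :
    pathVector φ (shComp i u v α β) = pathVector φ (shComp i u v α' β') := by
  have lα := hα.length_eq.trans length_range
  have lα' := hα'.length_eq.trans length_range
  have lβ := hβ.length_eq.trans length_range
  have lβ' := hβ'.length_eq.trans length_range
  rw [pathVector_eq_iff lα lα'] at e
  rw [pathVector_eq_iff lβ lβ'] at e'
  rw [pathVector_eq_iff hlen (length_shComp_eq h hα hα' hβ hβ' hlen)]
  intro x hx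
  rcases h.cases hn hx with ⟨j, hj, hne, rfl⟩ | ⟨l, hl, rfl⟩
  · rw [directedPath_shComp_left h hα hβ hj hne, directedPath_shComp_left h hα' hβ' hj hne, e j hj]
  · rw [directedPath_shComp_right h hα hβ hl, directedPath_shComp_right h hα' hβ' hl]
    exact hφ.eq (e i h.lt) (e' l hl)

theorem pathVector_shComp_lt_right (hφ : IsPathKey φ) (hn : 0 < n)
    (e : pathVector φ α = pathVector φ α') (e' : pathVector φ β < pathVector φ β') :
    pathVector φ (shComp i u v α β) < pathVector φ (shComp i u v α' β') := by
  have lα := hα.length_eq.trans length_range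
  have lα' := hα'.length_eq.trans length_range
  have lβ := hβ.length_eq.trans length_range
  have lβ' := hβ'.length_eq.trans length_range
  rw [pathVector_eq_iff lα lα'] at e
  rw [pathVector_lt_iff lβ lβ'] at e'
  rw [pathVector_lt_iff hlen (length_shComp_eq h hα hα' hβ hβ' hlen)]
  obtain ⟨l, hl, h1, h2⟩ := e'
  have hvl : v l < m + n - 1 := by
    have : v l ∈ Set.Iio (m + n - 1) := h.cover ▸ Or.inr ⟨l, hl, rfl⟩
    exact this
  refine ⟨v l, hvl, fun x hx => ?_, ?_⟩
  · rcases h.cases hn (hx.trans hvl) with ⟨j, hj, hne, rfl⟩ | ⟨l', hl', rfl⟩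
    · rw [directedPath_shComp_left h hα hβ hj hne, directedPath_shComp_left h hα' hβ' hj hne, e j hj]
    · rw [directedPath_shComp_right h hα hβ hl', directedPath_shComp_right h hα' hβ' hl']
      exact hφ.eq (e i h.lt) (h1 l' ((h.mono_right.lt_iff_lt hl' hl).1 hx))
  · rw [directedPath_shComp_right h hα hβ hl, directedPath_shComp_right h hα' hβ' hl]
    exact hφ.left (e i h.lt) h2

theorem pathVector_shComp_lt_left (hφ : IsPathKey φ) (hn : 0 < n)
    (e : pathVector φ α < pathVector φ α') (e' : pathVector φ β = pathVector φ β') :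
    pathVector φ (shComp i u v α β) < pathVector φ (shComp i u v α' β') := by
  have lα := hα.length_eq.trans length_range
  have lα' := hα'.length_eq.trans length_range
  have lβ := hβ.length_eq.trans length_range
  have lβ' := hβ'.length_eq.trans length_range
  rw [pathVector_lt_iff lα lα'] at e
  rw [pathVector_eq_iff lβ lβ'] at e'
  rw [pathVector_lt_iff hlen (length_shComp_eq h hα hα' hβ hβ' hlen)]
  obtain ⟨j₀, hj₀, h1, h2⟩ := e
  have hu : u j₀ < m + n - 1 := by
    have : u j₀ ∈ Set.Iio (m + n - 1) := h.cover ▸ Or.inl ⟨j₀, hj₀, rfl⟩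
    exact this
  refine ⟨u j₀, hu, fun x hx => ?_, ?_⟩
  · rcases h.cases hn (hx.trans hu) with ⟨j, hj, hne, rfl⟩ | ⟨l, hl, rfl⟩
    · rw [directedPath_shComp_left h hα hβ hj hne, directedPath_shComp_left h hα' hβ' hj hne,
        h1 j ((h.mono_left.lt_iff_lt hj hj₀).1 hx)]
    · rw [directedPath_shComp_right h hα hβ hl, directedPath_shComp_right h hα' hβ' hl]
      refine hφ.eq (h1 i ((h.mono_left.lt_iff_lt h.lt hj₀).1 ?_)) (e' l hl)
      rw [h.eq]
      exact (h.mono_right.monotoneOn hn hl (Nat.zero_le l)).trans_lt hx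
  · by_cases hne : j₀ = i
    · subst hne
      rw [h.eq, directedPath_shComp_right h hα hβ hn, directedPath_shComp_right h hα' hβ' hn]
      exact hφ.right h2 (e' 0 hn)
    · rwa [directedPath_shComp_left h hα hβ hj₀ hne, directedPath_shComp_left h hα' hβ' hj₀ hne]

end Compare

/-! ### The order -/

variable {ρ : ShOp → ℕ}

def qmPathKey (ρ : ShOp → ℕ) (w : List (ShOp × Bool)) : ℕᵒᵈ ×ₗ List ℕ ×ₗ ℕ ×ₗ List ℕ ×ₗ ℕ :=
  qmKey ρ (w.map Prod.fst)

theorem isPathKey_qmPathKey (hρ : Injective ρ) : IsPathKey (qmPathKey ρ) where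
  eq h h' := by
    simp only [qmPathKey, map_append, qmKey_eq_iff hρ] at *
    exact h.append h'
  left h h' := by
    simp only [qmPathKey, map_append, qmKey_eq_iff hρ, qmKey_lt_iff hρ] at *
    exact h'.append_left h
  right h h' := by
    simp only [qmPathKey, map_append, qmKey_eq_iff hρ, qmKey_lt_iff hρ] at *
    exact h.append_right h'

/-- The code of a step of a path. -/
def stepCode (ρ : ShOp → ℕ) (s : ShOp × Bool) : ℕ := 2 * ρ s.1 + s.2.toNat

theorem stepCode_injective (hρ : Injective ρ) : Injective (stepCode ρ) := by
  rintro ⟨g, x⟩ ⟨g', x'⟩ h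
  simp only [stepCode] at h
  cases x <;> cases x' <;> simp only [Bool.toNat_true, Bool.toNat_false] at h <;>
    first | omega | (have : ρ g = ρ g' := by omega); rw [hρ this]

/-- Directed paths are compared by length and then lexicographically. -/
def directedKey (ρ : ShOp → ℕ) (w : List (ShOp × Bool)) : ℕ ×ₗ List ℕ :=
  toLex (w.length, w.map (stepCode ρ))

theorem directedKey_eq_iff (hρ : Injective ρ) {u v : List (ShOp × Bool)} :
    directedKey ρ u = directedKey ρ v ↔ u = v := by
  refine ⟨fun h => ?_, fun h => h ▸ rfl⟩
  simp only [directedKey, EmbeddingLike.apply_eq_iff_eq, Prod.mk.injEq] at h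
  exact List.map_injective_iff.2 (stepCode_injective hρ) h.2

theorem directedKey_lt_iff {u v : List (ShOp × Bool)} : directedKey ρ u < directedKey ρ v ↔
    u.length < v.length ∨ u.length = v.length ∧ u.map (stepCode ρ) < v.map (stepCode ρ) := by
  simp only [directedKey, Prod.Lex.lt_iff, ofLex_toLex]

theorem isPathKey_directedKey (hρ : Injective ρ) : IsPathKey (directedKey ρ) where
  eq h h' := by
    rw [directedKey_eq_iff hρ] at *
    rw [h, h']
  left h h' := by
    rw [directedKey_eq_iff hρ] at h
    rw [directedKey_lt_iff] at *
    rw [h]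
    simp only [length_append, map_append]
    rcases h' with h' | ⟨e, h'⟩
    · exact .inl (by omega)
    · exact .inr ⟨by omega, List.append_left_lt h'⟩
  right h h' := by
    rw [directedKey_eq_iff hρ] at h'
    rw [directedKey_lt_iff] at *
    rw [h']
    simp only [length_append, map_append]
    rcases h with h | ⟨e, h⟩
    · exact .inl (by omega)
    · exact .inr ⟨by omega, append_lt_append_of_lt h (by simpa using e) _ _⟩

/-- The arity, the vector of the words, and the vector of the directed words. -/
def treeKey (ρ : ShOp → ℕ) (t : PTree ShOp ℕ) :
    ℕ ×ₗ Lex (ℕ → ℕᵒᵈ ×ₗ List ℕ ×ₗ ℕ ×ₗ List ℕ ×ₗ ℕ) ×ₗ Lex (ℕ → ℕ ×ₗ List ℕ) :=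
  toLex (t.labels.length, toLex (pathVector (qmPathKey ρ) t, pathVector (directedKey ρ) t))

theorem treeKey_le_iff {t t' : PTree ShOp ℕ} (h : t.labels.length = t'.labels.length) :
    treeKey ρ t ≤ treeKey ρ t' ↔ pathVector (qmPathKey ρ) t < pathVector (qmPathKey ρ) t' ∨
      pathVector (qmPathKey ρ) t = pathVector (qmPathKey ρ) t' ∧
      (pathVector (directedKey ρ) t < pathVector (directedKey ρ) t' ∨
        pathVector (directedKey ρ) t = pathVector (directedKey ρ) t') := by
  simp only [treeKey, Prod.Lex.le_iff, ofLex_toLex, h, lt_irrefl, false_or, true_and]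
  rw [le_iff_lt_or_eq]
  exact Iff.rfl

theorem length_of_mem_allShMonomials {n : ℕ} {t : PTree ShOp ℕ} (h : t ∈ allShMonomials shSig n) :
    t.labels.Perm (List.range n) ∧ t.labels.length = n := by
  obtain ⟨χ, c, h⟩ := h
  exact ⟨h.1, h.1.length_eq.trans length_range⟩

theorem isAdmissible_treeKey (hρ : Injective ρ) :
    IsAdmissible shSig fun t t' => treeKey ρ t ≤ treeKey ρ t' where
  refl _ _ _ := le_rfl
  trans _ _ _ _ _ _ _ _ _ := le_trans
  total _ _ _ _ _ _ := le_total _ _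
  antisymm m n t ht t' ht' h h' := by
    have e := le_antisymm h h'
    simp only [treeKey, EmbeddingLike.apply_eq_iff_eq, Prod.mk.injEq] at e
    obtain ⟨p, l⟩ := length_of_mem_allShMonomials ht
    obtain ⟨p', l'⟩ := length_of_mem_allShMonomials ht'
    obtain rfl : m = n := by rw [← l, ← l', e.1]
    have := (pathVector_eq_iff l l').1 e.2.2
    refine eq_of_directedPath (p.nodup_iff.2 nodup_range) (p'.nodup_iff.2 nodup_range)
      (leafSet_eq_of_perm (p.trans p'.symm)) fun x hx => ?_
    exact (directedKey_eq_iff hρ).1 (this x (mem_range.1 (p.mem_iff.1 hx)))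
  arity m n t ht t' ht' h := by
    have : treeKey ρ t < treeKey ρ t' := by
      refine Prod.Lex.lt_iff.2 (.inl ?_)
      simp only [treeKey, ofLex_toLex]
      rwa [(length_of_mem_allShMonomials ht).2, (length_of_mem_allShMonomials ht').2]
    exact ⟨this.le, this.not_ge⟩
  comp m n i u v h α hα α' hα' β hβ β' hβ' hc hc' h1 h2 := by
    obtain ⟨p, l⟩ := length_of_mem_allShMonomials hα
    obtain ⟨p', l'⟩ := length_of_mem_allShMonomials hα'
    obtain ⟨q, r⟩ := length_of_mem_allShMonomials hβ
    obtain ⟨q', r'⟩ := length_of_mem_allShMonomials hβ'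
    obtain ⟨-, s⟩ := length_of_mem_allShMonomials hc
    have hn : 0 < n := by
      rw [← r]
      exact List.length_pos_of_ne_nil (labels_ne_nil _)
    have hq := isPathKey_qmPathKey hρ
    have hd := isPathKey_directedKey hρ
    have s' := length_shComp_eq h p p q q' s
    have s'' := length_shComp_eq h p p' q q' s
    refine le_trans (b := treeKey ρ (shComp i u v α β')) ?_ ?_
    · rw [treeKey_le_iff (s.trans s'.symm)]
      rcases (treeKey_le_iff (r.trans r'.symm)).1 h2 with h2 | ⟨e, h2 | h2⟩
      · exact .inl (pathVector_shComp_lt_right h p p q q' s hq hn rfl h2)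
      · exact .inr ⟨pathVector_shComp_eq h p p q q' s hq hn rfl e,
          .inl (pathVector_shComp_lt_right h p p q q' s hd hn rfl h2)⟩
      · exact .inr ⟨pathVector_shComp_eq h p p q q' s hq hn rfl e,
          .inr (pathVector_shComp_eq h p p q q' s hd hn rfl h2)⟩
    · rw [treeKey_le_iff (s'.trans s''.symm)]
      rcases (treeKey_le_iff (l.trans l'.symm)).1 h1 with h1 | ⟨e, h1 | h1⟩
      · exact .inl (pathVector_shComp_lt_left h p p' q' q' s' hq hn h1 rfl)
      · exact .inr ⟨pathVector_shComp_eq h p p' q' q' s' hq hn e rfl,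
          .inl (pathVector_shComp_lt_left h p p' q' q' s' hd hn h1 rfl)⟩
      · exact .inr ⟨pathVector_shComp_eq h p p' q' q' s' hq hn e rfl,
          .inr (pathVector_shComp_eq h p p' q' q' s' hd hn h1 rfl)⟩

theorem extendsQM_treeKey (hρ : Injective ρ) :
    ExtendsQM ρ fun t t' => treeKey ρ t ≤ treeKey ρ t' := by
  intro m n t ht t' ht' h
  suffices treeKey ρ t < treeKey ρ t' from ⟨this.le, this.not_ge⟩
  refine Prod.Lex.lt_iff.2 ?_
  simp only [treeKey, ofLex_toLex]
  refine h.imp_right fun ⟨e, i, hi, h1, h2⟩ => ⟨e, Prod.Lex.lt_iff.2 (.inl ?_)⟩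
  simp only [ofLex_toLex]
  rw [pathVector_lt_iff e rfl]
  refine ⟨i, e ▸ hi, fun j hj => ?_, ?_⟩
  · rw [qmPathKey, qmPathKey, qmKey_eq_iff hρ, map_fst_directedPath, map_fst_directedPath]
    exact h1 j hj
  · rw [qmPathKey, qmPathKey, qmKey_lt_iff hρ, map_fst_directedPath, map_fst_directedPath]
    exact h2

end AdmissibleOrder

/-! ## The quadratic operad of the Swiss-cheese relations -/

section SCNormal

open PTree Colour

variable {X : Type}

/-- The two sides of a relation, the greater one first. -/
inductive SCPair : PTree SCOp ℕ → PTree SCOp ℕ → Prop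
  | comm : SCPair (node .m (leaf 0) (leaf 1)) (node .m (leaf 1) (leaf 0))
  | mAssoc : SCPair (node .m (node .m (leaf 0) (leaf 1)) (leaf 2))
      (node .m (leaf 0) (node .m (leaf 1) (leaf 2)))
  | aAssoc : SCPair (node .a (node .a (leaf 0) (leaf 1)) (leaf 2))
      (node .a (leaf 0) (node .a (leaf 1) (leaf 2)))
  | action : SCPair (node .d (leaf 0) (node .d (leaf 1) (leaf 2)))
      (node .d (node .m (leaf 0) (leaf 1)) (leaf 2))
  | linearLeft : SCPair (node .a (node .d (leaf 0) (leaf 1)) (leaf 2))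
      (node .d (leaf 0) (node .a (leaf 1) (leaf 2)))
  | linearRight : SCPair (node .a (leaf 1) (node .d (leaf 0) (leaf 2)))
      (node .d (leaf 0) (node .a (leaf 1) (leaf 2)))

variable (k) in
/-- The defining relations. -/
abbrev scRels : Set (PTree SCOp ℕ →₀ k) := (SCPres k).rels

theorem exists_scPair {r : PTree SCOp ℕ →₀ k} (hr : r ∈ scRels k) :
    ∃ T T', SCPair T T' ∧ (r = mon k T - mon k T' ∨ r = mon k T' - mon k T) := by
  rcases hr with rfl | rfl | rfl | rfl | rfl | rfl
  · exact ⟨_, _, .comm, .inl rfl⟩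
  · exact ⟨_, _, .mAssoc, .inl rfl⟩
  · exact ⟨_, _, .aAssoc, .inl rfl⟩
  · exact ⟨_, _, .action, .inr rfl⟩
  · exact ⟨_, _, .linearLeft, .inr rfl⟩
  · exact ⟨_, _, .linearRight, .inr rfl⟩

theorem SCPair.ne {T T' : PTree SCOp ℕ} (h : SCPair T T') : T ≠ T' := by cases h <;> simp

theorem SCPair.exists_mem {T T' : PTree SCOp ℕ} (h : SCPair T T') : ∃ r ∈ scRels k, T ∈ r.support ∧
    ∀ t ∈ r.support, t = T ∨ t = T' := by
  obtain ⟨r, hr, e⟩ : ∃ r ∈ scRels k, r = mon k T - mon k T' ∨ r = mon k T' - mon k T := by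
    cases h
    · exact ⟨_, .inl rfl, .inl rfl⟩
    · exact ⟨_, .inr (.inl rfl), .inl rfl⟩
    · exact ⟨_, .inr (.inr (.inl rfl)), .inl rfl⟩
    · exact ⟨_, .inr (.inr (.inr (.inl rfl))), .inr rfl⟩
    · exact ⟨_, .inr (.inr (.inr (.inr (.inl rfl)))), .inr rfl⟩
    · exact ⟨_, .inr (.inr (.inr (.inr (.inr rfl)))), .inr rfl⟩
  refine ⟨r, hr, ?_, fun t ht => ?_⟩
  · rw [mem_support_iff]
    rcases e with rfl | rfl <;> simp [mon, h.ne, h.ne.symm]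
  · rcases e with rfl | rfl
    · exact (support_sub_mon ht).imp_left support_mon
    · exact (support_sub_mon ht).symm.imp_right support_mon

theorem mem_support_scRels {r : PTree SCOp ℕ →₀ k} (hr : r ∈ scRels k) :
    ∃ T T', SCPair T T' ∧ ∀ t ∈ r.support, t = T ∨ t = T' := by
  obtain ⟨T, T', h, rfl | rfl⟩ := exists_scPair hr <;> refine ⟨T, T', h, fun t ht => ?_⟩
  · exact (support_sub_mon ht).imp_left support_mon
  · exact (support_sub_mon ht).symm.imp_right support_mon

theorem SCPair.innerEdges {T T' : PTree SCOp ℕ} (h : SCPair T T') {t : PTree SCOp ℕ}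
    (ht : t = T ∨ t = T') {C : Set ℕ} (hC : C ∈ t.innerEdges) :
    C = {0} ∪ {1} ∨ C = {0} ∪ {2} ∨ C = {1} ∪ {2} := by
  cases h <;> rcases ht with rfl | rfl <;>
    simp [PTree.innerEdges, clusters, leafSet_node, leafSet_leaf] at hC <;> simp [hC]

theorem homogeneous_SC : Homogeneous scSig (scRels k) := .of fun r hr => by
  obtain ⟨T, T', h, hs⟩ := mem_support_scRels hr
  refine ⟨T.labels.length, fun t ht t' ht' => ?_⟩
  cases h <;> rcases hs t ht with rfl | rfl <;> rcases hs t' ht' with rfl | rfl <;>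
    refine ⟨by decide, trivial, fun χ c => ?_⟩ <;> simp only [Signature.HasColour, scSig] <;> tauto

/-! ### The set-theoretic model -/

/-- A tree with root of colour `D` is sent to the multiset of its leaves, a tree with root of colour `S`
to the word of its leaves of colour `S` and the multiset of its leaves of colour `D`. -/
def scInv : PTree SCOp X → Multiset X × List X × Multiset X
  | .leaf x => ({x}, [x], 0)
  | .node .m l r => ((scInv l).1 + (scInv r).1, [], 0)
  | .node .a l r => (0, (scInv l).2.1 ++ (scInv r).2.1, (scInv l).2.2 + (scInv r).2.2)
  | .node .d l r => (0, (scInv r).2.1, (scInv l).1 + (scInv r).2.2)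

theorem SCPair.scInv_bind {T T' : PTree SCOp ℕ} (h : SCPair T T') (s : ℕ → PTree SCOp X) :
    scInv (T.bind s) = scInv (T'.bind s) := by
  cases h <;> simp only [PTree.bind, scInv, add_comm, add_left_comm, add_assoc, List.append_assoc]

theorem mapDomain_scInv_eq_zero {f : PTree SCOp X →₀ k} (hf : f ∈ relSpan (scRels k) ∅) :
    f.mapDomain scInv = 0 := by
  have key : ∀ f : PTree SCOp X →₀ k, RelInstance (scRels k) ∅ f → f.mapDomain scInv = 0 := by
    intro f hf
    induction hf with
    | subst r hr s hN =>
      rw [← mapDomain_comp]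
      obtain ⟨T, T', h, rfl | rfl⟩ := exists_scPair hr <;>
      · rw [← lmapDomain_apply k k, map_sub, lmapDomain_apply, lmapDomain_apply,
          mon, mon, mapDomain_single, mapDomain_single, Function.comp_apply,
          Function.comp_apply, h.scInv_bind, sub_self]
    | left g f t _ ih =>
      rw [← mapDomain_comp]
      obtain ⟨φ, e⟩ : ∃ φ : Multiset X × List X × Multiset X → Multiset X × List X × Multiset X,
          scInv ∘ (fun s => .node g s t) = φ ∘ scInv := by
        cases g
        · exact ⟨fun w => (w.1 + (scInv t).1, [], 0), rfl⟩
        · exact ⟨fun w => (0, w.2.1 ++ (scInv t).2.1, w.2.2 + (scInv t).2.2), rfl⟩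
        · exact ⟨fun w => (0, (scInv t).2.1, w.1 + (scInv t).2.2), rfl⟩
      rw [e, mapDomain_comp, ih, mapDomain_zero]
    | right g t f _ ih =>
      rw [← mapDomain_comp]
      obtain ⟨φ, e⟩ : ∃ φ : Multiset X × List X × Multiset X → Multiset X × List X × Multiset X,
          scInv ∘ (fun s => .node g t s) = φ ∘ scInv := by
        cases g
        · exact ⟨fun w => ((scInv t).1 + w.1, [], 0), rfl⟩
        · exact ⟨fun w => (0, (scInv t).2.1 ++ w.2.1, (scInv t).2.2 + w.2.2), rfl⟩
        · exact ⟨fun w => (0, w.2.1, (scInv t).1 + w.2.2), rfl⟩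
      rw [e, mapDomain_comp, ih, mapDomain_zero]
  exact (span_le (p := LinearMap.ker (lmapDomain k k scInv))).2 key hf

/-! ### Normal trees -/

def scRules : Rules SCOp where
  ori
    | .m, p => p
    | _, _ => True
  badL
    | .m, .m, _, _, _ => True
    | .a, .a, _, _, _ => True
    | .a, .d, _, _, _ => True
    | _, _, _, _, _ => False
  badR
    | .a, .d, _, _, _ => True
    | .d, .d, _, _, _ => True
    | _, _, _, _, _ => False

variable [LinearOrder X]

theorem length_labels_node_ne {Op X : Type} (g : Op) (l r : PTree Op X) :
    (node g l r).labels.length ≠ 1 := by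
  rw [length_labels, vertices]
  omega

/-- The normal trees with root of colour `c`. -/
def SCGood (c : Colour) (T : PTree SCOp X) : Prop :=
  T.labels.Nodup ∧ scSig.Composable c T ∧ scRules.Normal ∅ T

theorem SCGood.of_D {g : SCOp} {l r : PTree SCOp X} (h : SCGood D (node g l r)) :
    g = .m ∧ (∃ x, l = leaf x ∧ x < r.minL ∧ x ∉ r.labels) ∧ SCGood D r := by
  obtain ⟨hn, ⟨hg, cl, cr⟩, ho, hbl, -, nl, nr⟩ := h
  obtain ⟨h1, h2, hd⟩ := nodup_node hn
  cases g
  · refine ⟨rfl, ?_, h2, cr, nr⟩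
    cases l with
    | leaf x => exact ⟨x, rfl, ho, fun h => disjoint_left.1 hd (List.mem_singleton_self x) h⟩
    | node h A B =>
      cases h
      · exact (hbl trivial).elim
      · cases cl.1
      · cases cl.1
  · cases hg
  · cases hg

theorem SCGood.of_S {g : SCOp} {l r : PTree SCOp X} (h : SCGood S (node g l r)) :
    SCGood S r ∧ (∀ A B, r ≠ node .d A B) ∧ (g = .a ∧ (∃ x, l = leaf x) ∨ g = .d ∧ SCGood D l) := by
  obtain ⟨hn, ⟨hg, cl, cr⟩, ho, hbl, hbr, nl, nr⟩ := h
  obtain ⟨h1, h2, hd⟩ := nodup_node hn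
  cases g
  · cases hg
  · refine ⟨⟨h2, cr, nr⟩, fun A B e => ?_, .inl ⟨rfl, ?_⟩⟩
    · subst e; exact hbr trivial
    · cases l with
      | leaf x => exact ⟨x, rfl⟩
      | node h A B =>
        cases h
        · cases cl.1
        · exact (hbl trivial).elim
        · exact (hbl trivial).elim
  · refine ⟨⟨h2, cr, nr⟩, fun A B e => ?_, .inr ⟨rfl, h1, cl, nl⟩⟩
    subst e; exact hbr trivial

theorem SCGood.scInv_D {T : PTree SCOp X} (h : SCGood D T) : (scInv T).1 = T.labels := by
  induction T with
  | leaf x => rfl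
  | node g l r hl hr =>
    obtain ⟨rfl, ⟨x, rfl, -⟩, hr'⟩ := h.of_D
    rw [scInv, hr hr']; rfl

theorem SCGood.injective_D {T T' : PTree SCOp X} (h : SCGood D T) (h' : SCGood D T')
    (e : T.labels.Perm T'.labels) : T = T' := by
  induction T generalizing T' with
  | leaf x =>
    cases T' with
    | leaf y => rw [List.singleton_perm_singleton.1 e]
    | node g l r => exact (length_labels_node_ne g l r (e.length_eq).symm).elim
  | node g l r hl hr =>
    cases T' with
    | leaf y => exact (length_labels_node_ne g l r (e.length_eq)).elim
    | node g' l' r' =>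
      obtain ⟨rfl, ⟨x, rfl, hx, -⟩, g2⟩ := h.of_D
      obtain ⟨rfl, ⟨y, rfl, hy, -⟩, g2'⟩ := h'.of_D
      have hm := minL_eq_of_leafSet_eq (leafSet_eq_of_perm e)
      simp only [minL, min_eq_left hx.le, min_eq_left hy.le] at hm
      subst hm
      rw [hr g2 g2' ((List.perm_cons x).1 e)]

theorem SCGood.scInv_S {T : PTree SCOp X} (h : SCGood S T) (hd : ∀ A B, T ≠ node .d A B) :
    (scInv T).2 = (T.labels, 0) := by
  induction T with
  | leaf x => rfl
  | node g l r hl hr =>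
    obtain ⟨h1, h2, ⟨rfl, x, rfl⟩ | ⟨rfl, h3⟩⟩ := h.of_S
    · rw [scInv, hr h1 h2]; rfl
    · exact (hd _ _ rfl).elim

theorem SCGood.injective_comb {T T' : PTree SCOp X} (h : SCGood S T) (h' : SCGood S T')
    (hd : ∀ A B, T ≠ node .d A B) (hd' : ∀ A B, T' ≠ node .d A B) (e : T.labels = T'.labels) :
    T = T' := by
  induction T generalizing T' with
  | leaf x =>
    cases T' with
    | leaf y => rw [List.singleton_inj.1 e]
    | node g l r => exact (length_labels_node_ne g l r (congrArg List.length e).symm).elim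
  | node g l r hl hr =>
    cases T' with
    | leaf y => exact (length_labels_node_ne g l r (congrArg List.length e)).elim
    | node g' l' r' =>
      obtain ⟨h1, h2, ⟨rfl, x, rfl⟩ | ⟨rfl, -⟩⟩ := h.of_S
      swap
      · exact (hd _ _ rfl).elim
      obtain ⟨h1', h2', ⟨rfl, y, rfl⟩ | ⟨rfl, -⟩⟩ := h'.of_S
      swap
      · exact (hd' _ _ rfl).elim
      obtain ⟨rfl, e'⟩ := List.cons.inj e
      rw [hr h1 h1' h2 h2' e']

theorem SCGood.injective_S {T T' : PTree SCOp X} (h : SCGood S T) (h' : SCGood S T')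
    (e : (scInv T).2 = (scInv T').2) : T = T' := by
  have key : ∀ A B : PTree SCOp X, SCGood S (node .d A B) →
      SCGood D A ∧ SCGood S B ∧ (∀ A' B', B ≠ node .d A' B') ∧
      (scInv (node .d A B)).2 = (B.labels, (A.labels : Multiset X)) := by
    intro A B h
    obtain ⟨h1, h2, ⟨⟨⟩, -⟩ | ⟨-, h3⟩⟩ := h.of_S
    refine ⟨h3, h1, h2, ?_⟩
    rw [scInv, h1.scInv_S h2, h3.scInv_D, add_zero]
  by_cases hT : ∃ A B, T = node .d A B <;> by_cases hT' : ∃ A B, T' = node .d A B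
  · obtain ⟨A, B, rfl⟩ := hT
    obtain ⟨A', B', rfl⟩ := hT'
    obtain ⟨h1, h2, h3, h4⟩ := key A B h
    obtain ⟨h1', h2', h3', h4'⟩ := key A' B' h'
    rw [h4, h4', Prod.mk.injEq, Multiset.coe_eq_coe] at e
    rw [h1.injective_D h1' e.2, h2.injective_comb h2' h3 h3' e.1]
  · obtain ⟨A, B, rfl⟩ := hT
    push Not at hT'
    rw [(key A B h).2.2.2, h'.scInv_S hT', Prod.mk.injEq, Multiset.coe_eq_zero] at e
    exact (labels_ne_nil _ e.2).elim
  · obtain ⟨A, B, rfl⟩ := hT'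
    push Not at hT
    rw [(key A B h').2.2.2, h.scInv_S hT, Prod.mk.injEq, eq_comm (a := (0 : Multiset X)),
      Multiset.coe_eq_zero] at e
    exact (labels_ne_nil _ e.2).elim
  · push Not at hT hT'
    rw [h.scInv_S hT, h'.scInv_S hT'] at e
    exact h.injective_comb h' hT hT' (Prod.ext_iff.1 e).1

theorem SCGood.scInv_ne_nil {T : PTree SCOp X} (h : SCGood S T) : (scInv T).2.1 ≠ [] := by
  induction T with
  | leaf x => exact List.cons_ne_nil _ _
  | node g l r hl hr =>
    obtain ⟨h1, -, ⟨rfl, -⟩ | ⟨rfl, -⟩⟩ := h.of_S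
    · exact List.append_ne_nil_of_right_ne_nil _ (hr h1)
    · exact hr h1

theorem injOn_scInv : Set.InjOn (scInv (X := X)) {T | ∃ c, SCGood c T} := by
  have mixed : ∀ T T' : PTree SCOp X, SCGood D T → SCGood S T' → scInv T = scInv T' → T = T' := by
    intro T T' h h' e
    cases T with
    | leaf x => exact SCGood.injective_S ⟨h.1, trivial, h.2.2⟩ h' (congrArg Prod.snd e)
    | node g l r =>
      obtain ⟨rfl, -⟩ := h.of_D
      exact (h'.scInv_ne_nil (congrArg (fun w => w.2.1) e).symm).elim
  rintro T ⟨c, h⟩ T' ⟨c', h'⟩ e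
  cases c <;> cases c'
  · exact h.injective_S h' (congrArg Prod.snd e)
  · exact (mixed T' T h' h e.symm).symm
  · exact mixed T T' h h' e
  · have := congrArg Prod.fst e
    rw [h.scInv_D, h'.scInv_D, Multiset.coe_eq_coe] at this
    exact h.injective_D h' this

theorem eq_zero_of_mapDomain_scInv {f : PTree SCOp X →₀ k} (h : f.mapDomain scInv = 0)
    (hs : ∀ t ∈ f.support, ∃ c, SCGood c t) : f = 0 :=
  Finsupp.mapDomain_injOn {T | ∃ c, SCGood c T} injOn_scInv hs (fun t ht => by simp at ht)
    (h.trans mapDomain_zero.symm)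

theorem independentNormal_SC : IndependentNormal scSig (scRels k) scRules X := fun f hf hs =>
  eq_zero_of_mapDomain_scInv (mapDomain_scInv_eq_zero hf) fun t ht =>
    let ⟨h1, ⟨c, h2⟩, h3⟩ := hs t ht
    ⟨c, h1, h2, h3⟩

/-! ### Rewriting -/

def scWeight : PTree SCOp X → ℕ
  | .leaf _ => 2
  | .node .m l r => scWeight l + scWeight r
  | .node .a l r => scWeight l * (scWeight r + 1)
  | .node .d l r => scWeight l + scWeight r + 1

/-- The sum of the smallest leaves above the vertices of type `m`. -/
def scMinSum (ι : X → ℕ) : PTree SCOp X → ℕ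
  | .leaf _ => 0
  | .node .m l r => ι (min l.minL r.minL) + (scMinSum ι l + scMinSum ι r)
  | .node _ l r => scMinSum ι l + scMinSum ι r

open Classical in
def scDisorder : PTree SCOp X → ℕ
  | .leaf _ => 0
  | .node g l r => (if scRules.ori g (l.minL < r.minL) then 0 else 1) + (scDisorder l + scDisorder r)

def scKey (ι : X → ℕ) (T : PTree SCOp X) : ℕ ×ₗ ℕᵒᵈ ×ₗ ℕ :=
  toLex (scWeight T, toLex (OrderDual.toDual (scMinSum ι T), scDisorder T))

theorem scKey_lt_iff {ι : X → ℕ} {T' T : PTree SCOp X} : scKey ι T' < scKey ι T ↔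
    scWeight T' < scWeight T ∨ scWeight T' = scWeight T ∧ (scMinSum ι T < scMinSum ι T' ∨
      scMinSum ι T' = scMinSum ι T ∧ scDisorder T' < scDisorder T) := by
  simp only [scKey, Prod.Lex.lt_iff, ofLex_toLex, OrderDual.toDual_lt_toDual,
    EmbeddingLike.apply_eq_iff_eq]

theorem two_le_scWeight (T : PTree SCOp X) : 2 ≤ scWeight T := by
  induction T with
  | leaf x => exact le_rfl
  | node g l r hl hr => cases g <;> simp only [scWeight] <;> nlinarith

theorem scKey_node {ι : X → ℕ} (g : SCOp) {t t' : PTree SCOp X} (u : PTree SCOp X)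
    (hp : t'.labels.Perm t.labels) (h : scKey ι t' < scKey ι t) :
    scKey ι (.node g t' u) < scKey ι (.node g t u) ∧
      scKey ι (.node g u t') < scKey ι (.node g u t) := by
  have hm : t'.minL = t.minL := minL_eq_of_leafSet_eq (leafSet_eq_of_perm hp)
  have hu := two_le_scWeight u
  rw [scKey_lt_iff] at h
  rw [scKey_lt_iff, scKey_lt_iff]
  rcases h with h | ⟨h1, h | ⟨h2, h3⟩⟩ <;>
    [refine ⟨.inl ?_, .inl ?_⟩; refine ⟨.inr ⟨?_, .inl ?_⟩, .inr ⟨?_, .inl ?_⟩⟩;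
    refine ⟨.inr ⟨?_, .inr ⟨?_, ?_⟩⟩, .inr ⟨?_, .inr ⟨?_, ?_⟩⟩⟩] <;> cases g <;>
    simp only [scWeight, scMinSum, scDisorder, hm] <;> first | omega | (rw [hm]; omega) | nlinarith

theorem SCPair.reducible {T T' : PTree SCOp ℕ} (h : SCPair T T') {lt : PTree SCOp X → PTree SCOp X → Prop}
    (irrefl : ∀ t, ¬ lt t t) {N : Set (Set X)} {s : ℕ → PTree SCOp X}
    (hN : T.vertices = 1 ∨ (s 0).leafSet ∪ (s 1).leafSet ∉ N ∧ (s 0).leafSet ∪ (s 2).leafSet ∉ N ∧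
      (s 1).leafSet ∪ (s 2).leafSet ∉ N) (hlt : lt (T'.bind s) (T.bind s)) :
    Reducible (scRels k) lt N (T.bind s) := by
  obtain ⟨r, hr, hT, hs⟩ := h.exists_mem (k := k)
  refine reducible_of_subst irrefl hr hT (fun t ht C hC => ?_) fun t ht hne => ?_
  · rcases hN with hN | hN
    · cases h
      · rcases hs t ht with rfl | rfl <;> exact (hC.elim id id).elim
      all_goals cases hN
    · rcases h.innerEdges (hs t ht) hC with rfl | rfl | rfl <;>
        simp only [Set.biUnion_union, Set.biUnion_singleton] <;> tauto
  · rwa [(hs t ht).resolve_left hne]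

theorem sc_reducible_of_not_normal_node {ι : X → ℕ} (hι : StrictMono ι) {N : Set (Set X)} {g : SCOp}
    {l r : PTree SCOp X} (hn : (PTree.node g l r).labels.Nodup)
    (hc : ClosedCuts N (PTree.node g l r)) (hl : scRules.Normal N l) (hr : scRules.Normal N r)
    (hnn : ¬ scRules.Normal N (.node g l r)) :
    Reducible (scRels k) (fun T' T => scKey ι T' < scKey ι T) N (PTree.node g l r) := by
  obtain ⟨h1, h2, hd⟩ := nodup_node hn
  have irr : ∀ T : PTree SCOp X, ¬ scKey ι T < scKey ι T := fun T => lt_irrefl _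
  by_cases ho : scRules.ori g (l.minL < r.minL)
  · by_cases hbl : scRules.badLeft g l r ∧ l.leafSet ∉ N
    · obtain ⟨hb, hN⟩ := hbl
      cases l with
      | leaf x => exact hb.elim
      | node h A B =>
        have hN' := hc.notMem_left hn hN
        have wA := two_le_scWeight A
        have wB := two_le_scWeight B
        have wr := two_le_scWeight r
        cases g <;> cases h <;> try exact hb.elim
        · refine SCPair.mAssoc.reducible irr (s := triple A B r) (.inr hN') (scKey_lt_iff.2 (.inr ?_))
          have hab : A.minL < B.minL := hl.1
          have har : A.minL < r.minL := by
            have h : (PTree.node SCOp.m A B).minL < r.minL := ho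
            rwa [minL, min_eq_left hab.le] at h
          have := hι (lt_min hab har)
          refine ⟨add_assoc _ _ _ |>.symm, .inl ?_⟩
          simp only [PTree.bind, triple, scMinSum, minL, min_eq_left hab.le, min_eq_left har.le,
            min_eq_left (lt_min hab har).le]
          omega
        · refine SCPair.aAssoc.reducible irr (s := triple A B r) (.inr hN') (scKey_lt_iff.2 (.inl ?_))
          simp only [PTree.bind, triple, scWeight]
          nlinarith
        · refine SCPair.linearLeft.reducible irr (s := triple A B r) (.inr hN')
            (scKey_lt_iff.2 (.inl ?_))
          simp only [PTree.bind, triple, scWeight]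
          nlinarith
    by_cases hbr : scRules.badRight g l r ∧ r.leafSet ∉ N
    · obtain ⟨hb, hN⟩ := hbr
      cases r with
      | leaf x => cases g <;> exact hb.elim
      | node h B C =>
        obtain ⟨n1, n2, n3⟩ := hc.notMem_right hn hN
        have wl := two_le_scWeight l
        have wB := two_le_scWeight B
        have wC := two_le_scWeight C
        cases g <;> cases h <;> try exact hb.elim
        · refine SCPair.linearRight.reducible irr (s := triple B l C)
            (.inr ⟨by rwa [union_comm] at n1, n3, n2⟩) (scKey_lt_iff.2 (.inl ?_))
          simp only [PTree.bind, triple, scWeight]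
          nlinarith
        · refine SCPair.action.reducible irr (s := triple l B C) (.inr ⟨n1, n2, n3⟩)
            (scKey_lt_iff.2 (.inl ?_))
          simp only [PTree.bind, triple, scWeight]
          omega
    · exact (hnn ⟨ho, fun h => not_not.1 fun h' => hbl ⟨h, h'⟩,
        fun h => not_not.1 fun h' => hbr ⟨h, h'⟩, hl, hr⟩).elim
  · cases g with
    | a => exact (ho trivial).elim
    | d => exact (ho trivial).elim
    | m =>
      have hlt : r.minL < l.minL := lt_of_le_of_ne (not_lt.1 ho) (minL_ne_of_disjoint hd).symm
      refine SCPair.comm.reducible irr (s := triple l r r) (.inl rfl)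
        (scKey_lt_iff.2 (.inr ⟨add_comm _ _, .inr ⟨?_, ?_⟩⟩))
      · simp only [PTree.bind, triple, scMinSum, min_comm, add_comm]
      · simp only [PTree.bind, triple]
        rw [scDisorder, scDisorder, if_pos (show scRules.ori .m (r.minL < l.minL) from hlt), if_neg ho]
        omega

theorem isRewriting_SC {ι : X → ℕ} (hι : StrictMono ι) : IsRewriting (X := X) (SCPres k).rels scRules
    fun T' T => scKey ι T' < scKey ι T where
  irrefl _ := lt_irrefl _
  trans _ _ _ := lt_trans
  left g _ _ u _ hp h := (scKey_node g u hp h).1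
  right g _ _ u _ hp h := (scKey_node g u hp h).2
  reducible _ _ _ _ hn hc hl hr hnn := sc_reducible_of_not_normal_node hι hn hc hl hr hnn

instance : Finite SCOp :=
  Finite.of_injective (fun | .m => 0 | .a => 1 | .d => 2 : SCOp → Fin 3) fun g g' h => by
    cases g <;> cases g' <;> first | rfl | simp at h

theorem isKoszul_SC : (SCPres k).IsKoszul := by
  have : Finite (SCPres k).Op := inferInstanceAs (Finite SCOp)
  exact Presentation.isKoszul_of_rules homogeneous_SC independentNormal_SC fun n =>
    isRewriting_SC Fin.val_strictMono

end SCNormal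

section SCKernel

open PTree Colour

variable {X : Type} {χ : X → Colour} {c : Colour}

/-- The ideal consists of the elements that vanish in the model. -/
theorem mem_relSpan_scRels_iff [Finite X] {f : PTree SCOp X →₀ k}
    (hf : ↑f.support ⊆ scSig.monomials χ c) : f ∈ relSpan (scRels k) ∅ ↔ f.mapDomain scInv = 0 := by
  refine ⟨mapDomain_scInv_eq_zero, fun h => ?_⟩
  obtain ⟨n, ⟨e⟩⟩ := Finite.exists_equiv_fin X
  let _ : LinearOrder X := LinearOrder.lift' e e.injective
  have : Finite (SCPres k).Op := inferInstanceAs (Finite SCOp)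
  have hmem : f ∈ supported k k {T | ∃ c, SCGood c T} ⊔ relSpan (scRels k) ∅ := by
    refine mem_of_forall_single_mem fun t ht => supported_sup_mono ?_ _
      ((isRewriting_SC (k := k) (ι := fun x => (e x : ℕ)) fun _ _ h => h).single_mem homogeneous_SC
        (hf ht).1 (N := ∅) fun C hC => hC.elim)
    rintro T ⟨h1, h2, -, h4, -⟩
    exact ⟨c, h1.nodup_iff.1 (hf ht).1, (h2 χ c (hf ht).2.2).composable, h4⟩
  obtain ⟨g, hg, z, hz, rfl⟩ := mem_sup.1 hmem
  rw [mapDomain_add, mapDomain_scInv_eq_zero hz, add_zero] at h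
  rw [eq_zero_of_mapDomain_scInv h hg, zero_add]
  exact hz

theorem labels_eq {Op I : Type} {Γ : Signature I Op} {χ : X → I} {c : I}
    (hΓ : ∀ g, Γ.tgt g = c → Γ.src₁ g = c ∧ Γ.src₂ g = c)
    {t : PTree Op X}
    (ht : Γ.HasColour χ c t) : ∀ y ∈ t.labels, χ y = c := by
  induction t with
  | leaf x => exact fun y hy => mem_singleton.1 hy ▸ ht
  | node g l r hl hr =>
    obtain ⟨hg, cl, cr⟩ := ht
    rw [(hΓ g hg).1] at cl
    rw [(hΓ g hg).2] at cr
    exact fun y hy => (mem_append.1 hy).elim (hl cl y) (hr cr y)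

theorem colour_eq_D {t : PTree SCOp X} (h : scSig.HasColour χ D t) : ∀ x ∈ t.labels, χ x = D :=
  labels_eq (fun g hg => by cases g <;> first | exact ⟨rfl, rfl⟩ | cases hg) h

/-- The word of the leaves of colour `S`. -/
def openWord (χ : X → Colour) (t : PTree SCOp X) : List X := t.labels.filter fun x => χ x = S

theorem scInv_D {t : PTree SCOp X} (h : scSig.HasColour χ D t) : (scInv t).1 = t.labels := by
  induction t with
  | leaf x => rfl
  | node g l r hl hr =>
    obtain ⟨h1, h2, h3⟩ := h
    cases g
    · rw [scInv, hl h2, hr h3]; rfl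
    · cases h1
    · cases h1

theorem scInv_S {t : PTree SCOp X} (h : scSig.HasColour χ S t) :
    (scInv t).2 = (openWord χ t, ((t.labels.filter fun x => χ x = D : List X) : Multiset X)) := by
  induction t with
  | leaf x =>
    have h : χ x = S := h
    simp [scInv, openWord, labels, h]
  | node g l r hl hr =>
    obtain ⟨h1, h2, h3⟩ := h
    cases g
    · cases h1
    · rw [scInv, hl h2, hr h3]
      simp [openWord, labels]
    · have hD := colour_eq_D h2
      rw [scInv, hr h3, scInv_D h2]
      have e1 : l.labels.filter (fun x => χ x = S) = [] :=
        List.filter_eq_nil_iff.2 fun x hx => by simp [hD x hx]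
      have e2 : l.labels.filter (fun x => χ x = D) = l.labels :=
        List.filter_eq_self.2 fun x hx => by simp [hD x hx]
      simp [openWord, labels, e1, e2]

theorem labels_perm_of_mem_monomials {Op I : Type} {Γ : Signature I Op} {χ : X → I} {c : I}
    {t t' : PTree Op X} (ht : t ∈ Γ.monomials χ c) (ht' : t' ∈ Γ.monomials χ c) :
    t.labels.Perm t'.labels :=
  (List.perm_ext_iff_of_nodup ht.1 ht'.1).2 fun x => by simp [ht.2.1 x, ht'.2.1 x]

theorem scInv_eq_iff {t t' : PTree SCOp X} (ht : t ∈ scSig.monomials χ c)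
    (ht' : t' ∈ scSig.monomials χ c) :
    scInv t = scInv t' ↔ (c = S → openWord χ t = openWord χ t') := by
  have hp := labels_perm_of_mem_monomials ht ht'
  have shape : t = t' ∨ ∃ g l r g' l' r', t = node g l r ∧ t' = node g' l' r' := by
    cases t with
    | leaf x =>
      cases t' with
      | leaf y => rw [List.singleton_perm_singleton.1 hp]; exact .inl rfl
      | node g l r => exact (length_labels_node_ne g l r hp.length_eq.symm).elim
    | node g l r =>
      cases t' with
      | leaf y => exact (length_labels_node_ne g l r hp.length_eq).elim
      | node g' l' r' => exact .inr ⟨_, _, _, _, _, _, rfl, rfl⟩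
  cases c with
  | S =>
    have e := scInv_S ht.2.2
    have e' := scInv_S ht'.2.2
    refine ⟨fun h _ => by rw [h, e'] at e; exact (congrArg Prod.fst e).symm, fun h => ?_⟩
    have h2 : (scInv t).2 = (scInv t').2 := by
      rw [e, e', h rfl, Multiset.coe_eq_coe.2 (hp.filter _)]
    refine Prod.ext ?_ h2
    obtain rfl | ⟨g, l, r, g', l', r', rfl, rfl⟩ := shape
    · rfl
    · have h1 := ht.2.2.1
      have h1' := ht'.2.2.1
      cases g <;> cases g' <;> first | rfl | (cases h1; done) | (cases h1'; done)
  | D =>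
    refine ⟨fun _ h => (by cases h), fun _ => ?_⟩
    refine Prod.ext ?_ ?_
    · rw [scInv_D ht.2.2, scInv_D ht'.2.2, Multiset.coe_eq_coe.2 hp]
    obtain rfl | ⟨g, l, r, g', l', r', rfl, rfl⟩ := shape
    · rfl
    · have h1 := ht.2.2.1
      have h1' := ht'.2.2.1
      cases g <;> cases g' <;> first | rfl | (cases h1; done) | (cases h1'; done)

theorem mapDomain_eq_zero_of_factors {α β γ : Type*} {p : α → β} {q : α → γ}
    (h : ∀ x y, p x = p y → q x = q y) {f : α →₀ k} (h0 : f.mapDomain p = 0) :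
    f.mapDomain q = 0 := by
  by_cases hne : Nonempty α
  · have : Nonempty γ := hne.map q
    obtain ⟨φ, rfl⟩ := (Function.factorsThrough_iff q).1 fun x y e => h x y e
    rw [mapDomain_comp, h0, mapDomain_zero]
  · rw [not_nonempty_iff] at hne
    rw [Subsingleton.elim f 0, mapDomain_zero]

end SCKernel

/-! ## Path components of the Swiss-cheese spaces -/

section SCTopology

open PTree Colour

variable {X : Type} {χ : X → Colour} {c : Colour}

/-- The configurations of centres. -/
def Centres (χ : X → Colour) (c : Colour) : Set (X → ℂ) :=
  {z | (∀ x, ‖z x‖ < 1) ∧ (∀ x y, x ≠ y → z x ≠ z y) ∧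
    (c = S → ∀ x, (χ x = S → (z x).im = 0) ∧ (χ x = D → 0 < (z x).im))}

theorem centres_mem {κ : X → ℂ × ℝ} (h : κ ∈ SwissCheese χ c) : (fun x => (κ x).1) ∈ Centres χ c := by
  obtain ⟨-, h1, h2, h3⟩ := h
  refine ⟨fun x => by linarith [h1 x], fun x y hne e => ?_, ?_⟩
  · have := h2 x y hne
    rw [show (κ x).1 = (κ y).1 from e, sub_self, norm_zero] at this
    linarith [(h1 x).1, (h1 y).1]
  · rintro rfl x
    exact ⟨h3.1 x, fun hx => (h1 x).1.trans_le (h3.2 x hx)⟩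

/-- The condition that every open input is not a point. -/
theorem swissCheese_iff {κ : X → ℂ × ℝ} : κ ∈ SwissCheese χ c ↔ (∃ x, χ x = c) ∧
    (c = D → ∀ x, χ x = D) ∧ (∀ x, 0 < (κ x).2 ∧ ‖(κ x).1‖ + (κ x).2 ≤ 1) ∧
    (∀ x y, x ≠ y → (κ x).2 + (κ y).2 ≤ ‖(κ x).1 - (κ y).1‖) ∧
    (c = S → ∀ x, (χ x = S → (κ x).1.im = 0) ∧ (χ x = D → (κ x).2 ≤ (κ x).1.im)) := by
  cases c with
  | S =>
    constructor
    · rintro ⟨h1, h2, h3, h4, h5⟩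
      exact ⟨h1, fun h => (by cases h), h2, h3, fun _ x => ⟨h4 x, h5 x⟩⟩
    · rintro ⟨h1, -, h2, h3, h4⟩
      exact ⟨h1, h2, h3, fun x => (h4 rfl x).1, fun x => (h4 rfl x).2⟩
  | D =>
    constructor
    · rintro ⟨h1, h2, h3, h4⟩
      exact ⟨h1, fun _ => h4, h2, h3, fun h => (by cases h)⟩
    · rintro ⟨h1, h4, h2, h3, -⟩
      exact ⟨h1, h2, h3, h4 rfl⟩

/-- Configurations with the same centres are joined. -/
theorem joinedIn_of_centres_eq {κ κ' : X → ℂ × ℝ} (h : κ ∈ SwissCheese χ c) (h' : κ' ∈ SwissCheese χ c)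
    (e : ∀ x, (κ x).1 = (κ' x).1) : JoinedIn (SwissCheese χ c) κ κ' := by
  refine JoinedIn.ofLine (f := fun t : ℝ => fun x => ((κ x).1, (1 - t) * (κ x).2 + t * (κ' x).2))
    (Continuous.continuousOn (by fun_prop)) (by ext x <;> simp) ?_ ?_
  · funext x
    ext <;> simp [e]
  · rintro _ ⟨t, ⟨h0, h1⟩, rfl⟩
    rw [swissCheese_iff] at h h' ⊢
    obtain ⟨a1, a2, a3, a4, a5⟩ := h
    obtain ⟨b1, b2, b3, b4, b5⟩ := h'
    refine ⟨a1, a2, fun x => ⟨?_, ?_⟩, fun x y hne => ?_, fun hS x => ⟨(a5 hS x).1, fun hx => ?_⟩⟩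
    · have := (a3 x).1
      have := (b3 x).1
      dsimp only
      rcases h0.eq_or_lt with rfl | h0
      · simpa
      · nlinarith [mul_nonneg (sub_nonneg.2 h1) (a3 x).1.le, mul_pos h0 (b3 x).1]
    · have h3 := (a3 x).2
      have h4 := (b3 x).2
      rw [← e] at h4
      dsimp only
      nlinarith
    · have h3 := a4 x y hne
      have h4 := b4 x y hne
      rw [← e, ← e] at h4
      dsimp only
      nlinarith
    · have h3 := (a5 hS x).2 hx
      have h4 := (b5 hS x).2 hx
      rw [← e] at h4
      dsimp only
      nlinarith

/-- Centres are joined by straight lines if they do not collide. -/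
theorem joinedIn_line {z w : X → ℂ} (hz : z ∈ Centres χ c) (hw : w ∈ Centres χ c)
    (h : ∀ x y, x ≠ y → ∀ t : ℝ, 0 ≤ t → t ≤ 1 → (1 - t) * (z x - z y) + t * (w x - w y) ≠ 0) :
    JoinedIn (Centres χ c) z w := by
  refine JoinedIn.ofLine (f := fun t : ℝ => fun x => (1 - t) * z x + t * w x)
    (Continuous.continuousOn (by fun_prop)) (by ext x; simp) (by ext x; simp) ?_
  rintro _ ⟨t, ⟨h0, h1⟩, rfl⟩
  refine ⟨fun x => ?_, fun x y hne e => h x y hne t h0 h1 ?_, fun hS x => ⟨fun hx => ?_, fun hx => ?_⟩⟩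
  · have e1 : ‖((1 - t : ℝ) : ℂ) * z x + (t : ℂ) * w x‖ ≤ (1 - t) * ‖z x‖ + t * ‖w x‖ := by
      refine (norm_add_le _ _).trans_eq ?_
      rw [norm_mul, norm_mul, Complex.norm_real, Complex.norm_real,
        Real.norm_of_nonneg (sub_nonneg.2 h1), Real.norm_of_nonneg h0]
    push_cast at e1
    refine e1.trans_lt ?_
    have h3 := hz.1 x
    have h4 := hw.1 x
    rcases h0.eq_or_lt with rfl | h0
    · simpa
    · nlinarith [mul_nonneg (sub_nonneg.2 h1) (sub_nonneg.2 h3.le), mul_pos h0 (sub_pos.2 h4)]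
  · dsimp only at e
    linear_combination e
  · simp [((hz.2.2 hS x).1 hx), ((hw.2.2 hS x).1 hx)]
  · have h3 := (hz.2.2 hS x).2 hx
    have h4 := (hw.2.2 hS x).2 hx
    have : ((1 - (t : ℂ)) * z x + t * w x).im = (1 - t) * (z x).im + t * (w x).im := by
      simp [Complex.add_im, Complex.mul_im]
    change 0 < ((1 - (t : ℂ)) * z x + t * w x).im
    rw [this]
    rcases h0.eq_or_lt with rfl | h0
    · simpa
    · nlinarith [mul_nonneg (sub_nonneg.2 h1) h3.le, mul_pos h0 h4]

variable [Fintype X] [Nonempty X]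

open Classical in
/-- The distances that bound the radii. -/
def clearance (χ : X → Colour) (c : Colour) (z : X → ℂ) : X × X → ℝ := fun p =>
  min (1 - ‖z p.1‖) (min (if p.1 = p.2 then 1 else ‖z p.1 - z p.2‖ / 2)
    (if c = S ∧ χ p.1 = D then (z p.1).im else 1))

/-- A radius that is small enough for all the discs. -/
def smallRadius (χ : X → Colour) (c : Colour) (z : X → ℂ) : ℝ :=
  Finset.univ.inf' Finset.univ_nonempty (clearance χ c z)

theorem continuous_smallRadius : Continuous (smallRadius χ c) := by
  refine Continuous.finset_inf'_apply _ fun p _ => ?_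
  unfold clearance
  refine Continuous.min (by fun_prop) (Continuous.min ?_ ?_)
  · split_ifs
    · exact continuous_const
    · fun_prop
  · split_ifs
    · exact Complex.continuous_im.comp (continuous_apply _)
    · exact continuous_const

theorem smallRadius_pos {z : X → ℂ} (hz : z ∈ Centres χ c) : 0 < smallRadius χ c z := by
  obtain ⟨h1, h2, h3⟩ := hz
  refine (Finset.lt_inf'_iff _).2 fun p _ => lt_min (by linarith [h1 p.1]) (lt_min ?_ ?_)
  · split_ifs with h
    · exact one_pos
    · have := norm_pos_iff.2 (sub_ne_zero.2 (h2 _ _ h))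
      positivity
  · split_ifs with h
    · exact (h3 h.1 _).2 h.2
    · exact one_pos

theorem smallRadius_mem {z : X → ℂ} (hz : z ∈ Centres χ c) (hc : ∃ x, χ x = c)
    (hD : c = D → ∀ x, χ x = D) : (fun x => (z x, smallRadius χ c z)) ∈ SwissCheese χ c := by
  have hle : ∀ p, smallRadius χ c z ≤ clearance χ c z p := fun p =>
    Finset.inf'_le _ (Finset.mem_univ p)
  rw [swissCheese_iff]
  refine ⟨hc, hD, fun x => ⟨smallRadius_pos hz, ?_⟩, fun x y hne => ?_, fun hS x =>
    ⟨(hz.2.2 hS x).1, fun hx => ?_⟩⟩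
  · have := (hle (x, x)).trans (min_le_left _ _)
    dsimp only at this ⊢
    linarith
  · have := (hle (x, y)).trans ((min_le_right _ _).trans (min_le_left _ _))
    rw [if_neg hne] at this
    dsimp only at this ⊢
    linarith
  · have := (hle (x, x)).trans ((min_le_right _ _).trans (min_le_right _ _))
    rwa [if_pos ⟨hS, hx⟩] at this

/-- A path of centres gives a path of configurations. -/
theorem joinedIn_of_centres {κ κ' : X → ℂ × ℝ} (h : κ ∈ SwissCheese χ c) (h' : κ' ∈ SwissCheese χ c)
    (hj : JoinedIn (Centres χ c) (fun x => (κ x).1) fun x => (κ' x).1) :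
    JoinedIn (SwissCheese χ c) κ κ' := by
  obtain ⟨hc, hD, -⟩ := swissCheese_iff.1 h
  have hmem := fun z hz => smallRadius_mem (χ := χ) (c := c) (z := z) hz hc hD
  have hmap := hj.map (f := fun z : X → ℂ => fun x => (z x, smallRadius χ c z))
    (continuous_pi fun x => (continuous_apply x).prodMk continuous_smallRadius)
  refine ((joinedIn_of_centres_eq h (hmem _ (centres_mem h)) fun x => rfl).trans
    (hmap.mono ?_)).trans (joinedIn_of_centres_eq (hmem _ (centres_mem h')) h' fun x => rfl)
  rintro _ ⟨z, hz, rfl⟩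
  exact hmem z hz

end SCTopology

section SCComponents

open PTree Colour

variable {X : Type} {χ : X → Colour} {c : Colour}

theorem eq_S_of_exists (hD : c = D → ∀ x, χ x = D) {x : X} (hx : χ x = S) : c = S := by
  cases c
  · rfl
  · rw [hD rfl x] at hx; cases hx

theorem joinedIn_generic {z w : X → ℂ} (hz : z ∈ Centres χ c) (hw : w ∈ Centres χ c)
    (hD : c = D → ∀ x, χ x = D)
    (hS : ∀ x y, χ x = S → χ y = S → (z x).re < (z y).re → (w x).re < (w y).re) {s : ℝ}
    (hgen : ∀ x y, x ≠ y → χ x = D → χ y = D → (z x - z y).im ≠ s * (z x - z y).re ∧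
      (w x - w y).im = s * (w x - w y).re ∧ (w x - w y).re ≠ 0) :
    JoinedIn (Centres χ c) z w := by
  refine joinedIn_line hz hw fun x y hne t h0 h1 e => ?_
  have hre := congrArg Complex.re e
  have him := congrArg Complex.im e
  simp only [Complex.add_re, Complex.mul_re, Complex.sub_re, Complex.one_re, Complex.ofReal_re,
    Complex.sub_im, Complex.one_im, Complex.ofReal_im, sub_zero, zero_mul, Complex.zero_re,
    Complex.add_im, Complex.mul_im, add_zero, Complex.zero_im] at hre him
  have pos : ∀ a b : ℝ, 0 < a → 0 < b → 0 < (1 - t) * a + t * b := fun a b ha hb => by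
    rcases h0.eq_or_lt with rfl | h0
    · simpa
    · nlinarith [mul_nonneg (sub_nonneg.2 h1) ha.le, mul_pos h0 hb]
  have mixed : ∀ x y, χ x = S → χ y = D →
      (1 - t) * ((z x).im - (z y).im) + t * ((w x).im - (w y).im) ≠ 0 := by
    intro x y hx hy
    have hc := eq_S_of_exists hD hx
    rw [(hz.2.2 hc x).1 hx, (hw.2.2 hc x).1 hx]
    have := pos _ _ ((hz.2.2 hc y).2 hy) ((hw.2.2 hc y).2 hy)
    linarith
  cases hx : χ x <;> cases hy : χ y
  · have hc := eq_S_of_exists hD hx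
    have hne' : (z x).re ≠ (z y).re := fun e => hz.2.1 x y hne (Complex.ext e (by
      rw [(hz.2.2 hc x).1 hx, (hz.2.2 hc y).1 hy]))
    rcases lt_or_gt_of_ne hne' with hlt | hlt
    · have := pos _ _ (sub_pos.2 hlt) (sub_pos.2 (hS x y hx hy hlt))
      linarith
    · have := pos _ _ (sub_pos.2 hlt) (sub_pos.2 (hS y x hy hx hlt))
      linarith
  · exact mixed x y hx hy him
  · refine mixed y x hy hx ?_
    linarith
  · obtain ⟨g1, g2, g3⟩ := hgen x y hne hx hy
    simp only [Complex.sub_im, Complex.sub_re] at g1 g2 g3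
    rw [g2] at him
    have : (1 - t) * (((z x).im - (z y).im) - s * ((z x).re - (z y).re)) = 0 := by
      linear_combination him - s * hre
    rcases mul_eq_zero.1 this with h | h
    · rw [h, zero_mul, zero_add] at hre
      rcases mul_eq_zero.1 hre with h' | h'
      · linarith
      · exact g3 h'
    · exact g1 (sub_eq_zero.1 h)

/-- A configuration with the same open points and with the closed points on a line of slope `s`. -/
theorem exists_line_configuration [Finite X] {z : X → ℂ} (hz : z ∈ Centres χ c)
    (hD : c = D → ∀ x, χ x = D) (s : ℝ) : ∃ w ∈ Centres χ c, (∀ x, χ x = S → w x = z x) ∧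
      ∀ x y, x ≠ y → χ x = D → χ y = D →
        (w x - w y).im = s * (w x - w y).re ∧ (w x - w y).re ≠ 0 := by
  obtain ⟨n, ⟨e⟩⟩ := Finite.exists_equiv_fin X
  set j : X → ℝ := fun x => ((e x : ℕ) + 1 : ℝ)⁻¹
  have hj0 : ∀ x, 0 < j x := fun x => by positivity
  have hj1 : ∀ x, j x ≤ 1 := fun x => inv_le_one_of_one_le₀ (by
    have : (0 : ℝ) ≤ (e x : ℕ) := Nat.cast_nonneg _
    linarith)
  have hinj : ∀ x y, x ≠ y → j x ≠ j y := fun x y hne h => hne (e.injective (Fin.ext (by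
    have := inv_injective h
    exact_mod_cast add_right_cancel this)))
  set δ : ℝ := (4 * (1 + |s|))⁻¹
  have hs : 0 < 4 * (1 + |s|) := by positivity
  have hδ : 0 < δ := inv_pos.2 hs
  have hδ' : δ * (1 + |s|) = 1 / 4 := by
    simp only [δ]; field_simp
  set v : X → ℂ := fun x => ⟨δ * j x, 1 / 2 + δ * j x * s⟩
  have hv : ∀ x, ‖v x‖ ≤ 3 / 4 := fun x => by
    refine (Complex.norm_le_abs_re_add_abs_im _).trans ?_
    have h1 : |δ * j x| ≤ δ := by
      rw [abs_of_pos (mul_pos hδ (hj0 x))]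
      nlinarith [hj1 x]
    have h2 : |1 / 2 + δ * j x * s| ≤ 1 / 2 + δ * |s| := by
      refine (abs_add_le _ _).trans (add_le_add (by norm_num) ?_)
      rw [abs_mul]
      exact mul_le_mul_of_nonneg_right h1 (abs_nonneg s)
    simp only [v]
    nlinarith
  have hv' : ∀ x, 0 < (v x).im := fun x => by
    simp only [v]
    have h1 : |δ * j x * s| ≤ 1 / 4 := by
      rw [abs_mul, abs_of_pos (mul_pos hδ (hj0 x))]
      have : δ * j x ≤ δ := by nlinarith [hj1 x]
      nlinarith [abs_nonneg s, mul_le_mul_of_nonneg_right this (abs_nonneg s)]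
    linarith [neg_abs_le (δ * j x * s)]
  refine ⟨fun x => if χ x = S then z x else v x, ⟨fun x => ?_, fun x y hne => ?_, fun hc x =>
    ⟨fun hx => ?_, fun hx => ?_⟩⟩, fun x hx => if_pos hx, fun x y hne hx hy => ?_⟩
  · dsimp only
    split_ifs
    · exact hz.1 x
    · linarith [hv x]
  · have mixed : ∀ x y, χ x = S → z x ≠ v y := fun x y hx h => by
      have hc := eq_S_of_exists hD hx
      have := hv' y
      rw [← h, (hz.2.2 hc x).1 hx] at this
      exact lt_irrefl _ this
    dsimp only
    split_ifs with h1 h2 h2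
    · exact hz.2.1 x y hne
    · exact mixed x y h1
    · exact (mixed y x h2).symm
    · intro h
      exact hinj x y hne (mul_left_cancel₀ hδ.ne' (congrArg Complex.re h))
  · simpa [hx] using (hz.2.2 hc x).1 hx
  · simpa [hx] using hv' x
  · simp only [hx, hy, reduceCtorEq, if_false, v, Complex.sub_im, Complex.sub_re]
    refine ⟨by ring, fun h => hinj x y hne (mul_left_cancel₀ hδ.ne' (sub_eq_zero.1 h))⟩

/-- Configurations with the same order of the open inputs are joined. -/
theorem joinedIn_of_order [Finite X] {p q : X → ℂ × ℝ} (hp : p ∈ SwissCheese χ c)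
    (hq : q ∈ SwissCheese χ c)
    (h : ∀ x y, χ x = S → χ y = S → (p x).1.re < (p y).1.re → (q x).1.re < (q y).1.re) :
    JoinedIn (SwissCheese χ c) p q := by
  have := Fintype.ofFinite X
  obtain ⟨⟨x₀, -⟩, hD, -⟩ := swissCheese_iff.1 hp
  have : Nonempty X := ⟨x₀⟩
  have cp := centres_mem hp
  have cq := centres_mem hq
  have hfin : (Set.range (fun a : X × X => ((p a.1).1 - (p a.2).1).im / ((p a.1).1 - (p a.2).1).re) ∪
      Set.range fun a : X × X =>
        ((q a.1).1 - (q a.2).1).im / ((q a.1).1 - (q a.2).1).re).Finite := Set.toFinite _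
  obtain ⟨s, hs⟩ := hfin.exists_notMem
  rw [Set.mem_union, not_or] at hs
  have gen : ∀ v : ℂ, v ≠ 0 → s ≠ v.im / v.re → v.im ≠ s * v.re := by
    intro v hv hs e
    by_cases h0 : v.re = 0
    · rw [h0, mul_zero] at e
      exact hv (Complex.ext h0 e)
    · exact hs ((eq_div_iff h0).2 e.symm)
  obtain ⟨w, hw, w1, w2⟩ := exists_line_configuration cp hD s
  refine joinedIn_of_centres hp hq (JoinedIn.trans (y := w) ?_ (JoinedIn.symm ?_))
  · refine joinedIn_generic cp hw hD (fun x y hx hy hlt => ?_) fun x y hne hx hy =>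
      ⟨gen _ (sub_ne_zero.2 (cp.2.1 x y hne)) fun e => hs.1 ⟨(x, y), e.symm⟩, w2 x y hne hx hy⟩
    rwa [w1 x hx, w1 y hy]
  · refine joinedIn_generic cq hw hD (fun x y hx hy hlt => ?_) fun x y hne hx hy =>
      ⟨gen _ (sub_ne_zero.2 (cq.2.1 x y hne)) fun e => hs.2 ⟨(x, y), e.symm⟩, w2 x y hne hx hy⟩
    rw [w1 x hx, w1 y hy]
    have hc := eq_S_of_exists hD hx
    by_contra hn
    have hne : (p x).1.re ≠ (p y).1.re := fun e => by
      refine cp.2.1 x y (fun e => ?_) (Complex.ext e ?_)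
      · rw [e] at hlt; exact lt_irrefl _ hlt
      · exact ((cp.2.2 hc x).1 hx).trans ((cp.2.2 hc y).1 hy).symm
    exact lt_asymm hlt (h y x hy hx (lt_of_le_of_ne (not_lt.1 hn) hne.symm))

theorem order_of_joinedIn {p q : X → ℂ × ℝ} (h : JoinedIn (SwissCheese χ S) p q) {x y : X}
    (hx : χ x = S) (hy : χ y = S) (hlt : (p x).1.re < (p y).1.re) : (q x).1.re < (q y).1.re := by
  obtain ⟨γ, hγ⟩ := h
  have hne : x ≠ y := fun e => by rw [e] at hlt; exact lt_irrefl _ hlt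
  by_contra hn
  have hcont : Continuous fun t : unitInterval => (γ t y).1.re - (γ t x).1.re := by
    have := γ.continuous
    fun_prop
  obtain ⟨t, ht⟩ := mem_range_of_exists_le_of_exists_ge hcont (c := 0)
    ⟨1, by simpa using not_lt.1 hn⟩ ⟨0, by simpa using hlt.le⟩
  have hc := centres_mem (hγ t)
  exact hc.2.1 x y hne (Complex.ext (sub_eq_zero.1 ht).symm
    (((hc.2.2 rfl x).1 hx).trans ((hc.2.2 rfl y).1 hy).symm))

theorem order_of_pairwise {L : List X} {f g : X → ℝ} (hf : L.Pairwise fun x y => f x < f y)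
    (hg : L.Pairwise fun x y => g x < g y) {x y : X} (hx : x ∈ L) (hy : y ∈ L) (h : f x < f y) :
    g x < g y := by
  have : Std.Symm fun x y => (f x < f y → g x < g y) ∧ (f y < f x → g y < g x) :=
    ⟨fun _ _ h => ⟨h.2, h.1⟩⟩
  exact (List.Pairwise.forall_of_forall (R := fun x y => (f x < f y → g x < g y) ∧
    (f y < f x → g y < g x)) (fun x _ => ⟨fun h => absurd h (lt_irrefl _), fun h => absurd h
      (lt_irrefl _)⟩) (hf.imp₂ (fun _ _ h h' => ⟨fun _ => h', fun h'' => absurd h h''.not_gt⟩) hg)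
    hx hy).1 h

theorem pairwise_openWord {t : PTree SCOp X} (hn : t.labels.Nodup) (hc : scSig.HasColour χ S t) :
    (openWord χ t).Pairwise fun x y => (scConf t x).1.re < (scConf t y).1.re := by
  induction t with
  | leaf x => exact (List.pairwise_singleton _ x).filter _
  | node g l r hl hr =>
    obtain ⟨hg, cl, cr⟩ := hc
    obtain ⟨n1, n2, hd⟩ := nodup_node hn
    have el : ∀ x ∈ l.labels, scConf (.node g l r) x = place (scDisc₁ g) (scConf l x) :=
      fun x hx => by rw [scConf, if_pos hx]
    have er : ∀ x ∈ r.labels, scConf (.node g l r) x = place (scDisc₂ g) (scConf r x) :=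
      fun x hx => by rw [scConf, if_neg (show x ∉ l.labels from fun h => disjoint_left.1 hd h hx)]
    have hre : ∀ w p : ℂ × ℝ, (place w p).1.re = w.1.re + w.2 * p.1.re := fun w p => by simp [place]
    have right : scSig.HasColour χ S r → (openWord χ r).Pairwise fun x y =>
        (scConf (.node g l r) x).1.re < (scConf (.node g l r) y).1.re := fun cr =>
      (hr n2 cr).imp_of_mem fun {x y} hx hy h => by
        rw [er x (List.mem_of_mem_filter hx), er y (List.mem_of_mem_filter hy), hre, hre]
        have := (scDisc_spec g).2.1.1
        nlinarith
    cases g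
    · cases hg
    · rw [openWord, labels, List.filter_append, List.pairwise_append]
      refine ⟨(hl n1 cl).imp_of_mem fun {x y} hx hy h => ?_, right cr, fun x hx y hy => ?_⟩
      · rw [el x (List.mem_of_mem_filter hx), el y (List.mem_of_mem_filter hy), hre, hre]
        have := (scDisc_spec .a).1.1
        nlinarith
      · have hx := List.mem_of_mem_filter hx
        have hy := List.mem_of_mem_filter hy
        rw [el x hx, er y hy, hre, hre]
        have h1 := (scConf_spec χ l _ n1 cl).2.1 x hx
        have h2 := (scConf_spec χ r _ n2 cr).2.1 y hy
        have h3 := (abs_le.1 (Complex.abs_re_le_norm (scConf l x).1)).2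
        have h4 := (abs_le.1 (Complex.abs_re_le_norm (scConf r y).1)).1
        norm_num [scDisc₁, scDisc₂]
        linarith
    · have e : openWord χ (.node .d l r) = openWord χ r := by
        have hD := colour_eq_D cl
        rw [openWord, labels, List.filter_append, List.filter_eq_nil_iff.2 fun x hx => by simp [hD x hx]]
        rfl
      rw [e]
      exact right cr

theorem joinedIn_scConf_iff [Finite X] {t t' : PTree SCOp X} (ht : t ∈ scSig.monomials χ c)
    (ht' : t' ∈ scSig.monomials χ c) :
    JoinedIn (SwissCheese χ c) (scConf t) (scConf t') ↔ (c = S → openWord χ t = openWord χ t') := by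
  have mem : ∀ t ∈ scSig.monomials χ c, ∀ x, χ x = S → x ∈ openWord χ t := fun t ht x hx =>
    List.mem_filter.2 ⟨ht.2.1 x, by simpa⟩
  have hS : ∀ {t : PTree SCOp X} {x : X}, x ∈ openWord χ t → χ x = S := fun h => by
    simpa using (List.mem_filter.1 h).2
  constructor
  · rintro h rfl
    have p := pairwise_openWord ht.1 ht.2.2
    have p' := pairwise_openWord ht'.1 ht'.2.2
    refine List.Perm.eq_of_pairwise (fun x y _ _ h1 h2 => (lt_asymm h1 h2).elim) p
      (p'.imp_of_mem fun hx hy hlt => order_of_joinedIn h.symm (hS hx) (hS hy) hlt)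
      ((labels_perm_of_mem_monomials ht ht').filter _)
  · intro h
    refine joinedIn_of_order (scConf_mem ht) (scConf_mem ht') fun x y hx hy hlt => ?_
    obtain rfl := eq_S_of_exists (fun h x => colour_eq_D (h ▸ ht.2.2) x (ht.2.1 x)) hx
    refine order_of_pairwise (f := fun x => (scConf t x).1.re) (g := fun x => (scConf t' x).1.re)
      (pairwise_openWord ht.1 ht.2.2) ?_ (mem t ht x hx) (mem t ht y hy) hlt
    rw [h rfl]
    exact pairwise_openWord ht'.1 ht'.2.2

/-- The tree `g(x₁, g(x₂, …))`. -/
def comb {Op : Type} (g : Op) : X → List X → PTree Op X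
  | x, [] => leaf x
  | x, y :: L => node g (leaf x) (comb g y L)

theorem labels_comb {Op : Type} (g : Op) (x : X) (L : List X) : (comb g x L).labels = x :: L := by
  induction L generalizing x with
  | nil => rfl
  | cons y L ih => rw [comb, labels, ih]; rfl

theorem hasColour_comb {I Op : Type} {Γ : Signature I Op} {χ : X → I} {g : Op} {c : I}
    (h1 : Γ.src₁ g = c) (h2 : Γ.src₂ g = c) (h3 : Γ.tgt g = c) {x : X} {L : List X}
    (h : ∀ y ∈ x :: L, χ y = c) : Γ.HasColour χ c (comb g x L) := by
  induction L generalizing x with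
  | nil => exact h x (mem_cons_self ..)
  | cons y L ih =>
    refine ⟨h3, (h x (mem_cons_self ..)).trans h1.symm, ?_⟩
    rw [h2]
    exact ih fun z hz => h z (mem_cons_of_mem _ hz)

theorem exists_scConf_joinedIn [Finite X] {κ : X → ℂ × ℝ} (h : κ ∈ SwissCheese χ c) :
    ∃ t ∈ scSig.monomials χ c, JoinedIn (SwissCheese χ c) (scConf t) κ := by
  have := Fintype.ofFinite X
  obtain ⟨⟨x₀, hx₀⟩, hD, -⟩ := swissCheese_iff.1 h
  classical
  set M := (Finset.univ.filter fun x => χ x = D).toList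
  have hM : ∀ x, x ∈ M ↔ χ x = D := by simp [M]
  have nM : M.Nodup := Finset.nodup_toList _
  cases c with
  | D =>
    obtain ⟨x, L, e⟩ := List.exists_cons_of_ne_nil (List.ne_nil_of_mem ((hM x₀).2 hx₀))
    have ht : comb SCOp.m x L ∈ scSig.monomials χ D := by
      refine ⟨by rwa [labels_comb, ← e], fun y => ?_, hasColour_comb (Γ := scSig) (c := D) rfl rfl rfl
        fun y _ => hD rfl y⟩
      rw [labels_comb, ← e, hM, hD rfl]
    refine ⟨_, ht, joinedIn_of_order (scConf_mem ht) h fun y z hy => ?_⟩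
    rw [hD rfl y] at hy; cases hy
  | S =>
    let r : X → X → Prop := fun x y => (κ x).1.re ≤ (κ y).1.re
    have : Std.Total r := ⟨fun x y => le_total _ _⟩
    have : IsTrans X r := ⟨fun x y z => le_trans⟩
    set K := (Finset.univ.filter fun x => χ x = S).toList.insertionSort r
    have hK : ∀ x, x ∈ K ↔ χ x = S := by simp [K]
    have nK : K.Nodup := (List.perm_insertionSort _ _).nodup_iff.2 (Finset.nodup_toList _)
    have cκ := centres_mem h
    have pK : K.Pairwise fun x y => (κ x).1.re < (κ y).1.re := by
      refine ((List.pairwise_insertionSort r _).and nK).imp_of_mem fun {x y} hx hy ⟨h1, h2⟩ => ?_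
      refine lt_of_le_of_ne h1 fun e => cκ.2.1 x y h2 (Complex.ext e ?_)
      exact ((cκ.2.2 rfl x).1 ((hK x).1 hx)).trans ((cκ.2.2 rfl y).1 ((hK y).1 hy)).symm
    obtain ⟨x, L, e⟩ := List.exists_cons_of_ne_nil (List.ne_nil_of_mem ((hK x₀).2 hx₀))
    have hcomb : scSig.HasColour χ S (comb SCOp.a x L) :=
      hasColour_comb (Γ := scSig) (c := S) rfl rfl rfl fun y hy => (hK y).1 (e ▸ hy)
    have disj : ∀ y, χ y = D → χ y ≠ S := fun y h h' => by rw [h] at h'; cases h'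
    obtain ⟨t, ht, hw⟩ : ∃ t ∈ scSig.monomials χ S, openWord χ t = K := by
      have fK : K.filter (fun x => χ x = S) = K :=
        List.filter_eq_self.2 fun y hy => by simpa using (hK y).1 hy
      cases eM : M with
      | nil =>
        refine ⟨comb .a x L, ⟨by rwa [labels_comb, ← e], fun y => ?_, hcomb⟩, ?_⟩
        · rw [labels_comb, ← e, hK]
          cases hy : χ y
          · rfl
          · rw [← hM, eM] at hy
            cases hy
        · rw [openWord, labels_comb, ← e, fK]
      | cons y M' =>
        have el : (node SCOp.d (comb .m y M') (comb .a x L)).labels = M ++ K := by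
          rw [labels, labels_comb, labels_comb, eM, e]
        refine ⟨node .d (comb .m y M') (comb .a x L), ⟨?_, fun z => ?_, rfl, ?_, hcomb⟩, ?_⟩
        · rw [el]
          exact nM.append nK fun z h1 h2 => disj z ((hM z).1 h1) ((hK z).1 h2)
        · rw [el, mem_append, hM, hK]
          cases χ z <;> simp
        · exact hasColour_comb (Γ := scSig) (c := D) rfl rfl rfl fun z hz => (hM z).1 (eM ▸ hz)
        · rw [openWord, el, List.filter_append, fK, List.filter_eq_nil_iff.2 fun z hz => by
            simpa using disj z ((hM z).1 hz)]
          rfl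
    refine ⟨t, ht, joinedIn_of_order (scConf_mem ht) h fun y z hy hz hlt => ?_⟩
    have pt := pairwise_openWord ht.1 ht.2.2
    rw [hw] at pt
    exact order_of_pairwise (f := fun x => (scConf t x).1.re) (g := fun x => (κ x).1.re) pt pK ((hK y).2 hy) ((hK z).2 hz) hlt

theorem scClass_surjective [Finite X] : Function.Surjective (scClass k χ c) := by
  refine Finsupp.mapDomain_surjective fun q => ?_
  induction q using Quotient.inductionOn with
  | _ κ =>
    obtain ⟨t, ht, hj⟩ := exists_scConf_joinedIn κ.2
    exact ⟨⟨t, ht⟩, Quotient.sound hj.joined_subtype⟩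

theorem ker_scClass [Finite X] : LinearMap.ker (scClass k χ c) =
    ((SCPres k).ideal χ c).comap ((SCPres k).toTrees χ c) := by
  ext f
  have key : ∀ t t' : scSig.monomials χ c,
      (Quotient.mk _ ⟨scConf t.1, scConf_mem t.2⟩ : ZerothHomotopy (SwissCheese χ c)) =
        Quotient.mk _ ⟨scConf t'.1, scConf_mem t'.2⟩ ↔ scInv t.1 = scInv t'.1 := fun t t' => by
    rw [Quotient.eq, scInv_eq_iff t.2 t'.2, ← joinedIn_scConf_iff t.2 t'.2]
    exact (joinedIn_iff_joined _ _).symm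
  rw [LinearMap.mem_ker, Submodule.mem_comap,
    Presentation.mem_ideal_iff homogeneous_SC (Presentation.support_toTrees f)]
  refine Iff.trans ?_ (mem_relSpan_scRels_iff (k := k) (χ := χ) (c := c)
    (f := (SCPres k).toTrees χ c f) (Presentation.support_toTrees f)).symm
  have e : ((SCPres k).toTrees χ c f).mapDomain (scInv (X := X)) =
      f.mapDomain fun t => scInv t.1 := (mapDomain_comp ..).symm
  rw [e]
  exact ⟨mapDomain_eq_zero_of_factors fun t t' => (key t t').1,
    mapDomain_eq_zero_of_factors fun t t' => (key t t').2⟩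

end SCComponents

/-! ## The algebra of trees modulo relations -/

section TreeQuot

open PTree

variable {X : Type}

theorem map_mem_of_mem_span {M M' : Type*} [AddCommGroup M] [Module k M] [AddCommGroup M']
    [Module k M'] {F : M →ₗ[k] M'} {s : Set M} {N : Submodule k M'} (h : ∀ x ∈ s, F x ∈ N) {u : M}
    (hu : u ∈ span k s) : F u ∈ N :=
  span_le (p := N.comap F).2 h hu

/-- Linear combinations of trees modulo the consequences of the relations. -/
abbrev TreeQuot (R : Set (PTree Op ℕ →₀ k)) (X : Type) : Type u :=
  (PTree Op X →₀ k) ⧸ relSpan R (∅ : Set (Set X))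

namespace TreeQuot

variable {R : Set (PTree Op ℕ →₀ k)}

variable (R) in
def of (t : PTree Op X) : TreeQuot R X := Submodule.Quotient.mk (single t 1)

theorem hom_ext {M : Type*} [AddCommGroup M] [Module k M] {F G : TreeQuot R X →ₗ[k] M}
    (h : ∀ t, F (of R t) = G (of R t)) : F = G :=
  Submodule.linearMap_qext _ (lhom_ext' fun t => ext_ring (h t))

def op (R : Set (PTree Op ℕ →₀ k)) (X : Type) (g : Op) : TreeQuot R X →ₗ[k] TreeQuot R X →ₗ[k] TreeQuot R X :=
  liftQ _ (linearCombination k fun l =>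
    mapQ _ _ (lmapDomain k k fun r => node g l r) fun _ hf =>
      mapDomain_right_mem_relSpan g l hf) fun f hf => by
    refine LinearMap.mem_ker.2 (hom_ext fun r => ?_)
    have e : (LinearMap.applyₗ (of R r)) ∘ₗ (linearCombination k fun l =>
        mapQ (relSpan R (∅ : Set (Set X))) (relSpan R ∅)
          (lmapDomain k k fun r => node g l r) fun _ hf =>
          mapDomain_right_mem_relSpan g l hf) = Submodule.mkQ _ ∘ₗ
          lmapDomain k k (fun l => node g l r) :=
      lhom_ext' fun l => ext_ring (by
        simp only [comp_apply, Finsupp.lsingle_apply, linearCombination_single,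
          one_smul, LinearMap.applyₗ_apply_apply, lmapDomain_apply,
          mapDomain_single]
        exact congrArg Submodule.Quotient.mk mapDomain_single)
    exact (LinearMap.congr_fun e f).trans
      ((Submodule.Quotient.mk_eq_zero _).2 (mapDomain_left_mem_relSpan g r hf))

theorem op_of (g : Op) (l r : PTree Op X) : op R X g (of R l) (of R r) = of R (node g l r) := by
  refine (LinearMap.congr_fun (Submodule.liftQ_apply ..) _).trans ?_
  rw [linearCombination_single, one_smul]
  exact congrArg Submodule.Quotient.mk mapDomain_single

theorem evalTree_of {Y : Type} (s : Y → PTree Op X) (t : PTree Op Y) :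
    evalTree (op R X) (fun y => of R (s y)) t = of R (t.bind s) := by
  induction t with
  | leaf x => rfl
  | node g l r hl hr => rw [evalTree, hl, hr, op_of]; rfl

theorem evalLin_of {r : PTree Op ℕ →₀ k} (hr : r ∈ R) (s : ℕ → PTree Op X) :
    evalLin (op R X) (fun i => of R (s i)) r = 0 := by
  have e : evalLin (op R X) (fun i => of R (s i)) = Submodule.mkQ _ ∘ₗ
      lmapDomain k k (fun t => t.bind s) :=
    lhom_ext' fun t => ext_ring (by
      simp only [comp_apply, Finsupp.lsingle_apply, evalLin_single, evalTree_of,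
        one_smul, lmapDomain_apply, mapDomain_single]
      rfl)
  rw [e]
  exact (Submodule.Quotient.mk_eq_zero _).2
    (RelInstance.mem_relSpan (.subst r hr s fun _ _ _ _ => Set.notMem_empty _))

theorem op_antisymm {β : Op} (h : antisymmetry k β ∈ R) (A B : PTree Op X) :
    op R X β (of R A) (of R B) = - op R X β (of R B) (of R A) := by
  have := evalLin_of h (triple A B B)
  simp only [antisymmetry, mon, map_add, evalLin_single, evalTree, one_smul, triple] at this
  exact eq_neg_of_add_eq_zero_left this

theorem op_jacobi {β : Op} (h : jacobi k β ∈ R) (A B C : PTree Op X) :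
    op R X β (of R A) (op R X β (of R B) (of R C)) =
      op R X β (op R X β (of R A) (of R B)) (of R C) -
        op R X β (op R X β (of R A) (of R C)) (of R B) := by
  have := evalLin_of h (triple A B C)
  simp only [jacobi, mon, map_sub, evalLin_single, evalTree, one_smul, triple] at this
  exact (sub_eq_zero.1 this).symm

theorem op_assoc {a : Op} (h : associativity k a ∈ R) (A B C : PTree Op X) :
    op R X a (op R X a (of R A) (of R B)) (of R C) =
      op R X a (of R A) (op R X a (of R B) (of R C)) := by
  have := evalLin_of h (triple A B C)
  simp only [associativity, mon, map_sub, evalLin_single, evalTree, one_smul, triple] at this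
  exact sub_eq_zero.1 this

theorem op_derivation {d a : Op} (h : derivation k d a ∈ R) (A B C : PTree Op X) :
    op R X d (of R A) (op R X a (of R B) (of R C)) =
      op R X a (of R B) (op R X d (of R A) (of R C)) +
        op R X a (op R X d (of R A) (of R B)) (of R C) := by
  have := evalLin_of h (triple A B C)
  simp only [derivation, mon, map_sub, evalLin_single, evalTree, one_smul, triple] at this
  rw [sub_sub] at this
  exact sub_eq_zero.1 this

theorem op_lieAction {d β : Op} (h : lieAction k d β ∈ R) (A B C : PTree Op X) :
    op R X d (op R X β (of R A) (of R B)) (of R C) =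
      op R X d (of R A) (op R X d (of R B) (of R C)) -
        op R X d (of R B) (op R X d (of R A) (of R C)) := by
  have := evalLin_of h (triple A B C)
  simp only [lieAction, mon, map_sub, map_add, evalLin_single, evalTree, one_smul, triple] at this
  rw [sub_add] at this
  exact sub_eq_zero.1 this

end TreeQuot

/-! ## Combs span the components -/

open TreeQuot Colour

/-- The tree `β(β(β(x, y₁), y₂), …)`. -/
def lieComb (β : Op) (x : X) (w : List X) : PTree Op X :=
  w.foldl (fun t y => node β t (leaf y)) (leaf x)

/-- The tree `d(yₙ, … d(y₂, d(y₁, s)))`. -/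
def modComb (d : Op) (s : X) (w : List X) : PTree Op X :=
  w.foldl (fun t y => node d (leaf y) t) (leaf s)

/-- The product of the trees `modComb d s w` over the blocks `(s, w)`. -/
def blockComb (d a : Op) (b : Block X) (p : List (Block X)) : PTree Op X :=
  (comb a b p).bind fun b => modComb d (ofLex b).1 (ofLex b).2

theorem lieComb_append (β : Op) (x y : X) (w : List X) :
    lieComb β x (w ++ [y]) = node β (lieComb β x w) (leaf y) := by
  rw [lieComb, List.foldl_append]; rfl

theorem modComb_append (d : Op) (s y : X) (w : List X) :
    modComb d s (w ++ [y]) = node d (leaf y) (modComb d s w) := by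
  rw [modComb, List.foldl_append]; rfl

theorem labels_lieComb (β : Op) (x : X) (w : List X) : (lieComb β x w).labels = x :: w := by
  induction w using reverseRecOn with
  | nil => rfl
  | append_singleton w y ih => rw [lieComb_append, labels, ih]; rfl

theorem labels_modComb (d : Op) (s : X) (w : List X) : (modComb d s w).labels.Perm (s :: w) := by
  induction w using reverseRecOn with
  | nil => rfl
  | append_singleton w y ih =>
    rw [modComb_append, labels, ← cons_append]
    exact (ih.append_left _).trans perm_append_comm

theorem labels_blockComb (d a : Op) (b : Block X) (p : List (Block X)) :
    (blockComb d a b p).labels.Perm (letters (b :: p)) := by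
  rw [blockComb, labels_bind, labels_comb]
  exact List.Perm.flatMap_left _ fun b _ => labels_modComb d _ _

variable {R : Set (PTree Op ℕ →₀ k)} {Γ : Signature Colour Op} {χ : X → Colour}

theorem hasColour_lieComb {β : Op} (h1 : Γ.src₁ β = D) (h2 : Γ.src₂ β = D) (h3 : Γ.tgt β = D) {x : X}
    {w : List X} (h : ∀ y ∈ x :: w, χ y = D) : Γ.HasColour χ D (lieComb β x w) := by
  induction w using reverseRecOn with
  | nil => exact h x (mem_cons_self ..)
  | append_singleton w y ih =>
    rw [lieComb_append]
    refine ⟨h3, ?_, ?_⟩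
    · rw [h1]
      refine ih fun z hz => h z ?_
      rw [← cons_append]
      exact mem_append_left _ hz
    · exact (h y (by simp)).trans h2.symm

theorem hasColour_modComb {d : Op} (h1 : Γ.src₁ d = D) (h2 : Γ.src₂ d = S) (h3 : Γ.tgt d = S) {s : X}
    {w : List X} (hs : χ s = S) (h : ∀ y ∈ w, χ y = D) : Γ.HasColour χ S (modComb d s w) := by
  induction w using reverseRecOn with
  | nil => exact hs
  | append_singleton w y ih =>
    rw [modComb_append]
    refine ⟨h3, (h y (by simp)).trans h1.symm, ?_⟩
    rw [h2]
    exact ih fun z hz => h z (mem_append_left _ hz)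

/-- The bracket of `β` in the elements that act on the submodules `N L`. -/
theorem action_mem {M : Type*} [AddCommGroup M] [Module k M] {A : PTree Op X → M →ₗ[k] M} {β : Op}
    {ε : k} (hA : ∀ l r, A (node β l r) = ε • (A l ∘ₗ A r - A r ∘ₗ A l))
    {N : List X → Submodule k M} (hN : ∀ {L L' : List X}, L.Perm L' → N L = N L')
    (hleaf : ∀ y, χ y = D → ∀ L, ∀ u ∈ N L, A (leaf y) u ∈ N (y :: L))
    (hΓ : ∀ g, Γ.tgt g = D → g = β ∧ Γ.src₁ g = D ∧ Γ.src₂ g = D) {t : PTree Op X}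
    (ht : Γ.HasColour χ D t) {L : List X} {u : M} (hu : u ∈ N L) : A t u ∈ N (t.labels ++ L) := by
  induction t generalizing L u with
  | leaf y => exact hleaf y ht L u hu
  | node g l r hl hr =>
    obtain ⟨hg, cl, cr⟩ := ht
    obtain ⟨rfl, h1, h2⟩ := hΓ g hg
    rw [h1] at cl
    rw [h2] at cr
    rw [hA, labels]
    refine smul_mem _ _ (sub_mem ?_ ?_)
    · rw [List.append_assoc]
      exact hl cl (hr cr hu)
    · rw [hN (perm_append_comm.append_right L), List.append_assoc]
      exact hr cr (hl cl hu)

theorem of_mem_span_lieComb {β : Op} (ha : antisymmetry k β ∈ R) (hj : jacobi k β ∈ R)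
    (hΓ : ∀ g, Γ.tgt g = D → g = β ∧ Γ.src₁ g = D ∧ Γ.src₂ g = D) {t : PTree Op X}
    (ht : Γ.HasColour χ D t) {x : X} (hx : x ∈ t.labels) : ∃ L, (x :: L).Perm t.labels ∧
      of R t ∈ span k {v | ∃ w : List X, w.Perm L ∧ v = of R (lieComb β x w)} := by
  set N : List X → Submodule k (TreeQuot R X) := fun L =>
    span k {v | ∃ w : List X, w.Perm L ∧ v = of R (lieComb β x w)} with hN
  have act : ∀ {r : PTree Op X}, Γ.HasColour χ D r → ∀ {L u}, u ∈ N L →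
      op R X β u (of R r) ∈ N (r.labels ++ L) := by
    intro r hr L u hu
    refine action_mem (A := fun r => (op R X β).flip (of R r)) (ε := -1) (χ := χ) (N := N)
      (fun l r => hom_ext fun u => ?_) (fun {L L'} h => ?_) (fun y _ L u hu => ?_) hΓ hr hu
    · simp only [flip_apply, LinearMap.smul_apply, LinearMap.sub_apply,
        comp_apply, neg_smul, one_smul, neg_sub, ← op_of, op_jacobi hj]
    · simp only [hN]
      congr 1
      ext v
      exact exists_congr fun w => and_congr_left fun _ => ⟨fun h' => h'.trans h, fun h' => h'.trans h.symm⟩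
    · refine map_mem_of_mem_span ?_ hu
      rintro _ ⟨w, hw, rfl⟩
      refine subset_span ⟨w ++ [y], ?_, ?_⟩
      · exact perm_append_comm.trans (hw.cons y)
      · rw [lieComb_append, ← op_of]; rfl
  induction t with
  | leaf y =>
    obtain rfl : x = y := by simpa [labels] using hx
    exact ⟨[], .refl _, subset_span ⟨[], .refl _, rfl⟩⟩
  | node g l r hl hr =>
    obtain ⟨hg, cl, cr⟩ := ht
    obtain ⟨rfl, h1, h2⟩ := hΓ g hg
    rw [h1] at cl
    rw [h2] at cr
    rw [labels, mem_append] at hx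
    rcases hx with hx | hx
    · obtain ⟨L, hp, hm⟩ := hl cl hx
      refine ⟨r.labels ++ L, ?_, ?_⟩
      · exact (List.perm_middle.symm.trans (hp.append_left _)).trans perm_append_comm
      · rw [← op_of]
        exact act cr hm
    · obtain ⟨L, hp, hm⟩ := hr cr hx
      refine ⟨l.labels ++ L, List.perm_middle.symm.trans (hp.append_left _), ?_⟩
      rw [← op_of, op_antisymm ha]
      exact neg_mem (act cl hm)

theorem actD_node {d β : Op} (h : lieAction k d β ∈ R) (l r : PTree Op X) :
    op R X d (of R (node β l r)) = (1 : k) • (op R X d (of R l) ∘ₗ op R X d (of R r) -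
      op R X d (of R r) ∘ₗ op R X d (of R l)) :=
  hom_ext fun u => by simp only [LinearMap.sub_apply, comp_apply, one_smul, ← op_of, op_lieAction h]

theorem labels_eq_D {β : Op} (hΓ : ∀ g, Γ.tgt g = D → g = β ∧ Γ.src₁ g = D ∧ Γ.src₂ g = D)
    {t : PTree Op X} (ht : Γ.HasColour χ D t) : ∀ y ∈ t.labels, χ y = D :=
  labels_eq (fun g hg => (hΓ g hg).2) ht

theorem of_mem_span_modComb {β d : Op} (hd : lieAction k d β ∈ R)
    (hΓ : ∀ g, Γ.tgt g = D → g = β ∧ Γ.src₁ g = D ∧ Γ.src₂ g = D)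
    (hΓ' : ∀ g, Γ.tgt g = S → g = d ∧ Γ.src₁ g = D ∧ Γ.src₂ g = S) {t : PTree Op X}
    (ht : Γ.HasColour χ S t) : ∃ s L, χ s = S ∧ (∀ y ∈ L, χ y = D) ∧ (s :: L).Perm t.labels ∧
      of R t ∈ span k {v | ∃ w : List X, w.Perm L ∧ v = of R (modComb d s w)} := by
  induction t with
  | leaf s => exact ⟨s, [], ht, by simp, .refl _, subset_span ⟨[], .refl _, rfl⟩⟩
  | node g l r hl hr =>
    obtain ⟨hg, cl, cr⟩ := ht
    obtain ⟨rfl, h1, h2⟩ := hΓ' g hg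
    rw [h1] at cl
    rw [h2] at cr
    obtain ⟨s, L, hs, hL, hp, hm⟩ := hr cr
    refine ⟨s, l.labels ++ L, hs, fun y hy => (mem_append.1 hy).elim (labels_eq_D hΓ cl y)
      (hL y), List.perm_middle.symm.trans (hp.append_left _), ?_⟩
    rw [← op_of]
    refine action_mem (A := fun r => op R X g (of R r)) (χ := χ)
      (N := fun L => span k {v | ∃ w : List X, w.Perm L ∧ v = of R (modComb g s w)})
      (fun l r => actD_node hd l r) (fun {L L'} h => ?_) (fun y _ L u hu => ?_) hΓ cl hm
    · congr 1
      ext v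
      exact exists_congr fun w => and_congr_left fun _ => ⟨fun h' => h'.trans h, fun h' => h'.trans h.symm⟩
    · refine map_mem_of_mem_span ?_ hu
      rintro _ ⟨w, hw, rfl⟩
      refine subset_span ⟨w ++ [y], perm_append_comm.trans (hw.cons y), ?_⟩
      rw [modComb_append, ← op_of]

theorem op_comb_bind {a : Op} (h : associativity k a ∈ R) {Y : Type} (s : Y → PTree Op X) (x y : Y)
    (L L' : List Y) : op R X a (of R ((comb a x L).bind s)) (of R ((comb a y L').bind s)) =
      of R ((comb a x (L ++ y :: L')).bind s) := by
  induction L generalizing x with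
  | nil => exact op_of ..
  | cons z L ih =>
    rw [cons_append]
    change op R X a (of R (node a (s x) ((comb a z L).bind s))) _ =
      of R (node a (s x) ((comb a z _).bind s))
    rw [← op_of, op_assoc h, ih, op_of]

/-- The blocks have a solid head and a dotted tail. -/
def Block.Coloured (χ : X → Colour) (b : Block X) : Prop :=
  χ (ofLex b).1 = S ∧ ∀ y ∈ (ofLex b).2, χ y = D

variable (R χ) in
def blockSpan (d a : Op) (L : List X) : Submodule k (TreeQuot R X) :=
  span k {v | ∃ b p, (letters (b :: p)).Perm L ∧ (∀ b' ∈ b :: p, b'.Coloured χ) ∧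
    v = of R (blockComb d a b p)}

theorem op_mem_blockSpan {d a : Op} (h : associativity k a ∈ R) {L L' : List X}
    {u v : TreeQuot R X} (hu : u ∈ blockSpan R χ d a L) (hv : v ∈ blockSpan R χ d a L') :
    op R X a u v ∈ blockSpan R χ d a (L ++ L') := by
  refine map_mem_of_mem_span (F := (op R X a).flip v) ?_ hu
  rintro _ ⟨b, p, h1, h2, rfl⟩
  rw [flip_apply]
  refine map_mem_of_mem_span ?_ hv
  rintro _ ⟨b', p', h3, h4, rfl⟩
  refine subset_span ⟨b, p ++ b' :: p', ?_, fun c hc => ?_, ?_⟩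
  · rw [← cons_append, letters, List.flatMap_append]
    exact h1.append h3
  · rw [← cons_append, mem_append] at hc
    exact hc.elim (h2 c) (h4 c)
  · exact op_comb_bind h _ _ _ _ _

theorem blockSpan_congr {d a : Op} {L L' : List X} (h : L.Perm L') :
    blockSpan R χ d a L = blockSpan R χ d a L' := by
  rw [blockSpan, blockSpan]
  congr 1
  ext v
  exact exists_congr fun b => exists_congr fun p => and_congr_left fun _ =>
    ⟨fun h' => h'.trans h, fun h' => h'.trans h.symm⟩

theorem of_mem_blockSpan {β d a : Op} (ha : associativity k a ∈ R) (hder : derivation k d a ∈ R)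
    (hd : lieAction k d β ∈ R) (hΓ : ∀ g, Γ.tgt g = D → g = β ∧ Γ.src₁ g = D ∧ Γ.src₂ g = D)
    (hΓ' : ∀ g, Γ.tgt g = S → (g = d ∧ Γ.src₁ g = D ∨ g = a ∧ Γ.src₁ g = S) ∧ Γ.src₂ g = S)
    {t : PTree Op X} (ht : Γ.HasColour χ S t) : of R t ∈ blockSpan R χ d a t.labels := by
  have single : ∀ b : Block X, b.Coloured χ →
      of R (modComb d (ofLex b).1 (ofLex b).2) ∈ blockSpan R χ d a b.letters := fun b hb =>
    subset_span ⟨b, [], by rw [letters, List.flatMap_singleton], by simpa using hb, rfl⟩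
  have extend : ∀ (b : Block X) (y : X), b.Coloured χ → χ y = D →
      op R X d (of R (leaf y)) (of R (modComb d (ofLex b).1 (ofLex b).2)) ∈
        blockSpan R χ d a (y :: b.letters) := fun b y hb hy => by
    rw [op_of, ← modComb_append]
    rw [blockSpan_congr (L' := (b.extend [y]).letters)]
    · exact single (b.extend [y]) ⟨hb.1, fun z hz => (mem_append.1 hz).elim (hb.2 z)
        fun hz => by rw [mem_singleton.1 hz, hy]⟩
    · exact perm_append_comm (l₁ := [y])
  have leaf_mem : ∀ y, χ y = D → ∀ L, ∀ u ∈ blockSpan R χ d a L,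
      op R X d (of R (leaf y)) u ∈ blockSpan R χ d a (y :: L) := by
    intro y hy L u hu
    refine map_mem_of_mem_span ?_ hu
    rintro _ ⟨b, p, h1, h2, rfl⟩
    rw [blockSpan_congr (h1.symm.cons y)]
    clear h1 hu
    induction p generalizing b with
    | nil =>
      rw [letters, List.flatMap_singleton]
      exact extend b y (h2 b (mem_cons_self ..)) hy
    | cons b' p ih =>
      have hb := h2 b (mem_cons_self ..)
      have hp : ∀ c ∈ b' :: p, c.Coloured χ := fun c hc => h2 c (mem_cons_of_mem _ hc)
      change op R X d (of R (leaf y)) (of R (node a (modComb d (ofLex b).1 (ofLex b).2)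
        (blockComb d a b' p))) ∈ blockSpan R χ d a (y :: (b.letters ++ letters (b' :: p)))
      rw [← op_of, op_derivation hder]
      refine add_mem ?_ ?_
      · rw [blockSpan_congr List.perm_middle.symm]
        exact op_mem_blockSpan ha (single b hb) (ih b' hp)
      · rw [← cons_append]
        exact op_mem_blockSpan ha (extend b y hb hy) (subset_span ⟨b', p, .refl _, hp, rfl⟩)
  induction t with
  | leaf s => exact single (toLex (s, [])) ⟨ht, by simp⟩
  | node g l r hl hr =>
    obtain ⟨hg, cl, cr⟩ := ht
    obtain ⟨hg, h2⟩ := hΓ' g hg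
    rw [h2] at cr
    rw [← op_of, labels]
    rcases hg with ⟨rfl, h1⟩ | ⟨rfl, h1⟩
    · rw [h1] at cl
      exact action_mem (A := fun r => op R X g (of R r)) (N := blockSpan R χ g a)
        (fun l r => actD_node hd l r) blockSpan_congr leaf_mem hΓ cl (hr cr)
    · rw [h1] at cl
      exact op_mem_blockSpan ha (hl cl) (hr cr)

theorem of_eq_of_comb {a : Op} (ha : associativity k a ∈ R) (hop : ∀ g, g = a) (t : PTree Op X) :
    ∃ x L, t.labels = x :: L ∧ of R t = of R (comb a x L) := by
  have bind_leaf : ∀ t : PTree Op X, t.bind leaf = t := fun t => by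
    induction t with
    | leaf x => rfl
    | node g l r hl hr => rw [PTree.bind, hl, hr]
  induction t with
  | leaf x => exact ⟨x, [], rfl, rfl⟩
  | node g l r hl hr =>
    obtain ⟨x, L, h1, h2⟩ := hl
    obtain ⟨y, L', h3, h4⟩ := hr
    refine ⟨x, L ++ y :: L', by rw [labels, h1, h3]; rfl, ?_⟩
    have := op_comb_bind (R := R) ha leaf x y L L'
    rw [bind_leaf, bind_leaf, bind_leaf] at this
    rw [hop g, ← op_of, h2, h4, this]

end TreeQuot

/-! ## Bases of the components -/

section Bases

open PTree Colour TreeQuot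

variable {X : Type} {P : Presentation k I} {χ : X → I} {c : I}

namespace Presentation

variable (P) in
/-- The class of a tree monomial. -/
def cls (t : P.sig.monomials χ c) : P.toColl.obj X χ c :=
  Submodule.Quotient.mk (single t 1)

theorem obj_hom_ext {M : Type*} [AddCommGroup M] [Module k M] {F G : P.toColl.obj X χ c →ₗ[k] M}
    (h : ∀ t, F (P.cls t) = G (P.cls t)) : F = G :=
  Submodule.linearMap_qext _ (lhom_ext' fun t => ext_ring (h t))

theorem map_cls {Y : Type} (e : X ≃ Y) {ψ : Y → I} (h : ∀ x, ψ (e x) = χ x)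
    (t : P.sig.monomials χ c) : P.toColl.map e h c (P.cls t) =
      P.cls ⟨t.1.map e, Signature.map_mem_monomials e h t.2⟩ :=
  congrArg Submodule.Quotient.mk mapDomain_single

theorem span_range_cls : span k (Set.range (P.cls (χ := χ) (c := c))) = ⊤ := by
  refine Submodule.eq_top_iff'.2 fun v => ?_
  induction v using Submodule.Quotient.induction_on with
  | _ f =>
    induction f using induction_linear with
    | zero => exact zero_mem _
    | add f g hf hg => exact add_mem hf hg
    | single t a =>
      rw [← mul_one a, ← smul_eq_mul, ← smul_single]
      exact smul_mem _ a (subset_span (Set.mem_range_self (f := P.cls) t))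

variable (P χ c) in
/-- A component of the operad is a space of trees modulo relations. -/
def toQuot : P.toColl.obj X χ c →ₗ[k] TreeQuot P.rels X :=
  mapQ _ _ (P.toTrees χ c) 
    (Submodule.comap_mono (f := P.toTrees χ c) (span_mono fun _ h => And.left h))

theorem toQuot_cls (t : P.sig.monomials χ c) : P.toQuot χ c (P.cls t) = of P.rels t.1 :=
  congrArg Submodule.Quotient.mk mapDomain_single

theorem toQuot_injective (hom : Homogeneous P.sig P.rels) : Injective (P.toQuot χ c) := by
  refine LinearMap.ker_eq_bot.1 (ker_eq_bot'.2 fun v hv => ?_)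
  induction v using Submodule.Quotient.induction_on with
  | _ f =>
    refine (Submodule.Quotient.mk_eq_zero _).2 ((mem_ideal_iff hom (support_toTrees f)).2 ?_)
    exact (Submodule.Quotient.mk_eq_zero _).1 hv

theorem span_cls_eq_top (hom : Homogeneous P.sig P.rels) {B : Type*} {τ : B → P.sig.monomials χ c}
    (h : ∀ t ∈ P.sig.monomials χ c, of P.rels t ∈ span k (Set.range fun b => of P.rels (τ b).1)) :
    span k (Set.range fun b => P.cls (τ b)) = ⊤ := by
  rw [eq_top_iff, ← span_range_cls, span_le]
  rintro _ ⟨t, rfl⟩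
  have := h t.1 t.2
  have e : (Set.range fun b => of P.rels (τ b).1) =
      P.toQuot χ c '' (Set.range fun b => P.cls (τ b)) := by
    rw [← Set.range_comp]
    exact congrArg Set.range (funext fun b => (toQuot_cls _).symm)
  rw [e, ← Submodule.map_span, ← toQuot_cls t] at this
  obtain ⟨v, hv, hv'⟩ := this
  exact toQuot_injective hom hv' ▸ hv

variable {V : Type*} [AddCommGroup V] [Module k V]

variable (P χ c) in
/-- The evaluation of operations in an algebra. -/
def evalObj (op : P.Op → V →ₗ[k] V →ₗ[k] V) (hR : ∀ r ∈ P.rels, ∀ v : ℕ → V, evalLin op v r = 0)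
    (v : X → V) : P.toColl.obj X χ c →ₗ[k] V :=
  liftQ _ (evalLin op v ∘ₗ P.toTrees χ c) fun _ hf =>
    evalLin_relSpan op hR (span_mono (fun _ h => h.1) hf) v

theorem evalObj_cls {op : P.Op → V →ₗ[k] V →ₗ[k] V}
    {hR : ∀ r ∈ P.rels, ∀ v : ℕ → V, evalLin op v r = 0} (v : X → V) (t : P.sig.monomials χ c) :
    P.evalObj χ c op hR v (P.cls t) = evalTree op v t.1 := by
  change evalLin op v (Finsupp.mapDomain _ (single t 1)) = _
  rw [mapDomain_single, evalLin_single, one_smul]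

end Presentation

theorem linearIndependent_of_single {α B M : Type*} [AddCommGroup M] [Module k M] {F : B → M}
    (G : M →ₗ[k] (α →₀ k)) {key : B → α} (hkey : Injective key) {ε : B → k}
    (hε : ∀ b, ε b ≠ 0) (h : ∀ b, G (F b) = ε b • single (key b) 1) :
    LinearIndependent k F := by
  refine of_comp G ?_
  have := ((Finsupp.linearIndependent_single_one k α).comp key hkey).units_smul
    fun b => Units.mk0 (ε b) (hε b)
  convert this using 1
  exact funext h

theorem finrank_eq_natCard {B M : Type*} [AddCommGroup M] [Module k M] {F : B → M}
    (hF : LinearIndependent k F) (hspan : span k (Set.range F) = ⊤) :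
    Module.finrank k M = Nat.card B :=
  Module.finrank_eq_nat_card_basis (Module.Basis.mk hF hspan.ge)

theorem injective_of_linearIndependent {B M M' : Type*} [AddCommGroup M] [Module k M]
    [AddCommGroup M'] [Module k M'] {F : B → M} (hspan : span k (Set.range F) = ⊤)
    {G : M →ₗ[k] M'} (hG : LinearIndependent k fun b => G (F b)) : Injective G := by
  refine LinearMap.ker_eq_bot.1 (ker_eq_bot'.2 fun v hv => ?_)
  obtain ⟨l, rfl⟩ := (Finsupp.mem_span_range_iff_exists_finsupp).1 (hspan.ge (mem_top (x := v)))
  rw [map_finsuppSum] at hv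
  simp only [map_smul] at hv
  have : l = 0 := (linearIndependent_iff.1 hG) l hv
  rw [this, Finsupp.sum_zero_index]

/-! ### Evaluation of combs -/

section Evaluation

variable {Op Y : Type} {op : Op → WordPair k X →ₗ[k] WordPair k X →ₗ[k] WordPair k X}

theorem evalTree_modComb {d : Op} (hd : op d = wordOp .d) (g : Y → X) (s : Y) (w : List Y) :
    (evalTree op (fun y => wordLeaf (g y)) (modComb d s w)).2 =
      single [toLex (g s, w.map g)] 1 := by
  induction w using reverseRecOn with
  | nil => rfl
  | append_singleton w y ih =>
    rw [modComb_append, evalTree, hd, wordOp_d, ih]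
    change act (single [g y] 1) _ = _
    rw [act_single_singleton, Block.extend, ofLex_toLex, map_append]
    rfl

theorem evalTree_comb {a : Op} (ha : op a = wordOp .a) {v : Y → WordPair k X}
    {p : Y → List (Block X)} (hv : ∀ y, (v y).2 = single (p y) 1) (y : Y) (L : List Y) :
    (evalTree op v (comb a y L)).2 = single ((y :: L).flatMap p) 1 := by
  induction L generalizing y with
  | nil => rw [comb, evalTree, hv, List.flatMap_singleton]
  | cons z L ih =>
    rw [comb, evalTree, ha, wordOp_a, ih, evalTree, hv, cat_single]
    rfl

theorem evalTree_blockComb {d a : Op} (hd : op d = wordOp .d) (ha : op a = wordOp .a) (b : Block X)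
    (p : List (Block X)) : (evalTree op wordLeaf (blockComb d a b p)).2 = single (b :: p) 1 := by
  rw [blockComb, evalTree_bind, evalTree_comb ha (p := fun b => [b])]
  · rw [List.flatMap_singleton']
  · intro b
    have := evalTree_modComb hd id (ofLex b).1 (ofLex b).2
    rwa [List.map_id] at this

/-- The coefficients of the words with the first letter `x`. -/
def headPart (x : X) : (List X →₀ k) →ₗ[k] (List X →₀ k) :=
  Finsupp.lcomapDomain (x :: ·) List.cons_injective

theorem headPart_single_cons (x : X) (w : List X) :
    headPart x (single (x :: w) (1 : k)) = single w 1 :=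
  Finsupp.comapDomain_single _ _ _ _

theorem headPart_cat_single {x y : X} (h : x ≠ y) (f : List X →₀ k) :
    headPart x (cat f (single [y] 1)) = cat (headPart x f) (single [y] 1) ∧
    headPart x (cat (single [y] 1) f) = 0 := by
  have zero : ∀ (z : X) (w : List X), x ≠ z → headPart x (single (z :: w) (1 : k)) = 0 := by
    intro z w hz
    ext v
    change single (z :: w) (1 : k) (x :: v) = 0
    exact single_eq_of_ne fun e => hz (List.cons.inj e).1
  constructor
  · refine eq_of_eq_on_singles (F := headPart x ∘ₗ cat.flip (single [y] 1))
      (G := cat.flip (single [y] 1) ∘ₗ headPart x) (fun w => ?_) f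
    simp only [comp_apply, flip_apply, cat_single]
    cases w with
    | nil =>
      have : headPart x (single [] (1 : k)) = 0 := by
        ext v
        exact single_eq_of_ne (by simp)
      rw [this, map_zero, LinearMap.zero_apply]
      exact zero y [] h
    | cons z w =>
      rw [cons_append]
      by_cases hz : x = z
      · subst hz
        rw [headPart_single_cons, headPart_single_cons, cat_single]
      · rw [zero _ _ hz, zero _ _ hz, map_zero, LinearMap.zero_apply]
  · refine eq_of_eq_on_singles (F := headPart x ∘ₗ cat (single [y] 1)) (G := 0) (fun w => ?_) f
    rw [comp_apply, cat_single]
    exact zero y w h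

theorem evalTree_lieComb {β : Op} (hβ : op β = wordOp .β) (g : Y → X) (x : Y) (w : List Y)
    (h : ∀ y ∈ w, g x ≠ g y) :
    headPart (g x) (evalTree op (fun y => wordLeaf (g y)) (lieComb β x w)).1 =
      (-1 : k) ^ w.length • single (w.map g) 1 := by
  induction w using reverseRecOn with
  | nil => rw [List.length_nil, pow_zero, one_smul]; exact headPart_single_cons _ _
  | append_singleton w y ih =>
    rw [lieComb_append, evalTree, hβ, wordOp_β, bracket_apply]
    change headPart (g x) (cat (single [g y] 1) _ - cat _ (single [g y] 1)) = _
    have hy := h y (by simp)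
    rw [map_sub, (headPart_cat_single hy _).1, (headPart_cat_single hy _).2,
      ih fun z hz => h z (mem_append_left _ hz), map_smul, LinearMap.smul_apply, cat_single,
      zero_sub, length_append, List.length_singleton, pow_succ, mul_neg_one, neg_smul,
      map_append]
    rfl

end Evaluation

/-! ### The operads `As` and `MLie` act on words -/

def asWordOp : AsOp → WordPair k X →ₗ[k] WordPair k X →ₗ[k] WordPair k X := fun _ => wordOp .a

def mlieWordOp : MLieOp → WordPair k X →ₗ[k] WordPair k X →ₗ[k] WordPair k X
  | .β => wordOp .β
  | .d => wordOp .d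

theorem evalLin_asWordOp_rels : ∀ r ∈ (As k).rels, ∀ v : ℕ → WordPair k X,
    evalLin asWordOp v r = 0 := by
  rintro r rfl v
  have : evalLin wordOp v (associativity k LPOp.a) = 0 := evalLin_wordOp_rels v _ (.inr (.inr (.inl rfl)))
  simp only [associativity, mon, map_sub, evalLin_single, evalTree] at this ⊢
  exact this

theorem evalLin_mlieWordOp_rels : ∀ r ∈ (MLie k).rels, ∀ v : ℕ → WordPair k X,
    evalLin mlieWordOp v r = 0 := by
  rintro r (rfl | rfl | rfl) v
  · have : evalLin wordOp v (antisymmetry k LPOp.β) = 0 := evalLin_wordOp_rels v _ (.inl rfl)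
    simp only [antisymmetry, mon, map_add, evalLin_single, evalTree] at this ⊢
    exact this
  · have : evalLin wordOp v (jacobi k LPOp.β) = 0 := evalLin_wordOp_rels v _ (.inr (.inl rfl))
    simp only [jacobi, mon, map_sub, evalLin_single, evalTree] at this ⊢
    exact this
  · have : evalLin wordOp v (lieAction k LPOp.d LPOp.β) = 0 := evalLin_wordOp_rels v _ (.inr (.inr (.inr (.inr rfl))))
    simp only [lieAction, mon, map_sub, map_add, evalLin_single, evalTree] at this ⊢
    exact this

theorem homogeneous_As : Homogeneous (As k).sig (As k).rels := .of (by
  rintro r rfl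
  exact .associativity rfl rfl rfl)

theorem homogeneous_MLie : Homogeneous (MLie k).sig (MLie k).rels := .of (by
  rintro r (rfl | rfl | rfl)
  exacts [.antisymmetry rfl, .jacobi rfl rfl rfl, .lieAction rfl rfl rfl rfl rfl rfl])

end Bases

/-! ## Normal monomials and dimensions -/

section Dimensions

open PTree Colour TreeQuot

variable {X Y : Type} {χ : X → Colour} {c : Colour}

/-- In the colour `D` there are only the operations of the Lie operad. -/
def LieSignature (Γ : Signature Colour Op) (β : Op) : Prop :=
  Γ.tgt β = D ∧ ∀ g, Γ.tgt g = D → g = β ∧ Γ.src₁ g = D ∧ Γ.src₂ g = D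

theorem mem_monomials_of_perm {Γ : Signature Colour Op} {t t' : PTree Op X}
    (ht : t ∈ Γ.monomials χ c) (h : t'.labels.Perm t.labels) (h' : Γ.HasColour χ c t') :
    t' ∈ Γ.monomials χ c :=
  ⟨h.nodup_iff.2 ht.1, fun x => h.mem_iff.2 (ht.2.1 x), h'⟩

theorem comb_mem_monomials {Γ : Signature Colour Op} {a : Op} {x : X} {L : List X} :
    comb a x L ∈ Γ.monomials χ c ↔
      (x :: L).Nodup ∧ (∀ y, y ∈ x :: L) ∧ Γ.HasColour χ c (comb a x L) := by
  rw [Signature.monomials, Set.mem_ofPred_eq, labels_comb]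

section Lie

variable {P : Presentation k Colour} {β : P.Op}

theorem lieComb_mem_monomials {Γ : Signature Colour Op} {β : Op} (hΓ : LieSignature Γ β) {x : X}
    {w : List X} : lieComb β x w ∈ Γ.monomials χ D ↔
      (∀ y, χ y = D) ∧ (x :: w).Nodup ∧ ∀ y, y ∈ x :: w := by
  have h := hΓ.2 β hΓ.1
  rw [Signature.monomials, Set.mem_ofPred_eq, labels_lieComb]
  constructor
  · rintro ⟨h1, h2, h3⟩
    exact ⟨fun y => labels_eq_D hΓ.2 h3 y (by rw [labels_lieComb]; exact h2 y), h1, h2⟩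
  · rintro ⟨h1, h2, h3⟩
    exact ⟨h2, h3, hasColour_lieComb h.2.1 h.2.2 hΓ.1 fun y _ => h1 y⟩

theorem span_lieComb (hom : Homogeneous P.sig P.rels) (hΓ : LieSignature P.sig β)
    (ha : antisymmetry k β ∈ P.rels) (hj : jacobi k β ∈ P.rels) (χ : X → Colour) (x : X) :
    span k (Set.range fun w : {w // lieComb β x w ∈ P.sig.monomials χ D} =>
      P.cls ⟨_, w.2⟩) = ⊤ := by
  refine Presentation.span_cls_eq_top hom (τ := fun w : {w // lieComb β x w ∈
    P.sig.monomials χ D} => ⟨lieComb β x w.1, w.2⟩) fun t ht => ?_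
  obtain ⟨L, hp, hm⟩ := of_mem_span_lieComb ha hj hΓ.2 ht.2.2 (ht.2.1 x)
  refine span_mono ?_ hm
  rintro _ ⟨w, hw, rfl⟩
  have hw' : (x :: w).Perm t.labels := (hw.cons x).trans hp
  exact ⟨⟨w, mem_monomials_of_perm ht (by rwa [labels_lieComb]) (hasColour_lieComb
    (hΓ.2 β hΓ.1).2.1 (hΓ.2 β hΓ.1).2.2 hΓ.1 fun y hy =>
      labels_eq_D hΓ.2 ht.2.2 y (hw'.mem_iff.1 hy))⟩, rfl⟩

theorem linearIndependent_lieComb {op : P.Op → WordPair k Y →ₗ[k] WordPair k Y →ₗ[k] WordPair k Y}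
    {hR : ∀ r ∈ P.rels, ∀ v : ℕ → WordPair k Y, evalLin op v r = 0} (hβ : op β = wordOp .β)
    {g : X → Y} (hg : Injective g) (x : X) :
    LinearIndependent k fun w : {w // lieComb β x w ∈ P.sig.monomials χ D} =>
      P.evalObj χ D op hR (fun y => wordLeaf (g y)) (P.cls ⟨_, w.2⟩) := by
  refine linearIndependent_of_single (headPart (g x) ∘ₗ LinearMap.fst k _ _)
    (key := fun w => w.1.map g) (ε := fun w => (-1) ^ w.1.length)
    (fun w w' h => Subtype.ext (List.map_injective_iff.2 hg h))
    (fun w => pow_ne_zero _ (neg_ne_zero.2 one_ne_zero)) fun w => ?_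
  rw [Presentation.evalObj_cls, comp_apply]
  refine evalTree_lieComb hβ g x w.1 fun y hy e => ?_
  have := w.2.1
  rw [labels_lieComb] at this
  exact (List.nodup_cons.1 this).1 (hg e ▸ hy)

end Lie

/-! ### Counting words -/

theorem natCard_perm {L : List X} (hL : L.Nodup) :
    Nat.card {w : List X // w.Perm L} = L.length.factorial := by
  classical
  rw [Nat.subtype_card L.permutations.toFinset fun w => by
    rw [List.mem_toFinset, List.mem_permutations],
    List.toFinset_card_of_nodup (List.nodup_permutations L hL), List.length_permutations]

theorem natCard_cons [Finite X] (x : X) :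
    Nat.card {w : List X // (x :: w).Nodup ∧ ∀ y, y ∈ x :: w} = (Nat.card X - 1).factorial := by
  classical
  have := Fintype.ofFinite X
  have hn : (Finset.univ : Finset X).toList.Nodup := Finset.nodup_toList _
  have h : ∀ w : List X, ((x :: w).Nodup ∧ ∀ y, y ∈ x :: w) ↔
      w.Perm ((Finset.univ : Finset X).toList.erase x) := fun w => by
    refine Iff.trans ?_ (List.cons_perm_iff_perm_erase.trans (and_iff_right (by simp)))
    refine ⟨fun h => (List.perm_ext_iff_of_nodup h.1 hn).2 fun y => by simpa using h.2 y,
      fun h => ⟨h.nodup_iff.2 hn, fun y => h.mem_iff.2 (by simp)⟩⟩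
  rw [Nat.card_congr (Equiv.subtypeEquivRight h), natCard_perm (hn.erase _),
    List.length_erase_of_mem (by simp), Finset.length_toList, Finset.card_univ,
    Nat.card_eq_fintype_card]

/-- The words in all the letters whose first letter is solid. -/
def headWords (χ : X → Colour) : Set (X × List X) :=
  {q | χ q.1 = S ∧ (q.1 :: q.2).Nodup ∧ ∀ y, y ∈ q.1 :: q.2}

theorem natCard_headWords [Finite X] (χ : X → Colour) : Nat.card (headWords χ) =
    Nat.card {x // χ x = S} * (Nat.card X - 1).factorial := by
  have e : headWords χ ≃ Σ x : {x // χ x = S}, {w : List X // (x.1 :: w).Nodup ∧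
      ∀ y, y ∈ x.1 :: w} :=
    ⟨fun q => ⟨⟨q.1.1, q.2.1⟩, q.1.2, q.2.2⟩, fun q => ⟨(q.1.1, q.2.1), q.1.2, q.2.2⟩,
      fun _ => rfl, fun _ => rfl⟩
  have (x : X) : Finite {w : List X // (x :: w).Nodup ∧ ∀ y, y ∈ x :: w} :=
    Nat.finite_of_card_ne_zero (by rw [natCard_cons]; exact Nat.factorial_ne_zero _)
  have := Fintype.ofFinite {x // χ x = S}
  rw [Nat.card_congr e, Nat.card_sigma, sum_congr rfl fun x _ => natCard_cons x.1,
    Finset.sum_const, smul_eq_mul, Finset.card_univ,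
    Nat.card_eq_fintype_card (α := {x // χ x = S})]

theorem takeWhile_append_letters {w : List X} {p : List (Block X)} (hw : ∀ y ∈ w, χ y = D)
    (hp : ∀ b ∈ p, b.Coloured χ) : (w ++ letters p).takeWhile (fun y => χ y = D) = w := by
  rw [List.takeWhile_append_of_pos fun y hy => by simpa using hw y hy]
  cases p with
  | nil => simp [letters]
  | cons b p =>
    have hS := (hp b (mem_cons_self ..)).1
    rw [letters, List.flatMap_cons, Block.letters, cons_append,
      List.takeWhile_cons_of_neg (by simp [hS]), List.append_nil]

theorem letters_injective {p p' : List (Block X)} (hp : ∀ b ∈ p, b.Coloured χ)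
    (hp' : ∀ b ∈ p', b.Coloured χ) (h : letters p = letters p') : p = p' := by
  induction p generalizing p' with
  | nil =>
    cases p' with
    | nil => rfl
    | cons b p' => cases h
  | cons b p ih =>
    cases p' with
    | nil => cases h
    | cons b' p' =>
      obtain ⟨h1, h2⟩ := List.cons.inj h
      change (ofLex b).2 ++ letters p = (ofLex b').2 ++ letters p' at h2
      have c := fun d hd => hp d (mem_cons_of_mem b hd)
      have c' := fun d hd => hp' d (mem_cons_of_mem b' hd)
      have e := takeWhile_append_letters (hp b (mem_cons_self ..)).2 c
      rw [h2, takeWhile_append_letters (hp' b' (mem_cons_self ..)).2 c'] at e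
      rw [e, List.append_cancel_left_eq] at h2
      rw [ih c c' h2, show b = b' from Prod.ext h1 e.symm]

theorem exists_letters_eq (χ : X → Colour) (L : List X) : ∃ w p, L = w ++ letters p ∧
    (∀ y ∈ w, χ y = D) ∧ ∀ b ∈ p, Block.Coloured χ b := by
  induction L with
  | nil => exact ⟨[], [], rfl, by simp, by simp⟩
  | cons y L ih =>
    obtain ⟨w, p, rfl, hw, hp⟩ := ih
    cases hy : χ y with
    | D => exact ⟨y :: w, p, rfl, List.forall_mem_cons.2 ⟨hy, hw⟩, hp⟩
    | S => exact ⟨[], toLex (y, w) :: p, rfl, by simp, List.forall_mem_cons.2 ⟨⟨hy, hw⟩, hp⟩⟩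

/-! ### The dimensions -/

theorem finrank_eq_zero_of_isEmpty {P : Presentation k Colour} [IsEmpty X] :
    Module.finrank k (P.toColl.obj X χ c) = 0 := by
  have : IsEmpty (P.sig.monomials χ c) := ⟨fun t => by
    obtain ⟨x, -⟩ := List.exists_mem_of_ne_nil _ (labels_ne_nil t.1)
    exact IsEmpty.false x⟩
  rw [finrank_eq_natCard (linearIndependent_empty_type (v := P.cls (χ := χ) (c := c)))
    Presentation.span_range_cls, Nat.card_eq_zero]
  exact .inl inferInstance

open Classical in
/-- The components of the Lie operad. -/
theorem finrank_obj_D [Finite X] {P : Presentation k Colour} {β : P.Op}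
    (hom : Homogeneous P.sig P.rels) (hΓ : LieSignature P.sig β)
    (ha : antisymmetry k β ∈ P.rels) (hj : jacobi k β ∈ P.rels)
    {op : P.Op → WordPair k X →ₗ[k] WordPair k X →ₗ[k] WordPair k X}
    (hR : ∀ r ∈ P.rels, ∀ v : ℕ → WordPair k X, evalLin op v r = 0) (hβ : op β = wordOp .β) :
    Module.finrank k (P.toColl.obj X χ D) =
      if Nonempty X ∧ ∀ x, χ x = D then (Nat.card X - 1).factorial else 0 := by
  rcases isEmpty_or_nonempty X with hX | ⟨⟨x⟩⟩
  · rw [finrank_eq_zero_of_isEmpty, if_neg fun h => not_isEmpty_iff.2 h.1 hX]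
  · rw [finrank_eq_natCard (of_comp (P.evalObj χ D op hR wordLeaf)
      (linearIndependent_lieComb (χ := χ) (hR := hR) hβ Function.injective_id x))
      (span_lieComb hom hΓ ha hj χ x)]
    split_ifs with h
    · rw [← natCard_cons x]
      exact Nat.card_congr (Equiv.subtypeEquivRight fun w =>
        (lieComb_mem_monomials hΓ).trans (and_iff_right h.2))
    · rw [Nat.card_eq_zero]
      exact .inl ⟨fun w => h ⟨⟨x⟩, ((lieComb_mem_monomials hΓ).1 w.2).1⟩⟩

theorem lieSignature_LP : LieSignature lpSig .β :=
  ⟨rfl, fun g hg => by cases g <;> first | exact ⟨rfl, rfl, rfl⟩ | cases hg⟩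

theorem lieSignature_MLie : LieSignature mlieSig .β :=
  ⟨rfl, fun g hg => by cases g <;> first | exact ⟨rfl, rfl, rfl⟩ | cases hg⟩

section Modules

variable {Γ : Signature Colour Op} {β d a : Op}

theorem hasColour_modComb_iff (h1 : Γ.src₁ d = D) (h2 : Γ.src₂ d = S) (h3 : Γ.tgt d = S) {s : X}
    {w : List X} : Γ.HasColour χ S (modComb d s w) ↔ χ s = S ∧ ∀ y ∈ w, χ y = D := by
  refine ⟨fun h => ?_, fun h => hasColour_modComb h1 h2 h3 h.1 h.2⟩
  induction w using reverseRecOn with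
  | nil => exact ⟨h, by simp⟩
  | append_singleton w y ih =>
    rw [modComb_append] at h
    obtain ⟨-, c1, c2⟩ := h
    rw [h1] at c1
    rw [h2] at c2
    exact ⟨(ih c2).1, fun z hz => (mem_append.1 hz).elim ((ih c2).2 z) fun hz => by
      rw [mem_singleton.1 hz]; exact c1⟩

theorem modComb_mem_monomials (h1 : Γ.src₁ d = D) (h2 : Γ.src₂ d = S) (h3 : Γ.tgt d = S)
    {b : Block X} : modComb d (ofLex b).1 (ofLex b).2 ∈ Γ.monomials χ S ↔
      b.Coloured χ ∧ b.letters.Nodup ∧ ∀ y, y ∈ b.letters := by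
  have hp := labels_modComb d (ofLex b).1 (ofLex b).2
  rw [Block.Coloured, ← hasColour_modComb_iff h1 h2 h3, Block.letters, ← hp.nodup_iff]
  simp only [← hp.mem_iff]
  exact ⟨fun h => ⟨h.2.2, h.1, h.2.1⟩, fun h => ⟨h.2.1, h.2.2, h.1⟩⟩

theorem blockComb_mem_monomials (h1 : Γ.src₁ d = D) (h2 : Γ.src₂ d = S) (h3 : Γ.tgt d = S)
    (h4 : Γ.src₁ a = S) (h5 : Γ.src₂ a = S) (h6 : Γ.tgt a = S) {b : Block X} {p : List (Block X)} :
    blockComb d a b p ∈ Γ.monomials χ S ↔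
      (∀ b' ∈ b :: p, b'.Coloured χ) ∧ (letters (b :: p)).Nodup ∧ ∀ y, y ∈ letters (b :: p) := by
  have hp := labels_blockComb d a b p
  have hc : Γ.HasColour χ S (blockComb d a b p) ↔ ∀ b' ∈ b :: p, b'.Coloured χ := by
    clear hp
    induction p generalizing b with
    | nil =>
      rw [List.forall_mem_singleton]
      exact hasColour_modComb_iff h1 h2 h3
    | cons b' p ih =>
      rw [List.forall_mem_cons, ← ih, Block.Coloured, ← hasColour_modComb_iff h1 h2 h3]
      change Γ.tgt a = S ∧ Γ.HasColour χ (Γ.src₁ a) _ ∧ Γ.HasColour χ (Γ.src₂ a) _ ↔ _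
      rw [h4, h5]
      exact and_iff_right h6
  rw [← hc, ← hp.nodup_iff]
  simp only [← hp.mem_iff]
  exact ⟨fun h => ⟨h.2.2, h.1, h.2.1⟩, fun h => ⟨h.2.1, h.2.2, h.1⟩⟩

end Modules

section Generic

variable {P : Presentation k Colour} {β d a : P.Op}
  {op : P.Op → WordPair k Y →ₗ[k] WordPair k Y →ₗ[k] WordPair k Y}
  {hR : ∀ r ∈ P.rels, ∀ v : ℕ → WordPair k Y, evalLin op v r = 0}

theorem span_modComb (hom : Homogeneous P.sig P.rels) (hΓ : LieSignature P.sig β)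
    (hd : lieAction k d β ∈ P.rels) (h1 : P.sig.src₁ d = D) (h2 : P.sig.src₂ d = S)
    (h3 : P.sig.tgt d = S) (hS : ∀ g, P.sig.tgt g = S → g = d) (χ : X → Colour) :
    span k (Set.range fun b : {b : Block X // modComb d (ofLex b).1 (ofLex b).2 ∈
      P.sig.monomials χ S} => P.cls ⟨_, b.2⟩) = ⊤ := by
  refine Presentation.span_cls_eq_top hom (τ := fun b : {b : Block X //
    modComb d (ofLex b).1 (ofLex b).2 ∈ P.sig.monomials χ S} =>
      ⟨modComb d (ofLex b.1).1 (ofLex b.1).2, b.2⟩) fun t ht => ?_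
  obtain ⟨s, L, hs, hL, hp, hm⟩ := of_mem_span_modComb (R := P.rels) (d := d)
    hd hΓ.2 (fun g hg => by rw [hS g hg]; exact ⟨rfl, h1, h2⟩) ht.2.2
  refine span_mono ?_ hm
  rintro _ ⟨w, hw, rfl⟩
  have hw' : (s :: w).Perm t.labels := (hw.cons s).trans hp
  exact ⟨⟨toLex (s, w), (modComb_mem_monomials h1 h2 h3).2 ⟨⟨hs, fun y hy => hL y (hw.mem_iff.1 hy)⟩,
    hw'.nodup_iff.2 ht.1, fun y => hw'.mem_iff.2 (ht.2.1 y)⟩⟩, rfl⟩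

theorem linearIndependent_modComb (hd : op d = wordOp .d) {g : X → Y} (hg : Injective g) :
    LinearIndependent k fun b : {b : Block X // modComb d (ofLex b).1 (ofLex b).2 ∈
      P.sig.monomials χ S} => P.evalObj χ S op hR (fun y => wordLeaf (g y)) (P.cls ⟨_, b.2⟩) := by
  refine linearIndependent_of_single (LinearMap.snd k _ _)
    (key := fun b => [toLex (g (ofLex b.1).1, (ofLex b.1).2.map g)]) (ε := fun _ => 1)
    (fun b b' h => Subtype.ext ?_) (fun _ => one_ne_zero) fun b => ?_
  · have h' : (g (ofLex b.1).1, (ofLex b.1).2.map g) = (g (ofLex b'.1).1, (ofLex b'.1).2.map g) :=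
      List.singleton_inj.1 h
    rw [Prod.mk.injEq] at h'
    exact Prod.ext (hg h'.1) (List.map_injective_iff.2 hg h'.2)
  · rw [Presentation.evalObj_cls, one_smul]
    exact evalTree_modComb hd g _ _

theorem span_blockComb (hom : Homogeneous P.sig P.rels) (hΓ : LieSignature P.sig β)
    (ha : associativity k a ∈ P.rels) (hder : derivation k d a ∈ P.rels)
    (hd : lieAction k d β ∈ P.rels) (h1 : P.sig.src₁ d = D) (h2 : P.sig.src₂ d = S)
    (h3 : P.sig.tgt d = S) (h4 : P.sig.src₁ a = S) (h5 : P.sig.src₂ a = S) (h6 : P.sig.tgt a = S)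
    (hS : ∀ g, P.sig.tgt g = S → g = d ∨ g = a) (χ : X → Colour) :
    span k (Set.range fun b : {b : Block X × List (Block X) //
      blockComb d a b.1 b.2 ∈ P.sig.monomials χ S} => P.cls ⟨_, b.2⟩) = ⊤ := by
  refine Presentation.span_cls_eq_top hom (τ := fun b : {b : Block X × List (Block X) //
    blockComb d a b.1 b.2 ∈ P.sig.monomials χ S} => ⟨blockComb d a b.1.1 b.1.2, b.2⟩) fun t ht => ?_
  have hm := of_mem_blockSpan (R := P.rels) ha hder hd hΓ.2 (fun g hg => by
    rcases hS g hg with rfl | rfl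
    · exact ⟨.inl ⟨rfl, h1⟩, h2⟩
    · exact ⟨.inr ⟨rfl, h4⟩, h5⟩) ht.2.2
  refine span_mono ?_ hm
  rintro _ ⟨b, p, hp, hc, rfl⟩
  exact ⟨⟨(b, p), (blockComb_mem_monomials h1 h2 h3 h4 h5 h6).2 ⟨hc, hp.nodup_iff.2 ht.1,
    fun y => hp.mem_iff.2 (ht.2.1 y)⟩⟩, rfl⟩

theorem linearIndependent_blockComb (hd : op d = wordOp .d) (ha : op a = wordOp .a)
    {χ : Y → Colour} : LinearIndependent k fun b : {b : Block Y × List (Block Y) //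
      blockComb d a b.1 b.2 ∈ P.sig.monomials χ S} =>
        P.evalObj χ S op hR wordLeaf (P.cls ⟨_, b.2⟩) := by
  refine linearIndependent_of_single (LinearMap.snd k _ _)
    (key := fun b => b.1.1 :: b.1.2) (ε := fun _ => 1)
    (fun b b' h => Subtype.ext (Prod.ext (List.cons.inj h).1 (List.cons.inj h).2))
    (fun _ => one_ne_zero) fun b => ?_
  rw [Presentation.evalObj_cls, one_smul]
  exact evalTree_blockComb hd ha _ _

theorem span_comb (hom : Homogeneous P.sig P.rels) (ha : associativity k a ∈ P.rels)
    (hop : ∀ g, g = a) (h4 : P.sig.src₁ a = S) (h5 : P.sig.src₂ a = S) (h6 : P.sig.tgt a = S)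
    (χ : X → Colour) (c : Colour) :
    span k (Set.range fun q : {q : X × List X //
      comb a q.1 q.2 ∈ P.sig.monomials χ c} => P.cls ⟨_, q.2⟩) = ⊤ := by
  refine Presentation.span_cls_eq_top hom (τ := fun q : {q : X × List X //
    comb a q.1 q.2 ∈ P.sig.monomials χ c} => ⟨comb a q.1.1 q.1.2, q.2⟩) fun t ht => ?_
  obtain ⟨x, L, hl, e⟩ := of_eq_of_comb (R := P.rels) ha hop t
  rw [e]
  refine subset_span ⟨⟨(x, L), mem_monomials_of_perm ht ?_ ?_⟩, rfl⟩
  · rw [labels_comb, hl]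
  · have hS := labels_eq (Γ := P.sig) (χ := χ) (t := t) (c := S) fun g _ => by
      rw [hop g]; exact ⟨h4, h5⟩
    cases t with
    | leaf y =>
      obtain ⟨rfl, rfl⟩ := List.cons.inj hl
      exact ht.2.2
    | node g l r =>
      have := ht.2.2.1
      rw [hop g, h6] at this
      subst this
      exact hasColour_comb h4 h5 h6 fun y hy => hS ht.2.2 y (hl ▸ hy)

theorem linearIndependent_comb (ha : op a = wordOp .a) {χ : Y → Colour} :
    LinearIndependent k fun q : {q : Y × List Y // comb a q.1 q.2 ∈ P.sig.monomials χ c} =>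
      P.evalObj χ c op hR wordLeaf (P.cls ⟨_, q.2⟩) := by
  refine linearIndependent_of_single (LinearMap.snd k _ _)
    (key := fun q => (q.1.1 :: q.1.2).flatMap fun y => [toLex (y, [])]) (ε := fun _ => 1)
    (fun q q' h => Subtype.ext ?_) (fun _ => one_ne_zero) fun q => ?_
  · have e : ∀ L : List Y, L.flatMap (fun y => [(toLex (y, []) : Block Y)]) =
        L.map fun y => toLex (y, []) := fun L => by
      induction L with
      | nil => rfl
      | cons y L ih => rw [List.flatMap_cons, ih]; rfl
    have inj : Injective fun y : Y => (toLex (y, []) : Block Y) :=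
      fun x y h => congrArg (fun b => (ofLex b).1) h
    have := List.map_injective_iff.2 inj ((e _).symm.trans (h.trans (e _)))
    exact Prod.ext (List.cons.inj this).1 (List.cons.inj this).2
  · rw [Presentation.evalObj_cls, one_smul]
    exact evalTree_comb ha (fun y => rfl) _ _

end Generic

end Dimensions

/-! ## Generating series -/

section Series

open PTree Colour TreeQuot

variable {X : Type} {χ : X → Colour} {c : Colour}

theorem module_finite_obj [Finite X] (P : Presentation k Colour) [Finite P.Op] :
    Module.Finite k (P.toColl.obj X χ c) := by
  classical
  have := Fintype.ofFinite X
  have : Finite (P.sig.monomials χ c) := by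
    refine ((finite_setOf_perm (Finset.univ : Finset X).toList).subset fun t ht => ?_).to_subtype
    exact (List.perm_ext_iff_of_nodup ht.1 (Finset.nodup_toList _)).2 fun x => by simpa using ht.2.1 x
  exact Module.Finite.of_surjective (M := P.Free χ c) (Submodule.mkQ _) (Submodule.mkQ_surjective _)

instance : Finite AsOp :=
  Finite.of_injective (fun _ => 0 : AsOp → Fin 1) fun g g' _ => by cases g; cases g'; rfl

instance : Finite MLieOp :=
  Finite.of_injective (fun | .β => 0 | .d => 1 : MLieOp → Fin 2) fun g g' h => by
    cases g <;> cases g' <;> first | rfl | simp at h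

variable (χ) in
theorem span_blockComb_LP : span k (Set.range fun b : {b : Block X × List (Block X) //
    blockComb LPOp.d LPOp.a b.1 b.2 ∈ lpSig.monomials χ S} => (LP k).cls ⟨_, b.2⟩) = ⊤ :=
  span_blockComb (P := LP k) (β := LPOp.β) homogeneous_LP lieSignature_LP
    (.inr (.inr (.inl rfl))) (.inr (.inr (.inr (.inl rfl)))) (.inr (.inr (.inr (.inr rfl))))
    rfl rfl rfl rfl rfl rfl (fun g hg => by
      cases g
      · cases hg
      · exact .inr rfl
      · exact .inl rfl) χ

theorem finrank_LP_S [Finite X] : Module.finrank k ((LP k).toColl.obj X χ S) =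
    Nat.card {x // χ x = S} * (Nat.card X - 1).factorial := by
  have mem := fun (b : Block X) (p : List (Block X)) => blockComb_mem_monomials (Γ := lpSig)
    (d := .d) (a := .a) (χ := χ) rfl rfl rfl rfl rfl rfl (b := b) (p := p)
  rw [finrank_eq_natCard (of_comp ((LP k).evalObj χ S wordOp
    (fun r hr v => evalLin_wordOp_rels v r hr) wordLeaf)
    (linearIndependent_blockComb (P := LP k) (d := LPOp.d) (a := LPOp.a) rfl rfl))
    (span_blockComb_LP χ), ← natCard_headWords]
  refine Nat.card_eq_of_bijective (fun b => ⟨((ofLex b.1.1).1, (ofLex b.1.1).2 ++ letters b.1.2),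
    (((mem _ _).1 b.2).1 _ (mem_cons_self ..)).1, ((mem _ _).1 b.2).2⟩) ⟨fun b b' h => ?_, ?_⟩
  · have h' := congrArg (fun q : headWords χ => q.1.1 :: q.1.2) h
    have := letters_injective ((mem _ _).1 b.2).1 ((mem _ _).1 b'.2).1 h'
    exact Subtype.ext (Prod.ext (List.cons.inj this).1 (List.cons.inj this).2)
  · rintro ⟨⟨x, L⟩, hx, hn, hc⟩
    obtain ⟨w, p, rfl, hw, hp⟩ := exists_letters_eq χ L
    exact ⟨⟨(toLex (x, w), p), (mem _ _).2 ⟨List.forall_mem_cons.2 ⟨⟨hx, hw⟩, hp⟩, hn, hc⟩⟩, rfl⟩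

theorem finrank_MLie_S [Finite X] : Module.finrank k ((MLie k).toColl.obj X χ S) =
    if Nat.card {x // χ x = S} = 1 then (Nat.card X - 1).factorial else 0 := by
  have mem := fun (b : Block X) => modComb_mem_monomials (Γ := mlieSig) (d := .d) (χ := χ)
    rfl rfl rfl (b := b)
  rw [finrank_eq_natCard (of_comp ((MLie k).evalObj χ S mlieWordOp evalLin_mlieWordOp_rels wordLeaf)
    (linearIndependent_modComb (P := MLie k) (d := MLieOp.d) rfl Function.injective_id))
    (span_modComb (P := MLie k) (β := MLieOp.β) homogeneous_MLie lieSignature_MLie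
      (.inr (.inr rfl)) rfl rfl rfl (fun g hg => by
        cases g
        · cases hg
        · rfl) χ)]
  have unique : ∀ (b : Block X), b.Coloured χ → (∀ y, y ∈ b.letters) → ∀ y, χ y = S →
      y = (ofLex b).1 := fun b hb hc y hy => by
    refine (List.mem_cons.1 (hc y)).resolve_right fun h => ?_
    rw [hb.2 y h] at hy
    cases hy
  split_ifs with h
  · have e := natCard_headWords χ
    rw [h, one_mul] at e
    rw [← e]
    refine Nat.card_congr (ofLex.subtypeEquiv fun b => (mem b).trans ⟨fun h => ⟨h.1.1, h.2⟩,
      fun h' => ⟨⟨h'.1, fun y hy => ?_⟩, h'.2⟩⟩)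
    cases hχ : χ y with
    | D => rfl
    | S =>
      obtain ⟨hs, -⟩ := Nat.card_eq_one_iff_unique.1 h
      have : y = (ofLex b).1 := congrArg Subtype.val (hs.elim ⟨y, hχ⟩ ⟨_, h'.1⟩)
      exact absurd (this ▸ hy) (List.nodup_cons.1 h'.2.1).1
  · refine Nat.card_eq_zero.2 (.inl ⟨fun b => h (Nat.card_eq_one_iff_unique.2 ?_)⟩)
    obtain ⟨h1, -, h2⟩ := (mem b.1).1 b.2
    exact ⟨⟨fun y z => Subtype.ext ((unique _ h1 h2 _ y.2).trans (unique _ h1 h2 _ z.2).symm)⟩,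
      ⟨⟨_, h1.1⟩⟩⟩

open Classical in
theorem finrank_As_S [Finite X] : Module.finrank k ((As k).toColl.obj X χ S) =
    if ∀ x, χ x = S then Nat.card X * (Nat.card X - 1).factorial else 0 := by
  rw [finrank_eq_natCard (of_comp ((As k).evalObj χ S asWordOp
    evalLin_asWordOp_rels wordLeaf) (linearIndependent_comb (P := As k) (a := AsOp.a) rfl))
    (span_comb (P := As k) (a := AsOp.a) homogeneous_As rfl (fun g => rfl) rfl rfl rfl χ S)]
  split_ifs with h
  · have e := natCard_headWords χ
    rw [Nat.card_congr (Equiv.subtypeUnivEquiv h)] at e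
    rw [← e]
    refine Nat.card_congr (Equiv.subtypeEquivRight fun q => ?_)
    have hl := labels_comb (Op := (As k).Op) AsOp.a q.1 q.2
    constructor
    · rintro ⟨h1, h2, -⟩
      rw [hl] at h1
      exact ⟨h _, h1, fun y => hl ▸ h2 y⟩
    · rintro ⟨-, h1, h2⟩
      exact ⟨hl.symm ▸ h1, fun y => hl.symm ▸ h2 y, hasColour_comb rfl rfl rfl fun y _ => h y⟩
  · exact Nat.card_eq_zero.2 (.inl ⟨fun q => h fun x =>
    labels_eq (fun _ _ => ⟨rfl, rfl⟩) q.2.2.2 x (q.2.2.1 x)⟩)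

open Classical in
theorem finrank_As_D [Finite X] : Module.finrank k ((As k).toColl.obj X χ D) =
    if Nat.card X = 1 ∧ ∀ x, χ x = D then 1 else 0 := by
  rw [finrank_eq_natCard (of_comp ((As k).evalObj χ D asWordOp
    evalLin_asWordOp_rels wordLeaf) (linearIndependent_comb (P := As k) (a := AsOp.a) rfl))
    (span_comb (P := As k) (a := AsOp.a) homogeneous_As rfl (fun g => rfl) rfl rfl rfl χ D)]
  have leaf : ∀ q : {q : X × List X // comb AsOp.a q.1 q.2 ∈ (As k).sig.monomials χ D},
      q.1.2 = [] ∧ χ q.1.1 = D ∧ ∀ y, y = q.1.1 := by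
    rintro ⟨⟨x, L⟩, h1, h2, h3⟩
    cases L with
    | nil => exact ⟨rfl, h3, fun y => mem_singleton.1 (h2 y)⟩
    | cons y L => cases h3.1
  split_ifs with h
  · obtain ⟨h1, h2⟩ := h
    obtain ⟨hs, ⟨x⟩⟩ := Nat.card_eq_one_iff_unique.1 h1
    refine Nat.card_eq_one_iff_unique.2 ⟨⟨fun q q' => Subtype.ext (Prod.ext (hs.elim _ _)
      ((leaf q).1.trans (leaf q').1.symm))⟩, ⟨⟨(x, []), List.nodup_singleton x,
      fun y => mem_singleton.2 (hs.elim _ _), h2 x⟩⟩⟩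
  · refine Nat.card_eq_zero.2 (.inl ⟨fun q => h ?_⟩)
    obtain ⟨-, h1, h2⟩ := leaf q
    exact ⟨Nat.card_eq_one_iff_unique.2 ⟨⟨fun y z => (h2 y).trans (h2 z).symm⟩, ⟨q.1.1⟩⟩,
      fun y => h2 y ▸ h1⟩

/-! ### Coefficients -/

theorem sum_colour {M : Type*} [AddCommMonoid M] (f : Colour → M) : ∑ i, f i = f S + f D := by
  rw [show (Finset.univ : Finset Colour) = {S, D} from rfl, Finset.sum_pair (by simp)]

theorem prod_colour {M : Type*} [CommMonoid M] (f : Colour → M) : ∏ i, f i = f S * f D := by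
  rw [show (Finset.univ : Finset Colour) = {S, D} from rfl, Finset.prod_pair (by simp)]

variable (m : Colour →₀ ℕ)

theorem natCard_sigma : Nat.card (Σ i, Fin (m i)) = m S + m D := by
  rw [Nat.card_sigma, sum_colour, Nat.card_fin, Nat.card_fin]

theorem natCard_solid : Nat.card {x : Σ i, Fin (m i) // x.1 = S} = m S := by
  rw [Nat.card_congr (Equiv.sigmaSubtype S), Nat.card_fin]

theorem forall_fst_iff {c c' : Colour} (h : ∀ i, i = c ∨ i = c') (hne : c ≠ c') :
    (∀ x : Σ i, Fin (m i), x.1 = c) ↔ m c' = 0 := by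
  constructor
  · intro h
    by_contra h0
    exact hne.symm (h ⟨c', ⟨0, Nat.pos_of_ne_zero h0⟩⟩)
  · rintro h0 ⟨i, y⟩
    refine (h i).resolve_right ?_
    rintro rfl
    rw [h0] at y
    exact y.elim0

theorem forall_fst_S : (∀ x : Σ i, Fin (m i), x.1 = S) ↔ m D = 0 :=
  forall_fst_iff m (fun i => by cases i <;> simp) (by simp)

theorem forall_fst_D : (∀ x : Σ i, Fin (m i), x.1 = D) ↔ m S = 0 :=
  forall_fst_iff m (fun i => by cases i <;> simp) (by simp)

theorem coeff_genSeries (P : SymColl k Colour) (c : Colour) : (P.genSeries c).coeff m =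
    (Module.finrank k (P.obj (Σ i, Fin (m i)) Sigma.fst c) : ℚ) /
      ((m S).factorial * (m D).factorial) := by
  rw [← prod_colour fun i => ((m i).factorial : ℚ)]
  rfl

theorem coeff_genSeries_LP_S : ((LP k).toColl.genSeries S).coeff m =
    m S * (m S + m D - 1).factorial / ((m S).factorial * (m D).factorial) := by
  rw [coeff_genSeries, finrank_LP_S, natCard_solid, natCard_sigma, Nat.cast_mul]

theorem coeff_genSeries_MLie_S : ((MLie k).toColl.genSeries S).coeff m =
    if m S = 1 then 1 else 0 := by
  rw [coeff_genSeries, finrank_MLie_S, natCard_solid, natCard_sigma]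
  split_ifs with h
  · rw [h, Nat.add_sub_cancel_left, Nat.factorial_one, Nat.cast_one, one_mul,
      div_self (Nat.cast_ne_zero.2 (Nat.factorial_ne_zero _))]
  · rw [Nat.cast_zero, zero_div]

theorem coeff_genSeries_As_S : ((As k).toColl.genSeries S).coeff m =
    if m D = 0 ∧ m S ≠ 0 then 1 else 0 := by
  rw [coeff_genSeries, finrank_As_S, natCard_sigma, forall_fst_S]
  by_cases h : m D = 0
  · rw [if_pos h, h, add_zero, Nat.factorial_zero, Nat.cast_one, mul_one]
    by_cases h0 : m S = 0
    · simp [h0]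
    · rw [Nat.mul_factorial_pred h0, if_pos ⟨rfl, h0⟩,
        div_self (Nat.cast_ne_zero.2 (Nat.factorial_ne_zero _))]
  · simp [h]


theorem coeff_genSeries_As_D : ((As k).toColl.genSeries D).coeff m =
    if m = single D 1 then 1 else 0 := by
  have h : m = single D 1 ↔ m S + m D = 1 ∧ m S = 0 := by
    constructor
    · rintro rfl
      simp
    · rintro ⟨h1, h2⟩
      ext c
      cases c
      · simpa using h2
      · simpa [h2] using h1
  rw [coeff_genSeries, finrank_As_D, natCard_sigma, forall_fst_D]
  simp only [h]
  split_ifs with h'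
  · rw [h'.2, show m D = 1 by omega]
    simp
  · rw [Nat.cast_zero, zero_div]

theorem coeff_neg_log : (- PowerSeries.subst (- MvPowerSeries.X D : MvPowerSeries Colour ℚ)
    (PowerSeries.log ℚ)).coeff m = if m S = 0 ∧ m D ≠ 0 then ((m D : ℚ))⁻¹ else 0 := by
  have hs : PowerSeries.HasSubst (- MvPowerSeries.X D : MvPowerSeries Colour ℚ) :=
    PowerSeries.HasSubst.of_constantCoeff_zero (by simp)
  rw [map_neg, PowerSeries.coeff_subst hs]
  have key : ∀ n, PowerSeries.coeff n (PowerSeries.log ℚ) •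
      MvPowerSeries.coeff m ((- MvPowerSeries.X D : MvPowerSeries Colour ℚ) ^ n) =
        if m = single D n ∧ n ≠ 0 then - (n : ℚ)⁻¹ else 0 := by
    intro n
    rw [neg_pow, PowerSeries.coeff_log]
    have : (-1 : MvPowerSeries Colour ℚ) ^ n = MvPowerSeries.C ((-1 : ℚ) ^ n) := by simp
    rw [this, MvPowerSeries.coeff_C_mul, MvPowerSeries.coeff_X_pow]
    by_cases h0 : n = 0
    · simp [h0]
    · by_cases h1 : m = single D n
      · simp only [h0, h1, if_true, if_false, ne_eq, not_false_eq_true, and_self, smul_eq_mul,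
          mul_one, Algebra.algebraMap_self, RingHom.id_apply]
        rw [div_mul_eq_mul_div, ← pow_add, show n + 1 + n = 2 * n + 1 by ring, pow_succ, pow_mul]
        simp [neg_div]
      · simp [h1]
  simp only [key]
  have iff : ∀ n, m = single D n ↔ m S = 0 ∧ n = m D := fun n => by
    constructor
    · rintro rfl
      simp
    · rintro ⟨h, rfl⟩
      ext c
      cases c
      · simpa using h
      · simp
  rw [finsum_eq_single _ (m D) fun n hn => if_neg fun h => hn ((iff n).1 h.1).2]
  simp only [iff, and_true]
  split_ifs <;> simp

theorem coeff_genSeries_D {P : Presentation k Colour}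
    (hP : Module.finrank k (P.toColl.obj (Σ i, Fin (m i)) Sigma.fst D) =
      open Classical in if Nonempty (Σ i, Fin (m i)) ∧ ∀ x : Σ i, Fin (m i), x.1 = D then
        (Nat.card (Σ i, Fin (m i)) - 1).factorial else 0) :
    (P.toColl.genSeries D).coeff m = if m S = 0 ∧ m D ≠ 0 then ((m D : ℚ))⁻¹ else 0 := by
  have hn : Nonempty (Σ i, Fin (m i)) ↔ m S + m D ≠ 0 := by
    rw [← natCard_sigma, ← Nat.pos_iff_ne_zero, Nat.card_pos_iff]
    exact (and_iff_left (inferInstance : Finite (Σ i, Fin (m i)))).symm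
  rw [coeff_genSeries, hP]
  simp only [hn, forall_fst_D, natCard_sigma]
  by_cases h : m S = 0
  · by_cases h0 : m D = 0
    · simp [h, h0]
    · rw [if_pos ⟨by omega, h⟩, if_pos ⟨h, h0⟩, h, zero_add, Nat.factorial_zero, Nat.cast_one, one_mul,
        ← Nat.mul_factorial_pred h0, Nat.cast_mul, div_mul_cancel_right₀]
      exact Nat.cast_ne_zero.2 (Nat.factorial_ne_zero _)
  · simp [h]

end Series

/-! ### The series -/

section SeriesIdentities

open Colour

variable (m : Colour →₀ ℕ)

open MvPowerSeries in
theorem coeff_mul_X (F : MvPowerSeries Colour ℚ) (c : Colour) :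
    (F * X c).coeff m = if m c = 0 then 0 else F.coeff (m - single c 1) := by
  rw [X, coeff_mul_monomial, mul_one]
  by_cases h : m c = 0
  · rw [if_pos h, if_neg fun h' => by simpa [h] using h' c]
  · rw [if_neg h, if_pos (Finsupp.single_le_iff.2 (Nat.one_le_iff_ne_zero.2 h))]

theorem eq_single_S_iff : m = single S 1 ↔ m S = 1 ∧ m D = 0 := by
  constructor
  · rintro rfl
    simp
  · rintro ⟨h1, h2⟩
    ext c
    cases c
    · simpa using h1
    · simpa using h2

open MvPowerSeries in
theorem genSeries_As_S : (As k).toColl.genSeries S = X S * (1 - X S)⁻¹ := by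
  rw [MvPowerSeries.eq_mul_inv_iff_mul_eq (by simp)]
  ext m
  rw [mul_sub, mul_one, map_sub, coeff_mul_X, coeff_genSeries_As_S, coeff_genSeries_As_S, coeff_X]
  simp only [eq_single_S_iff, Finsupp.tsub_apply, Finsupp.single_eq_same,
    single_eq_of_ne (show D ≠ S by simp), tsub_zero]
  by_cases h : m D = 0
  · rcases hS : m S with _ | _ | i <;> simp [h]
  · simp [h]

open MvPowerSeries in
theorem genSeries_MLie_S : (MLie k).toColl.genSeries S = X S * (1 - X D)⁻¹ := by
  rw [MvPowerSeries.eq_mul_inv_iff_mul_eq (by simp)]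
  ext m
  rw [mul_sub, mul_one, map_sub, coeff_mul_X, coeff_genSeries_MLie_S, coeff_genSeries_MLie_S,
    coeff_X]
  simp only [eq_single_S_iff, Finsupp.tsub_apply, single_eq_of_ne (show S ≠ D by simp), tsub_zero]
  by_cases h : m D = 0 <;> simp [h]

open MvPowerSeries in
theorem genSeries_LP_S : (LP k).toColl.genSeries S = X S * (1 - X S - X D)⁻¹ := by
  rw [MvPowerSeries.eq_mul_inv_iff_mul_eq (by simp)]
  ext m
  rw [sub_sub, mul_sub, mul_one, mul_add, map_sub, map_add, coeff_mul_X, coeff_mul_X,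
    coeff_genSeries_LP_S, coeff_genSeries_LP_S, coeff_genSeries_LP_S, coeff_X]
  simp only [eq_single_S_iff, Finsupp.tsub_apply, Finsupp.single_eq_same,
    single_eq_of_ne (show D ≠ S by simp), single_eq_of_ne (show S ≠ D by simp),
    tsub_zero]
  rcases m S with _ | _ | i <;> rcases m D with _ | j
  · simp
  · simp
  · simp
  · simp [Nat.add_comm 1 j, Nat.factorial_succ]
    field_simp
    simp
  · simp [Nat.factorial_succ]
    field_simp
    simp
  · rw [if_neg (by omega), if_neg (by omega), if_neg (by omega)]
    simp only [Nat.add_sub_cancel, show i + 1 + 1 + (j + 1) - 1 = i + j + 1 + 1 by omega,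
      show i + 1 + (j + 1) - 1 = i + j + 1 by omega, show i + 1 + 1 + j - 1 = i + j + 1 by omega,
      Nat.factorial_succ]
    push_cast
    field_simp
    ring

open MvPowerSeries in
theorem genSeries_LP_D : (LP k).toColl.genSeries D =
    - PowerSeries.subst (- X D : MvPowerSeries Colour ℚ) (PowerSeries.log ℚ) := by
  ext m
  rw [coeff_neg_log, coeff_genSeries_D]
  exact (finrank_obj_D (χ := Sigma.fst) (X := Σ i, Fin (m i)) (P := LP k) (β := LPOp.β) homogeneous_LP lieSignature_LP (.inl rfl)
    (.inr (.inl rfl)) (fun r hr v => evalLin_wordOp_rels v r hr) rfl).trans (by congr)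

open MvPowerSeries in
theorem genSeries_MLie_D : (MLie k).toColl.genSeries D =
    - PowerSeries.subst (- X D : MvPowerSeries Colour ℚ) (PowerSeries.log ℚ) := by
  ext m
  rw [coeff_neg_log, coeff_genSeries_D]
  exact (finrank_obj_D (χ := Sigma.fst) (X := Σ i, Fin (m i)) (P := MLie k) (β := MLieOp.β) homogeneous_MLie lieSignature_MLie (.inl rfl)
    (.inr (.inl rfl)) evalLin_mlieWordOp_rels rfl).trans (by congr)

open MvPowerSeries in
theorem genSeries_As_D : (As k).toColl.genSeries D = X D := by
  ext m
  rw [coeff_genSeries_As_D, coeff_X]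

open MvPowerSeries in
theorem genSeries_LP_eq_subst (c : Colour) : (LP k).toColl.genSeries c =
    subst (MLie k).toColl.genSeries ((As k).toColl.genSeries c) := by
  have h0 : HasSubst (MLie k).toColl.genSeries := hasSubst_of_constantCoeff_zero fun c => by
    rw [← coeff_zero_eq_constantCoeff_apply]
    cases c
    · rw [coeff_genSeries_MLie_S]; simp
    · rw [genSeries_MLie_D, coeff_neg_log]; simp
  have hX : ∀ c, subst (MLie k).toColl.genSeries (X c : MvPowerSeries Colour ℚ) =
      (MLie k).toColl.genSeries c := fun c => by rw [← substAlgHom_apply h0, substAlgHom_X]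
  cases c with
  | D => rw [genSeries_As_D, hX, genSeries_LP_D, genSeries_MLie_D]
  | S =>
    have hA : (As k).toColl.genSeries S * (1 - X S) = X S := by
      rw [genSeries_As_S, mul_assoc, MvPowerSeries.inv_mul_cancel _ (by simp), mul_one]
    have hM : (MLie k).toColl.genSeries S * (1 - X D) = X S := by
      rw [genSeries_MLie_S, mul_assoc, MvPowerSeries.inv_mul_cancel _ (by simp), mul_one]
    have := congrArg (substAlgHom h0) hA
    rw [map_mul, map_sub, map_one, substAlgHom_X, substAlgHom_apply] at this
    rw [genSeries_LP_S, eq_comm, MvPowerSeries.eq_mul_inv_iff_mul_eq (by simp)]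
    set F := (MLie k).toColl.genSeries S
    set G := subst (MLie k).toColl.genSeries ((As k).toColl.genSeries S)
    calc G * (1 - X S - X D) = G * (1 - F) * (1 - X D) := by rw [← hM]; ring
      _ = X S := by rw [this, hM]

end SeriesIdentities

/-! ## The composite of `As` and `MLie` -/

section Composite

open PTree Colour SymColl

section Multilinear

variable {Op X V : Type*} [AddCommGroup V] [Module k V]

theorem evalTree_map {Op X Y : Type} (op : Op → V →ₗ[k] V →ₗ[k] V) (v : Y → V) (e : X → Y)
    (t : PTree Op X) : evalTree op v (t.map e) = evalTree op (fun x => v (e x)) t := by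
  induction t with
  | leaf x => rfl
  | node g l r hl hr => rw [PTree.map, evalTree, hl, hr]; rfl

theorem evalTree_update_of_notMem {Op X : Type} [DecidableEq X] (op : Op → V →ₗ[k] V →ₗ[k] V)
    (v : X → V) {x : X} (u : V) {t : PTree Op X} (h : x ∉ t.labels) :
    evalTree op (Function.update v x u) t = evalTree op v t := by
  induction t with
  | leaf y => exact Function.update_of_ne (fun e => h (mem_singleton.2 e.symm)) _ _
  | node g l r hl hr =>
    rw [labels, mem_append, not_or] at h
    rw [evalTree, hl h.1, hr h.2, evalTree]

theorem exists_evalTree_update {Op X : Type} [DecidableEq X] (op : Op → V →ₗ[k] V →ₗ[k] V)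
    (v : X → V) {x : X} {t : PTree Op X} (hn : t.labels.Nodup) (hx : x ∈ t.labels) :
    ∃ F : V →ₗ[k] V, ∀ u, evalTree op (Function.update v x u) t = F u := by
  induction t with
  | leaf y =>
    obtain rfl := mem_singleton.1 hx
    exact ⟨LinearMap.id, fun u => Function.update_self ..⟩
  | node g l r hl hr =>
    obtain ⟨n1, n2, hd⟩ := nodup_node hn
    rcases mem_append.1 hx with h | h
    · obtain ⟨F, hF⟩ := hl n1 h
      exact ⟨(op g).flip (evalTree op v r) ∘ₗ F, fun u => by
        rw [evalTree, hF, evalTree_update_of_notMem op v u (disjoint_left.1 hd h)]; rfl⟩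
    · obtain ⟨F, hF⟩ := hr n2 h
      exact ⟨op g (evalTree op v l) ∘ₗ F, fun u => by
        rw [evalTree, hF, evalTree_update_of_notMem op v u fun h' => disjoint_left.1 hd h' h]
        rfl⟩

theorem multilinear_mem {ι : Type} [Finite ι] {M : ι → Type*} {N : Type*}
    [∀ j, AddCommGroup (M j)] [∀ j, Module k (M j)] [AddCommGroup N] [Module k N]
    (F : MultilinearMap k M N) {s : ∀ j, Set (M j)} (hs : ∀ j, span k (s j) = ⊤)
    {W : Submodule k N} (h : ∀ q, (∀ j, q j ∈ s j) → F q ∈ W) (q : ∀ j, M j) : F q ∈ W := by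
  classical
  have := Fintype.ofFinite ι
  suffices ∀ (A : Finset ι) q, (∀ j ∉ A, q j ∈ s j) → F q ∈ W from
    this Finset.univ q fun j hj => absurd (Finset.mem_univ j) hj
  intro A
  induction A using Finset.induction_on with
  | empty => exact fun q hq => h q fun j => hq j (Finset.notMem_empty j)
  | insert j A _ ih =>
    intro q hq
    rw [← Function.update_eq_self j q]
    refine map_mem_of_mem_span (F := F.toLinearMap q j) (s := s j) (fun x hx => ih _ fun l hl => ?_)
      (hs j ▸ mem_top)
    by_cases e : l = j
    · subst e
      rwa [Function.update_self]
    · rw [Function.update_of_ne e]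
      exact hq l fun h => (Finset.mem_insert.1 h).elim e hl

end Multilinear

variable {X Y : Type} {χ : X → Colour} {c : Colour}

theorem Presentation.evalObj_map {P : Presentation k Colour} {V : Type*} [AddCommGroup V] [Module k V]
    {op : P.Op → V →ₗ[k] V →ₗ[k] V} {hR : ∀ r ∈ P.rels, ∀ v : ℕ → V, evalLin op v r = 0}
    {ψ : Y → Colour} (e : X ≃ Y) (h : ∀ x, ψ (e x) = χ x) (v : Y → V) (p : P.toColl.obj X χ c) :
    P.evalObj ψ c op hR v (P.toColl.map e h c p) = P.evalObj χ c op hR (fun x => v (e x)) p := by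
  refine LinearMap.congr_fun (f := P.evalObj ψ c op hR v ∘ₗ P.toColl.map e h c)
    (obj_hom_ext fun t => ?_) p
  rw [comp_apply, map_cls, evalObj_cls, evalObj_cls, evalTree_map]

/-- The evaluation of operations is multilinear in the arguments. -/
def evalMulti (P : Presentation k Colour) {V : Type*} [AddCommGroup V] [Module k V]
    (op : P.Op → V →ₗ[k] V →ₗ[k] V) (hR : ∀ r ∈ P.rels, ∀ v : ℕ → V, evalLin op v r = 0) :
    MultilinearMap k (fun _ : X => V) (P.toColl.obj X χ c →ₗ[k] V) where
  toFun := P.evalObj χ c op hR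
  map_update_add' v j x y := Presentation.obj_hom_ext fun t => by
    obtain ⟨F, hF⟩ := exists_evalTree_update op v t.2.1 (t.2.2.1 j)
    simp only [LinearMap.add_apply, Presentation.evalObj_cls, hF, map_add]
  map_update_smul' v j a x := Presentation.obj_hom_ext fun t => by
    obtain ⟨F, hF⟩ := exists_evalTree_update op v t.2.1 (t.2.2.1 j)
    simp only [LinearMap.smul_apply, Presentation.evalObj_cls, hF, map_smul]

variable (χ c) in
def compSumEval (v : X → WordPair k Y) :
    CompSum (As k).toColl (MLie k).toColl X χ c →ₗ[k] WordPair k Y := by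
  classical
  exact DirectSum.toModule k _ _ fun i => TensorProduct.lift (LinearMap.flip (PiTensorProduct.lift
    ((evalMulti (As k) asWordOp evalLin_asWordOp_rels).compLinearMap fun j =>
      (MLie k).evalObj _ (i.κ j) mlieWordOp evalLin_mlieWordOp_rels fun y => v y.1)))

theorem compSumEval_pure (v : X → WordPair k Y) (i : CompIndex Colour X)
    (p : (As k).toColl.obj (Fin i.m) i.κ c)
    (q : ∀ j, (MLie k).toColl.obj {x // i.f x = j} (fun x => χ x) (i.κ j)) :
    compSumEval χ c v (compPure _ _ χ c i p q) = (As k).evalObj i.κ c asWordOp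
      evalLin_asWordOp_rels (fun j => (MLie k).evalObj _ (i.κ j) mlieWordOp
        evalLin_mlieWordOp_rels (fun y => v y.1) (q j)) p := by
  classical
  unfold compSumEval compPure
  rw [DirectSum.toModule_lof, TensorProduct.lift.tmul, flip_apply, PiTensorProduct.lift.tprod]
  rfl

theorem compSumEval_congr {m : ℕ} (v : X → WordPair k Y) {f : X → Fin m} {κ : Fin m → Colour} {j j' : Fin m}
    (h : j' = j) (q : ∀ j, (MLie k).toColl.obj {x // f x = j} (fun x => χ x) (κ j)) :
    (MLie k).evalObj _ (κ j) mlieWordOp evalLin_mlieWordOp_rels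
      (fun y : {x // f x = j} => v y.1) (q j) = (MLie k).evalObj _ (κ j') mlieWordOp
        evalLin_mlieWordOp_rels (fun y : {x // f x = j'} => v y.1) (q j') := by
  subst h
  rfl

variable (χ c) in
/-- The evaluation of the elements of the composite. -/
def compEval (v : X → WordPair k Y) :
    ((As k).toColl.comp (MLie k).toColl).obj X χ c →ₗ[k] WordPair k Y :=
  liftQ _ (compSumEval χ c v) (span_le.2 (by
    rintro _ ⟨i, σ, p, q, rfl⟩
    refine (map_sub _ _ _).trans (sub_eq_zero.2 ((compSumEval_pure ..).trans
      (Eq.trans ?_ (compSumEval_pure ..).symm)))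
    refine Eq.trans ?_ (Presentation.evalObj_map (P := As k) σ _ _ p).symm
    refine congrArg (fun u => (As k).evalObj i.κ c asWordOp evalLin_asWordOp_rels u p) ?_
    funext j
    refine Eq.trans ?_ (Presentation.evalObj_map (P := MLie k) (i.fibrePerm σ (σ j)) _ _ _).symm
    exact compSumEval_congr v (σ.symm_apply_apply j) q))

theorem compEval_map {Z : Type} {ψ : Y → Colour} (e : X ≃ Y) (h : ∀ x, ψ (e x) = χ x)
    (v : Y → WordPair k Z) (w : ((As k).toColl.comp (MLie k).toColl).obj X χ c) :
    compEval ψ c v (((As k).toColl.comp (MLie k).toColl).map e h c w) =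
      compEval χ c (fun x => v (e x)) w := by
  have key : compSumEval ψ c v ∘ₗ compPush _ _ e h c = compSumEval χ c fun x => v (e x) := by
    refine compSum_hom_ext _ _ fun i p q => ?_
    refine (congrArg (compSumEval ψ c v) (compPush_pure ..)).trans ((compSumEval_pure ..).trans
      (Eq.trans ?_ (compSumEval_pure ..).symm))
    refine congrArg (fun u => (As k).evalObj i.κ c asWordOp evalLin_asWordOp_rels u p) ?_
    funext j
    exact Presentation.evalObj_map (P := MLie k) (i.fibrePush e j) _ _ _
  obtain ⟨w, rfl⟩ := Submodule.Quotient.mk_surjective _ w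
  exact LinearMap.congr_fun key w

/-- The class of a pure tensor. -/
def pureCls (i : CompIndex Colour X) (p : (As k).toColl.obj (Fin i.m) i.κ c)
    (q : ∀ j, (MLie k).toColl.obj {x // i.f x = j} (fun x => χ x) (i.κ j)) :
    ((As k).toColl.comp (MLie k).toColl).obj X χ c :=
  Submodule.Quotient.mk (compPure _ _ χ c i p q)

theorem pureCls_mem {W : Submodule k (((As k).toColl.comp (MLie k).toColl).obj X χ c)}
    {i : CompIndex Colour X} {p : (As k).toColl.obj (Fin i.m) i.κ c}
    {s : ∀ j, Set ((MLie k).toColl.obj {x // i.f x = j} (fun x => χ x) (i.κ j))}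
    (hs : ∀ j, span k (s j) = ⊤) (h : ∀ q, (∀ j, q j ∈ s j) → pureCls i p q ∈ W) :
    ∀ q, pureCls i p q ∈ W := by
  classical
  exact multilinear_mem ((Submodule.mkQ (compRel _ _ X χ c) ∘ₗ DirectSum.lof k _
    (CompSummand (As k).toColl (MLie k).toColl X χ c) i ∘ₗ
      TensorProduct.mk k _ _ p).compMultilinearMap (PiTensorProduct.tprod k)) hs h

theorem eq_top_of_pureCls_mem {W : Submodule k (((As k).toColl.comp (MLie k).toColl).obj X χ c)}
    (h : ∀ i (x : Fin i.m × List (Fin i.m)) (hx : comb .a x.1 x.2 ∈ (As k).sig.monomials i.κ c) q,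
      pureCls i ((As k).cls ⟨_, hx⟩) q ∈ W) : W = ⊤ := by
  classical
  have : Submodule.mkQ W ∘ₗ Submodule.mkQ (compRel _ _ X χ c) = 0 := by
    refine compSum_hom_ext _ _ fun i p q => (Submodule.Quotient.mk_eq_zero W).2 ?_
    refine map_mem_of_mem_span (F := Submodule.mkQ (compRel _ _ X χ c) ∘ₗ DirectSum.lof k _
      (CompSummand (As k).toColl (MLie k).toColl X χ c) i ∘ₗ
        (TensorProduct.mk k _ _).flip (PiTensorProduct.tprod k q)) ?_
      ((span_comb (P := As k) (a := AsOp.a) homogeneous_As rfl (fun g => rfl) rfl rfl rfl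
        i.κ c).ge (mem_top (x := p)))
    rintro _ ⟨x, rfl⟩
    exact h i x.1 x.2 q
  refine Submodule.eq_top_iff'.2 fun v => ?_
  obtain ⟨v, rfl⟩ := Submodule.mkQ_surjective _ v
  exact (Submodule.Quotient.mk_eq_zero W).1 (LinearMap.congr_fun this v)

end Composite

section CompositeIso

open PTree Colour SymColl

theorem exists_equiv_of_eval {k M N V ι : Type*} [Field k] [AddCommGroup M] [Module k M]
    [AddCommGroup N] [Module k N] [AddCommGroup V] [Module k V] {τ : ι → M} {e : ι → N}
    (hτ : span k (Set.range τ) = ⊤) (he : span k (Set.range e) = ⊤)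
    {A : M →ₗ[k] V} {B : N →ₗ[k] V} (h : ∀ i, B (e i) = A (τ i))
    (hA : LinearIndependent k fun i => A (τ i)) :
    Injective B ∧ ∃ φ : M ≃ₗ[k] N, ∀ i, φ (τ i) = e i := by
  have hB : LinearIndependent k fun i => B (e i) := by simpa only [h] using hA
  refine ⟨injective_of_linearIndependent he hB, ?_⟩
  refine ⟨(Module.Basis.mk (.of_comp A hA) hτ.ge).equiv (Module.Basis.mk (.of_comp B hB) he.ge)
    (Equiv.refl _), fun i => ?_⟩
  rw [← Module.Basis.mk_apply (.of_comp A hA) hτ.ge i, Module.Basis.equiv_apply,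
    Module.Basis.mk_apply]
  rfl

theorem exists_map_eq_finRange {n : ℕ} {l : List (Fin n)} (h : l.Nodup) (h' : ∀ j, j ∈ l) :
    ∃ σ : Equiv.Perm (Fin n), l.map σ = finRange n := by
  have hl : l.length = n := by
    simpa using ((List.perm_ext_iff_of_nodup h (List.nodup_finRange n)).2 fun j =>
      ⟨fun _ => List.mem_finRange j, fun _ => h' j⟩).length_eq
  refine ⟨(h.getEquivOfForallMemList l h').symm.trans (finCongr hl), ?_⟩
  refine List.ext_getElem (by simpa using hl) fun i h1 h2 => ?_
  simp [Fin.ext_iff, h.idxOf_getElem]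

variable {X Y : Type} {χ : X → Colour} {c : Colour}

theorem pureCls_perm {i : CompIndex Colour X} (σ : Equiv.Perm (Fin i.m))
    (p : (As k).toColl.obj (Fin i.m) i.κ c)
    (q : ∀ j, (MLie k).toColl.obj {x // i.f x = j} (fun x => χ x) (i.κ j)) :
    pureCls i p q = pureCls (i.perm σ) ((As k).toColl.map σ (fun x => by simp) c p)
      fun j => (MLie k).toColl.map (i.fibrePerm σ j) (fun _ => rfl) _ (q (σ.symm j)) :=
  (Submodule.Quotient.eq _).2 (subset_span ⟨i, σ, p, q, rfl⟩)

theorem map_comb {Op : Type} (a : Op) (g : X → Y) (x : X) (L : List X) :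
    (comb a x L).map g = comb a (g x) (L.map g) := by
  induction L generalizing x with
  | nil => rfl
  | cons y L ih => rw [comb, PTree.map, ih]; rfl

theorem evalTree_modComb_map {V : Type*} {Op Op' : Type} [AddCommGroup V] [Module k V]
    {op : Op → V →ₗ[k] V →ₗ[k] V} {op' : Op' → V →ₗ[k] V →ₗ[k] V} {d : Op} {d' : Op'}
    (h : op d = op' d') (v : Y → V) (g : X → Y) (s : X) (w : List X) :
    evalTree op (fun x => v (g x)) (modComb d s w) = evalTree op' v (modComb d' (g s) (w.map g)) := by
  induction w using reverseRecOn with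
  | nil => rfl
  | append_singleton w y ih =>
    rw [map_append, List.map_singleton, modComb_append, modComb_append, evalTree, evalTree, ih, h]
    rfl

theorem evalTree_lieComb_congr {V : Type*} {Op Op' : Type} [AddCommGroup V] [Module k V]
    {op : Op → V →ₗ[k] V →ₗ[k] V} {op' : Op' → V →ₗ[k] V →ₗ[k] V} {β : Op} {β' : Op'}
    (h : op β = op' β') (v : X → V) (x : X) (w : List X) :
    evalTree op v (lieComb β x w) = evalTree op' v (lieComb β' x w) := by
  induction w using reverseRecOn with
  | nil => rfl
  | append_singleton w y ih =>
    rw [lieComb_append, lieComb_append, evalTree, evalTree, ih, h]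
    rfl

theorem evalTree_comb_modComb {m : ℕ} (v : X → WordPair k Y) (B : Fin m → Block X) (x : Fin m)
    (L : List (Fin m)) :
    evalTree asWordOp (fun j => evalTree wordOp v (modComb .d (ofLex (B j)).1 (ofLex (B j)).2))
      (comb AsOp.a x L) = evalTree wordOp v (blockComb .d .a (B x) (L.map B)) := by
  induction L generalizing x with
  | nil => rfl
  | cons y L ih => 
    rw [comb, evalTree, ih]
    rfl

variable (χ) in
/-- The composites of the product of the solid inputs of `As` with combs of `MLie`. -/
structure SolidData where
  m : ℕ
  f : X → Fin (m + 1)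
  surj : Function.Surjective f
  b : ∀ j, Block {x // f x = j}
  mem : ∀ j, modComb MLieOp.d (ofLex (b j)).1 (ofLex (b j)).2 ∈ mlieSig.monomials (fun x : {x // f x = j} => χ x) S

namespace SolidData

variable (s : SolidData χ)

def block (j : Fin (s.m + 1)) : Block X := toLex ((ofLex (s.b j)).1.1, (ofLex (s.b j)).2.map (·.1))

def rest (m : ℕ) : List (Fin (m + 1)) := (finRange m).map Fin.succ

theorem cons_rest (m : ℕ) : 0 :: rest m = finRange (m + 1) := (List.finRange_succ).symm

def key : Block X × List (Block X) := (s.block 0, (rest s.m).map s.block)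

theorem cons_key : s.key.1 :: s.key.2 = (finRange (s.m + 1)).map s.block := by
  rw [← cons_rest]; rfl

theorem letters_block (j) : (s.block j).letters = (s.b j).letters.map (·.1) := rfl

theorem mem_letters_block {j} {x : X} : x ∈ (s.block j).letters ↔ s.f x = j := by
  rw [letters_block, mem_map]
  exact ⟨fun ⟨y, _, e⟩ => e ▸ y.2, fun e => ⟨⟨x, e⟩, ((modComb_mem_monomials rfl rfl rfl).1
    (s.mem j)).2.2 _, rfl⟩⟩

theorem key_injective : Injective (key : SolidData χ → _) := by
  intro s s' h
  have h1 : (finRange (s.m + 1)).map s.block = (finRange (s'.m + 1)).map s'.block := by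
    rw [← cons_key, ← cons_key, h]
  have hm : s.m = s'.m := by simpa using congrArg List.length h1
  have hx := @mem_letters_block _ _ s
  have hx' := @mem_letters_block _ _ s'
  obtain ⟨m, f, hs, b, hb⟩ := s
  obtain ⟨m', f', hs', b', hb'⟩ := s'
  obtain rfl : m = m' := hm
  have h2 := fun j => List.map_inj_left.1 h1 j (List.mem_finRange j)
  obtain rfl : f = f' := by
    funext x
    have := (hx (j := f' x) (x := x))
    rw [h2] at this
    exact this.1 (hx'.2 rfl)
  obtain rfl : b = b' := by
    funext j
    have := h2 j
    exact Prod.ext (Subtype.ext (congrArg (fun b => (ofLex b).1) this))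
      (List.map_injective_iff.2 Subtype.val_injective (congrArg (fun b => (ofLex b).2) this))
  rfl

theorem key_mem : blockComb .d .a s.key.1 s.key.2 ∈ lpSig.monomials χ S := by
  refine (blockComb_mem_monomials rfl rfl rfl rfl rfl rfl).2 ?_
  rw [cons_key, letters, List.flatMap_map]
  have h := fun j => (modComb_mem_monomials rfl rfl rfl).1 (s.mem j)
  refine ⟨List.forall_mem_map.2 fun j _ => ⟨(h j).1.1, List.forall_mem_map.2 (h j).1.2⟩,
    List.nodup_flatMap.2 ⟨fun j _ => (h j).2.1.map Subtype.val_injective, ?_⟩, fun x =>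
      mem_flatMap.2 ⟨s.f x, List.mem_finRange _, s.mem_letters_block.2 rfl⟩⟩
  refine (List.nodup_finRange _).imp fun {i j} hij x hi hj => hij ?_
  rw [← s.mem_letters_block.1 hi, s.mem_letters_block.1 hj]

theorem exists_key_eq {b : Block X} {p : List (Block X)}
    (h : blockComb .d .a b p ∈ lpSig.monomials χ S) : ∃ s : SolidData χ, s.key = (b, p) := by
  obtain ⟨h1, h2, h3⟩ := (blockComb_mem_monomials rfl rfl rfl rfl rfl rfl).1 h
  obtain ⟨h4, h5⟩ := List.nodup_flatMap.1 h2
  let B : Fin (p.length + 1) → Block X := (b :: p).get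
  have hB : ∀ j, B j ∈ b :: p := fun j => List.get_mem (b :: p) j
  have ex : ∀ x, ∃ j, x ∈ (B j).letters := fun x => by
    obtain ⟨b', hb, hx⟩ := mem_flatMap.1 (h3 x)
    obtain ⟨j, rfl⟩ := List.mem_iff_get.1 hb
    exact ⟨j, hx⟩
  choose f hf using ex
  have uniq : ∀ {i j x}, x ∈ (B i).letters → x ∈ (B j).letters → i = j := by
    have := List.pairwise_iff_get.1 h5
    intro i j x hi hj
    rcases lt_trichotomy i j with h | h | h
    · exact absurd hj (this i j h hi)
    · exact h
    · exact absurd hi (this j i h hj)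
  have hf' : ∀ j, ∀ x ∈ (ofLex (B j)).1 :: (ofLex (B j)).2, f x = j := fun j x hx => uniq (hf x) hx
  have e : ∀ j, ((ofLex (B j)).2.attachWith (fun x => f x = j) fun x hx =>
      hf' j x (mem_cons_of_mem _ hx)).map (·.1) = (ofLex (B j)).2 := fun j => by simp
  let t : ∀ j, Block {x // f x = j} := fun j => toLex (⟨_, hf' j _ (mem_cons_self ..)⟩,
    (ofLex (B j)).2.attachWith _ fun x hx => hf' j x (mem_cons_of_mem _ hx))
  have ht : ∀ j, (t j).letters.map (·.1) = (B j).letters := fun j => congrArg _ (e j)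
  let s : SolidData χ := ⟨p.length, f, fun j => ⟨_, hf' j _ (mem_cons_self ..)⟩, t, fun j => by
    refine (modComb_mem_monomials rfl rfl rfl).2 ⟨⟨(h1 _ (hB j)).1, fun y hy =>
      (h1 _ (hB j)).2 y.1 ?_⟩, .of_map (·.1) (ht j ▸ h4 _ (hB j)), fun y => ?_⟩
    · rw [← e j]
      exact List.mem_map_of_mem hy
    · have := hf y
      rw [y.2, ← ht] at this
      obtain ⟨z, hz, hz'⟩ := mem_map.1 this
      exact Subtype.ext hz' ▸ hz⟩
  have hs : s.block = B := funext fun j => Prod.ext rfl (e j)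
  refine ⟨s, Prod.ext (congrFun hs 0) ?_⟩
  rw [key, hs, rest, List.map_map]
  exact List.map_get_finRange p

theorem comb_rest_mem {m : ℕ} : comb AsOp.a 0 (rest m) ∈ (As k).sig.monomials (fun _ => S) S :=
  comb_mem_monomials.2 ⟨cons_rest _ ▸ List.nodup_finRange _, fun j =>
    cons_rest _ ▸ List.mem_finRange j, hasColour_comb rfl rfl rfl fun _ _ => rfl⟩

/-- The element of the composite. -/
def elem : ((As k).toColl.comp (MLie k).toColl).obj X χ S :=
  pureCls ⟨s.m + 1, fun _ => S, s.f, s.surj⟩ ((As k).cls ⟨comb .a 0 (rest s.m), comb_rest_mem⟩)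
    fun j => (MLie k).cls ⟨_, s.mem j⟩

theorem compEval_elem (v : X → WordPair k Y) : compEval χ S v s.elem = (LP k).evalObj χ S wordOp
    (fun r hr v => evalLin_wordOp_rels v r hr) v ((LP k).cls ⟨_, s.key_mem⟩) := by
  refine (compSumEval_pure ..).trans ((Presentation.evalObj_cls ..).trans
    (Eq.trans ?_ (Presentation.evalObj_cls ..).symm))
  refine Eq.trans (congrArg (fun u : Fin (s.m + 1) → WordPair k Y =>
    evalTree asWordOp u (comb AsOp.a 0 (rest s.m))) ?_)
    (evalTree_comb_modComb v s.block 0 (rest s.m))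
  funext j
  exact (Presentation.evalObj_cls ..).trans (evalTree_modComb_map (op := mlieWordOp)
    (op' := wordOp) (d := .d) (d' := .d) rfl v Subtype.val _ _)

theorem span_elem : span k (Set.range fun s : SolidData χ => s.elem (k := k)) = ⊤ := by
  refine eq_top_of_pureCls_mem fun i ⟨x, L⟩ hx q => ?_
  obtain ⟨h1, h2, h3⟩ := comb_mem_monomials.1 hx
  obtain ⟨m, κ, f, hf⟩ := i
  obtain ⟨σ, hσ⟩ := exists_map_eq_finRange h1 h2
  obtain rfl : κ = fun _ => S := funext fun j => 
    labels_eq (Γ := (As k).sig) (fun _ _ => ⟨rfl, rfl⟩) h3 j (hx.2.1 j)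
  cases m with
  | zero => exact x.elim0
  | succ m =>
  rw [← cons_rest] at hσ
  refine (congrArg (· ∈ _) ((pureCls_perm σ _ _).trans (congrArg (fun p => pureCls _ p _)
    ((Presentation.map_cls ..).trans (congrArg (As k).cls (Subtype.ext (a2 := ⟨_, comb_rest_mem⟩) ((map_comb ..).trans
      (congrArg₂ (comb AsOp.a) (List.cons.inj hσ).1 (List.cons.inj hσ).2)))))))).mpr
    (pureCls_mem (fun j => span_modComb (P := MLie k) (β := MLieOp.β) (d := MLieOp.d)
      homogeneous_MLie lieSignature_MLie (.inr (.inr rfl)) rfl rfl rfl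
        (fun g hg => by cases g <;> first | rfl | cases hg) _) (fun q hq => ?_) _)
  choose b hb using hq
  obtain rfl := funext hb
  exact subset_span ⟨⟨m, σ ∘ f, σ.surjective.comp hf, fun j => b j, fun j => (b j).2⟩, rfl⟩

end SolidData

theorem map_surjective {P : SymColl k Colour} {ψ : Y → Colour} (e : X ≃ Y)
    (h : ∀ x, ψ (e x) = χ x) : Function.Surjective (P.map e h c) := fun u => by
  have h' : ∀ y, χ (e.symm y) = ψ y := fun y => by rw [← h, e.apply_symm_apply]
  refine ⟨P.map e.symm h' c u, (P.map_trans e.symm e h' h (fun y => by simp) c u).trans ?_⟩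
  simp only [Equiv.symm_trans_self]
  exact P.map_refl (fun _ => rfl) c u

variable (χ c) in
/-- Generators of the components of the operad and of the composite with the same values. -/
theorem exists_generators : ∃ (ι : Type) (τ : ι → (LP k).toColl.obj X χ c)
    (e : ι → ((As k).toColl.comp (MLie k).toColl).obj X χ c),
    span k (Set.range τ) = ⊤ ∧ span k (Set.range e) = ⊤ ∧
    (∀ (Y : Type) (v : X → WordPair k Y) i, compEval χ c v (e i) = (LP k).evalObj χ c wordOp
      (fun r hr v => evalLin_wordOp_rels v r hr) v (τ i)) ∧
    LinearIndependent k fun i => (LP k).evalObj χ c wordOp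
      (fun r hr v => evalLin_wordOp_rels v r hr) wordLeaf (τ i) := by
  cases c with
  | S =>
    refine ⟨SolidData χ, fun s => (LP k).cls ⟨_, s.key_mem⟩, SolidData.elem, ?_,
      SolidData.span_elem, fun Y v s => s.compEval_elem v, ?_⟩
    · refine top_le_iff.1 ((span_blockComb_LP χ).ge.trans (span_mono ?_))
      rintro _ ⟨⟨b, hb⟩, rfl⟩
      obtain ⟨s, hs⟩ := SolidData.exists_key_eq hb
      obtain rfl : s.key = b := hs
      exact ⟨s, rfl⟩
    · exact (linearIndependent_blockComb (P := LP k) (d := LPOp.d) (a := LPOp.a) rfl rfl).comp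
        (fun s : SolidData χ => ⟨s.key, s.key_mem⟩)
        fun s s' h => SolidData.key_injective (congrArg Subtype.val h)
  | D =>
    rcases isEmpty_or_nonempty X with hX | ⟨⟨x₀⟩⟩
    · have h : IsEmpty ((LP k).sig.monomials χ D) := ⟨fun t => by
        obtain ⟨x, -⟩ := List.exists_mem_of_ne_nil _ (labels_ne_nil t.1)
        exact hX.false x⟩
      exact ⟨_, (LP k).cls, h.elim, Presentation.span_range_cls,
        eq_top_of_pureCls_mem fun i x => (hX.false (i.surj x.1).choose).elim,
        fun _ _ i => h.elim i, linearIndependent_empty_type⟩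
    · have mem : ∀ w, lieComb LPOp.β x₀ w ∈ lpSig.monomials χ D →
          lieComb MLieOp.β x₀ w ∈ mlieSig.monomials χ D := fun w hw =>
        (lieComb_mem_monomials lieSignature_MLie).2 ((lieComb_mem_monomials lieSignature_LP).1 hw)
      let E : ∀ j : Fin 1, X ≃ {x : X // (0 : Fin 1) = j} := fun j =>
        (Equiv.subtypeUnivEquiv fun _ => Subsingleton.elim _ _).symm
      refine ⟨{w // lieComb LPOp.β x₀ w ∈ lpSig.monomials χ D}, fun w => (LP k).cls ⟨_, w.2⟩,
        fun w => pureCls ⟨1, fun _ => D, fun _ => 0, fun j => ⟨x₀, Subsingleton.elim _ _⟩⟩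
          ((As k).cls ⟨comb AsOp.a 0 [], comb_mem_monomials.2 ⟨List.nodup_singleton _, fun j =>
            mem_singleton.2 (Subsingleton.elim _ _), rfl⟩⟩)
          fun j => (MLie k).toColl.map (E j) (fun _ => rfl) D ((MLie k).cls ⟨_, mem w.1 w.2⟩),
        span_lieComb (P := LP k) homogeneous_LP lieSignature_LP (.inl rfl) (.inr (.inl rfl)) χ x₀,
        eq_top_of_pureCls_mem fun i ⟨x, L⟩ hx q => ?_, fun Y v w => ?_,
        linearIndependent_lieComb (P := LP k) rfl Function.injective_id x₀⟩
      · obtain ⟨h1, h2, h3⟩ := comb_mem_monomials.1 hx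
        cases L with
        | cons y L => cases h3.1
        | nil =>
        have hj : ∀ j, j = x := fun j => mem_singleton.1 (h2 j)
        obtain ⟨m, κ, f, hf⟩ := i
        obtain _ | _ | m := m
        · exact x.elim0
        · obtain rfl : κ = fun _ => D := funext fun j => (congrArg κ (hj j)).trans h3
          obtain rfl : f = fun _ => 0 := funext fun _ => Subsingleton.elim (α := Fin 1) _ _
          obtain rfl : x = 0 := Subsingleton.elim (α := Fin 1) _ _
          refine pureCls_mem (s := fun j => Set.range fun w : {w // lieComb LPOp.β x₀ w ∈
            lpSig.monomials χ D} => (MLie k).toColl.map (E j) (fun _ => rfl) D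
              ((MLie k).cls ⟨_, mem w.1 w.2⟩)) (fun j => ?_) (fun q hq => ?_) q
          · refine (congrArg _ (Set.range_comp' ..)).trans ((Submodule.span_image _).trans ?_)
            refine (congrArg _ (Eq.trans ?_ (span_lieComb (P := MLie k) (β := MLieOp.β)
              homogeneous_MLie lieSignature_MLie (.inl rfl) (.inr (.inl rfl)) χ x₀))).trans
                ((Submodule.map_top _).trans (LinearMap.range_eq_top.2 (map_surjective _ _)))
            refine congrArg _ (Set.Subset.antisymm ?_ ?_) <;> rintro _ ⟨w, rfl⟩
            · exact ⟨⟨w, mem w.1 w.2⟩, rfl⟩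
            · exact ⟨⟨w, (lieComb_mem_monomials lieSignature_LP).2
                ((lieComb_mem_monomials lieSignature_MLie).1 w.2)⟩, rfl⟩
          · obtain ⟨w, hw⟩ := hq 0
            refine subset_span ⟨w, congrArg (pureCls _ _) (funext fun j => ?_)⟩
            obtain rfl : j = 0 := Subsingleton.elim _ _
            exact hw
        · exact absurd ((hj 0).trans (hj 1).symm) (by simp)
      · refine (compSumEval_pure ..).trans ((Presentation.evalObj_cls ..).trans
          (Eq.trans ?_ (Presentation.evalObj_cls ..).symm))
        refine (Presentation.evalObj_map (P := MLie k) (E 0) _ _ _).trans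
          ((Presentation.evalObj_cls ..).trans ?_)
        exact evalTree_lieComb_congr (op := mlieWordOp) (op' := wordOp) (β := .β) (β' := .β) rfl
          v x₀ w.1

variable (χ c) in
theorem exists_equiv_composite :
    ∃ φ : (LP k).toColl.obj X χ c ≃ₗ[k] ((As k).toColl.comp (MLie k).toColl).obj X χ c,
      Injective (compEval χ c (wordLeaf : X → WordPair k X)) ∧
      ∀ (Y : Type) (v : X → WordPair k Y) x, compEval χ c v (φ x) = (LP k).evalObj χ c wordOp
        (fun r hr v => evalLin_wordOp_rels v r hr) v x := by
  obtain ⟨ι, τ, e, hτ, he, h, hA⟩ := exists_generators (k := k) χ c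
  obtain ⟨hi, φ, hφ⟩ := exists_equiv_of_eval hτ he (h X wordLeaf) hA
  refine ⟨φ, hi, fun Y v x => LinearMap.congr_fun (f := compEval χ c v ∘ₗ φ.toLinearMap)
    (LinearMap.ext_on_range hτ fun i => ?_) x⟩
  exact (congrArg _ (hφ i)).trans (h Y v i)

theorem isomorphic_LP_comp : (LP k).toColl.Isomorphic ((As k).toColl.comp (MLie k).toColl) := by
  choose φ hi hφ using fun (X : Type) (χ : X → Colour) (c : Colour) =>
    exists_equiv_composite (k := k) χ c
  refine ⟨fun X _ χ c => φ X χ c, fun X Y _ _ e χ ψ h c v => hi Y ψ c ?_⟩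
  refine (hφ Y ψ c Y wordLeaf _).trans ((Presentation.evalObj_map (P := LP k) e h _ v).trans ?_)
  exact (hφ X χ c Y _ v).symm.trans (compEval_map e h _ _).symm

end CompositeIso

end ColouredOperad

theorem mainTheorem9 {k : Type*} [Field k] [CharZero k] :
    -- the defining relations of `LP` form a quadratic Gröbner basis for the QM-ordering
    (ColouredOperad.IsQuadratic ColouredOperad.shSig (ColouredOperad.lpShuffleRels k) ∧
      ∀ ρ : ColouredOperad.ShOp → ℕ, Function.Injective ρ → ρ .b < ρ .a → ρ .e < ρ .d →
        (∃ le, ColouredOperad.IsAdmissible ColouredOperad.shSig le ∧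
          ColouredOperad.ExtendsQM ρ le) ∧
        ∀ le, ColouredOperad.IsAdmissible ColouredOperad.shSig le →
          ColouredOperad.ExtendsQM ρ le →
          ColouredOperad.IsGroebnerBasis ColouredOperad.shSig le
            (ColouredOperad.lpShuffleRels k)) ∧
    -- `LP` is Koszul
    (ColouredOperad.LP k).IsKoszul ∧
    -- `H₀(SC)` is the operad presented by `SCPres`, and it is Koszul
    ((∀ (X : Type) [Finite X] (χ : X → ColouredOperad.Colour) (c : ColouredOperad.Colour),
        Function.Surjective (ColouredOperad.scClass k χ c) ∧
        LinearMap.ker (ColouredOperad.scClass k χ c) =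
          ((ColouredOperad.SCPres k).ideal χ c).comap ((ColouredOperad.SCPres k).toTrees χ c)) ∧
      (ColouredOperad.SCPres k).IsKoszul) ∧
    -- `LP ≅ As ∘ MLie`
    (ColouredOperad.LP k).toColl.Isomorphic
      ((ColouredOperad.As k).toColl.comp (ColouredOperad.MLie k).toColl) ∧
    -- the components are finite-dimensional and the generating series are as follows
    (∀ (X : Type) [Finite X] (χ : X → ColouredOperad.Colour) (c : ColouredOperad.Colour),
      Module.Finite k ((ColouredOperad.LP k).toColl.obj X χ c) ∧
      Module.Finite k ((ColouredOperad.As k).toColl.obj X χ c) ∧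
      Module.Finite k ((ColouredOperad.MLie k).toColl.obj X χ c)) ∧
    (∀ c : ColouredOperad.Colour, (ColouredOperad.LP k).toColl.genSeries c =
      MvPowerSeries.subst (ColouredOperad.MLie k).toColl.genSeries
        ((ColouredOperad.As k).toColl.genSeries c)) ∧
    (ColouredOperad.As k).toColl.genSeries .S =
      MvPowerSeries.X .S * (1 - MvPowerSeries.X .S)⁻¹ ∧
    (ColouredOperad.As k).toColl.genSeries .D = MvPowerSeries.X .D ∧
    (ColouredOperad.MLie k).toColl.genSeries .S =
      MvPowerSeries.X .S * (1 - MvPowerSeries.X .D)⁻¹ ∧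
    (ColouredOperad.MLie k).toColl.genSeries .D =
      - PowerSeries.subst (- MvPowerSeries.X .D : MvPowerSeries ColouredOperad.Colour ℚ)
        (PowerSeries.log ℚ) ∧
    (ColouredOperad.LP k).toColl.genSeries .S =
      MvPowerSeries.X .S * (1 - MvPowerSeries.X .S - MvPowerSeries.X .D)⁻¹ ∧
    (ColouredOperad.LP k).toColl.genSeries .D =
      - PowerSeries.subst (- MvPowerSeries.X .D : MvPowerSeries ColouredOperad.Colour ℚ)
        (PowerSeries.log ℚ) := by
  refine ⟨⟨ColouredOperad.isQuadratic_lpShuffleRels, fun ρ hρ hba hed =>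
    ⟨⟨_, ColouredOperad.isAdmissible_treeKey hρ, ColouredOperad.extendsQM_treeKey hρ⟩,
      fun le hle hqm => ColouredOperad.isGroebnerBasis_lpShuffleRels hρ hba hed hle hqm⟩⟩,
    ColouredOperad.isKoszul_LP,
    ⟨fun X _ χ c => ⟨ColouredOperad.scClass_surjective, ColouredOperad.ker_scClass⟩,
      ColouredOperad.isKoszul_SC⟩, ColouredOperad.isomorphic_LP_comp, fun X _ χ c => ?_,
    ColouredOperad.genSeries_LP_eq_subst, ColouredOperad.genSeries_As_S,
    ColouredOperad.genSeries_As_D, ColouredOperad.genSeries_MLie_S, ColouredOperad.genSeries_MLie_D,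
    ColouredOperad.genSeries_LP_S, ColouredOperad.genSeries_LP_D⟩
  have : Finite (ColouredOperad.LP k).Op := inferInstanceAs (Finite ColouredOperad.LPOp)
  have : Finite (ColouredOperad.As k).Op := inferInstanceAs (Finite ColouredOperad.AsOp)
  have : Finite (ColouredOperad.MLie k).Op := inferInstanceAs (Finite ColouredOperad.MLieOp)
  exact ⟨ColouredOperad.module_finite_obj _, ColouredOperad.module_finite_obj _,
    ColouredOperad.module_finite_obj _⟩
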